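/- Let $d\ge 1$, let $f:\mathbb R^d\to\mathbb R$, let $\theta^\star$ be the minimizer of $f$, let $\mathbb P_\xi$ be a probability measure on a measurable space $\mathsf Z$, and let $\nabla F:\mathbb R^d\times\mathsf Z\to\mathbb R^d$ be a jointly measurable stochastic gradient. Norms are Euclidean (operator norms for tensors). Assume: * (strong convexity) $f$ is $C^1$ and for some $\mu>0$, $\frac{\mu}{2}\|\theta-\theta'\|^2\le f(\theta)-f(\theta')-\langle\nabla f(\theta'),\theta-\theta'\rangle$ for all $\theta,\theta'$; * (smoothness) $f$ is $C^4$, $\nabla f$ is $\mathrm L_2$-Lipschitz, and $\|\nabla^3 f\|\le \mathrm L_3$, $\|\nabla^4 f\|\le \mathrm L_4$ everywhere; * (A($p$) for $p=2,4,6$, with constants $\tau_p\ge 0$ and a common $\mathrm L_1>0$) $\mathsf E_{\xi\sim\mathbb P_\xi}[\nabla F(\theta,\xi)]=\nabla f(\theta)$ for all $\theta$, $\mathsf E^{1/p}[\|\nabla F(\theta^\star,\xi)\|^p]\le\tau_p$, and for all integers $2\le q\le p$ and all $\theta_1,\theta_2$, $$\mathsf E[\|\nabla F(\theta_1,\xi)-\nabla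 F(\theta_2,\xi)\|^q]\le \mathrm L_1^{q-1}\|\theta_1-\theta_2\|^{q-2}\langle\nabla f(\theta_1)-\nabla f(\theta_2),\theta_1-\theta_2\rangle .$$ Put $\mathrm L=\max(\mathrm L_1,\mathrm L_2,\mathrm L_3,\mathrm L_4)$. For $\gamma>0$ let $\theta^{(\gamma)}_{k+1}=\theta^{(\gamma)}_k-\gamma\nabla F(\theta^{(\gamma)}_k,\xi_{k+1})$, $\theta_0^{(\gamma)}=\theta_0\sim\nu$, where $(\xi_k)$ are i.i.d. with law $\mathbb P_\xi$ and $\theta_0$ is independent of $(\xi_k)$; $\mathsf E_\nu$ is the corresponding expectation. Assume further: * (C($p$) for $p=2,4,6$) there are constants $D_p,\mathrm C_p\ge 2$ such that for all $\gamma\in(0,1/(\mathrm L\mathrm C_p)]$, all initial distributions $\nu$ and all $k\ge 0$, $$\mathsf E_\nu^{2/p}[\|\theta_k^{(\gamma)}-\theta^\star\|^p]\le(1-\gamma\mu)^k\,\mathsf E_\nu^{2/p}[\|\theta_0-\theta^\star\|^p]+D_p\gamma\tau_p^2/\mu,$$ and $\big(\int\|\theta-\theta^\star\|^p\,\pi_\gamma(\mathrm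 d\theta)\big)^{2/p}\le D_p\gamma\tau_p^2/\mu$ for the stationary distribution $\pi_\gamma$ of the chain. Let $\bar\theta_n^{(\gamma)}=\frac1n\sum_{k=n+1}^{2n}\theta_k^{(\gamma)}$ and let $\bar\theta_n^{(RR)}=2\bar\theta_n^{(\gamma)}-\bar\theta_n^{(2\gamma)}$, where both chains use the same $(\xi_k)$ and the same $\theta_0$. Let $\mathrm H^\star=\nabla^2 f(\theta^\star)$ and $\Sigma^\star_\varepsilon=\mathsf E[\nabla F(\theta^\star,\xi)\nabla F(\theta^\star,\xi)^\top]$. Then there is an absolute constant $c_0>0$ (independent of all of the above data) such that for every $\gamma\in(0,1/(\mathrm L\mathrm C_6)]$, every initial distribution $\nu$ and every $n\ge 1$, $$\mathsf E_\nu^{1/2}\big[\|\mathrm H^\star(\bar\theta_n^{(RR)}-\theta^\star)\|^2\big]\le c_0\Big(\frac{\sqrt{\operatorname{Tr}\Sigma_\varepsilon^\star}}{\sqrt n}+\frac{K_1\gamma^{1/2}}{n^{1/2}}+\frac{K_2}{\gamma^{1/2}n}+K_3\gamma^{3/2}+\frac{K_4\gamma}{n^{1/2}}+\mathcal R_4\Big),$$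 where $$K_1=\frac{D_4\mathrm L\tau_4^2}{\mu^{3/2}}+\frac{\mathrm L D_2^{1/2}\tau_2}{\mu^{1/2}},\quad K_2=\frac{D_2^{1/2}\tau_2}{\mu^{1/2}},\quad K_4=\frac{D_4\mathrm L\tau_4^2}{\mu},$$ $$K_3=\frac{\mathrm L D_6^{3/2}\tau_6^3}{\mu^{3/2}}+\Big(\frac{\mathrm L^2D_2}{\sqrt\mu}+\frac{\mathrm L\sqrt{D_2}}{\sqrt\mu}\Big)\frac{\tau_2^2}{\mu}+\frac{\mathrm L}{\mu},$$ $$\mathcal R_4=\frac{\mathrm L(1-\gamma\mu)^{(n+1)/2}}{n\gamma\mu}\Big(\mathsf E_\nu^{1/2}[\|\theta_0-\theta^\star\|^6]+\mathsf E_\nu^{1/2}[\|\theta_0-\theta^\star\|^4]+\mathsf E_\nu^{1/2}[\|\theta_0-\theta^\star\|^2]+\frac{D_4\gamma\tau_4^2}{\mu}\Big).$$ The bound holds in $[0,\infty]$; it is trivial when $\mathsf E_\nu[\|\theta_0-\theta^\star\|^6]=\infty$. -/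

import Mathlib

open MeasureTheory ProbabilityTheory
open scoped ENNReal

namespace RRSGD

/-- `ℝ^d` with the Euclidean norm. -/
abbrev Vec (d : ℕ) : Type := EuclideanSpace ℝ (Fin d)

/-- `f` is continuously differentiable and `μ`-strongly convex. -/
structure StronglyConvex {d : ℕ} (f : Vec d → ℝ) (μ : ℝ) : Prop where
  contDiff : ContDiff ℝ 1 f
  pos : 0 < μ
  lower : ∀ θ θ' : Vec d,
    μ / 2 * ‖θ - θ'‖ ^ 2 ≤ f θ - f θ' - inner ℝ (gradient f θ') (θ - θ')

/-- `f` is four times continuously differentiable, its gradient is `L₂`-Lipschitz, and its third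
and fourth differentials are bounded by `L₃` and `L₄` in operator norm. -/
structure SmoothUpToFour {d : ℕ} (f : Vec d → ℝ) (L₂ L₃ L₄ : ℝ) : Prop where
  contDiff : ContDiff ℝ 4 f
  nonneg₂ : 0 ≤ L₂
  nonneg₃ : 0 ≤ L₃
  nonneg₄ : 0 ≤ L₄
  lipschitz : ∀ θ θ' : Vec d, ‖gradient f θ - gradient f θ'‖ ≤ L₂ * ‖θ - θ'‖
  bound₃ : ∀ θ : Vec d, ‖iteratedFDeriv ℝ 3 f θ‖ ≤ L₃
  bound₄ : ∀ θ : Vec d, ‖iteratedFDeriv ℝ 4 f θ‖ ≤ L₄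

/-- `θs` is a minimizer of `f`. -/
def IsMinimizer {d : ℕ} (f : Vec d → ℝ) (θs : Vec d) : Prop := ∀ θ, f θs ≤ f θ

/-- Condition A(p) on the stochastic gradient `g θ z` (written `∇F(θ, z)` in the literature) when
the noise variable `z` has law `Pξ`: it is unbiased, has `p`-th moment at `θs` at most `τ ^ p`, and
is co-coercive in the mean of every integer order `q = 2, …, p`. Moments are Lebesgue integrals
in `[0, ∞]`, so the bounds include their finiteness. -/
structure GradientNoise {d : ℕ} {Z : Type*} [MeasurableSpace Z] (p : ℕ) (f : Vec d → ℝ)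
    (g : Vec d → Z → Vec d) (Pξ : Measure Z) (θs : Vec d) (L₁ τ : ℝ) : Prop where
  integrable : ∀ θ, Integrable (g θ) Pξ
  unbiased : ∀ θ, ∫ z, g θ z ∂Pξ = gradient f θ
  nonneg : 0 ≤ τ
  moment : (∫⁻ z, ‖g θs z‖ₑ ^ p ∂Pξ) ^ (1 / (p : ℝ)) ≤ ENNReal.ofReal τ
  pos : 0 < L₁
  cocoercive : ∀ q : ℕ, 2 ≤ q → q ≤ p → ∀ θ₁ θ₂ : Vec d,
    ∫⁻ z, ‖g θ₁ z - g θ₂ z‖ₑ ^ q ∂Pξ ≤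
      ENNReal.ofReal (L₁ ^ (q - 1) * ‖θ₁ - θ₂‖ ^ (q - 2) *
        inner ℝ (gradient f θ₁ - gradient f θ₂) (θ₁ - θ₂))

/-- One step of SGD on laws: the law of `θ - γ g(θ, z)` when `θ ∼ ν` and `z ∼ Pξ` are independent.
This is `ν Q_γ` for the Markov kernel `Q_γ` of SGD with step size `γ`. -/
noncomputable def lawStep {d : ℕ} {Z : Type*} [MeasurableSpace Z] (g : Vec d → Z → Vec d)
    (Pξ : Measure Z) (γ : ℝ) (ν : Measure (Vec d)) : Measure (Vec d) :=
  (ν.prod Pξ).map (fun x => x.1 - γ • g x.1 x.2)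

/-- `‖θ - θs‖_{L^p(ν)}²`, that is `E_ν^{2/p} ‖θ - θs‖^p`, in `[0, ∞]`. -/
noncomputable def sqMoment {d : ℕ} (p : ℕ) (θs : Vec d) (ν : Measure (Vec d)) : ℝ≥0∞ :=
  (∫⁻ θ, ‖θ - θs‖ₑ ^ p ∂ν) ^ (2 / (p : ℝ))

/-- Condition C(p) with constants `Clast, Cstep ≥ 2`: for every step size
`γ ∈ (0, 1 / (L Cstep)]`, the `p`-th moments of the SGD iterates from an arbitrary initial law and
those of a stationary law are controlled. -/
structure MomentBounds {d : ℕ} {Z : Type*} [MeasurableSpace Z] (p : ℕ)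
    (g : Vec d → Z → Vec d) (Pξ : Measure Z) (θs : Vec d) (μ L τ Clast Cstep : ℝ) : Prop where
  two_le_last : 2 ≤ Clast
  two_le_step : 2 ≤ Cstep
  transient : ∀ γ : ℝ, 0 < γ → γ ≤ 1 / (L * Cstep) →
    ∀ ν : Measure (Vec d), IsProbabilityMeasure ν → ∀ k : ℕ,
      sqMoment p θs ((lawStep g Pξ γ)^[k] ν) ≤
        ENNReal.ofReal ((1 - γ * μ) ^ k) * sqMoment p θs ν +
          ENNReal.ofReal (Clast * γ * τ ^ 2 / μ)
  stationary : ∀ γ : ℝ, 0 < γ → γ ≤ 1 / (L * Cstep) →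
    ∀ π : Measure (Vec d), IsProbabilityMeasure π → lawStep g Pξ γ π = π →
      sqMoment p θs π ≤ ENNReal.ofReal (Clast * γ * τ ^ 2 / μ)

/-- The noise variables are i.i.d. with law `Pξ`, and the initial point is independent of them. -/
structure IsNoiseSequence {d : ℕ} {Z Ω : Type*} [MeasurableSpace Z] [MeasurableSpace Ω]
    (P : Measure Ω) (Pξ : Measure Z) (ξ : ℕ → Ω → Z) (θ₀ : Ω → Vec d) : Prop where
  measurable : ∀ k, Measurable (ξ k)
  law : ∀ k, P.map (ξ k) = Pξ
  indep : iIndepFun ξ P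
  measurable_init : Measurable θ₀
  indep_init : IndepFun θ₀ (fun ω k => ξ k ω) P

/-- Constant step size SGD: `θ_{k+1} = θ_k - γ g(θ_k, ξ_{k+1})`. -/
noncomputable def sgd {d : ℕ} {Z Ω : Type*} (g : Vec d → Z → Vec d) (ξ : ℕ → Ω → Z)
    (θ₀ : Ω → Vec d) (γ : ℝ) : ℕ → Ω → Vec d
  | 0 => θ₀
  | k + 1 => fun ω => sgd g ξ θ₀ γ k ω - γ • g (sgd g ξ θ₀ γ k ω) (ξ (k + 1) ω)

/-- The Polyak-Ruppert tail average `(1/n) ∑_{k=n+1}^{2n} θ_k`. -/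
noncomputable def polyakRuppert {d : ℕ} {Z Ω : Type*} (g : Vec d → Z → Vec d) (ξ : ℕ → Ω → Z)
    (θ₀ : Ω → Vec d) (γ : ℝ) (n : ℕ) (ω : Ω) : Vec d :=
  (1 / (n : ℝ)) • ∑ k ∈ Finset.Icc (n + 1) (2 * n), sgd g ξ θ₀ γ k ω

/-- The Richardson-Romberg estimator; both chains use the same noise and initial point. -/
noncomputable def richardsonRomberg {d : ℕ} {Z Ω : Type*} (g : Vec d → Z → Vec d)
    (ξ : ℕ → Ω → Z) (θ₀ : Ω → Vec d) (γ : ℝ) (n : ℕ) (ω : Ω) : Vec d :=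
  (2 : ℝ) • polyakRuppert g ξ θ₀ γ n ω - polyakRuppert g ξ θ₀ (2 * γ) n ω

/-- The Hessian of `f` at `θs`, as a linear operator. -/
noncomputable def hessian {d : ℕ} (f : Vec d → ℝ) (θs : Vec d) : Vec d →L[ℝ] Vec d :=
  fderiv ℝ (gradient f) θs

/-- The matrix `E[g(θs, ξ) g(θs, ξ)ᵀ]`. -/
noncomputable def noiseCov {d : ℕ} {Z : Type*} [MeasurableSpace Z] (g : Vec d → Z → Vec d)
    (Pξ : Measure Z) (θs : Vec d) : Matrix (Fin d) (Fin d) ℝ :=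
  Matrix.of fun i j => ∫ z, g θs z i * g θs z j ∂Pξ

/-- `E^{1/2} ‖X‖^j` in `[0, ∞]`. -/
noncomputable def rootMoment {d : ℕ} {Ω : Type*} [MeasurableSpace Ω] (P : Measure Ω) (j : ℕ)
    (X : Ω → Vec d) : ℝ≥0∞ :=
  (∫⁻ ω, ‖X ω‖ₑ ^ j ∂P) ^ (1 / 2 : ℝ)

/-- The bias constant `C₁` of the Polyak-Ruppert estimator; `D₂` is the constant of C(2). -/
noncomputable def biasConst (L μ D₂ τ₂ : ℝ) : ℝ :=
  (L ^ 2 * D₂ / √μ + L * √D₂ / √μ) * (τ₂ ^ 2 / μ) + L / μ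

noncomputable def rrConst₁ (L μ D₂ D₄ τ₂ τ₄ : ℝ) : ℝ :=
  D₄ * L * τ₄ ^ 2 / μ ^ (3 / 2 : ℝ) + L * √D₂ * τ₂ / √μ

noncomputable def rrConst₂ (μ D₂ τ₂ : ℝ) : ℝ := √D₂ * τ₂ / √μ

noncomputable def rrConst₃ (L μ D₂ D₆ τ₂ τ₆ : ℝ) : ℝ :=
  L * D₆ ^ (3 / 2 : ℝ) * τ₆ ^ 3 / μ ^ (3 / 2 : ℝ) + biasConst L μ D₂ τ₂

noncomputable def rrConst₄ (L μ D₄ τ₄ : ℝ) : ℝ := D₄ * L * τ₄ ^ 2 / μ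

/-- The exponentially small remainder `R₄`; `E₀` is the initial error `θ₀ - θs`. -/
noncomputable def remainder₄ {d : ℕ} {Ω : Type*} [MeasurableSpace Ω] (P : Measure Ω)
    (E₀ : Ω → Vec d) (L μ D₄ τ₄ γ : ℝ) (n : ℕ) : ℝ≥0∞ :=
  ENNReal.ofReal (L * (1 - γ * μ) ^ (((n : ℝ) + 1) / 2) / (n * γ * μ)) *
    (rootMoment P 6 E₀ + rootMoment P 4 E₀ + rootMoment P 2 E₀ +
      ENNReal.ofReal (D₄ * γ * τ₄ ^ 2 / μ))

end RRSGD

open MeasureTheory ProbabilityTheory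
open scoped ENNReal

set_option linter.unusedSectionVars false

namespace RRSGD

/-! Centre at the minimizer and write `D` for the gradient field, `H` and `T` for its first and
second differentials at `0`. Strong convexity and co-coercivity make two chains driven by the same
noise approach each other in mean square like `(1 - γμ)^k` (`sgd_coupling_le`). Replacing the
initial point by the minimizer therefore costs only `remainder₄`, and it remains to study the chains
started at `0` with steps `γ` and `2γ`.

For such a chain `X`, summing the recursion (`orbit_sum_eq`) writes `∑ H X_k` as a boundary term
`(X_m - X_{m+n})/γ`, minus a martingale, minus the sum of the remainders `D X_k - H X_k`. The
boundary term gives `rrConst₂`; the martingale gives the leading term and one half of `rrConst₁`.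
The fluctuations of the remainders, controlled by the decay of correlations (`variance_sum_le`),
give the other half.

The mean of the remainders is the bias, where the extrapolation acts. To leading order it is half
the mean of `T X_k X_k`, and `X` may be replaced there by the linearized chain `Y`
(`sum_mean_rem_sub_le`). The quadratic moments of `Y` are explicit (`linear_orbit_quadratic`). Two
linear steps of size `γ` nearly equal one step of size `2γ`, so twice the moment at `γ` cancels the
moment at `2γ`, up to a relative error `γL · L/μ` and a transient (`abs_quadratic_combination_le`).
What is left is of order `γ^(3/2)`.

Two facts keep the dependence on `L/μ` as small as claimed. Positivity of the Hessian at every point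
bounds `T e` by `H` (field `psd`, `abs_third_le`), so that square roots of `L/μ` appear. And the
time average of `⟪D x, x⟫` is about `μ` times the stationary variance, not `L` times it
(`orbit_zero_sum_field_le`).

All moments come from one-step drift inequalities. Those of order four and six are proved for `γL ≤
1/30`. For larger steps `γL` is bounded below, no cancellation is needed, and each chain is bounded
separately (`large_step_sum_le`), with a Lyapunov function of order `5/2` whose drift persists up to
`γL = 1`. -/

/-- Regularity of a gradient field `D` of a strongly convex function, centred at the minimizer `0`,
with first and second differentials `H` and `T` at `0`. -/
structure RegularField {d : ℕ} (D : Vec d → Vec d) (H : Vec d →L[ℝ] Vec d)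
    (T : Vec d →L[ℝ] Vec d →L[ℝ] Vec d) (μ L : ℝ) : Prop where
  pos : 0 < μ
  le : μ ≤ L
  zero : D 0 = 0
  lip : ∀ x y, ‖D x - D y‖ ≤ L * ‖x - y‖
  mono : ∀ x y, μ * ‖x - y‖ ^ 2 ≤ inner ℝ (D x - D y) (x - y)
  hsymm : ∀ u v, inner ℝ (H u) v = inner ℝ u (H v)
  hlower : ∀ v, μ * ‖v‖ ^ 2 ≤ inner ℝ (H v) v
  hnorm : ∀ v, ‖H v‖ ≤ L * ‖v‖
  rem_lip : ∀ x y, ‖(D x - H x) - (D y - H y)‖ ≤ L * (‖x‖ + ‖y‖) * ‖x - y‖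
  taylor : ∀ x, ‖D x - H x - (1 / 2 : ℝ) • T x x‖ ≤ L * ‖x‖ ^ 3
  tcomm : ∀ u v, T u v = T v u
  tsymm : ∀ e u v, inner ℝ (T e u) v = inner ℝ u (T e v)
  tnorm : ∀ u v, ‖T u v‖ ≤ L * ‖u‖ * ‖v‖
  psd : ∀ e v, 0 ≤ inner ℝ (H v) v + inner ℝ (T e v) v + L * ‖e‖ ^ 2 * ‖v‖ ^ 2

/-! ### Taylor expansions of the gradient field -/

section Calculus

variable {d : ℕ} {f : Vec d → ℝ}

lemma gradient_eq_comp (f : Vec d → ℝ) :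
    gradient f = fun x => (InnerProductSpace.toDual ℝ (Vec d)).symm (fderiv ℝ f x) := rfl

lemma contDiff_gradient {n : ℕ} (hf : ContDiff ℝ (n + 1 : ℕ) f) : ContDiff ℝ n (gradient f) := by
  rw [gradient_eq_comp]
  exact (LinearIsometryEquiv.contDiff _).comp
    (hf.fderiv_right (m := n) (by norm_cast))

lemma norm_iteratedFDeriv_gradient (n : ℕ) (x : Vec d) :
    ‖iteratedFDeriv ℝ n (gradient f) x‖ = ‖iteratedFDeriv ℝ (n + 1) f x‖ := by
  rw [← norm_iteratedFDeriv_fderiv, gradient_eq_comp]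
  exact LinearIsometryEquiv.norm_iteratedFDeriv_comp_left
    (InnerProductSpace.toDual ℝ (Vec d)).symm (fderiv ℝ f) x n

lemma inner_fderiv_gradient (hf : ContDiff ℝ 2 f) (x u v : Vec d) :
    inner ℝ (fderiv ℝ (gradient f) x u) v = fderiv ℝ (fderiv ℝ f) x u v := by
  have h1 : DifferentiableAt ℝ (fderiv ℝ f) x :=
    ((hf.fderiv_right (m := 1) (by norm_num)).differentiable (by norm_num)) x
  have h2 : HasFDerivAt (gradient f)
      (((InnerProductSpace.toDual ℝ (Vec d)).symm.toContinuousLinearEquiv.toContinuousLinearMap :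
        (Vec d →L[ℝ] ℝ) →L[ℝ] Vec d).comp (fderiv ℝ (fderiv ℝ f) x)) x :=
    ContinuousLinearMap.hasFDerivAt ((InnerProductSpace.toDual ℝ
      (Vec d)).symm.toContinuousLinearEquiv.toContinuousLinearMap :
        (Vec d →L[ℝ] ℝ) →L[ℝ] Vec d) |>.comp x h1.hasFDerivAt
  rw [h2.fderiv]
  exact InnerProductSpace.toDual_symm_apply

lemma inner_fderiv_gradient_comm (hf : ContDiff ℝ 2 f) (x u v : Vec d) :
    inner ℝ (fderiv ℝ (gradient f) x u) v = inner ℝ u (fderiv ℝ (gradient f) x v) := by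
  rw [real_inner_comm v, real_inner_comm, inner_fderiv_gradient hf, real_inner_comm,
    inner_fderiv_gradient hf]
  exact (hf.contDiffAt.isSymmSndFDerivAt (by simp)) u v

section Taylor

variable {F : Type*} [NormedAddCommGroup F] [NormedSpace ℝ F]

lemma norm_fderiv_fderiv_le {g : F → F} {C : ℝ} {x : F}
    (h : ‖iteratedFDeriv ℝ 2 g x‖ ≤ C) : ‖fderiv ℝ (fderiv ℝ g) x‖ ≤ C := by
  rwa [← norm_iteratedFDeriv_fderiv, ← norm_iteratedFDeriv_fderiv, norm_iteratedFDeriv_zero] at h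

lemma norm_fderiv_fderiv_fderiv_le {g : F → F} {C : ℝ} {x : F}
    (h : ‖iteratedFDeriv ℝ 3 g x‖ ≤ C) : ‖fderiv ℝ (fderiv ℝ (fderiv ℝ g)) x‖ ≤ C := by
  rwa [← norm_iteratedFDeriv_fderiv, ← norm_iteratedFDeriv_fderiv, ← norm_iteratedFDeriv_fderiv,
    norm_iteratedFDeriv_zero] at h

/-- The mean value inequality along a segment ending at the centre. -/
lemma norm_sub_le_of_fderiv_le {G : Type*} [NormedAddCommGroup G] [NormedSpace ℝ G] {φ : F → G} (hφ : Differentiable ℝ φ) {C : ℝ}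
    (x y : F) (h : ∀ z ∈ segment ℝ x y, ‖fderiv ℝ φ z‖ ≤ C) : ‖φ y - φ x‖ ≤ C * ‖y - x‖ :=
  (convex_segment x y).norm_image_sub_le_of_norm_fderiv_le (𝕜 := ℝ)
    (fun z _ => hφ z) h (left_mem_segment ℝ x y) (right_mem_segment ℝ x y)

lemma norm_le_of_mem_segment {x y z : F}
    (h : z ∈ segment ℝ x y) : ‖z‖ ≤ ‖x‖ + ‖y‖ := by
  obtain ⟨a, b, ha, hb, hab, rfl⟩ := h
  calc ‖a • x + b • y‖ ≤ a * ‖x‖ + b * ‖y‖ := by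
        refine (norm_add_le _ _).trans ?_
        rw [norm_smul, norm_smul, Real.norm_of_nonneg ha, Real.norm_of_nonneg hb]
    _ ≤ 1 * ‖x‖ + 1 * ‖y‖ := by gcongr <;> linarith
    _ = _ := by ring

lemma norm_le_of_mem_segment_zero {y z : F}
    (h : z ∈ segment ℝ 0 y) : ‖z‖ ≤ ‖y‖ := by
  simpa using norm_le_of_mem_segment h

variable {g : F → F} {L : ℝ}

/-- The derivative of the remainder at `z` is `fderiv g z - fderiv g 0`, of norm at most `L‖z‖`, and
`‖z‖ ≤ ‖x‖ + ‖y‖` on the segment. -/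
lemma remainder₁_lipschitz (hg : ContDiff ℝ 3 g) (h₂ : ∀ x, ‖iteratedFDeriv ℝ 2 g x‖ ≤ L)
    (x y : F) :
    ‖(g x - fderiv ℝ g 0 x) - (g y - fderiv ℝ g 0 y)‖ ≤ L * (‖x‖ + ‖y‖) * ‖x - y‖ := by
  have hL : 0 ≤ L := (norm_nonneg _).trans (h₂ 0)
  have hd : Differentiable ℝ g := hg.differentiable (by norm_num)
  have hd2 : Differentiable ℝ (fderiv ℝ g) :=
    (hg.fderiv_right (m := 2) (by norm_num)).differentiable (by norm_num)
  refine norm_sub_le_of_fderiv_le (φ := fun x => g x - fderiv ℝ g 0 x)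
    (hd.sub (fderiv ℝ g 0).differentiable) y x fun z hz => ?_
  rw [fderiv_fun_sub (hd z) (fderiv ℝ g 0).differentiableAt, ContinuousLinearMap.fderiv]
  have := norm_sub_le_of_fderiv_le hd2 0 z (fun w _ => norm_fderiv_fderiv_le (h₂ w))
  rw [sub_zero] at this
  refine this.trans ?_
  gcongr
  linarith [norm_le_of_mem_segment hz]

/-- The mean value inequality applied twice. It costs the factor `1/2` of the integral remainder,
which is irrelevant here. -/
lemma fderiv_taylor₁ (hg : ContDiff ℝ 3 g) (h₃ : ∀ x, ‖iteratedFDeriv ℝ 3 g x‖ ≤ L)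
    (x : F) :
    ‖fderiv ℝ g x - fderiv ℝ g 0 - fderiv ℝ (fderiv ℝ g) 0 x‖ ≤ L * ‖x‖ ^ 2 := by
  have hL : 0 ≤ L := (norm_nonneg _).trans (h₃ 0)
  have hd2 : Differentiable ℝ (fderiv ℝ g) :=
    (hg.fderiv_right (m := 2) (by norm_num)).differentiable (by norm_num)
  have hd3 : Differentiable ℝ (fderiv ℝ (fderiv ℝ g)) :=
    ((hg.fderiv_right (m := 2) (by norm_num)).fderiv_right (m := 1) (by norm_num)).differentiable
      (by norm_num)
  have key := norm_sub_le_of_fderiv_le (C := L * ‖x‖)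
    (φ := fun y => fderiv ℝ g y - fderiv ℝ (fderiv ℝ g) 0 y)
    (hd2.sub (fderiv ℝ (fderiv ℝ g) 0).differentiable) 0 x fun z hz => by
      rw [fderiv_fun_sub (hd2 z) (fderiv ℝ (fderiv ℝ g) 0).differentiableAt,
        ContinuousLinearMap.fderiv]
      have := norm_sub_le_of_fderiv_le hd3 0 z (fun w _ => norm_fderiv_fderiv_fderiv_le (h₃ w))
      rw [sub_zero] at this
      refine this.trans ?_
      gcongr
      exact norm_le_of_mem_segment_zero hz
  simp only [map_zero, sub_zero] at key
  calc _ = ‖fderiv ℝ g x - fderiv ℝ (fderiv ℝ g) 0 x - fderiv ℝ g 0‖ := by congr 1; abel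
    _ ≤ _ := key
    _ = _ := by ring

/-- The derivative of this remainder is the one bounded in `fderiv_taylor₁`: by symmetry of the
second differential, `x ↦ (1/2) T x x` has derivative `T z` at `z`. -/
lemma taylor₂ (hg : ContDiff ℝ 3 g) (h₃ : ∀ x, ‖iteratedFDeriv ℝ 3 g x‖ ≤ L)
    (h0 : g 0 = 0) (x : F) :
    ‖g x - fderiv ℝ g 0 x - (1 / 2 : ℝ) • fderiv ℝ (fderiv ℝ g) 0 x x‖ ≤ L * ‖x‖ ^ 3 := by
  have hL : 0 ≤ L := (norm_nonneg _).trans (h₃ 0)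
  have hd : Differentiable ℝ g := hg.differentiable (by norm_num)
  set T := fderiv ℝ (fderiv ℝ g) 0 with hT
  have hsymm : ∀ u v, T u v = T v u := fun u v =>
    (hg.contDiffAt.isSymmSndFDerivAt (by simp; norm_num)) u v
  have hq : ∀ z, HasFDerivAt (fun x : F => (1 / 2 : ℝ) • T x x) (T z) z := fun z => by
    have h1 : HasFDerivAt (fun x : F => T x x)
        ((T.precompR (F) z (ContinuousLinearMap.id ℝ _)) +
          (T.precompL (F) (ContinuousLinearMap.id ℝ _) z)) z :=
      T.hasFDerivAt_of_bilinear (hasFDerivAt_id z) (hasFDerivAt_id z)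
    refine (h1.const_smul (1 / 2 : ℝ)).congr_fderiv ?_
    ext v
    change (1 / 2 : ℝ) • (T z v + T v z) = T z v
    rw [hsymm v z, ← two_smul ℝ (T z v), smul_smul]
    norm_num
  have hD : ∀ z, HasFDerivAt (fun x => g x - fderiv ℝ g 0 x - (1 / 2 : ℝ) • T x x)
      (fderiv ℝ g z - fderiv ℝ g 0 - T z) z := fun z =>
    ((hd z).hasFDerivAt.sub (fderiv ℝ g 0).hasFDerivAt).sub (hq z)
  have key := norm_sub_le_of_fderiv_le (C := L * ‖x‖ ^ 2)
    (φ := fun x => g x - fderiv ℝ g 0 x - (1 / 2 : ℝ) • T x x)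
    (fun z => (hD z).differentiableAt) 0 x fun z hz => by
      rw [(hD z).fderiv]
      refine (fderiv_taylor₁ hg h₃ z).trans ?_
      gcongr
      exact norm_le_of_mem_segment_zero hz
  simp only [map_zero, sub_zero, h0, smul_zero] at key
  calc _ ≤ _ := key
    _ = _ := by ring

end Taylor

/-- Divide the monotonicity inequality between `x + t v` and `x` by `t ^ 2` and let `t` decrease to
`0`. -/
lemma inner_fderiv_ge_of_monotone {g : Vec d → Vec d} {μ : ℝ} (hd : Differentiable ℝ g)
    (hm : ∀ x y, μ * ‖x - y‖ ^ 2 ≤ inner ℝ (g x - g y) (x - y)) (x v : Vec d) :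
    μ * ‖v‖ ^ 2 ≤ inner ℝ (fderiv ℝ g x v) v := by
  have h1 : HasDerivAt (fun t : ℝ => g (x + t • v)) (fderiv ℝ g x v) 0 := by
    have h2 : HasDerivAt (fun t : ℝ => x + t • v) v 0 := by
      simpa using ((hasDerivAt_id (0 : ℝ)).smul_const v).const_add x
    have h3 : HasFDerivAt g (fderiv ℝ g x) (x + (0 : ℝ) • v) := by
      simpa using (hd x).hasFDerivAt
    exact h3.comp_hasDerivAt (0 : ℝ) h2
  have h2 := h1.tendsto_slope_zero_right
  have h3 : Filter.Tendsto (fun t : ℝ => inner ℝ (t⁻¹ • (g (x + (0 + t) • v) - g (x + (0 : ℝ) • v))) v)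
      (nhdsWithin 0 (Set.Ioi 0)) (nhds (inner ℝ (fderiv ℝ g x v) v)) := h2.inner tendsto_const_nhds
  refine ge_of_tendsto h3 ?_
  filter_upwards [self_mem_nhdsWithin] with t ht
  have ht : 0 < t := ht
  have := hm (x + t • v) x
  simp only [add_sub_cancel_left, norm_smul, inner_smul_right, Real.norm_of_nonneg ht.le] at this
  simp only [zero_add, zero_smul, add_zero, inner_smul_left, conj_trivial]
  rw [inv_mul_eq_div, le_div_iff₀ ht]
  nlinarith

end Calculus

/-- The centred gradient of a smooth strongly convex function is a regular field. -/
lemma regularField_gradient {d : ℕ} (hd : 0 < d) {f : Vec d → ℝ} {θs : Vec d}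
    {μ L L₂ L₃ L₄ : ℝ} (h₂ : L₂ ≤ L) (h₃ : L₃ ≤ L) (h₄ : L₄ ≤ L) (hmin : IsMinimizer f θs)
    (hc : StronglyConvex f μ) (hs : SmoothUpToFour f L₂ L₃ L₄) :
    RegularField (fun x => gradient f (θs + x)) (hessian f θs)
      (fderiv ℝ (fderiv ℝ fun x => gradient f (θs + x)) 0) μ L := by
  set D : Vec d → Vec d := fun x => gradient f (θs + x) with hDdef
  set f' : Vec d → ℝ := fun x => f (θs + x) with hf'
  have hf4 : ContDiff ℝ 4 f' := hs.contDiff.comp (contDiff_const.add contDiff_id)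
  have hDf : D = gradient f' := by
    funext x
    simp only [hDdef, hf', gradient]
    rw [fderiv_comp_add_left]
  have hD3 : ContDiff ℝ 3 D := hDf ▸ contDiff_gradient (n := 3) (by exact_mod_cast hf4)
  have hH : hessian f θs = fderiv ℝ D 0 := by
    rw [hDdef, fderiv_comp_add_left, add_zero]; rfl
  have hdiff : Differentiable ℝ D := hD3.differentiable (by norm_num)
  have hiter : ∀ n x, ‖iteratedFDeriv ℝ n D x‖ = ‖iteratedFDeriv ℝ (n + 1) f (θs + x)‖ := by
    intro n x
    rw [hDf, norm_iteratedFDeriv_gradient, hf', iteratedFDeriv_comp_add_left]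
  have hT2 : ∀ x, ‖iteratedFDeriv ℝ 2 D x‖ ≤ L := fun x => by
    rw [hiter]; exact (hs.bound₃ _).trans h₃
  have hT3 : ∀ x, ‖iteratedFDeriv ℝ 3 D x‖ ≤ L := fun x => by
    rw [hiter]; exact (hs.bound₄ _).trans h₄
  have hzero : D 0 = 0 := by
    have : IsLocalMin f θs := Filter.Eventually.of_forall hmin
    simp only [hDdef, add_zero, gradient, this.fderiv_eq_zero, map_zero]
  have hlip : ∀ x y, ‖D x - D y‖ ≤ L * ‖x - y‖ := fun x y => by
    refine (hs.lipschitz _ _).trans ?_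
    rw [add_sub_add_left_eq_sub]
    gcongr
  have hmono : ∀ x y, μ * ‖x - y‖ ^ 2 ≤ inner ℝ (D x - D y) (x - y) := fun x y => by
    have h1 := hc.lower (θs + x) (θs + y)
    have h2 := hc.lower (θs + y) (θs + x)
    rw [add_sub_add_left_eq_sub] at h1 h2
    rw [norm_sub_rev y x, ← neg_sub x y, inner_neg_right] at h2
    rw [inner_sub_left]
    linarith
  have hlow : ∀ x v, μ * ‖v‖ ^ 2 ≤ inner ℝ (fderiv ℝ D x v) v := fun x v =>
    inner_fderiv_ge_of_monotone hdiff hmono x v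
  have hsym : ∀ x u v, inner ℝ (fderiv ℝ D x u) v = inner ℝ u (fderiv ℝ D x v) := fun x u v => by
    rw [hDf]
    exact inner_fderiv_gradient_comm (hf4.of_le (by norm_num)) x u v
  have hd2 : Differentiable ℝ (fderiv ℝ D) :=
    (hD3.fderiv_right (m := 2) (by norm_num)).differentiable (by norm_num)
  -- Positive dimension supplies a nonzero vector, at which the monotonicity and Lipschitz bounds
  -- are compared.
  have hμL : μ ≤ L := by
    obtain ⟨v, hv⟩ : ∃ v : Vec d, v ≠ 0 := by
      have : Nonempty (Fin d) := ⟨⟨0, hd⟩⟩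
      exact exists_ne 0
    have h1 := hmono v 0
    have h2 := hlip v 0
    rw [hzero, sub_zero, sub_zero] at h1 h2
    have h3 := real_inner_le_norm (D v) v
    have h4 : 0 < ‖v‖ := norm_pos_iff.2 hv
    have h5 : μ * ‖v‖ ^ 2 ≤ L * ‖v‖ ^ 2 := by nlinarith
    exact le_of_mul_le_mul_right h5 (by positivity)
  have hL : 0 ≤ L := hc.pos.le.trans hμL
  rw [hH]
  refine ⟨hc.pos, hμL, hzero, hlip, hmono, hsym 0, hlow 0, fun v => ?_,
    remainder₁_lipschitz hD3 hT2, taylor₂ hD3 hT3 hzero, fun u v => ?_, fun e u v => ?_,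
    fun u v => ?_, fun e v => ?_⟩
  · have : ‖fderiv ℝ D 0‖ ≤ L := by
      have hlw : LipschitzWith ⟨L, hL⟩ D := LipschitzWith.of_dist_le_mul fun x y => by
        rw [dist_eq_norm, dist_eq_norm]; exact hlip x y
      exact norm_fderiv_le_of_lipschitz ℝ hlw
    exact ((fderiv ℝ D 0).le_opNorm v).trans (by gcongr)
  · exact (hD3.contDiffAt.isSymmSndFDerivAt (by simp; norm_num)) u v
  -- Differentiate the symmetry of the Hessian at `x` in the direction `e`, at `x = 0`.
  · have h1 : HasFDerivAt (fun x => inner ℝ (fderiv ℝ D x u) v) _ 0 :=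
      ((hd2 0).hasFDerivAt.clm_apply (hasFDerivAt_const u 0)).inner ℝ (hasFDerivAt_const v 0)
    have h2 : HasFDerivAt (fun x => inner ℝ u (fderiv ℝ D x v)) _ 0 :=
      (hasFDerivAt_const u (0 : Vec d)).inner ℝ
        ((hd2 0).hasFDerivAt.clm_apply (hasFDerivAt_const v 0))
    have h3 : (fun x => inner ℝ (fderiv ℝ D x u) v) = fun x => inner ℝ u (fderiv ℝ D x v) :=
      funext fun x => hsym x u v
    rw [h3] at h1
    have := congrArg (fun A => A e) (h1.unique h2)
    simpa [fderivInnerCLM_apply] using this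
  · calc ‖fderiv ℝ (fderiv ℝ D) 0 u v‖ ≤ ‖fderiv ℝ (fderiv ℝ D) 0 u‖ * ‖v‖ :=
          ContinuousLinearMap.le_opNorm _ _
      _ ≤ ‖fderiv ℝ (fderiv ℝ D) 0‖ * ‖u‖ * ‖v‖ := by
          gcongr; exact ContinuousLinearMap.le_opNorm _ _
      _ ≤ _ := by gcongr; exact norm_fderiv_fderiv_le (hT2 0)
  -- The Hessian at `e` is nonnegative and differs from `H + T e` by at most `L‖e‖ ^ 2`.
  · have h1 := hlow e v
    have h2 := fderiv_taylor₁ hD3 hT3 e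
    set R := fderiv ℝ D e - fderiv ℝ D 0 - fderiv ℝ (fderiv ℝ D) 0 e with hR
    have h3 : inner ℝ (fderiv ℝ D e v) v = inner ℝ (fderiv ℝ D 0 v) v
        + inner ℝ (fderiv ℝ (fderiv ℝ D) 0 e v) v + inner ℝ (R v) v := by
      rw [← inner_add_left, ← inner_add_left]
      congr 1
      simp [hR]
    have h4 : inner ℝ (R v) v ≤ L * ‖e‖ ^ 2 * ‖v‖ ^ 2 := by
      refine (real_inner_le_norm _ _).trans ?_
      have := R.le_opNorm v
      calc ‖R v‖ * ‖v‖ ≤ (‖R‖ * ‖v‖) * ‖v‖ := by gcongr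
        _ ≤ (L * ‖e‖ ^ 2 * ‖v‖) * ‖v‖ := by gcongr
        _ = _ := by ring
    have h5 : 0 ≤ μ * ‖v‖ ^ 2 := mul_nonneg hc.pos.le (by positivity)
    linarith

end RRSGD

/-! ### Conditioning on the past by Fubini -/

namespace RRSGD

section History

variable {d : ℕ} {Z Ω : Type*} [MeasurableSpace Z] [mΩ : MeasurableSpace Ω]
  {P : Measure Ω} [IsProbabilityMeasure P] {Pξ : Measure Z} [IsProbabilityMeasure Pξ]
  {ξ : ℕ → Ω → Z} {θ₀ : Ω → Vec d}

/-- The initial point together with the noise up to time `k`. -/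
def history (ξ : ℕ → Ω → Z) (θ₀ : Ω → Vec d) (k : ℕ) (ω : Ω) : Vec d × (Finset.Iic k → Z) :=
  (θ₀ ω, fun i => ξ i ω)

/-- The σ-algebra generated by the initial point and the noise up to time `k`. -/
@[reducible] def past (ξ : ℕ → Ω → Z) (θ₀ : Ω → Vec d) (k : ℕ) : MeasurableSpace Ω :=
  MeasurableSpace.comap (history ξ θ₀ k) inferInstance

lemma measurable_history (hN : IsNoiseSequence P Pξ ξ θ₀) (k : ℕ) :
    Measurable (history ξ θ₀ k) :=
  hN.measurable_init.prodMk (measurable_pi_lambda _ fun i => hN.measurable i)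

lemma past_le (hN : IsNoiseSequence P Pξ ξ θ₀) (k : ℕ) : past ξ θ₀ k ≤ mΩ :=
  (measurable_history hN k).comap_le

lemma measurable_past_init (k : ℕ) : Measurable[past ξ θ₀ k] θ₀ :=
  measurable_fst.comp (comap_measurable (history ξ θ₀ k))

lemma measurable_past_noise {i k : ℕ} (h : i ≤ k) : Measurable[past ξ θ₀ k] (ξ i) :=
  (measurable_pi_apply (⟨i, Finset.mem_Iic.2 h⟩ : Finset.Iic k)).comp
    (measurable_snd.comp (comap_measurable (history ξ θ₀ k)))

lemma past_mono {i k : ℕ} (h : i ≤ k) : past ξ θ₀ i ≤ past ξ θ₀ k := by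
  refine Measurable.comap_le (m₁ := past ξ θ₀ k) ?_
  refine Measurable.prodMk (measurable_past_init k) ?_
  refine @measurable_pi_lambda Ω _ _ (past ξ θ₀ k) _ _ fun j => ?_
  exact measurable_past_noise ((Finset.mem_Iic.1 j.2).trans h)

/-- `θ₀` is independent of the pair formed by the past noise `V` and `ξ (k + 1)`, and these two are
independent of each other. The joint law is thus a triple product, and reassociating it gives the
claim. -/
lemma indepFun_history (hN : IsNoiseSequence P Pξ ξ θ₀) (k : ℕ) :
    IndepFun (history ξ θ₀ k) (ξ (k + 1)) P := by
  set V : Ω → (Finset.Iic k → Z) := fun ω i => ξ i ω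
  have hVm : Measurable V := measurable_pi_lambda _ fun i => hN.measurable i
  have hW := hN.measurable (k + 1)
  have hVW : IndepFun V (ξ (k + 1)) P := by
    have h := hN.indep.indepFun_finset (Finset.Iic k) {k + 1}
      (by simp) hN.measurable
    exact h.comp (φ := id) (ψ := fun a => a ⟨k + 1, Finset.mem_singleton_self _⟩)
      measurable_id
      (measurable_pi_apply (⟨k + 1, Finset.mem_singleton_self _⟩ : ({k + 1} : Finset ℕ)))
  have hU : IndepFun θ₀ (fun ω => (V ω, ξ (k + 1) ω)) P :=
    hN.indep_init.comp (φ := id)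
      (ψ := fun a : ℕ → Z => ((fun i : Finset.Iic k => a i), a (k + 1))) measurable_id
      (by fun_prop)
  rw [indepFun_iff_map_prod_eq_prod_map_map (measurable_history hN k).aemeasurable
    hW.aemeasurable]
  have hUV : IndepFun θ₀ V P :=
    hU.comp (φ := id) (ψ := Prod.fst) measurable_id measurable_fst
  have e1 := hU.map_prod_eq_prod_map_map hN.measurable_init.aemeasurable
    (hVm.prodMk hW).aemeasurable
  rw [hVW.map_prod_eq_prod_map_map hVm.aemeasurable hW.aemeasurable] at e1
  have e2 : P.map (history ξ θ₀ k) = (P.map θ₀).prod (P.map V) :=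
    hUV.map_prod_eq_prod_map_map hN.measurable_init.aemeasurable hVm.aemeasurable
  have : IsProbabilityMeasure (P.map θ₀) :=
    Measure.isProbabilityMeasure_map hN.measurable_init.aemeasurable
  have : IsProbabilityMeasure (P.map V) := Measure.isProbabilityMeasure_map hVm.aemeasurable
  have : IsProbabilityMeasure (P.map (ξ (k + 1))) :=
    Measure.isProbabilityMeasure_map hW.aemeasurable
  rw [e2]
  apply MeasurableEquiv.map_measurableEquiv_injective MeasurableEquiv.prodAssoc
  rw [Measure.prodAssoc_prod, ← e1, Measure.map_map (MeasurableEquiv.measurable _)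
    ((measurable_history hN k).prodMk hW)]
  rfl

variable {S : Type*} [MeasurableSpace S] {X : Ω → S} {k : ℕ}

lemma map_prod_noise (hN : IsNoiseSequence P Pξ ξ θ₀) (hX : Measurable[past ξ θ₀ k] X) :
    P.map (fun ω => (X ω, ξ (k + 1) ω)) = (P.map X).prod Pξ := by
  rw [← hN.law (k + 1)]
  have hXm : Measurable X := hX.mono (past_le hN k) le_rfl
  have hi : IndepFun X (ξ (k + 1)) P :=
    indep_of_indep_of_le_left (indepFun_history hN k) hX.comap_le
  exact hi.map_prod_eq_prod_map_map hXm.aemeasurable (hN.measurable _).aemeasurable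

variable {E : Type*} [NormedAddCommGroup E] [NormedSpace ℝ E] [MeasurableSpace E] [BorelSpace E]
  [SecondCountableTopology E]

/-- Conditional expectation given the past, in the form of Fubini's theorem for the product law of
`X` and the fresh noise. -/
lemma integral_noise (hN : IsNoiseSequence P Pξ ξ θ₀) (hX : Measurable[past ξ θ₀ k] X)
    {F : S × Z → E} (hF : Measurable F) (hi : Integrable (fun ω => F (X ω, ξ (k + 1) ω)) P) :
    Integrable (fun ω => ∫ z, F (X ω, z) ∂Pξ) P ∧
      ∫ ω, F (X ω, ξ (k + 1) ω) ∂P = ∫ ω, ∫ z, F (X ω, z) ∂Pξ ∂P := by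
  have hXm : Measurable X := hX.mono (past_le hN k) le_rfl
  have hp := hXm.prodMk (hN.measurable (k + 1))
  have hFs : StronglyMeasurable F := hF.stronglyMeasurable
  have hi' : Integrable F ((P.map X).prod Pξ) := by
    rw [← map_prod_noise hN hX, integrable_map_measure hFs.aestronglyMeasurable hp.aemeasurable]
    exact hi
  have hG : StronglyMeasurable fun x => ∫ z, F (x, z) ∂Pξ := hFs.integral_prod_right'
  constructor
  · have := hi'.integral_prod_left
    rwa [integrable_map_measure hG.aestronglyMeasurable hXm.aemeasurable] at this
  · rw [← integral_map hp.aemeasurable hFs.aestronglyMeasurable, map_prod_noise hN hX,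
      integral_prod _ hi', integral_map hXm.aemeasurable hG.aestronglyMeasurable]

lemma integrable_noise (hN : IsNoiseSequence P Pξ ξ θ₀) (hX : Measurable[past ξ θ₀ k] X)
    {F : S × Z → E} (hF : Measurable F) (h1 : ∀ s, Integrable (fun z => F (s, z)) Pξ)
    (h2 : Integrable (fun ω => ∫ z, ‖F (X ω, z)‖ ∂Pξ) P) :
    Integrable (fun ω => F (X ω, ξ (k + 1) ω)) P := by
  have hXm : Measurable X := hX.mono (past_le hN k) le_rfl
  have hp := hXm.prodMk (hN.measurable (k + 1))
  have hFs : StronglyMeasurable F := hF.stronglyMeasurable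
  have : Integrable F ((P.map X).prod Pξ) := by
    rw [integrable_prod_iff hFs.aestronglyMeasurable]
    refine ⟨Filter.Eventually.of_forall h1, ?_⟩
    rw [integrable_map_measure hFs.norm.integral_prod_right'.aestronglyMeasurable
      hXm.aemeasurable]
    exact h2
  rw [← map_prod_noise hN hX, integrable_map_measure hFs.aestronglyMeasurable
    hp.aemeasurable] at this
  exact this

end History

/-! ### Lyapunov drift for driven Markov chains -/

section Drift

variable {d : ℕ} {Z Ω : Type*} [MeasurableSpace Z] [mΩ : MeasurableSpace Ω]
  {P : Measure Ω} [IsProbabilityMeasure P] {Pξ : Measure Z} [IsProbabilityMeasure Pξ]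
  {ξ : ℕ → Ω → Z} {θ₀ : Ω → Vec d} {S : Type*} [MeasurableSpace S]

/-- A Markov chain `X` driven by the noise `ξ` through the update map `u`. -/
structure IsDriven (ξ : ℕ → Ω → Z) (θ₀ : Ω → Vec d) (u : S × Z → S) (X : ℕ → Ω → S) : Prop where
  measurable : Measurable u
  init : Measurable[past ξ θ₀ 0] (X 0)
  succ : ∀ k ω, X (k + 1) ω = u (X k ω, ξ (k + 1) ω)

lemma IsDriven.adapted {u : S × Z → S} {X : ℕ → Ω → S} (h : IsDriven ξ θ₀ u X) (k : ℕ) :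
    Measurable[past ξ θ₀ k] (X k) := by
  induction k with
  | zero => exact h.init
  | succ k ih =>
    have : X (k + 1) = u ∘ fun ω => (X k ω, ξ (k + 1) ω) := funext (h.succ k)
    rw [this]
    exact h.measurable.comp ((ih.mono (past_mono k.le_succ) le_rfl).prodMk
      (measurable_past_noise le_rfl))

lemma IsDriven.meas {u : S × Z → S} {X : ℕ → Ω → S} (h : IsDriven ξ θ₀ u X)
    (hN : IsNoiseSequence P Pξ ξ θ₀) (k : ℕ) : Measurable (X k) :=
  (h.adapted k).mono (past_le hN k) le_rfl

/-- A one-step drift inequality `E V(u(s, ξ)) ≤ (1 - β) V(s) - Q(s) + B` for all states. -/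
structure HasDrift (Pξ : Measure Z) (u : S × Z → S) (V Q : S → ℝ) (β B : ℝ) : Prop where
  measV : Measurable V
  measQ : Measurable Q
  nonnegV : ∀ s, 0 ≤ V s
  nonnegQ : ∀ s, 0 ≤ Q s
  nonnegβ : 0 ≤ β
  leβ : β ≤ 1
  nonnegB : 0 ≤ B
  integrable : ∀ s, Integrable (fun z => V (u (s, z))) Pξ
  drift : ∀ s, ∫ z, V (u (s, z)) ∂Pξ ≤ (1 - β) * V s - Q s + B

variable {u : S × Z → S} {X : ℕ → Ω → S} {V Q : S → ℝ} {β B : ℝ}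

/-- The conditional expectation of `V` is nonnegative, so the drift inequality bounds both it and
`Q` by `V + B`. Integrability of `V` therefore passes to the next step and to `Q`. -/
lemma HasDrift.step (hD : HasDrift Pξ u V Q β B) (hN : IsNoiseSequence P Pξ ξ θ₀)
    (hX : IsDriven ξ θ₀ u X) {k : ℕ} (hk : Integrable (fun ω => V (X k ω)) P) :
    Integrable (fun ω => V (X (k + 1) ω)) P ∧ Integrable (fun ω => Q (X k ω)) P ∧
      ∫ ω, V (X (k + 1) ω) ∂P + ∫ ω, Q (X k ω) ∂P ≤ (1 - β) * ∫ ω, V (X k ω) ∂P + B := by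
  have hVu : Measurable fun p : S × Z => V (u p) := hD.measV.comp hX.measurable
  have hle : ∀ s, ∫ z, V (u (s, z)) ∂Pξ ≤ V s + B := fun s => by
    nlinarith [hD.drift s, hD.nonnegQ s, hD.nonnegβ, hD.nonnegV s,
      mul_nonneg hD.nonnegβ (hD.nonnegV s)]
  have hdom : Integrable (fun ω => V (X k ω) + B) P := hk.add (integrable_const B)
  have hmP : Measurable fun s => ∫ z, V (u (s, z)) ∂Pξ :=
    (hVu.stronglyMeasurable.integral_prod_right').measurable
  have h1 : Integrable (fun ω => ∫ z, V (u (X k ω, z)) ∂Pξ) P := by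
    refine hdom.mono' (hmP.comp (hX.meas hN k)).aestronglyMeasurable
      (Filter.Eventually.of_forall fun ω => ?_)
    rw [Real.norm_of_nonneg (integral_nonneg fun z => hD.nonnegV _)]
    exact hle _
  have hi : Integrable (fun ω => V (u (X k ω, ξ (k + 1) ω))) P := by
    refine integrable_noise hN (hX.adapted k) hVu hD.integrable ?_
    simp_rw [Real.norm_of_nonneg (hD.nonnegV _)]
    exact h1
  have hQ : Integrable (fun ω => Q (X k ω)) P := by
    refine hdom.mono' (hD.measQ.comp (hX.meas hN k)).aestronglyMeasurable
      (Filter.Eventually.of_forall fun ω => ?_)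
    rw [Real.norm_of_nonneg (hD.nonnegQ _)]
    nlinarith [hD.drift (X k ω), integral_nonneg (μ := Pξ) (f := fun z => V (u (X k ω, z))) fun z => hD.nonnegV _,
      mul_nonneg hD.nonnegβ (hD.nonnegV (X k ω))]
  have e : (fun ω => V (X (k + 1) ω)) = fun ω => V (u (X k ω, ξ (k + 1) ω)) := by
    funext ω; rw [hX.succ]
  refine ⟨e ▸ hi, hQ, ?_⟩
  rw [e, (integral_noise hN (hX.adapted k) hVu hi).2]
  have hr : Integrable (fun ω => (1 - β) * V (X k ω) - Q (X k ω) + B) P :=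
    ((hk.const_mul _).sub hQ).add (integrable_const B)
  have := integral_mono h1 hr fun ω => hD.drift (X k ω)
  have e2 : ∫ ω, ((1 - β) * V (X k ω) - Q (X k ω) + B) ∂P =
      (1 - β) * ∫ ω, V (X k ω) ∂P - ∫ ω, Q (X k ω) ∂P + B := by
    have h3 := hk.const_mul (1 - β)
    have h4 : Integrable (fun ω => (1 - β) * V (X k ω) - Q (X k ω)) P := h3.sub hQ
    rw [integral_add h4 (integrable_const B), integral_sub h3 hQ, integral_const_mul]
    simp
  linarith

lemma HasDrift.integrable_process (hD : HasDrift Pξ u V Q β B) (hN : IsNoiseSequence P Pξ ξ θ₀)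
    (hX : IsDriven ξ θ₀ u X) (h0 : Integrable (fun ω => V (X 0 ω)) P) (k : ℕ) :
    Integrable (fun ω => V (X k ω)) P := by
  induction k with
  | zero => exact h0
  | succ k ih => exact (hD.step hN hX ih).1

/-- `B / β` is the fixed point of the affine recursion obtained by dropping `Q`. -/
lemma HasDrift.integral_le (hD : HasDrift Pξ u V Q β B) (hN : IsNoiseSequence P Pξ ξ θ₀)
    (hX : IsDriven ξ θ₀ u X) (h0 : Integrable (fun ω => V (X 0 ω)) P) (hβ : 0 < β) (k : ℕ) :
    ∫ ω, V (X k ω) ∂P ≤ (1 - β) ^ k * ∫ ω, V (X 0 ω) ∂P + B / β := by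
  induction k with
  | zero => simpa using div_nonneg hD.nonnegB hβ.le
  | succ k ih =>
    have h := (hD.step hN hX (hD.integrable_process hN hX h0 k)).2.2
    have hQ : 0 ≤ ∫ ω, Q (X k ω) ∂P := integral_nonneg fun ω => hD.nonnegQ _
    have h1 : 0 ≤ 1 - β := by linarith [hD.leβ]
    have h2 := mul_le_mul_of_nonneg_left ih h1
    have h3 : (1 - β) * (B / β) + B = B / β := by field_simp; ring
    rw [pow_succ']
    nlinarith

/-- Telescoping, with the contraction dropped in favour of the dissipation `Q`. The time average of
`Q` obtained in this way is often much smaller than what a pointwise bound by `V` would give. -/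
lemma HasDrift.sum_le (hD : HasDrift Pξ u V Q β B) (hN : IsNoiseSequence P Pξ ξ θ₀)
    (hX : IsDriven ξ θ₀ u X) (h0 : Integrable (fun ω => V (X 0 ω)) P) (m n : ℕ) :
    ∑ k ∈ Finset.range n, ∫ ω, Q (X (m + k) ω) ∂P ≤ ∫ ω, V (X m ω) ∂P + n * B := by
  suffices h : ∑ k ∈ Finset.range n, ∫ ω, Q (X (m + k) ω) ∂P + ∫ ω, V (X (m + n) ω) ∂P ≤
      ∫ ω, V (X m ω) ∂P + n * B by
    linarith [integral_nonneg (μ := P) (f := fun ω => V (X (m + n) ω)) fun ω => hD.nonnegV _]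
  induction n with
  | zero => simp
  | succ n ih =>
    have h := (hD.step hN hX (hD.integrable_process hN hX h0 (m + n))).2.2
    have h2 : 0 ≤ β * ∫ ω, V (X (m + n) ω) ∂P :=
      mul_nonneg hD.nonnegβ (integral_nonneg fun ω => hD.nonnegV _)
    rw [Finset.sum_range_succ, ← add_assoc m n 1]
    push_cast
    nlinarith

lemma HasDrift.integrable_rate (hD : HasDrift Pξ u V Q β B) (hN : IsNoiseSequence P Pξ ξ θ₀)
    (hX : IsDriven ξ θ₀ u X) (h0 : Integrable (fun ω => V (X 0 ω)) P) (k : ℕ) :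
    Integrable (fun ω => Q (X k ω)) P :=
  (hD.step hN hX (hD.integrable_process hN hX h0 k)).2.1

end Drift

end RRSGD

/-! ### Stochastic oracles, second moments and the Markov property -/

namespace RRSGD

/-- A stochastic oracle `G` for the field `D`, with moments `τ₂ ≤ τ₄ ≤ τ₆` at the minimizer and
co-coercive in the mean. -/
structure Oracle {d : ℕ} {Z : Type*} [MeasurableSpace Z] (D : Vec d → Vec d)
    (G : Vec d → Z → Vec d) (Pξ : Measure Z) (L τ₂ τ₄ τ₆ : ℝ) : Prop where
  meas : Measurable (Function.uncurry G)
  memLp : ∀ x, MemLp (G x) 6 Pξ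
  mean : ∀ x, ∫ z, G x z ∂Pξ = D x
  nonneg : 0 ≤ τ₂
  le24 : τ₂ ≤ τ₄
  le46 : τ₄ ≤ τ₆
  m2 : ∫ z, ‖G 0 z‖ ^ 2 ∂Pξ ≤ τ₂ ^ 2
  m4 : ∫ z, ‖G 0 z‖ ^ 4 ∂Pξ ≤ τ₄ ^ 4
  m6 : ∫ z, ‖G 0 z‖ ^ 6 ∂Pξ ≤ τ₆ ^ 6
  coco : ∀ q : ℕ, 2 ≤ q → q ≤ 6 → ∀ x y, ∫ z, ‖G x z - G y z‖ ^ q ∂Pξ ≤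
    L ^ (q - 1) * ‖x - y‖ ^ (q - 2) * inner ℝ (D x - D y) (x - y)

section L2

variable {Ω : Type*} [MeasurableSpace Ω] {P : Measure Ω} {d : ℕ}

lemma integrable_norm_mul_norm {E F : Type*} [NormedAddCommGroup E] [NormedAddCommGroup F]
    {f : Ω → E} {g : Ω → F} (hf : MemLp f 2 P) (hg : MemLp g 2 P) :
    Integrable (fun ω => ‖f ω‖ * ‖g ω‖) P :=
  MemLp.integrable_mul (p := 2) (q := 2) hf.norm hg.norm

lemma integrable_inner {f g : Ω → Vec d} (hf : MemLp f 2 P) (hg : MemLp g 2 P) :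
    Integrable (fun ω => inner ℝ (f ω) (g ω)) P :=
  (integrable_norm_mul_norm hf hg).mono' (hf.1.inner hg.1)
    (Filter.Eventually.of_forall fun _ => norm_inner_le_norm _ _)

lemma integrable_norm_sq {E : Type*} [NormedAddCommGroup E] {f : Ω → E} (hf : MemLp f 2 P) :
    Integrable (fun ω => ‖f ω‖ ^ 2) P :=
  (memLp_two_iff_integrable_sq_norm hf.1).1 hf

/-- Jensen's inequality for the square. -/
lemma sq_integral_le [IsProbabilityMeasure P] {f : Ω → ℝ} (hf : MemLp f 2 P) :
    (∫ ω, f ω ∂P) ^ 2 ≤ ∫ ω, f ω ^ 2 ∂P := by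
  have h1 : Integrable f P := hf.integrable (by norm_num)
  have h2 := hf.integrable_sq
  set m := ∫ ω, f ω ∂P with hm
  have h3 : Integrable (fun ω => 2 * m * f ω) P := h1.const_mul _
  have h4 : Integrable (fun ω => f ω ^ 2 - 2 * m * f ω) P := h2.sub h3
  have h5 : 0 ≤ ∫ ω, (f ω ^ 2 - 2 * m * f ω + m ^ 2) ∂P :=
    integral_nonneg fun ω => by
      change 0 ≤ f ω ^ 2 - 2 * m * f ω + m ^ 2
      nlinarith [sq_nonneg (f ω - m)]
  rw [integral_add h4 (integrable_const _), integral_sub h2 h3, integral_const_mul] at h5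
  simp only [integral_const, probReal_univ, smul_eq_mul, one_mul] at h5
  rw [← hm] at h5
  nlinarith

/-- The Cauchy-Schwarz inequality in the form used for moments. -/
lemma integral_mul_le_sqrt {f g : Ω → ℝ} (hf : MemLp f 2 P) (hg : MemLp g 2 P) :
    ∫ ω, f ω * g ω ∂P ≤ √(∫ ω, f ω ^ 2 ∂P) * √(∫ ω, g ω ^ 2 ∂P) := by
  set a := ∫ ω, f ω ^ 2 ∂P with ha
  set b := ∫ ω, g ω ^ 2 ∂P with hb
  have hfg : Integrable (fun ω => f ω * g ω) P := MemLp.integrable_mul (p := 2) (q := 2) hf hg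
  have ha0 : 0 ≤ a := integral_nonneg fun ω => sq_nonneg _
  have hb0 : 0 ≤ b := integral_nonneg fun ω => sq_nonneg _
  set c := ∫ ω, f ω * g ω ∂P with hc
  have key : ∀ t : ℝ, 0 ≤ a + 2 * t * c + t ^ 2 * b := fun t => by
    have h0 : 0 ≤ ∫ ω, (f ω ^ 2 + 2 * t * (f ω * g ω) + t ^ 2 * g ω ^ 2) ∂P :=
      integral_nonneg fun ω => by
        change 0 ≤ f ω ^ 2 + 2 * t * (f ω * g ω) + t ^ 2 * g ω ^ 2
        nlinarith [sq_nonneg (f ω + t * g ω)]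
    have h1 : Integrable (fun ω => 2 * t * (f ω * g ω)) P := hfg.const_mul _
    have h2 : Integrable (fun ω => f ω ^ 2 + 2 * t * (f ω * g ω)) P := hf.integrable_sq.add h1
    rw [integral_add h2 (hg.integrable_sq.const_mul _), integral_add hf.integrable_sq h1,
      integral_const_mul, integral_const_mul] at h0
    exact h0
  rw [← Real.sqrt_mul ha0]
  refine Real.le_sqrt_of_sq_le ?_
  have := discrim_le_zero (a := b) (b := 2 * c) (c := a) fun t => by nlinarith [key t]
  rw [discrim] at this
  nlinarith

lemma norm_integral_sq_le [IsProbabilityMeasure P] {f : Ω → Vec d} (hf : MemLp f 2 P) :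
    ‖∫ ω, f ω ∂P‖ ^ 2 ≤ ∫ ω, ‖f ω‖ ^ 2 ∂P := by
  refine le_trans ?_ (sq_integral_le hf.norm)
  gcongr
  exact norm_integral_le_integral_norm _

/-- The covariance of two random vectors. -/
lemma integral_inner_centered [IsProbabilityMeasure P] {f g : Ω → Vec d}
    (hf : MemLp f 2 P) (hg : MemLp g 2 P) :
    ∫ ω, inner ℝ (f ω - ∫ ω, f ω ∂P) (g ω - ∫ ω, g ω ∂P) ∂P =
      ∫ ω, inner ℝ (f ω) (g ω) ∂P - inner ℝ (∫ ω, f ω ∂P) (∫ ω, g ω ∂P) := by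
  have hf1 : Integrable f P := hf.integrable (by norm_num)
  have hg1 : Integrable g P := hg.integrable (by norm_num)
  set a := ∫ ω, f ω ∂P
  set b := ∫ ω, g ω ∂P
  have i1 : Integrable (fun ω => inner ℝ (f ω) b) P := hf1.inner_const b
  have i2 : Integrable (fun ω => inner ℝ a (g ω)) P := hg1.const_inner a
  have i0 := integrable_inner hf hg
  have e : ∀ ω, inner ℝ (f ω - a) (g ω - b) =
      inner ℝ (f ω) (g ω) - inner ℝ (f ω) b - inner ℝ a (g ω) + inner ℝ a b := fun ω => by
    rw [inner_sub_left, inner_sub_right, inner_sub_right]; ring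
  simp_rw [e]
  have i3 : Integrable (fun ω => inner ℝ (f ω) (g ω) - inner ℝ (f ω) b) P := i0.sub i1
  have i4 : Integrable (fun ω => inner ℝ (f ω) (g ω) - inner ℝ (f ω) b - inner ℝ a (g ω)) P :=
    i3.sub i2
  rw [integral_add i4 (integrable_const _), integral_sub i3 i2, integral_sub i0 i1,
    integral_inner hg1 a]
  have e2 : ∫ ω, inner ℝ (f ω) b ∂P = inner ℝ a b := by
    simp_rw [real_inner_comm b]
    rw [integral_inner hf1 b, real_inner_comm]
  rw [e2]
  change _ - _ - inner ℝ a b + _ = _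
  simp only [integral_const, probReal_univ, one_smul]
  ring

end L2

section Oracle

variable {d : ℕ} {Z : Type*} [MeasurableSpace Z] {Pξ : Measure Z} [IsProbabilityMeasure Pξ]
  {D : Vec d → Vec d} {G : Vec d → Z → Vec d} {L τ₂ τ₄ τ₆ : ℝ}

lemma Oracle.meas_right (hG : Oracle D G Pξ L τ₂ τ₄ τ₆) (x : Vec d) : Measurable (G x) :=
  hG.meas.comp measurable_prodMk_left

lemma Oracle.memLp_of_le (hG : Oracle D G Pξ L τ₂ τ₄ τ₆) (x : Vec d) {p : ℝ≥0∞} (hp : p ≤ 6) :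
    MemLp (G x) p Pξ := (hG.memLp x).mono_exponent hp

lemma Oracle.integrable (hG : Oracle D G Pξ L τ₂ τ₄ τ₆) (x : Vec d) : Integrable (G x) Pξ :=
  memLp_one_iff_integrable.1 (hG.memLp_of_le x (by norm_num))

/-- All moments up to order six of affine functions of the oracle are integrable. -/
lemma integrable_pow_of_memLp {E : Type*} [NormedAddCommGroup E] {f : Z → E}
    (hf : MemLp f 6 Pξ) {q : ℕ} (hq : q ≤ 6) : Integrable (fun z => ‖f z‖ ^ q) Pξ := by
  have : MemLp f (q : ℝ≥0∞) Pξ := hf.mono_exponent (by exact_mod_cast hq)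
  exact this.integrable_norm_pow'

lemma Oracle.integral_inner (hG : Oracle D G Pξ L τ₂ τ₄ τ₆) (x y : Vec d) :
    ∫ z, inner ℝ (G x z) y ∂Pξ = inner ℝ (D x) y := by
  simp_rw [real_inner_comm y]
  rw [_root_.integral_inner (hG.integrable x) y, hG.mean]

end Oracle

section Markov

variable {d : ℕ} {Z Ω : Type*} [MeasurableSpace Z] [mΩ : MeasurableSpace Ω]
  {P : Measure Ω} [IsProbabilityMeasure P] {Pξ : Measure Z} [IsProbabilityMeasure Pξ]
  {ξ : ℕ → Ω → Z} {θ₀ : Ω → Vec d}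
  {D : Vec d → Vec d} {G : Vec d → Z → Vec d} {L τ₂ τ₄ τ₆ γ : ℝ}

lemma isDriven_sgd (hG : Measurable (Function.uncurry G)) {x₀ : Ω → Vec d}
    (h0 : Measurable[past ξ θ₀ 0] x₀) :
    IsDriven ξ θ₀ (fun p : Vec d × Z => p.1 - γ • G p.1 p.2) (sgd G ξ x₀ γ) :=
  ⟨measurable_fst.sub (hG.const_smul γ), h0, fun _ _ => rfl⟩

lemma IsDriven.pair {S S' : Type*} [MeasurableSpace S] [MeasurableSpace S'] {u : S × Z → S}
    {u' : S' × Z → S'} {X : ℕ → Ω → S} {X' : ℕ → Ω → S'} (h : IsDriven ξ θ₀ u X)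
    (h' : IsDriven ξ θ₀ u' X') :
    IsDriven ξ θ₀ (fun p : (S × S') × Z => (u (p.1.1, p.2), u' (p.1.2, p.2)))
      (fun k ω => (X k ω, X' k ω)) := by
  refine ⟨?_, h.init.prodMk h'.init, fun k ω => by rw [h.succ, h'.succ]⟩
  exact (h.measurable.comp (by fun_prop)).prodMk (h'.measurable.comp (by fun_prop))

/-- The transition operator of constant step size SGD. -/
noncomputable def transition (G : Vec d → Z → Vec d) (Pξ : Measure Z) (γ : ℝ)
    (h : Vec d → Vec d) (x : Vec d) : Vec d := ∫ z, h (x - γ • G x z) ∂Pξ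

/-- Measurable functions of at most linear growth. -/
def LinearGrowth (h : Vec d → Vec d) : Prop :=
  Measurable h ∧ ∃ C, 0 ≤ C ∧ ∀ x, ‖h x‖ ≤ C * (1 + ‖x‖)

/-- Split `G x = (G x - G 0) + G 0`; co-coercivity of order two bounds the first part by `L ⟪D x, x⟫
≤ (L‖x‖) ^ 2`. -/
lemma Oracle.integral_norm_le (hG : Oracle D G Pξ L τ₂ τ₄ τ₆) (hL : 0 ≤ L)
    (hlip : ∀ x, ‖D x‖ ≤ L * ‖x‖) (hD0 : D 0 = 0) (x : Vec d) :
    ∫ z, ‖G x z‖ ^ 2 ∂Pξ ≤ 2 * (L * ‖x‖) ^ 2 + 2 * τ₂ ^ 2 := by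
  have h := hG.coco 2 le_rfl (by norm_num) x 0
  norm_num at h
  rw [hD0, sub_zero] at h
  have h1 : inner ℝ (D x) x ≤ L * ‖x‖ ^ 2 := by
    refine (real_inner_le_norm _ _).trans ?_
    nlinarith [hlip x, norm_nonneg x]
  have i1 := integrable_pow_of_memLp ((hG.memLp x).sub (hG.memLp 0)) (q := 2) (by norm_num)
  have i2 := integrable_pow_of_memLp (hG.memLp 0) (q := 2) (by norm_num)
  have h2 : ∫ z, ‖G x z‖ ^ 2 ∂Pξ ≤ ∫ z, (2 * ‖G x z - G 0 z‖ ^ 2 + 2 * ‖G 0 z‖ ^ 2) ∂Pξ := by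
    refine integral_mono (integrable_pow_of_memLp (hG.memLp x) (by norm_num))
      ((i1.const_mul 2).add (i2.const_mul 2)) fun z => ?_
    have := norm_add_le (G x z - G 0 z) (G 0 z)
    rw [sub_add_cancel] at this
    change ‖G x z‖ ^ 2 ≤ 2 * ‖G x z - G 0 z‖ ^ 2 + 2 * ‖G 0 z‖ ^ 2
    nlinarith [norm_nonneg (G x z), sq_nonneg (‖G x z - G 0 z‖ - ‖G 0 z‖)]
  have i1' : Integrable (fun z => 2 * ‖G x z - G 0 z‖ ^ 2) Pξ := i1.const_mul 2
  rw [integral_add i1' (i2.const_mul 2), integral_const_mul, integral_const_mul] at h2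
  have := hG.m2
  have h3 : L * inner ℝ (D x) x ≤ L * (L * ‖x‖ ^ 2) := by gcongr
  nlinarith

lemma LinearGrowth.integrable_step {h : Vec d → Vec d} (hh : LinearGrowth h)
    (hG : Oracle D G Pξ L τ₂ τ₄ τ₆) (x : Vec d) :
    Integrable (fun z => h (x - γ • G x z)) Pξ := by
  obtain ⟨hm, C, hC, hb⟩ := hh
  have i : Integrable (fun z => C * (1 + ‖x - γ • G x z‖)) Pξ :=
    (((integrable_const 1).add
      ((integrable_const x).sub ((hG.integrable x).smul γ)).norm)).const_mul C
  exact i.mono' (hm.comp (measurable_const.sub ((hG.meas_right x).const_smul γ))).aestronglyMeasurable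
    (Filter.Eventually.of_forall fun z => hb _)

lemma LinearGrowth.transition {h : Vec d → Vec d} (hh : LinearGrowth h)
    (hG : Oracle D G Pξ L τ₂ τ₄ τ₆) (hL : 0 ≤ L) (hlip : ∀ x, ‖D x‖ ≤ L * ‖x‖) (hD0 : D 0 = 0) :
    LinearGrowth (transition G Pξ γ h) := by
  have hi := fun x => hh.integrable_step (γ := γ) hG x
  obtain ⟨hm, C, hC, hb⟩ := hh
  have hu : Measurable fun p : Vec d × Z => h (p.1 - γ • G p.1 p.2) :=
    hm.comp (measurable_fst.sub (hG.meas.const_smul γ))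
  refine ⟨(hu.stronglyMeasurable.integral_prod_right').measurable,
    C * (1 + |γ| * (1 + 2 * L + 2 * τ₂)), ?_, fun x => ?_⟩
  · have := hG.nonneg
    positivity
  -- Jensen's inequality turns the quadratic bound on the second moment into a linear one on the
  -- first, which is why linear growth is preserved.
  have hn : ∫ z, ‖G x z‖ ∂Pξ ≤ 2 * (L * ‖x‖) + 2 * τ₂ := by
    have h1 := sq_integral_le (hG.memLp_of_le x (p := 2) (by norm_num)).norm
    have h2 := hG.integral_norm_le hL hlip hD0 x
    have := hG.nonneg
    refine abs_le_of_sq_le_sq' ?_ (by positivity) |>.2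
    have : 0 ≤ L * ‖x‖ * τ₂ := by positivity
    nlinarith [sq_nonneg (L * ‖x‖), sq_nonneg τ₂]
  calc ‖∫ z, h (x - γ • G x z) ∂Pξ‖ ≤ ∫ z, ‖h (x - γ • G x z)‖ ∂Pξ :=
        norm_integral_le_integral_norm _
    _ ≤ ∫ z, (C * (1 + ‖x‖) + C * |γ| * ‖G x z‖) ∂Pξ := by
        refine integral_mono (hi x).norm
          ((integrable_const _).add ((hG.integrable x).norm.const_mul _)) fun z => ?_
        refine (hb _).trans ?_
        have : ‖x - γ • G x z‖ ≤ ‖x‖ + |γ| * ‖G x z‖ := by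
          refine (norm_sub_le _ _).trans ?_
          rw [norm_smul, Real.norm_eq_abs]
        change _ ≤ C * (1 + ‖x‖) + C * |γ| * ‖G x z‖
        nlinarith
    _ = C * (1 + ‖x‖) + C * |γ| * ∫ z, ‖G x z‖ ∂Pξ := by
        rw [integral_add (integrable_const _) ((hG.integrable x).norm.const_mul _)]
        simp only [integral_const, probReal_univ, one_smul, integral_const_mul]
    _ ≤ C * (1 + ‖x‖) + C * |γ| * (2 * (L * ‖x‖) + 2 * τ₂) := by gcongr
    _ ≤ _ := by
        have h1 : 0 ≤ C * |γ| := by positivity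
        have h2 := norm_nonneg x
        have h3 := hG.nonneg
        have h4 : 0 ≤ C * |γ| * (1 + ‖x‖ + 2 * L + 2 * τ₂ * ‖x‖) := by positivity
        nlinarith

lemma LinearGrowth.iterate {h : Vec d → Vec d} (hh : LinearGrowth h)
    (hG : Oracle D G Pξ L τ₂ τ₄ τ₆) (hL : 0 ≤ L) (hlip : ∀ x, ‖D x‖ ≤ L * ‖x‖) (hD0 : D 0 = 0)
    (l : ℕ) : LinearGrowth ((RRSGD.transition G Pξ γ)^[l] h) := by
  induction l with
  | zero => exact hh
  | succ l ih =>
    rw [Function.iterate_succ_apply']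
    exact ih.transition hG hL hlip hD0

lemma LinearGrowth.memLp {h : Vec d → Vec d} (hh : LinearGrowth h) {X : Ω → Vec d}
    (hX : MemLp X 2 P) (hXm : Measurable X) : MemLp (fun ω => h (X ω)) 2 P := by
  obtain ⟨hm, C, hC, hb⟩ := hh
  have h1 : MemLp (fun ω => 1 + ‖X ω‖) 2 P := (memLp_const (1 : ℝ)).add hX.norm
  have : MemLp (fun ω => C * (1 + ‖X ω‖)) 2 P := h1.const_mul C
  have hm2 : AEStronglyMeasurable (fun ω => h (X ω)) P := (hm.comp hXm).aestronglyMeasurable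
  refine MemLp.mono this hm2 (Filter.Eventually.of_forall fun ω => ?_)
  exact (hb _).trans (le_abs_self _)

/-- The Markov property, tested against a function of the past. -/
lemma integral_inner_transition (hN : IsNoiseSequence P Pξ ξ θ₀) (hG : Oracle D G Pξ L τ₂ τ₄ τ₆)
    {k : ℕ} {X A : Ω → Vec d} (hX : Measurable[past ξ θ₀ k] X) (hA : Measurable[past ξ θ₀ k] A)
    (hA2 : MemLp A 2 P) {φ : Vec d → Vec d} (hφ : LinearGrowth φ)
    (hX2 : MemLp (fun ω => X ω - γ • G (X ω) (ξ (k + 1) ω)) 2 P) :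
    ∫ ω, inner ℝ (A ω) (φ (X ω - γ • G (X ω) (ξ (k + 1) ω))) ∂P =
      ∫ ω, inner ℝ (A ω) (transition G Pξ γ φ (X ω)) ∂P := by
  set F : (Vec d × Vec d) × Z → ℝ := fun p => inner ℝ p.1.1 (φ (p.1.2 - γ • G p.1.2 p.2))
  have hXm : Measurable X := hX.mono (past_le hN k) le_rfl
  have hF : Measurable F := by
    have h1 : Measurable fun p : (Vec d × Vec d) × Z => φ (p.1.2 - γ • G p.1.2 p.2) :=
      hφ.1.comp ((measurable_snd.comp measurable_fst).sub
        ((hG.meas.comp (f := fun p : (Vec d × Vec d) × Z => (p.1.2, p.2))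
          (by fun_prop)).const_smul γ))
    exact (measurable_fst.comp measurable_fst).inner h1
  have hm2 : Measurable fun ω => X ω - γ • G (X ω) (ξ (k + 1) ω) :=
    hXm.sub ((hG.meas.comp (hXm.prodMk (hN.measurable (k + 1)))).const_smul γ)
  have hi : Integrable (fun ω => F ((A ω, X ω), ξ (k + 1) ω)) P :=
    integrable_inner hA2 (hφ.memLp hX2 hm2)
  have := (integral_noise hN (hA.prodMk hX) hF hi).2
  refine this.trans ?_
  congr 1
  funext ω
  exact _root_.integral_inner (hφ.integrable_step hG (X ω)) (A ω)

/-- The Markov property in expectation. -/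
lemma integral_transition (hN : IsNoiseSequence P Pξ ξ θ₀) (hG : Oracle D G Pξ L τ₂ τ₄ τ₆)
    {k : ℕ} {X : Ω → Vec d} (hX : Measurable[past ξ θ₀ k] X)
    {φ : Vec d → Vec d} (hφ : LinearGrowth φ)
    (hX2 : MemLp (fun ω => X ω - γ • G (X ω) (ξ (k + 1) ω)) 2 P) :
    ∫ ω, φ (X ω - γ • G (X ω) (ξ (k + 1) ω)) ∂P =
      ∫ ω, transition G Pξ γ φ (X ω) ∂P := by
  have hXm : Measurable X := hX.mono (past_le hN k) le_rfl
  have hm2 : Measurable fun ω => X ω - γ • G (X ω) (ξ (k + 1) ω) :=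
    hXm.sub ((hG.meas.comp (hXm.prodMk (hN.measurable (k + 1)))).const_smul γ)
  exact (integral_noise hN hX (F := fun p : Vec d × Z => φ (p.1 - γ • G p.1 p.2))
    (hφ.1.comp (measurable_fst.sub (hG.meas.const_smul γ)))
    ((hφ.memLp hX2 hm2).integrable (by norm_num))).2

section Iterates

variable {x₀ : Ω → Vec d}

/-- The last step of the chain is removed first; this changes the test function, over which the
induction is therefore generalized. -/
lemma integral_inner_iterate (hL : 0 ≤ L) (hlip : ∀ x, ‖D x‖ ≤ L * ‖x‖) (hD0 : D 0 = 0)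
    (hN : IsNoiseSequence P Pξ ξ θ₀) (hG : Oracle D G Pξ L τ₂ τ₄ τ₆)
    (h0 : Measurable[past ξ θ₀ 0] x₀) (h2 : ∀ k, MemLp (sgd G ξ x₀ γ k) 2 P)
    {k : ℕ} {A : Ω → Vec d} (hA : Measurable[past ξ θ₀ k] A) (hA2 : MemLp A 2 P) (l : ℕ)
    {φ : Vec d → Vec d} (hφ : LinearGrowth φ) :
    ∫ ω, inner ℝ (A ω) (φ (sgd G ξ x₀ γ (k + l) ω)) ∂P =
      ∫ ω, inner ℝ (A ω) ((transition G Pξ γ)^[l] φ (sgd G ξ x₀ γ k ω)) ∂P := by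
  induction l generalizing φ with
  | zero => rfl
  | succ l ih =>
    rw [Function.iterate_succ_apply, ← ih (hφ.transition hG hL hlip hD0)]
    exact integral_inner_transition hN hG ((isDriven_sgd hG.meas h0).adapted (k + l))
      (hA.mono (past_mono (Nat.le_add_right k l)) le_rfl) hA2 hφ (h2 (k + l + 1))

lemma integral_iterate (hL : 0 ≤ L) (hlip : ∀ x, ‖D x‖ ≤ L * ‖x‖) (hD0 : D 0 = 0)
    (hN : IsNoiseSequence P Pξ ξ θ₀) (hG : Oracle D G Pξ L τ₂ τ₄ τ₆)
    (h0 : Measurable[past ξ θ₀ 0] x₀) (h2 : ∀ k, MemLp (sgd G ξ x₀ γ k) 2 P) (k l : ℕ)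
    {φ : Vec d → Vec d} (hφ : LinearGrowth φ) :
    ∫ ω, φ (sgd G ξ x₀ γ (k + l) ω) ∂P =
      ∫ ω, (transition G Pξ γ)^[l] φ (sgd G ξ x₀ γ k ω) ∂P := by
  induction l generalizing φ with
  | zero => rfl
  | succ l ih =>
    rw [Function.iterate_succ_apply, ← ih (hφ.transition hG hL hlip hD0)]
    exact integral_transition hN hG ((isDriven_sgd hG.meas h0).adapted (k + l))
      hφ (h2 (k + l + 1))

/-- The variance of a sum along the chain, in terms of the oscillation of the conditional
expectations of the summands. -/
lemma variance_sum_le (hL : 0 ≤ L) (hlip : ∀ x, ‖D x‖ ≤ L * ‖x‖) (hD0 : D 0 = 0)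
    (hN : IsNoiseSequence P Pξ ξ θ₀) (hG : Oracle D G Pξ L τ₂ τ₄ τ₆)
    (h0 : Measurable[past ξ θ₀ 0] x₀) (h2 : ∀ k, MemLp (sgd G ξ x₀ γ k) 2 P)
    {h : Vec d → Vec d} (hh : LinearGrowth h) {U : Vec d → ℝ} (hU : Measurable U)
    (hosc : ∀ m x, ∑ l ∈ Finset.range m,
      ‖(transition G Pξ γ)^[l] h x - (transition G Pξ γ)^[l] h 0‖ ≤ U x)
    (hU2 : ∀ k, Integrable (fun ω => U (sgd G ξ x₀ γ k ω) ^ 2) P) {c : ℝ} (hc : 0 < c)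
    (a n : ℕ) :
    ∫ ω, ‖∑ k ∈ Finset.range n, (h (sgd G ξ x₀ γ (a + k) ω) -
        ∫ ω, h (sgd G ξ x₀ γ (a + k) ω) ∂P)‖ ^ 2 ∂P ≤
      ∑ k ∈ Finset.range n, (2 * c * ∫ ω, ‖h (sgd G ξ x₀ γ (a + k) ω)‖ ^ 2 ∂P +
        2 / c * ∫ ω, U (sgd G ξ x₀ γ (a + k) ω) ^ 2 ∂P) := by
  set X := sgd G ξ x₀ γ with hXdef
  have hdr := isDriven_sgd (ξ := ξ) (θ₀ := θ₀) (γ := γ) hG.meas h0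
  have hXm : ∀ k, Measurable (X k) := hdr.meas hN
  have hhX : ∀ k, MemLp (fun ω => h (X k ω)) 2 P := fun k => hh.memLp (h2 k) (hXm k)
  have hV : ∀ k, MemLp (fun ω => h (X k ω) - ∫ ω, h (X k ω) ∂P) 2 P := fun k =>
    (hhX k).sub (memLp_const _)
  have hU0 : ∀ x, 0 ≤ U x := fun x => by simpa using hosc 0 x
  have hUL : ∀ k, MemLp (fun ω => U (X k ω)) 2 P := fun k =>
    (memLp_two_iff_integrable_sq (hU.comp (hXm k)).aestronglyMeasurable).2 (hU2 k)
  have hS : ∀ a n, MemLp (fun ω => ∑ k ∈ Finset.range n,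
      (h (X (a + k) ω) - ∫ ω, h (X (a + k) ω) ∂P)) 2 P := fun a n =>
    memLp_finsetSum _ fun k _ => hV (a + k)
  -- Conditional expectations recentred by their value at `0`. Constants do not affect covariances,
  -- and `ψ l` is what the oscillation hypothesis controls.
  set ψ : ℕ → Vec d → Vec d := fun l x =>
    (transition G Pξ γ)^[l] h x - (transition G Pξ γ)^[l] h 0 with hψ
  have hψg : ∀ l, LinearGrowth (ψ l) := fun l => by
    obtain ⟨hm, C, hC, hb⟩ := hh.iterate (γ := γ) hG hL hlip hD0 l
    refine ⟨hm.sub_const _, 2 * C, by positivity, fun x => ?_⟩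
    have h1 := hb 0
    rw [norm_zero] at h1
    have h2 : 0 ≤ C * ‖x‖ := by positivity
    linarith [norm_sub_le ((transition G Pξ γ)^[l] h x) ((transition G Pξ γ)^[l] h 0), hb x]
  have hψL : ∀ l k, MemLp (fun ω => ψ l (X k ω)) 2 P := fun l k => (hψg l).memLp (h2 k) (hXm k)
  -- By the Markov property, the covariance of `h (X a)` and `h (X (a + l))` is that of `h (X a)`
  -- and `ψ l (X a)`.
  have hcov : ∀ a l, ∫ ω, inner ℝ (h (X a ω) - ∫ ω, h (X a ω) ∂P)
      (h (X (a + l) ω) - ∫ ω, h (X (a + l) ω) ∂P) ∂P ≤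
      ∫ ω, ‖h (X a ω)‖ * ‖ψ l (X a ω)‖ ∂P +
        (∫ ω, ‖h (X a ω)‖ ∂P) * ∫ ω, ‖ψ l (X a ω)‖ ∂P := fun a l => by
    rw [integral_inner_centered (hhX a) (hhX (a + l)),
      integral_inner_iterate hL hlip hD0 hN hG h0 h2 (A := fun ω => h (X a ω))
        (hh.1.comp (hdr.adapted a)) (hhX a) l hh,
      integral_iterate hL hlip hD0 hN hG h0 h2 a l hh]
    have hPl : MemLp (fun ω => (transition G Pξ γ)^[l] h (X a ω)) 2 P :=
      (hh.iterate hG hL hlip hD0 l).memLp (h2 a) (hXm a)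
    rw [← integral_inner_centered (hhX a) hPl]
    have e1 : (∫ ω, ψ l (X a ω) ∂P) = (∫ ω, (transition G Pξ γ)^[l] h (X a ω) ∂P) -
        (transition G Pξ γ)^[l] h 0 := by
      simp only [hψ]
      rw [integral_sub (hPl.integrable (by norm_num)) (integrable_const _)]
      simp
    have e2 : ∀ ω, (transition G Pξ γ)^[l] h (X a ω) -
        (∫ ω, (transition G Pξ γ)^[l] h (X a ω) ∂P) =
        ψ l (X a ω) - ∫ ω, ψ l (X a ω) ∂P := fun ω => by
      rw [e1]; simp only [hψ]; abel
    simp_rw [e2]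
    rw [integral_inner_centered (hhX a) (hψL l a)]
    have b1 : ∫ ω, inner ℝ (h (X a ω)) (ψ l (X a ω)) ∂P ≤
        ∫ ω, ‖h (X a ω)‖ * ‖ψ l (X a ω)‖ ∂P :=
      integral_mono (integrable_inner (hhX a) (hψL l a))
        (integrable_norm_mul_norm (hhX a) (hψL l a)) fun ω => real_inner_le_norm _ _
    have b2 : -inner ℝ (∫ ω, h (X a ω) ∂P) (∫ ω, ψ l (X a ω) ∂P) ≤
        (∫ ω, ‖h (X a ω)‖ ∂P) * ∫ ω, ‖ψ l (X a ω)‖ ∂P := by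
      refine (neg_le_abs _).trans ((abs_real_inner_le_norm _ _).trans ?_)
      gcongr <;> exact norm_integral_le_integral_norm _
    linarith
  -- Sum the covariances over the lag, diagonal included, bound the total oscillation by `U`, and
  -- apply Young's inequality with weight `c`.
  have hrow : ∀ a n, ∫ ω, inner ℝ (h (X a ω) - ∫ ω, h (X a ω) ∂P)
      (∑ l ∈ Finset.range n, (h (X (a + l) ω) - ∫ ω, h (X (a + l) ω) ∂P)) ∂P ≤
      c * ∫ ω, ‖h (X a ω)‖ ^ 2 ∂P + 1 / c * ∫ ω, U (X a ω) ^ 2 ∂P := fun a n => by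
    simp_rw [inner_sum]
    rw [integral_finsetSum _ fun l _ => integrable_inner (hV a) (hV (a + l))]
    refine (Finset.sum_le_sum fun l _ => hcov a l).trans ?_
    rw [Finset.sum_add_distrib, ← Finset.mul_sum,
      ← integral_finsetSum _ fun l _ => integrable_norm_mul_norm (hhX a) (hψL l a),
      ← integral_finsetSum _ fun l _ => ((hψL l a).integrable (by norm_num)).norm]
    simp_rw [← Finset.mul_sum]
    have iU := (hUL a).integrable (by norm_num)
    have iψ : Integrable (fun ω => ∑ l ∈ Finset.range n, ‖ψ l (X a ω)‖) P :=
      integrable_finsetSum _ fun l _ => ((hψL l a).integrable (by norm_num)).norm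
    have ihψ : Integrable (fun ω => ‖h (X a ω)‖ * ∑ l ∈ Finset.range n, ‖ψ l (X a ω)‖) P := by
      simp_rw [Finset.mul_sum]
      exact integrable_finsetSum _ fun l _ => integrable_norm_mul_norm (hhX a) (hψL l a)
    have ihU : Integrable (fun ω => ‖h (X a ω)‖ * U (X a ω)) P :=
      MemLp.integrable_mul (p := 2) (q := 2) (hhX a).norm (hUL a)
    have b1 : ∫ ω, ‖h (X a ω)‖ * ∑ l ∈ Finset.range n, ‖ψ l (X a ω)‖ ∂P ≤
        ∫ ω, ‖h (X a ω)‖ * U (X a ω) ∂P := integral_mono ihψ ihU fun ω =>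
      mul_le_mul_of_nonneg_left (hosc n _) (norm_nonneg _)
    have b2 : ∫ ω, ∑ l ∈ Finset.range n, ‖ψ l (X a ω)‖ ∂P ≤ ∫ ω, U (X a ω) ∂P :=
      integral_mono iψ iU fun ω => hosc n _
    set x := ∫ ω, ‖h (X a ω)‖ ∂P with hx
    set y := ∫ ω, U (X a ω) ∂P with hy
    set p := ∫ ω, ‖h (X a ω)‖ ^ 2 ∂P with hp
    set q := ∫ ω, U (X a ω) ^ 2 ∂P with hq
    have hx2 : x ^ 2 ≤ p := sq_integral_le (hhX a).norm
    have hy2 : y ^ 2 ≤ q := sq_integral_le (hUL a)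
    have hx0 : 0 ≤ x := integral_nonneg fun ω => norm_nonneg _
    have young : ∀ s t : ℝ, s * t ≤ c / 2 * s ^ 2 + 1 / (2 * c) * t ^ 2 := fun s t => by
      have : c / 2 * s ^ 2 + 1 / (2 * c) * t ^ 2 - s * t = 1 / (2 * c) * (c * s - t) ^ 2 := by
        field_simp; ring
      have h3 : 0 ≤ 1 / (2 * c) * (c * s - t) ^ 2 := by positivity
      linarith
    have b3 : ∫ ω, ‖h (X a ω)‖ * U (X a ω) ∂P ≤ c / 2 * p + 1 / (2 * c) * q := by
      have i1 := (integrable_norm_sq (hhX a)).const_mul (c / 2)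
      have i2 := (hU2 a).const_mul (1 / (2 * c))
      have := integral_mono ihU (i1.add i2) fun ω => young ‖h (X a ω)‖ (U (X a ω))
      refine this.trans (le_of_eq ?_)
      rw [integral_add' i1 i2, integral_const_mul, integral_const_mul]
    have b4 : x * y ≤ c / 2 * p + 1 / (2 * c) * q :=
      (young x y).trans (by gcongr)
    have b5 := mul_le_mul_of_nonneg_left b2 hx0
    have e : 1 / (2 * c) * q + 1 / (2 * c) * q = 1 / c * q := by field_simp; ring
    linarith
  induction n generalizing a with
  | zero => simp
  | succ n ih =>
    have e : ∀ ω, ∑ k ∈ Finset.range (n + 1), (h (X (a + k) ω) - ∫ ω, h (X (a + k) ω) ∂P) =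
        (∑ k ∈ Finset.range n, (h (X (a + 1 + k) ω) - ∫ ω, h (X (a + 1 + k) ω) ∂P)) +
          (h (X a ω) - ∫ ω, h (X a ω) ∂P) := fun ω => by
      rw [Finset.sum_range_succ']
      simp only [add_zero, add_assoc, add_comm 1]
    -- With `v` the first term and `S` the rest, `‖S + v‖² = 2⟪v, S + v⟫ + ‖S‖² - ‖v‖²`; the last
    -- square is discarded.
    have b1 : ∫ ω, ‖∑ k ∈ Finset.range (n + 1),
        (h (X (a + k) ω) - ∫ ω, h (X (a + k) ω) ∂P)‖ ^ 2 ∂P ≤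
        ∫ ω, (2 * inner ℝ (h (X a ω) - ∫ ω, h (X a ω) ∂P)
          (∑ k ∈ Finset.range (n + 1), (h (X (a + k) ω) - ∫ ω, h (X (a + k) ω) ∂P)) +
        ‖∑ k ∈ Finset.range n, (h (X (a + 1 + k) ω) - ∫ ω, h (X (a + 1 + k) ω) ∂P)‖ ^ 2) ∂P := by
      refine integral_mono (integrable_norm_sq (hS a (n + 1)))
        (((integrable_inner (hV a) (hS a (n + 1))).const_mul 2).add
          (integrable_norm_sq (hS (a + 1) n))) fun ω => ?_
      simp only [e]
      rw [norm_add_sq_real, inner_add_right, real_inner_self_eq_norm_sq,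
        real_inner_comm (h (X a ω) - ∫ ω, h (X a ω) ∂P)]
      nlinarith [sq_nonneg ‖h (X a ω) - ∫ ω, h (X a ω) ∂P‖]
    refine b1.trans ?_
    rw [integral_add ((integrable_inner (hV a) (hS a (n + 1))).const_mul 2)
      (integrable_norm_sq (hS (a + 1) n)), integral_const_mul, Finset.sum_range_succ']
    have b2 := hrow a (n + 1)
    have b3 := ih (a + 1)
    simp only [add_zero, add_assoc, add_comm 1] at b3 ⊢
    have e3 : 2 / c * ∫ ω, U (X a ω) ^ 2 ∂P = 2 * (1 / c * ∫ ω, U (X a ω) ^ 2 ∂P) := by ring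
    linarith

end Iterates

end Markov

end RRSGD

/-! ### Inequalities between the field, its Hessian and its third derivative -/

namespace RRSGD

section Field

variable {d : ℕ} {D : Vec d → Vec d} {H : Vec d →L[ℝ] Vec d}
  {T : Vec d →L[ℝ] Vec d →L[ℝ] Vec d} {μ L : ℝ}

lemma RegularField.posL (hR : RegularField D H T μ L) : 0 < L := hR.pos.trans_le hR.le

lemma RegularField.continuous (hR : RegularField D H T μ L) : Continuous D :=
  (LipschitzWith.of_dist_le_mul (K := ⟨L, hR.posL.le⟩) fun x y => by
    rw [dist_eq_norm, dist_eq_norm]; exact hR.lip x y).continuous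

lemma RegularField.norm_le (hR : RegularField D H T μ L) (x : Vec d) : ‖D x‖ ≤ L * ‖x‖ := by
  simpa [hR.zero] using hR.lip x 0

lemma RegularField.inner_ge (hR : RegularField D H T μ L) (x : Vec d) :
    μ * ‖x‖ ^ 2 ≤ inner ℝ (D x) x := by
  simpa [hR.zero] using hR.mono x 0

lemma RegularField.inner_nonneg (hR : RegularField D H T μ L) (x : Vec d) :
    0 ≤ inner ℝ (D x) x :=
  (mul_nonneg hR.pos.le (sq_nonneg _)).trans (hR.inner_ge x)

lemma RegularField.inner_le (hR : RegularField D H T μ L) (x : Vec d) :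
    inner ℝ (D x) x ≤ L * ‖x‖ ^ 2 := by
  refine (real_inner_le_norm _ _).trans ?_
  nlinarith [hR.norm_le x, norm_nonneg x]

lemma RegularField.norm_rem_le (hR : RegularField D H T μ L) (x : Vec d) :
    ‖D x - H x‖ ≤ L * ‖x‖ ^ 2 := by
  have := hR.rem_lip x 0
  simp only [hR.zero, map_zero, sub_zero, norm_zero, add_zero] at this
  nlinarith

lemma RegularField.hessian_nonneg (hR : RegularField D H T μ L) (v : Vec d) :
    0 ≤ inner ℝ (H v) v :=
  (mul_nonneg hR.pos.le (sq_nonneg _)).trans (hR.hlower v)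

lemma RegularField.hessian_le (hR : RegularField D H T μ L) (v : Vec d) :
    inner ℝ (H v) v ≤ L * ‖v‖ ^ 2 := by
  refine (real_inner_le_norm _ _).trans ?_
  nlinarith [hR.hnorm v, norm_nonneg v]

/-- A symmetric positive operator bounded by `L` satisfies `H² ≤ L H`. -/
lemma RegularField.norm_hessian_sq_le (hR : RegularField D H T μ L) (v : Vec d) :
    ‖H v‖ ^ 2 ≤ L * inner ℝ (H v) v := by
  set w := H v with hw
  have h1 : inner ℝ (H w) v = ‖w‖ ^ 2 := by
    rw [hR.hsymm, ← hw, real_inner_self_eq_norm_sq]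
  -- Nonnegativity of the Hessian form at `v - t H v`; it is used below with `t = 1 / L`.
  have key : ∀ t : ℝ, 0 ≤ inner ℝ w v - 2 * t * ‖w‖ ^ 2 + t ^ 2 * (L * ‖w‖ ^ 2) := fun t => by
    have h := hR.hessian_nonneg (v - t • w)
    rw [map_sub, map_smul, inner_sub_left, inner_sub_right, inner_sub_right, inner_smul_left,
      inner_smul_right, inner_smul_left, inner_smul_right, h1, ← hw,
      real_inner_self_eq_norm_sq] at h
    simp only [conj_trivial] at h
    nlinarith [hR.hessian_le w, sq_nonneg t]
  have hL := hR.posL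
  have h2 := key (1 / L)
  have h3 : inner ℝ w v - 2 * (1 / L) * ‖w‖ ^ 2 + (1 / L) ^ 2 * (L * ‖w‖ ^ 2) =
      (L * inner ℝ w v - ‖w‖ ^ 2) / L := by field_simp; ring
  rw [h3] at h2
  have := mul_nonneg h2 hL.le
  rw [div_mul_cancel₀ _ hL.ne'] at this
  linarith

/-- The polarized form of the comparison between the third derivative and the Hessian. -/
lemma RegularField.abs_third_le (hR : RegularField D H T μ L) (e v : Vec d) {t : ℝ} (ht : 0 < t) :
    |inner ℝ (T e v) v| ≤ inner ℝ (H v) v / t + L * t * ‖e‖ ^ 2 * ‖v‖ ^ 2 := by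
  -- The directions `t e` and `-t e` bound the third derivative from both sides; `t` is left free
  -- for later balancing.
  have h1 := hR.psd (t • e) v
  have h2 := hR.psd (-(t • e)) v
  simp only [map_neg, map_smul, neg_apply, smul_apply,
    inner_neg_left, inner_smul_left, conj_trivial, norm_neg, norm_smul, Real.norm_eq_abs,
    abs_of_pos ht] at h1 h2
  have h3 : inner ℝ (H v) v / t + L * t * ‖e‖ ^ 2 * ‖v‖ ^ 2 =
      (inner ℝ (H v) v + L * (t * ‖e‖) ^ 2 * ‖v‖ ^ 2) / t := by field_simp
  rw [h3, le_div_iff₀ ht, ← abs_of_pos ht, ← abs_mul, abs_of_pos ht, abs_le]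
  constructor <;> linarith

/-- Polarization of `abs_third_le` along `√l u ± u' / √l`, with `u' = v`. The bounding expression
`N` is itself a quadratic form and obeys the parallelogram law. -/
lemma RegularField.abs_third_inner_le (hR : RegularField D H T μ L) (e u v : Vec d) {t l : ℝ}
    (ht : 0 < t) (hl : 0 < l) :
    |inner ℝ (T e u) v| ≤
      (l * (inner ℝ (H u) u / t + L * t * ‖e‖ ^ 2 * ‖u‖ ^ 2) +
        (inner ℝ (H v) v / t + L * t * ‖e‖ ^ 2 * ‖v‖ ^ 2) / l) / 2 := by
  have hN : ∀ w, 0 ≤ inner ℝ (H w) w / t + L * t * ‖e‖ ^ 2 * ‖w‖ ^ 2 := fun w =>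
    (abs_nonneg _).trans (hR.abs_third_le e w ht)
  set N : Vec d → ℝ := fun w => inner ℝ (H w) w / t + L * t * ‖e‖ ^ 2 * ‖w‖ ^ 2 with hNdef
  have par : ∀ a b : Vec d, N (a + b) + N (a - b) = 2 * N a + 2 * N b := fun a b => by
    have h1 := parallelogram_law_with_norm ℝ a b
    simp only [hNdef, map_add, map_sub, inner_add_left, inner_add_right, inner_sub_left,
      inner_sub_right]
    have : ‖a + b‖ ^ 2 + ‖a - b‖ ^ 2 = 2 * (‖a‖ ^ 2 + ‖b‖ ^ 2) := by nlinarith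
    linear_combination (L * t * ‖e‖ ^ 2) * this
  set m := √l with hm
  have hm0 : 0 < m := Real.sqrt_pos.2 hl
  have hm2 : m ^ 2 = l := Real.sq_sqrt hl.le
  have pol : 4 * inner ℝ (T e u) v =
      inner ℝ (T e (m • u + m⁻¹ • v)) (m • u + m⁻¹ • v) -
        inner ℝ (T e (m • u - m⁻¹ • v)) (m • u - m⁻¹ • v) := by
    have hs : inner ℝ (T e v) u = inner ℝ (T e u) v := by
      rw [hR.tsymm, real_inner_comm]
    simp only [map_add, map_sub, map_smul, inner_add_left, inner_add_right, inner_sub_left,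
      inner_sub_right, inner_smul_left, inner_smul_right, conj_trivial, hs]
    field_simp
    ring
  have h1 := hR.abs_third_le e (m • u + m⁻¹ • v) ht
  have h2 := hR.abs_third_le e (m • u - m⁻¹ • v) ht
  have h3 := par (m • u) (m⁻¹ • v)
  have sc : ∀ (c : ℝ) (w : Vec d), N (c • w) = c ^ 2 * N w := fun c w => by
    simp only [hNdef, map_smul, inner_smul_left, inner_smul_right, conj_trivial, norm_smul,
      mul_pow, Real.norm_eq_abs, sq_abs]
    ring
  rw [sc, sc, inv_pow, hm2] at h3
  change |_| ≤ N _ at h1 h2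
  change |inner ℝ (T e u) v| ≤ (l * N u + N v / l) / 2
  have h4 : |4 * inner ℝ (T e u) v| ≤ 2 * (l * N u) + 2 * (l⁻¹ * N v) := by
    rw [pol, ← h3]
    exact (abs_sub _ _).trans (add_le_add h1 h2)
  rw [abs_mul, abs_of_pos (by norm_num : (0 : ℝ) < 4)] at h4
  rw [div_eq_inv_mul (N v)]
  linarith

/-- Take `e = v = x` and `t = 1` in `abs_third_le`: half of the cubic term of the Taylor expansion
is absorbed by half of the Hessian form. -/
lemma RegularField.hessian_le_quartic (hR : RegularField D H T μ L) (x : Vec d) :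
    inner ℝ (H x) x ≤ 2 * inner ℝ (D x) x + 3 * L * ‖x‖ ^ 4 := by
  have h1 := hR.abs_third_le x x one_pos
  have h2 := hR.taylor x
  have h3 := (abs_real_inner_le_norm (D x - H x - (1 / 2 : ℝ) • T x x) x).trans
    (mul_le_mul_of_nonneg_right h2 (norm_nonneg x))
  rw [inner_sub_left, inner_sub_left, inner_smul_left, conj_trivial] at h3
  have h4 := abs_le.1 h1
  have h5 := abs_le.1 h3
  rw [div_one, mul_one] at h4
  have e : L * ‖x‖ ^ 2 * ‖x‖ ^ 2 = L * ‖x‖ ^ 4 := by ring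
  have e' : L * ‖x‖ ^ 3 * ‖x‖ = L * ‖x‖ ^ 4 := by ring
  rw [e] at h4
  rw [e'] at h5
  linarith [h4.1, h5.1]

/-- Monotonicity along rays bounds the Hessian form by the field. -/
lemma RegularField.hessian_le_field (hR : RegularField D H T μ L) (x : Vec d) :
    inner ℝ (H x) x ≤
      2 * inner ℝ (D x) x + 2 * √(L / μ) * √‖x‖ * inner ℝ (D x) x := by
  set q := inner ℝ (H x) x with hq
  set δ := inner ℝ (D x) x with hδ
  have hL := hR.posL
  have hμ := hR.pos
  have hq0 : 0 ≤ q := hR.hessian_nonneg x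
  have hδ0 : 0 ≤ δ := hR.inner_nonneg x
  -- `⟪D (t x), x⟫` is nondecreasing in `t`, so any point of the ray may be used for a lower bound
  -- on `⟪D x, x⟫`.
  have ray : ∀ t : ℝ, 0 ≤ t → t ≤ 1 → t * q - t ^ 2 * (L * ‖x‖ ^ 3) ≤ δ := fun t ht ht1 => by
    have h1 := hR.mono x (t • x)
    have e1 : x - t • x = (1 - t) • x := by rw [sub_smul, one_smul]
    rw [e1, inner_smul_right, inner_sub_left] at h1
    have h2 : 0 ≤ inner ℝ (D x) x - inner ℝ (D (t • x)) x := by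
      rcases ht1.lt_or_eq with ht1 | rfl
      · exact nonneg_of_mul_nonneg_right ((by positivity : (0 : ℝ) ≤ _).trans h1)
          (by linarith : 0 < 1 - t)
      · simp
    have h3 := (abs_real_inner_le_norm (D (t • x) - H (t • x)) x).trans
      (mul_le_mul_of_nonneg_right (hR.norm_rem_le (t • x)) (norm_nonneg x))
    rw [inner_sub_left, map_smul, inner_smul_left, conj_trivial, norm_smul, Real.norm_eq_abs,
      mul_pow, sq_abs] at h3
    have h4 := (abs_le.1 h3).1
    have e2 : L * (t ^ 2 * ‖x‖ ^ 2) * ‖x‖ = t ^ 2 * (L * ‖x‖ ^ 3) := by ring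
    rw [e2] at h4
    linarith
  have hs : 0 ≤ 2 * √(L / μ) * √‖x‖ * δ := by positivity
  set R := L * ‖x‖ ^ 3 with hRdef
  have hR0 : 0 ≤ R := by positivity
  -- The bound `t q - t² R` is largest at `t = q / (2R)`. If this exceeds `1` the endpoint `t = 1`
  -- suffices; otherwise `q² ≤ 4 R δ`, and `R ≤ (L/μ) ‖x‖ δ` by strong monotonicity.
  rcases le_or_gt (R * 2) q with h | h
  · have := ray 1 (by norm_num) le_rfl
    nlinarith
  · have hR1 : 0 < R := by linarith
    have ht : q / (2 * R) < 1 := by rw [div_lt_one (by positivity)]; linarith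
    have h1 := ray (q / (2 * R)) (by positivity) ht.le
    have e : q / (2 * R) * q - (q / (2 * R)) ^ 2 * R = q ^ 2 / (4 * R) := by field_simp; ring
    rw [e, div_le_iff₀ (by positivity)] at h1
    have h2 : R ≤ L / μ * ‖x‖ * δ := by
      have := hR.inner_ge x
      rw [hRdef, div_mul_eq_mul_div, div_mul_eq_mul_div, le_div_iff₀ hμ]
      have : L * ‖x‖ * (μ * ‖x‖ ^ 2) ≤ L * ‖x‖ * δ := by gcongr
      nlinarith
    have h3 : q ^ 2 ≤ (2 * √(L / μ) * √‖x‖ * δ) ^ 2 := by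
      rw [mul_pow, mul_pow, mul_pow, Real.sq_sqrt (by positivity), Real.sq_sqrt (norm_nonneg _)]
      nlinarith [mul_le_mul_of_nonneg_left h2 hδ0]
    have := abs_le_of_sq_le_sq' h3 hs
    linarith [this.2]

end Field

section Moments

variable {d : ℕ} {Z : Type*} [MeasurableSpace Z] {Pξ : Measure Z} [IsProbabilityMeasure Pξ]
  {D : Vec d → Vec d} {H : Vec d →L[ℝ] Vec d} {T : Vec d →L[ℝ] Vec d →L[ℝ] Vec d}
  {G : Vec d → Z → Vec d} {μ L τ₂ τ₄ τ₆ γ : ℝ}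

/-- Integration of a pointwise one-step bound against the noise. -/
lemma Oracle.step_le (hG : Oracle D G Pξ L τ₂ τ₄ τ₆) (hD0 : D 0 = 0) (x : Vec d) {F : Z → ℝ}
    (hFm : Measurable F) (hF0 : ∀ z, 0 ≤ F z) {c₀ c₁ a₂ a₃ a₄ a₆ b₂ b₄ b₆ : ℝ}
    (ha₂ : 0 ≤ a₂) (ha₃ : 0 ≤ a₃) (ha₄ : 0 ≤ a₄) (ha₆ : 0 ≤ a₆) (hb₂ : 0 ≤ b₂) (hb₄ : 0 ≤ b₄)
    (hb₆ : 0 ≤ b₆)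
    (hF : ∀ z, F z ≤ c₀ - c₁ * inner ℝ (G x z) x + a₂ * ‖G x z - G 0 z‖ ^ 2 +
      a₃ * ‖G x z - G 0 z‖ ^ 3 + a₄ * ‖G x z - G 0 z‖ ^ 4 + a₆ * ‖G x z - G 0 z‖ ^ 6 +
      b₂ * ‖G 0 z‖ ^ 2 + b₄ * ‖G 0 z‖ ^ 4 + b₆ * ‖G 0 z‖ ^ 6) :
    Integrable F Pξ ∧ ∫ z, F z ∂Pξ ≤ c₀ - c₁ * inner ℝ (D x) x +
      (a₂ * L + a₃ * (L ^ 2 * ‖x‖) + a₄ * (L ^ 3 * ‖x‖ ^ 2) + a₆ * (L ^ 5 * ‖x‖ ^ 4)) *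
        inner ℝ (D x) x + b₂ * τ₂ ^ 2 + b₄ * τ₄ ^ 4 + b₆ * τ₆ ^ 6 := by
  have iG : Integrable (fun z => inner ℝ (G x z) x) Pξ := (hG.integrable x).inner_const x
  have ip : ∀ q ≤ 6, Integrable (fun z => ‖G x z - G 0 z‖ ^ q) Pξ := fun q hq =>
    integrable_pow_of_memLp ((hG.memLp x).sub (hG.memLp 0)) hq
  have ib : ∀ q ≤ 6, Integrable (fun z => ‖G 0 z‖ ^ q) Pξ := fun q hq =>
    integrable_pow_of_memLp (hG.memLp 0) hq
  have j1 : Integrable (fun z => c₀ - c₁ * inner ℝ (G x z) x) Pξ :=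
    (integrable_const c₀).sub (iG.const_mul c₁)
  have j2 := j1.add ((ip 2 (by norm_num)).const_mul a₂)
  have j3 := j2.add ((ip 3 (by norm_num)).const_mul a₃)
  have j4 := j3.add ((ip 4 (by norm_num)).const_mul a₄)
  have j5 := j4.add ((ip 6 (by norm_num)).const_mul a₆)
  have j6 := j5.add ((ib 2 (by norm_num)).const_mul b₂)
  have j7 := j6.add ((ib 4 (by norm_num)).const_mul b₄)
  have j8 := j7.add ((ib 6 (by norm_num)).const_mul b₆)
  have hint : Integrable F Pξ := j8.mono' hFm.aestronglyMeasurable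
    (Filter.Eventually.of_forall fun z => by
      rw [Real.norm_of_nonneg (hF0 z)]; exact hF z)
  refine ⟨hint, (integral_mono hint j8 hF).trans ?_⟩
  rw [integral_add' j7 ((ib 6 (by norm_num)).const_mul b₆),
    integral_add' j6 ((ib 4 (by norm_num)).const_mul b₄),
    integral_add' j5 ((ib 2 (by norm_num)).const_mul b₂),
    integral_add' j4 ((ip 6 (by norm_num)).const_mul a₆),
    integral_add' j3 ((ip 4 (by norm_num)).const_mul a₄),
    integral_add' j2 ((ip 3 (by norm_num)).const_mul a₃),
    integral_add' j1 ((ip 2 (by norm_num)).const_mul a₂),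
    integral_sub (integrable_const c₀) (iG.const_mul c₁)]
  simp only [integral_const_mul, hG.integral_inner, integral_const, probReal_univ, one_smul]
  have k := fun (q : ℕ) h2 h6 => hG.coco q h2 h6 x 0
  have k2 := k 2 le_rfl (by norm_num)
  have k3 := k 3 (by norm_num) (by norm_num)
  have k4 := k 4 (by norm_num) (by norm_num)
  have k6 := k 6 (by norm_num) (by norm_num)
  simp only [hD0, sub_zero, Nat.sub_self, Nat.add_one_sub_one, pow_one, pow_zero, mul_one,
    Nat.reduceSub] at k2 k3 k4 k6
  have l2 := mul_le_mul_of_nonneg_left k2 ha₂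
  have l3 := mul_le_mul_of_nonneg_left k3 ha₃
  have l4 := mul_le_mul_of_nonneg_left k4 ha₄
  have l6 := mul_le_mul_of_nonneg_left k6 ha₆
  have m2 := mul_le_mul_of_nonneg_left hG.m2 hb₂
  have m4 := mul_le_mul_of_nonneg_left hG.m4 hb₄
  have m6 := mul_le_mul_of_nonneg_left hG.m6 hb₆
  nlinarith

end Moments

end RRSGD

/-! ### Scalar expansions and drift inequalities -/

namespace RRSGD

section Scalar

/-- A second order expansion of `v ↦ v ^ (5 / 2)`, in the variable `w = √v`. -/
lemma pow_five_le_of_unit {w U : ℝ} (hw : 0 ≤ w) (hU : |w ^ 2 - 1| ≤ U) :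
    w ^ 5 ≤ -1 / 4 + 5 / 4 * w ^ 4 + 3 / 4 * U ^ 2 + 1 / 3 * U ^ 3 := by
  have h0 := abs_nonneg (w ^ 2 - 1)
  have h2 : |w ^ 2 - 1| ^ 2 ≤ U ^ 2 := by gcongr
  have h3 : |w ^ 2 - 1| ^ 3 ≤ U ^ 3 := by gcongr
  suffices h : w ^ 5 ≤ -1 / 4 + 5 / 4 * w ^ 4 + 3 / 4 * |w ^ 2 - 1| ^ 2 +
      1 / 3 * |w ^ 2 - 1| ^ 3 by linarith
  rcases le_total 1 w with h1 | h1
  · rw [abs_of_nonneg (by nlinarith)]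
    -- This product is three times the difference of the two sides, which has a double root at `w =
    -- 1`.
    have : 0 ≤ (w - 1) ^ 2 * (w ^ 3 * (w - 1) + (w + 1 / 2)) := by
      have : 0 ≤ w - 1 := by linarith
      positivity
    nlinarith
  · rw [abs_of_nonpos (by nlinarith)]
    -- Here the product is exactly the difference of the two sides.
    have : 0 ≤ (w - 1) ^ 2 * ((1 - w ^ 4) / 3 + 5 / 3 * w * (1 - w ^ 2) + 1 / 2) := by
      have e1 : w ^ 2 ≤ 1 := by nlinarith
      have e2 : w ^ 4 ≤ 1 := by nlinarith [sq_nonneg (w ^ 2)]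
      have : 0 ≤ w * (1 - w ^ 2) := mul_nonneg hw (by linarith)
      exact mul_nonneg (sq_nonneg _) (by nlinarith)
    nlinarith

/-- The previous bound rescaled by `A`. In the application `A = √‖x‖`, `w = √‖x - g‖`, `U = ‖g‖` and
`X = ⟪g, x⟫`, and the first hypothesis expands `‖x - g‖²`. -/
lemma pow_five_le {A w U X : ℝ} (hA : 0 < A) (hw : 0 ≤ w) (hX : w ^ 4 = A ^ 4 - 2 * X + U ^ 2)
    (hU : |w ^ 2 - A ^ 2| ≤ U) :
    w ^ 5 ≤ A ^ 5 - 5 / 2 * A * X + 2 * A * U ^ 2 + 1 / 3 * (U ^ 3 / A) := by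
  have h := pow_five_le_of_unit (w := w / A) (U := U / A ^ 2) (by positivity) (by
    have : (w / A) ^ 2 - 1 = (w ^ 2 - A ^ 2) / A ^ 2 := by field_simp
    rw [this, abs_div, abs_of_pos (pow_pos hA 2)]
    gcongr)
  have h5 := mul_le_mul_of_nonneg_left h (pow_nonneg hA.le 5)
  have e1 : A ^ 5 * (w / A) ^ 5 = w ^ 5 := by field_simp
  have e2 : A ^ 5 * (-1 / 4 + 5 / 4 * (w / A) ^ 4 + 3 / 4 * (U / A ^ 2) ^ 2 +
      1 / 3 * (U / A ^ 2) ^ 3) =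
      -1 / 4 * A ^ 5 + 5 / 4 * A * w ^ 4 + 3 / 4 * A * U ^ 2 + 1 / 3 * (U ^ 3 / A) := by
    field_simp
  rw [e1, e2, hX] at h5
  linarith [show 5 / 4 * A * (A ^ 4 - 2 * X + U ^ 2) =
    5 / 4 * A ^ 5 - 5 / 2 * A * X + 5 / 4 * A * U ^ 2 by ring]

set_option maxHeartbeats 800000 in
/-- The expansion for an increment that is the sum of a multiplicative and an additive part. -/
lemma pow_five_le_add {A w U X P b β : ℝ} (hA : 0 < A) (hw : 0 ≤ w)
    (hX : w ^ 4 = A ^ 4 - 2 * X + U ^ 2) (hU : |w ^ 2 - A ^ 2| ≤ U) (hXU : X ≤ A ^ 2 * U)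
    (hP : 0 ≤ P) (hβ : 0 ≤ β) (hb : b = β ^ 2) (hUP : U ≤ P + b) :
    w ^ 5 ≤ A ^ 5 - 5 / 2 * A * X + 21 / 10 * A * P ^ 2 + 7 / 20 * (P ^ 3 / A) +
      40000 * (A * b ^ 2 + β ^ 5) := by
  have hb0 : 0 ≤ b := hb ▸ sq_nonneg β
  have hU0 : 0 ≤ U := (abs_nonneg _).trans hU
  -- The coefficients of `P` must stay close to `2` and `1/3`, as they compete with the drift; those
  -- of `b` may be large. If `b ≤ A ^ 2` the expansion is combined with unbalanced Young
  -- inequalities. Otherwise no expansion is used: the noise already exceeds the position.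
  rcases le_or_gt b (A ^ 2) with hbA | hbA
  · refine (pow_five_le hA hw hX hU).trans ?_
    have h2 : U ^ 2 ≤ 21 / 20 * P ^ 2 + 21 * b ^ 2 := by
      have : U ^ 2 ≤ (P + b) ^ 2 := by gcongr
      nlinarith [sq_nonneg (P - 20 * b)]
    have h3 : U ^ 3 ≤ 21 / 20 * P ^ 3 + 100000 * b ^ 3 := by
      have h : U ^ 3 ≤ (P + b) ^ 3 := by gcongr
      refine h.trans ?_
      rcases le_total (125 * b) P with h4 | h4
      · have h5 : P ^ 2 * (125 * b) ≤ P ^ 2 * P := by gcongr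
        have h6 : P * b * b ≤ P * b * P := by gcongr; linarith
        linarith [pow_nonneg hb0 3, pow_nonneg hP 3]
      · have h5 : P ^ 2 * b ≤ (125 * b) ^ 2 * b := by gcongr
        have h6 : P * b ^ 2 ≤ 125 * b * b ^ 2 := by gcongr
        linarith [pow_nonneg hb0 3, pow_nonneg hP 3]
    have h4 : U ^ 3 / A ≤ 21 / 20 * (P ^ 3 / A) + 100000 * (A * b ^ 2) := by
      have e : 21 / 20 * (P ^ 3 / A) + 100000 * (A * b ^ 2) =
        (21 / 20 * P ^ 3 + 100000 * (A ^ 2 * b ^ 2)) / A := by field_simp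
      rw [e]
      gcongr
      refine h3.trans ?_
      have : b * b ^ 2 ≤ A ^ 2 * b ^ 2 := by gcongr
      linarith
    have h5 : A * U ^ 2 ≤ A * (21 / 20 * P ^ 2 + 21 * b ^ 2) := by gcongr
    linarith [pow_nonneg hβ 5, mul_nonneg hA.le (sq_nonneg b)]
  · have hAβ : A ≤ β := by
      rw [hb] at hbA
      exact (abs_lt_of_sq_lt_sq hbA hβ).le |> (le_abs_self A).trans
    have hw2 : w ^ 2 ≤ A ^ 2 + P + b := by linarith [(abs_le.1 hU).2]
    have hX2 : A * X ≤ A ^ 3 * (P + b) := by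
      have : A * X ≤ A * (A ^ 2 * U) := by gcongr
      have h' : A ^ 3 * U ≤ A ^ 3 * (P + b) := by gcongr
      linarith
    have hPA : 0 ≤ P ^ 3 / A := by positivity
    have hAP : 0 ≤ A * P ^ 2 := by positivity
    have hAb : 0 ≤ A * b ^ 2 := by positivity
    have hA5 : 0 ≤ A ^ 5 := by positivity
    rcases le_or_gt P (25 * b) with hPb | hPb
    -- When `P` is at most `25 b` as well, every term is of order `β ^ 5`.
    · have hwβ : w ≤ 6 * β := by
        refine abs_le_of_sq_le_sq' ?_ (by positivity) |>.2
        nlinarith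
      have h5 : w ^ 5 ≤ (6 * β) ^ 5 := by gcongr
      have h6 : A ^ 3 * (P + b) ≤ β ^ 3 * (26 * β ^ 2) := by
        gcongr
        linarith
      have e1 : (6 * β) ^ 5 = 7776 * β ^ 5 := by ring
      have e2 : β ^ 3 * (26 * β ^ 2) = 26 * β ^ 5 := by ring
      rw [e1] at h5
      rw [e2] at h6
      linarith [pow_nonneg hβ 5]
    · set π := √P with hπ
      have hπ2 : π ^ 2 = P := Real.sq_sqrt hP
      have hπ0 : 0 ≤ π := Real.sqrt_nonneg _
      have hβπ : β ≤ π / 5 := by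
        refine abs_le_of_sq_le_sq' ?_ (by positivity) |>.2
        rw [div_pow, hπ2]; linarith
      have hwπ : w ≤ 21 / 20 * π := by
        refine abs_le_of_sq_le_sq' ?_ (by positivity) |>.2
        nlinarith
      have h5 : w ^ 5 ≤ (21 / 20 * π) ^ 5 := by gcongr
      have h6 : A ^ 3 * (P + b) ≤ (π / 5) ^ 3 * (26 / 25 * π ^ 2) := by
        gcongr
        · exact hAβ.trans hβπ
        · linarith
      -- Here `P` dominates both `A²` and `b`, and `π⁵` is absorbed by the two `P` terms together:
      -- the quadratic form in `A` and `π` below has negative discriminant.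
      have h7 : 17 / 10 * π ^ 5 ≤ 21 / 10 * A * P ^ 2 + 7 / 20 * (P ^ 3 / A) := by
        have e : 21 / 10 * A * P ^ 2 + 7 / 20 * (P ^ 3 / A) =
            (21 / 10 * A ^ 2 * P ^ 2 + 7 / 20 * P ^ 3) / A := by field_simp
        rw [e, le_div_iff₀ hA, ← hπ2]
        have : 0 ≤ π ^ 4 * (21 / 10 * A ^ 2 + 7 / 20 * π ^ 2 - 17 / 10 * π * A) :=
          mul_nonneg (by positivity) (by nlinarith [sq_nonneg (π - 17 / 7 * A)])
        linarith
      have e1 : (21 / 20 * π) ^ 5 = (21 / 20) ^ 5 * π ^ 5 := by ring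
      have e2 : (π / 5) ^ 3 * (26 / 25 * π ^ 2) = 26 / 3125 * π ^ 5 := by ring
      rw [e1] at h5
      rw [e2] at h6
      norm_num at h5
      linarith [pow_nonneg hβ 5, pow_nonneg hπ0 5]

end Scalar

section Drifts

variable {d : ℕ} {Z : Type*} [MeasurableSpace Z] {Pξ : Measure Z} [IsProbabilityMeasure Pξ]
  {D : Vec d → Vec d} {H : Vec d →L[ℝ] Vec d} {T : Vec d →L[ℝ] Vec d →L[ℝ] Vec d}
  {G : Vec d → Z → Vec d} {μ L τ₂ τ₄ τ₆ γ : ℝ}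

/-- The update map of SGD. -/
def sgdStep (G : Vec d → Z → Vec d) (γ : ℝ) (p : Vec d × Z) : Vec d := p.1 - γ • G p.1 p.2

lemma RegularField.mul_le_one (hR : RegularField D H T μ L) (hγ : 0 < γ) (hγL : γ * L ≤ 1) :
    γ * μ ≤ 1 :=
  (mul_le_mul_of_nonneg_left hR.le hγ.le).trans hγL

lemma RegularField.measurable_inner (hR : RegularField D H T μ L) :
    Measurable fun x : Vec d => inner ℝ (D x) x :=
  (hR.continuous.inner continuous_id).measurable

/-- Young's weights `3/2` and `3` leave at least `(γ/2) ⟪D x, x⟫` of dissipation for every `γL ≤ 1`.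
One half is kept as the rate and the other gives the contraction. -/
lemma drift_sq (hR : RegularField D H T μ L) (hG : Oracle D G Pξ L τ₂ τ₄ τ₆) (hγ : 0 < γ)
    (hγL : γ * L ≤ 1) :
    HasDrift Pξ (sgdStep G γ) (fun x => ‖x‖ ^ 2) (fun x => γ / 4 * inner ℝ (D x) x)
      (γ * μ / 4) (3 * γ ^ 2 * τ₂ ^ 2) := by
  have hL := hR.posL
  have key := fun x : Vec d => hG.step_le hR.zero x
    (F := fun z => ‖x - γ • G x z‖ ^ 2) (c₀ := ‖x‖ ^ 2) (c₁ := 2 * γ) (a₂ := 3 / 2 * γ ^ 2)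
    (b₂ := 3 * γ ^ 2) (a₃ := 0) (a₄ := 0) (a₆ := 0) (b₄ := 0) (b₆ := 0)
    ((measurable_const.sub ((hG.meas_right x).const_smul γ)).norm.pow_const 2)
    (fun z => by positivity) (by positivity) le_rfl le_rfl le_rfl (by positivity) le_rfl le_rfl
    (fun z => by
      rw [norm_sub_sq_real, inner_smul_right, norm_smul, real_inner_comm, mul_pow,
        Real.norm_eq_abs, sq_abs]
      have h1 := norm_add_le (G x z - G 0 z) (G 0 z)
      rw [sub_add_cancel] at h1
      have h2 : ‖G x z‖ ^ 2 ≤ 3 / 2 * ‖G x z - G 0 z‖ ^ 2 + 3 * ‖G 0 z‖ ^ 2 := by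
        nlinarith [norm_nonneg (G x z), sq_nonneg (‖G x z - G 0 z‖ - 2 * ‖G 0 z‖)]
      have h3 := mul_le_mul_of_nonneg_left h2 (sq_nonneg γ)
      linarith)
  refine ⟨measurable_norm.pow_const 2, hR.measurable_inner.const_mul _, fun _ => by positivity,
    fun x => mul_nonneg (by positivity) (hR.inner_nonneg x), by have := hR.pos; positivity, ?_,
    by positivity, fun x => (key x).1, fun x => (key x).2.trans ?_⟩
  · linarith [hR.mul_le_one hγ hγL]
  · have h1 := hR.inner_ge x
    have h2 := hR.inner_nonneg x
    have h3 : γ * L * (γ * inner ℝ (D x) x) ≤ 1 * (γ * inner ℝ (D x) x) := by gcongr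
    have h4 : γ * (μ * ‖x‖ ^ 2) ≤ γ * inner ℝ (D x) x := by gcongr
    nlinarith

/-- The second order terms have constants `16` and `24`, hence the restriction on `γL`. Of the four
copies of `γ‖x‖² ⟪D x, x⟫`, one absorbs these terms; the others provide the rate, the contraction
and the control of the cross term with `τ₂²`. -/
lemma drift_four (hR : RegularField D H T μ L) (hG : Oracle D G Pξ L τ₂ τ₄ τ₆) (hγ : 0 < γ)
    (hγL : γ * L ≤ 1 / 30) :
    HasDrift Pξ (sgdStep G γ) (fun x => ‖x‖ ^ 4) (fun x => γ * (‖x‖ ^ 2 * inner ℝ (D x) x))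
      (γ * μ) (88 * γ ^ 3 * τ₄ ^ 4 / μ) := by
  have hL := hR.posL
  have hμ := hR.pos
  have hγμ := hR.mul_le_one hγ (hγL.trans (by norm_num))
  have key := fun x : Vec d => hG.step_le hR.zero x
    (F := fun z => ‖x - γ • G x z‖ ^ 4) (c₀ := ‖x‖ ^ 4) (c₁ := 4 * γ * ‖x‖ ^ 2)
    (a₂ := 16 * γ ^ 2 * ‖x‖ ^ 2)
    (b₂ := 16 * γ ^ 2 * ‖x‖ ^ 2) (a₃ := 0) (a₄ := 24 * γ ^ 4) (a₆ := 0) (b₄ := 24 * γ ^ 4)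
    (b₆ := 0)
    ((measurable_const.sub ((hG.meas_right x).const_smul γ)).norm.pow_const 4)
    (fun z => by positivity) (by positivity) le_rfl (by positivity) le_rfl (by positivity)
    (by positivity) le_rfl
    (fun z => by
      have e : ‖x - γ • G x z‖ ^ 4 = (‖x - γ • G x z‖ ^ 2) ^ 2 := by ring
      rw [e, norm_sub_sq_real, inner_smul_right, norm_smul, real_inner_comm, mul_pow,
        Real.norm_eq_abs, sq_abs]
      have h1 := norm_add_le (G x z - G 0 z) (G 0 z)
      rw [sub_add_cancel] at h1
      set P := ‖G x z - G 0 z‖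
      set b := ‖G 0 z‖
      set u := ‖G x z‖
      set r := ‖x‖
      have hX := abs_le.1 (abs_real_inner_le_norm (G x z) x)
      set X := inner ℝ (G x z) x
      have hu : 0 ≤ u := norm_nonneg _
      have hr : 0 ≤ r := norm_nonneg _
      have h2 : u ^ 2 ≤ 2 * P ^ 2 + 2 * b ^ 2 := by nlinarith [sq_nonneg (P - b)]
      have h4 : u ^ 4 ≤ 8 * P ^ 4 + 8 * b ^ 4 := by
        have : (u ^ 2) ^ 2 ≤ (2 * P ^ 2 + 2 * b ^ 2) ^ 2 := by gcongr
        nlinarith [sq_nonneg (P ^ 2 - b ^ 2)]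
      have hX2 : X ^ 2 ≤ (u * r) ^ 2 := sq_le_sq' hX.1 hX.2
      have h5 : (r ^ 2 - 2 * (γ * X) + γ ^ 2 * u ^ 2) ^ 2 ≤
          r ^ 4 - 4 * γ * r ^ 2 * X + 8 * γ ^ 2 * r ^ 2 * u ^ 2 + 3 * γ ^ 4 * u ^ 4 := by
        have h6 : -(4 * γ ^ 3 * u ^ 2 * X) ≤ 2 * γ ^ 2 * X ^ 2 + 2 * γ ^ 4 * u ^ 4 := by
          nlinarith [sq_nonneg (γ * X + γ ^ 2 * u ^ 2)]
        have h7 : 6 * γ ^ 2 * X ^ 2 ≤ 6 * γ ^ 2 * (u * r) ^ 2 := by gcongr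
        nlinarith
      refine h5.trans ?_
      have h8 : 8 * γ ^ 2 * r ^ 2 * u ^ 2 ≤ 8 * γ ^ 2 * r ^ 2 * (2 * P ^ 2 + 2 * b ^ 2) := by
        gcongr
      have h9 : 3 * γ ^ 4 * u ^ 4 ≤ 3 * γ ^ 4 * (8 * P ^ 4 + 8 * b ^ 4) := by gcongr
      nlinarith)
  refine ⟨measurable_norm.pow_const 4,
    ((measurable_norm.pow_const 2).mul hR.measurable_inner).const_mul _,
    fun _ => by positivity, fun x => ?_, by positivity, hγμ,
    by positivity, fun x => (key x).1, fun x => (key x).2.trans ?_⟩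
  · have := hR.inner_nonneg x
    positivity
  · set δ := inner ℝ (D x) x with hδ
    set r := ‖x‖ with hr
    have h1 : μ * r ^ 2 ≤ δ := hR.inner_ge x
    have h2 : 0 ≤ δ := hR.inner_nonneg x
    have h4 : γ * r ^ 2 * (μ * r ^ 2) ≤ γ * r ^ 2 * δ := by gcongr
    have ha : 0 ≤ γ * L := by positivity
    have h5 : (16 * (γ * L) + 24 * (γ * L) ^ 3) * (γ * r ^ 2 * δ) ≤ 1 * (γ * r ^ 2 * δ) := by
      gcongr
      have : (γ * L) ^ 3 ≤ (1 / 30) ^ 3 := by gcongr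
      nlinarith
    have hτ : τ₂ ^ 4 ≤ τ₄ ^ 4 := pow_le_pow_left₀ hG.nonneg hG.le24 4
    have h6 : 16 * γ ^ 2 * r ^ 2 * τ₂ ^ 2 ≤ γ * μ * r ^ 4 + 64 * γ ^ 3 * τ₄ ^ 4 / μ := by
      have e : γ * μ * r ^ 4 + 64 * γ ^ 3 * τ₂ ^ 4 / μ - 16 * γ ^ 2 * r ^ 2 * τ₂ ^ 2 =
        γ / μ * (μ * r ^ 2 - 8 * γ * τ₂ ^ 2) ^ 2 := by field_simp; ring
      have : 0 ≤ γ / μ * (μ * r ^ 2 - 8 * γ * τ₂ ^ 2) ^ 2 := by positivity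
      have h7 : 64 * γ ^ 3 * τ₂ ^ 4 / μ ≤ 64 * γ ^ 3 * τ₄ ^ 4 / μ := by gcongr
      linarith
    have h7 : 24 * γ ^ 4 * τ₄ ^ 4 ≤ 24 * γ ^ 3 * τ₄ ^ 4 / μ := by
      rw [le_div_iff₀ hμ]
      have : 24 * γ ^ 3 * τ₄ ^ 4 * (γ * μ) ≤ 24 * γ ^ 3 * τ₄ ^ 4 * 1 := by gcongr
      nlinarith
    have e8 : 88 * γ ^ 3 * τ₄ ^ 4 / μ = 64 * γ ^ 3 * τ₄ ^ 4 / μ + 24 * γ ^ 3 * τ₄ ^ 4 / μ := by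
      ring
    rw [e8]
    nlinarith

/-- Young's inequality with exponents `3/2` and `3`, up to constants, by comparing `c` with `ε y`.
-/
lemma sq_mul_le_cube {y c ε : ℝ} (hy : 0 ≤ y) (hc : 0 ≤ c) (hε : 0 < ε) :
    y ^ 2 * c ≤ ε * y ^ 3 + c ^ 3 / ε ^ 2 := by
  rcases le_total c (ε * y) with h | h
  · have : y ^ 2 * c ≤ y ^ 2 * (ε * y) := by gcongr
    have h2 : 0 ≤ c ^ 3 / ε ^ 2 := by positivity
    nlinarith
  · have h1 : y ≤ c / ε := by rw [le_div_iff₀ hε]; linarith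
    have : y ^ 2 * c ≤ (c / ε) ^ 2 * c := by gcongr
    have e : (c / ε) ^ 2 * c = c ^ 3 / ε ^ 2 := by field_simp
    have h2 : 0 ≤ ε * y ^ 3 := by positivity
    linarith

lemma sixth_power_expansion {r u X : ℝ} (hX : -(r * u) ≤ X ∧ X ≤ r * u) :
    (r ^ 2 - 2 * X + u ^ 2) ^ 3 ≤
      r ^ 6 - 6 * r ^ 4 * X + 54 * r ^ 4 * u ^ 2 + 18 * u ^ 6 := by
  have hX2 : X ^ 2 ≤ (r * u) ^ 2 := sq_le_sq' hX.1 hX.2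
  have h0 : -X ≤ r * u := by linarith [hX.1]
  have hX3 : (-X) ^ 3 ≤ (r * u) ^ 3 := (Odd.strictMono_pow (by decide)).monotone h0
  have a1 : r ^ 2 * X ^ 2 ≤ r ^ 2 * (r * u) ^ 2 := by gcongr
  have a2 : u ^ 2 * X ^ 2 ≤ u ^ 2 * (r * u) ^ 2 := by gcongr
  have b0 : 0 ≤ u ^ 4 := by positivity
  have a3 : r ^ 2 * u ^ 2 * (-X) ≤ r ^ 2 * u ^ 2 * (r * u) := by gcongr
  have a4 : u ^ 4 * (-X) ≤ u ^ 4 * (r * u) := by gcongr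
  have b1 : 0 ≤ r ^ 2 * u ^ 2 * (r - u) ^ 2 := by positivity
  have b2 : 0 ≤ u ^ 2 * (r ^ 2 - u ^ 2) ^ 2 := by positivity
  have b3 : 0 ≤ u ^ 4 * (r - u) ^ 2 := by positivity
  have b4 : 0 ≤ r ^ 4 * u ^ 2 := by positivity
  linarith

/-- Four of the six copies of `γ‖x‖⁴ ⟪D x, x⟫` absorb the second order terms; one gives the
contraction and one the cross term, whose constant is `108 ^ 3 = 1259712`. -/
lemma drift_six (hR : RegularField D H T μ L) (hG : Oracle D G Pξ L τ₂ τ₄ τ₆) (hγ : 0 < γ)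
    (hγL : γ * L ≤ 1 / 30) :
    HasDrift Pξ (sgdStep G γ) (fun x => ‖x‖ ^ 6) (fun _ => 0)
      (γ * μ) (1260288 * γ ^ 4 * τ₆ ^ 6 / μ ^ 2) := by
  have hL := hR.posL
  have hμ := hR.pos
  have hγμ := hR.mul_le_one hγ (hγL.trans (by norm_num))
  have key := fun x : Vec d => hG.step_le hR.zero x
    (F := fun z => ‖x - γ • G x z‖ ^ 6) (c₀ := ‖x‖ ^ 6) (c₁ := 6 * γ * ‖x‖ ^ 4)
    (a₂ := 108 * γ ^ 2 * ‖x‖ ^ 4)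
    (b₂ := 108 * γ ^ 2 * ‖x‖ ^ 4) (a₃ := 0) (a₄ := 0) (a₆ := 576 * γ ^ 6) (b₄ := 0)
    (b₆ := 576 * γ ^ 6)
    ((measurable_const.sub ((hG.meas_right x).const_smul γ)).norm.pow_const 6)
    (fun z => by positivity) (by positivity) le_rfl le_rfl (by positivity) (by positivity)
    le_rfl (by positivity)
    (fun z => by
      have e : ‖x - γ • G x z‖ ^ 6 = (‖x - γ • G x z‖ ^ 2) ^ 3 := by ring
      have hp : 0 ≤ ‖x - γ • G x z‖ ^ 2 := by positivity
      have h1 : ‖γ • G x z‖ ≤ γ * ‖G x z - G 0 z‖ + γ * ‖G 0 z‖ := by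
        rw [norm_smul, Real.norm_of_nonneg hγ.le, ← mul_add]
        have := norm_add_le (G x z - G 0 z) (G 0 z)
        rw [sub_add_cancel] at this
        gcongr
      have hi : γ * inner ℝ (G x z) x = inner ℝ x (γ • G x z) := by
        rw [inner_smul_right, real_inner_comm]
      have hX := abs_le.1 (abs_real_inner_le_norm x (γ • G x z))
      rw [e, norm_sub_sq_real] at *
      suffices h : (‖x‖ ^ 2 - 2 * inner ℝ x (γ • G x z) + ‖γ • G x z‖ ^ 2) ^ 3 ≤
          ‖x‖ ^ 6 - 6 * ‖x‖ ^ 4 * inner ℝ x (γ • G x z) +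
          108 * ‖x‖ ^ 4 * (γ * ‖G x z - G 0 z‖) ^ 2 + 576 * (γ * ‖G x z - G 0 z‖) ^ 6 +
          108 * ‖x‖ ^ 4 * (γ * ‖G 0 z‖) ^ 2 + 576 * (γ * ‖G 0 z‖) ^ 6 by
        rw [← hi] at h ⊢
        refine h.trans (le_of_eq ?_)
        ring
      have hP : 0 ≤ γ * ‖G x z - G 0 z‖ := by positivity
      have hb : 0 ≤ γ * ‖G 0 z‖ := by positivity
      set P := γ * ‖G x z - G 0 z‖
      set b := γ * ‖G 0 z‖
      set u := ‖γ • G x z‖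
      set r := ‖x‖
      set X := inner ℝ x (γ • G x z)
      have hu : 0 ≤ u := norm_nonneg _
      have hr : 0 ≤ r := norm_nonneg _
      have h2 : u ^ 2 ≤ 2 * P ^ 2 + 2 * b ^ 2 := by nlinarith [sq_nonneg (P - b)]
      have h6 : u ^ 6 ≤ 32 * P ^ 6 + 32 * b ^ 6 := by
        have h3 : (u ^ 2) ^ 3 ≤ (2 * P ^ 2 + 2 * b ^ 2) ^ 3 := by gcongr
        have h4 : 0 ≤ (P ^ 2 + b ^ 2) * (P ^ 2 - b ^ 2) ^ 2 := by positivity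
        nlinarith
      have h5 := sixth_power_expansion hX
      refine h5.trans ?_
      have h8 : 54 * r ^ 4 * u ^ 2 ≤ 54 * r ^ 4 * (2 * P ^ 2 + 2 * b ^ 2) := by gcongr
      linarith)
  refine ⟨measurable_norm.pow_const 6, measurable_const,
    fun _ => by positivity, fun x => le_rfl, by positivity, hγμ,
    by positivity, fun x => (key x).1, fun x => (key x).2.trans ?_⟩
  set δ := inner ℝ (D x) x with hδ
  set r := ‖x‖ with hr
  have h1 : μ * r ^ 2 ≤ δ := hR.inner_ge x
  have h2 : 0 ≤ δ := hR.inner_nonneg x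
  have h4 : γ * r ^ 4 * (μ * r ^ 2) ≤ γ * r ^ 4 * δ := by gcongr
  have ha : 0 ≤ γ * L := by positivity
  have h5 : (108 * (γ * L) + 576 * (γ * L) ^ 5) * (γ * r ^ 4 * δ) ≤ 4 * (γ * r ^ 4 * δ) := by
    gcongr
    have : (γ * L) ^ 5 ≤ (1 / 30) ^ 5 := by gcongr
    nlinarith
  have hτ : τ₂ ^ 6 ≤ τ₆ ^ 6 := pow_le_pow_left₀ hG.nonneg (hG.le24.trans hG.le46) 6
  have h6 : 108 * γ ^ 2 * r ^ 4 * τ₂ ^ 2 ≤ γ * μ * r ^ 6 + 1259712 * γ ^ 4 * τ₆ ^ 6 / μ ^ 2 := by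
    have h := sq_mul_le_cube (y := r ^ 2) (c := 108 * γ ^ 2 * τ₂ ^ 2) (ε := γ * μ)
      (by positivity) (by positivity) (by positivity)
    have e : (108 * γ ^ 2 * τ₂ ^ 2) ^ 3 / (γ * μ) ^ 2 = 1259712 * γ ^ 4 * τ₂ ^ 6 / μ ^ 2 := by
      field_simp; ring
    have h7 : 1259712 * γ ^ 4 * τ₂ ^ 6 / μ ^ 2 ≤ 1259712 * γ ^ 4 * τ₆ ^ 6 / μ ^ 2 := by gcongr
    rw [e] at h
    nlinarith
  have h7 : 576 * γ ^ 6 * τ₆ ^ 6 ≤ 576 * γ ^ 4 * τ₆ ^ 6 / μ ^ 2 := by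
    rw [le_div_iff₀ (by positivity)]
    have : 576 * γ ^ 4 * τ₆ ^ 6 * (γ * μ) ^ 2 ≤ 576 * γ ^ 4 * τ₆ ^ 6 * 1 ^ 2 := by
      have := hG.nonneg.trans (hG.le24.trans hG.le46)
      gcongr
    nlinarith
  have e8 : 1260288 * γ ^ 4 * τ₆ ^ 6 / μ ^ 2 =
      1259712 * γ ^ 4 * τ₆ ^ 6 / μ ^ 2 + 576 * γ ^ 4 * τ₆ ^ 6 / μ ^ 2 := by ring
  rw [e8]
  nlinarith

end Drifts

end RRSGD

namespace RRSGD

section Drifts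

variable {d : ℕ} {Z : Type*} [MeasurableSpace Z] {Pξ : Measure Z} [IsProbabilityMeasure Pξ]
  {D : Vec d → Vec d} {H : Vec d →L[ℝ] Vec d} {T : Vec d →L[ℝ] Vec d →L[ℝ] Vec d}
  {G : Vec d → Z → Vec d} {μ L τ₂ τ₄ τ₆ γ : ℝ}

/-- The one-step bound for the moment of order `5 / 2`, up to terms of order two and four of the
additive noise. -/
lemma fractional_pointwise (x g p b : Vec d) (hg : g = p + b) (hp : x = 0 → p = 0) {k : ℝ}
    (hk : 0 ≤ k) :
    k * (‖x - g‖ ^ 2 * √‖x - g‖) ≤ k * (‖x‖ ^ 2 * √‖x‖) - 5 / 2 * k * √‖x‖ * inner ℝ g x +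
      21 / 10 * k * √‖x‖ * ‖p‖ ^ 2 + 7 / 20 * k / √‖x‖ * ‖p‖ ^ 3 +
      (40000 * k * √‖x‖ + 40000) * ‖b‖ ^ 2 + 40000 * k ^ 4 * ‖b‖ ^ 4 := by
  have five : ∀ r : ℝ, 0 ≤ r → r ^ 2 * √r = √r ^ 5 := fun r hr => by
    have := Real.sq_sqrt hr
    calc r ^ 2 * √r = (√r ^ 2) ^ 2 * √r := by rw [this]
      _ = √r ^ 5 := by ring
  have four : ∀ r : ℝ, 0 ≤ r → √r ^ 4 = r ^ 2 := fun r hr => by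
    have := Real.sq_sqrt hr
    calc √r ^ 4 = (√r ^ 2) ^ 2 := by ring
      _ = r ^ 2 := by rw [this]
  -- From `t ≤ 1 + t ^ 4` with `t = k √‖b‖`: the noise moment of order `5/2` is reduced to the
  -- moments of order two and four, which the oracle controls.
  have hb5 : k * √‖b‖ ^ 5 ≤ ‖b‖ ^ 2 + k ^ 4 * ‖b‖ ^ 4 := by
    have h1 : k * √‖b‖ ≤ 1 + (k * √‖b‖) ^ 4 := by
      nlinarith [sq_nonneg ((k * √‖b‖) ^ 2 - 1 / 2), sq_nonneg (k * √‖b‖ - 1 / 2)]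
    rw [mul_pow, four _ (norm_nonneg b)] at h1
    rw [← five _ (norm_nonneg b)]
    have := mul_le_mul_of_nonneg_left h1 (sq_nonneg ‖b‖)
    linarith
  rw [five _ (norm_nonneg _), five _ (norm_nonneg _)]
  rcases eq_or_ne x 0 with rfl | hx
  · rw [hp rfl, zero_add] at hg
    subst hg
    have h2 : 0 ≤ ‖g‖ ^ 2 + k ^ 4 * ‖g‖ ^ 4 := by positivity
    simp only [zero_sub, norm_neg, norm_zero, Real.sqrt_zero, hp rfl]
    norm_num
    linarith
  · have hA : 0 < √‖x‖ := Real.sqrt_pos.2 (norm_pos_iff.2 hx)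
    have h := pow_five_le_add (A := √‖x‖) (w := √‖x - g‖) (U := ‖g‖) (X := inner ℝ g x)
      (P := ‖p‖) (b := ‖b‖) (β := √‖b‖) hA (Real.sqrt_nonneg _)
      (by
        rw [four _ (norm_nonneg _), four _ (norm_nonneg _), norm_sub_sq_real, real_inner_comm])
      (by
        rw [Real.sq_sqrt (norm_nonneg _), Real.sq_sqrt (norm_nonneg _)]
        refine (abs_norm_sub_norm_le _ _).trans (le_of_eq ?_)
        rw [sub_sub_cancel_left, norm_neg])
      (by
        rw [Real.sq_sqrt (norm_nonneg _), mul_comm]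
        exact real_inner_le_norm _ _)
      (norm_nonneg _) (Real.sqrt_nonneg _) (Real.sq_sqrt (norm_nonneg _)).symm
      (hg ▸ norm_add_le _ _)
    have h2 := mul_le_mul_of_nonneg_left h hk
    have e : 7 / 20 * k / √‖x‖ * ‖p‖ ^ 3 = k * (7 / 20 * (‖p‖ ^ 3 / √‖x‖)) := by ring
    rw [e]
    linarith

/-- The Lyapunov function of order `5 / 2` which replaces the fourth moment for large step
sizes. -/
noncomputable def lyapunov (μ L : ℝ) (x : Vec d) : ℝ := ‖x‖ ^ 2 + √(L / μ) * (‖x‖ ^ 2 * √‖x‖)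

lemma measurable_lyapunov : Measurable (lyapunov (d := d) μ L) :=
  (measurable_norm.pow_const 2).add
    (((measurable_norm.pow_const 2).mul measurable_norm.sqrt).const_mul _)

lemma lyapunov_nonneg (x : Vec d) : 0 ≤ lyapunov μ L x := by
  rw [lyapunov]; positivity

lemma sq_le_lyapunov (x : Vec d) : ‖x‖ ^ 2 ≤ lyapunov μ L x := by
  rw [lyapunov]
  have : 0 ≤ √(L / μ) * (‖x‖ ^ 2 * √‖x‖) := by positivity
  linarith

/-- The size of the noise in the drift of `lyapunov`. -/
noncomputable def lyapunovNoise (μ L γ s s₄ : ℝ) : ℝ :=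
  1800000 * (γ * μ * s ^ 2 + γ * μ * (√(L / μ) * (s ^ 2 * √s)) + γ * L * s₄ ^ 4)

-- The drift survives up to `γL = 1` because `5/2 - 21/10 - 7/20 = 1/20` is positive. This margin
-- pays for the rate (`1/50`, by `hessian_le_field`), the contraction (`1/50`) and the noise
-- (`1/100`). The weight `√(L/μ)` is the one occurring in `hessian_le_field`; `s` and `s₄` are the
-- stationary scales of the second and fourth moments.
set_option maxHeartbeats 800000 in
lemma drift_lyapunov (hR : RegularField D H T μ L) (hG : Oracle D G Pξ L τ₂ τ₄ τ₆) (hγ : 0 < γ)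
    (hγL : γ * L ≤ 1) {s s₄ : ℝ} (hs0 : 0 ≤ s) (hs : γ * τ₂ ^ 2 = μ * s ^ 2)
    (hs₄ : γ * τ₄ ^ 2 = μ * s₄ ^ 2) :
    HasDrift Pξ (sgdStep G γ) (lyapunov μ L) (fun x => γ / (100 * L) * ‖H x‖ ^ 2)
      (γ * μ / 50) (lyapunovNoise μ L γ s s₄) := by
  have hL := hR.posL
  have hμ := hR.pos
  set k := √(L / μ) with hk
  have hk0 : 0 ≤ k := Real.sqrt_nonneg _
  have hk2 : k ^ 2 = L / μ := Real.sq_sqrt (by positivity)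
  have hm : ∀ x, Measurable fun z => x - γ • G x z := fun x =>
    measurable_const.sub ((hG.meas_right x).const_smul γ)
  have key := fun x : Vec d => hG.step_le hR.zero x
    (F := fun z => lyapunov μ L (x - γ • G x z)) (c₀ := lyapunov μ L x)
    (c₁ := 2 * γ + 5 / 2 * k * √‖x‖ * γ)
    (a₂ := 3 / 2 * γ ^ 2 + 21 / 10 * k * √‖x‖ * γ ^ 2) (a₃ := 7 / 20 * k / √‖x‖ * γ ^ 3)
    (b₂ := 3 * γ ^ 2 + (40000 * k * √‖x‖ + 40000) * γ ^ 2) (a₄ := 0) (a₆ := 0)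
    (b₄ := 40000 * k ^ 4 * γ ^ 4) (b₆ := 0)
    (measurable_lyapunov.comp (hm x))
    (fun z => lyapunov_nonneg _) (by positivity) (by positivity) le_rfl le_rfl (by positivity)
    (by positivity) le_rfl
    (fun z => by
      have h1 := norm_add_le (G x z - G 0 z) (G 0 z)
      rw [sub_add_cancel] at h1
      have h2 : ‖G x z‖ ^ 2 ≤ 3 / 2 * ‖G x z - G 0 z‖ ^ 2 + 3 * ‖G 0 z‖ ^ 2 := by
        nlinarith [norm_nonneg (G x z), sq_nonneg (‖G x z - G 0 z‖ - 2 * ‖G 0 z‖)]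
      have h3 := mul_le_mul_of_nonneg_left h2 (sq_nonneg γ)
      have h4 := fractional_pointwise x (γ • G x z) (γ • (G x z - G 0 z)) (γ • G 0 z)
        (by rw [← smul_add, sub_add_cancel]) (fun h => by rw [h, sub_self, smul_zero]) hk0
      rw [inner_smul_left, conj_trivial, norm_smul, norm_smul, Real.norm_of_nonneg hγ.le,
        mul_pow, mul_pow, mul_pow, mul_pow] at h4
      rw [lyapunov, lyapunov, ← hk, norm_sub_sq_real x, inner_smul_right, norm_smul,
        real_inner_comm, mul_pow, Real.norm_eq_abs, sq_abs]
      rw [norm_sub_sq_real x, inner_smul_right, norm_smul,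
        real_inner_comm, mul_pow, Real.norm_eq_abs, sq_abs] at h4
      linarith)
  refine ⟨measurable_lyapunov, (H.continuous.measurable.norm.pow_const 2).const_mul _,
    fun x => lyapunov_nonneg x, fun x => by positivity, by positivity, ?_,
    by rw [lyapunovNoise]; positivity, fun x => (key x).1, fun x => (key x).2.trans ?_⟩
  · linarith [hR.mul_le_one hγ hγL]
  · set δ := inner ℝ (D x) x with hδ
    set A := √‖x‖ with hA
    set r := ‖x‖ with hr
    have hA0 : 0 ≤ A := Real.sqrt_nonneg _
    have hA2 : A ^ 2 = r := Real.sq_sqrt (norm_nonneg x)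
    have h1 : μ * r ^ 2 ≤ δ := hR.inner_ge x
    have h2 : 0 ≤ δ := hR.inner_nonneg x
    have hH : ‖H x‖ ^ 2 ≤ L * (2 * δ + 2 * k * A * δ) :=
      (hR.norm_hessian_sq_le x).trans (mul_le_mul_of_nonneg_left (hR.hessian_le_field x) hL.le)
    have hHγ : γ / (100 * L) * ‖H x‖ ^ 2 ≤ γ / 50 * (δ + k * A * δ) := by
      have h3 : γ / (100 * L) * ‖H x‖ ^ 2 ≤ γ / (100 * L) * (L * (2 * δ + 2 * k * A * δ)) := by
        gcongr
      have e : γ / (100 * L) * (L * (2 * δ + 2 * k * A * δ)) = γ / 50 * (δ + k * A * δ) := by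
        field_simp; ring
      linarith
    -- At `x = 0` both sides vanish, division by zero being zero.
    have hcub : 7 / 20 * k / A * γ ^ 3 * (L ^ 2 * r) = 7 / 20 * (k * A * γ) * (γ * L) ^ 2 := by
      rw [← hA2]
      rcases hA0.eq_or_lt with h | h
      · rw [← h]; simp
      · field_simp
    have ha : 0 ≤ γ * L := by positivity
    have hkA : 0 ≤ k * A * γ * δ := by positivity
    have hγδ : 0 ≤ γ * δ := by positivity
    have d1 : 3 / 2 * (γ * L) * (γ * δ) ≤ 3 / 2 * 1 * (γ * δ) := by gcongr
    have d2 : 21 / 10 * (γ * L) * (k * A * γ * δ) ≤ 21 / 10 * 1 * (k * A * γ * δ) := by gcongr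
    have d3 : 7 / 20 * (γ * L) ^ 2 * (k * A * γ * δ) ≤ 7 / 20 * 1 ^ 2 * (k * A * γ * δ) := by
      gcongr
    have n1 : γ ^ 2 * τ₂ ^ 2 = γ * μ * s ^ 2 := by
      rw [pow_two γ, mul_assoc, hs]; ring
    have n2 : k ^ 4 * γ ^ 4 * τ₄ ^ 4 ≤ γ * L * s₄ ^ 4 := by
      have e : k ^ 4 * γ ^ 4 * τ₄ ^ 4 = (γ * L) * (γ * L * s₄ ^ 4) := by
        have : k ^ 4 * γ ^ 4 * τ₄ ^ 4 = (k ^ 2) ^ 2 * γ ^ 2 * (γ * τ₄ ^ 2) ^ 2 := by ring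
        rw [this, hk2, hs₄]; field_simp
      rw [e]
      have : (γ * L) * (γ * L * s₄ ^ 4) ≤ 1 * (γ * L * s₄ ^ 4) := by gcongr
      linarith
    -- The threshold `A = 45 σ` works since `45 ^ 4 ≥ 100 · 40000`, and `40000 · 45 = 1800000` is
    -- the constant of `lyapunovNoise`.
    have n3 : 40000 * A * s ^ 2 ≤ 1 / 100 * A ^ 5 + 1800000 * (s ^ 2 * √s) := by
      set σ := √s with hσ
      have hσ2 : σ ^ 2 = s := Real.sq_sqrt hs0
      have hσ0 : 0 ≤ σ := Real.sqrt_nonneg _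
      rw [← hσ2]
      rcases le_total A (45 * σ) with h | h
      · have : A * σ ^ 4 ≤ 45 * σ * σ ^ 4 := by gcongr
        have : 0 ≤ A ^ 5 := by positivity
        linarith
      · have h5 : (45 * σ) ^ 4 ≤ A ^ 4 := by gcongr
        have h6 : A * (45 * σ) ^ 4 ≤ A * A ^ 4 := by gcongr
        have : 0 ≤ σ ^ 5 := by positivity
        have : 0 ≤ A * σ ^ 4 := by positivity
        linarith
    have n4 := mul_le_mul_of_nonneg_left n3 (by positivity : 0 ≤ k * (γ * μ))
    have n5 : k * (γ * A) * (μ * r ^ 2) ≤ k * (γ * A) * δ := by gcongr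
    have n6 : γ * (μ * r ^ 2) ≤ γ * δ := by gcongr
    have e5 : A ^ 5 = r ^ 2 * A := by rw [← hA2]; ring
    rw [e5] at n4
    have n7 : 0 ≤ γ * μ * s ^ 2 := by positivity
    have n8 : 0 ≤ γ * L * s₄ ^ 4 := by positivity
    rw [lyapunovNoise, lyapunov, ← hk, ← hA, ← hr]
    have E1 : (3 * γ ^ 2 + (40000 * k * A + 40000) * γ ^ 2) * τ₂ ^ 2 =
        40003 * (γ * μ * s ^ 2) + k * (γ * μ) * (40000 * A * s ^ 2) := by
      calc _ = (40003 + 40000 * k * A) * (γ ^ 2 * τ₂ ^ 2) := by ring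
        _ = _ := by rw [n1]; ring
    rw [E1, hcub]
    linarith

/-- The synchronous coupling contracts. -/
lemma drift_coupling (hR : RegularField D H T μ L) (hG : Oracle D G Pξ L τ₂ τ₄ τ₆) (hγ : 0 < γ)
    (hγL : γ * L ≤ 1) {t : ℝ} (ht0 : 0 ≤ t) (ht1 : t ≤ 1) :
    HasDrift Pξ (fun p : (Vec d × Vec d) × Z => (sgdStep G γ (p.1.1, p.2), sgdStep G γ (p.1.2, p.2)))
      (fun x => ‖x.1 - x.2‖ ^ 2)
      (fun x => (1 - t) * γ * inner ℝ (D x.1 - D x.2) (x.1 - x.2)) (t * (γ * μ)) 0 := by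
  have hμ := hR.pos
  have hL := hR.posL
  have hγμ := hR.mul_le_one hγ hγL
  have h0 : ∀ x : Vec d × Vec d, 0 ≤ inner ℝ (D x.1 - D x.2) (x.1 - x.2) := fun x =>
    (mul_nonneg hμ.le (sq_nonneg _)).trans (hR.mono x.1 x.2)
  have e : ∀ (x : Vec d × Vec d) z, ‖sgdStep G γ (x.1, z) - sgdStep G γ (x.2, z)‖ ^ 2 =
      ‖x.1 - x.2‖ ^ 2 - 2 * γ * inner ℝ (G x.1 z - G x.2 z) (x.1 - x.2) +
        γ ^ 2 * ‖G x.1 z - G x.2 z‖ ^ 2 := fun x z => by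
    have : sgdStep G γ (x.1, z) - sgdStep G γ (x.2, z) =
        (x.1 - x.2) - γ • (G x.1 z - G x.2 z) := by
      simp only [sgdStep, smul_sub]; abel
    rw [this, norm_sub_sq_real, inner_smul_right, real_inner_comm, norm_smul, mul_pow,
      Real.norm_eq_abs, sq_abs]
    ring
  have i1 : ∀ x : Vec d × Vec d, Integrable (fun z => G x.1 z - G x.2 z) Pξ := fun x =>
    (hG.integrable x.1).sub (hG.integrable x.2)
  have i2 : ∀ x : Vec d × Vec d, Integrable
      (fun z => ‖x.1 - x.2‖ ^ 2 - 2 * γ * inner ℝ (G x.1 z - G x.2 z) (x.1 - x.2)) Pξ := fun x =>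
    (integrable_const _).sub (((i1 x).inner_const _).const_mul _)
  have i3 : ∀ x : Vec d × Vec d, Integrable (fun z => γ ^ 2 * ‖G x.1 z - G x.2 z‖ ^ 2) Pξ :=
    fun x => (integrable_pow_of_memLp ((hG.memLp x.1).sub (hG.memLp x.2)) (by norm_num)).const_mul _
  refine ⟨(measurable_fst.sub measurable_snd).norm.pow_const 2, ?_, fun _ => by positivity,
    fun x => ?_, by positivity, ?_, le_rfl, fun x => ?_, fun x => ?_⟩
  · exact (((hR.continuous.comp continuous_fst).sub (hR.continuous.comp continuous_snd)).inner
      (continuous_fst.sub continuous_snd)).measurable.const_mul _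
  · have := h0 x
    have : 0 ≤ 1 - t := by linarith
    positivity
  · nlinarith
  · simp_rw [e]; exact (i2 x).add (i3 x)
  · simp_rw [e]
    rw [integral_add (i2 x) (i3 x), integral_sub (integrable_const _)
      (((i1 x).inner_const _).const_mul _), integral_const_mul, integral_const_mul]
    have e1 : ∫ z, inner ℝ (G x.1 z - G x.2 z) (x.1 - x.2) ∂Pξ =
        inner ℝ (D x.1 - D x.2) (x.1 - x.2) := by
      simp_rw [real_inner_comm (x.1 - x.2)]
      rw [_root_.integral_inner (i1 x), integral_sub (hG.integrable _) (hG.integrable _),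
        hG.mean, hG.mean]
    rw [e1]
    simp only [integral_const, probReal_univ, one_smul]
    have h1 := hG.coco 2 le_rfl (by norm_num) x.1 x.2
    norm_num at h1
    have h2 := hR.mono x.1 x.2
    have h3 := h0 x
    set δ := inner ℝ (D x.1 - D x.2) (x.1 - x.2)
    have h4 : γ ^ 2 * ∫ z, ‖G x.1 z - G x.2 z‖ ^ 2 ∂Pξ ≤ γ ^ 2 * (L * δ) := by gcongr
    -- One of the two copies of `γ δ` absorbs the second order term; `t` divides the other between
    -- contraction and rate.
    have h5 : γ * L * (γ * δ) ≤ 1 * (γ * δ) := by gcongr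
    have h6 : t * γ * (μ * ‖x.1 - x.2‖ ^ 2) ≤ t * γ * δ := by gcongr
    nlinarith

end Drifts

end RRSGD

/-! ### Moments, couplings and martingale noise along orbits -/

namespace RRSGD

section Orbit

variable {d : ℕ} {Z Ω : Type*} [MeasurableSpace Z] [mΩ : MeasurableSpace Ω]
  {P : Measure Ω} [IsProbabilityMeasure P] {Pξ : Measure Z} [IsProbabilityMeasure Pξ]
  {ξ : ℕ → Ω → Z} {θ₀ : Ω → Vec d}
  {D : Vec d → Vec d} {H : Vec d →L[ℝ] Vec d} {T : Vec d →L[ℝ] Vec d →L[ℝ] Vec d}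
  {G : Vec d → Z → Vec d} {μ L τ₂ τ₄ τ₆ γ : ℝ}

/-- The SGD chain started at a deterministic point. -/
noncomputable abbrev orbit (G : Vec d → Z → Vec d) (ξ : ℕ → Ω → Z) (γ : ℝ) (x : Vec d) :
    ℕ → Ω → Vec d := sgd G ξ (fun _ => x) γ

lemma orbit_isDriven (hG : Oracle D G Pξ L τ₂ τ₄ τ₆) (x : Vec d) :
    IsDriven ξ θ₀ (sgdStep G γ) (orbit G ξ γ x) :=
  isDriven_sgd hG.meas measurable_const

lemma orbit_measurable (hG : Oracle D G Pξ L τ₂ τ₄ τ₆) (hN : IsNoiseSequence P Pξ ξ θ₀)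
    (x : Vec d) (k : ℕ) : Measurable (orbit G ξ γ x k) :=
  (orbit_isDriven (θ₀ := θ₀) hG x).meas hN k

lemma integrable_const_orbit (V : Vec d → ℝ) (x : Vec d) :
    Integrable (fun ω => V (orbit G ξ γ x 0 ω)) P := integrable_const (V x)

lemma integral_orbit_zero {V : Vec d → ℝ} (x : Vec d) :
    ∫ ω, V (orbit G ξ γ x 0 ω) ∂P = V x := by
  change ∫ _, V x ∂P = V x
  simp

lemma orbit_sq_le (hR : RegularField D H T μ L) (hG : Oracle D G Pξ L τ₂ τ₄ τ₆)
    (hN : IsNoiseSequence P Pξ ξ θ₀) (hγ : 0 < γ) (hγL : γ * L ≤ 1) (x : Vec d) (k : ℕ) :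
    ∫ ω, ‖orbit G ξ γ x k ω‖ ^ 2 ∂P ≤
      (1 - γ * μ / 4) ^ k * ‖x‖ ^ 2 + 12 * (γ * τ₂ ^ 2 / μ) := by
  have hμ := hR.pos
  have h := (drift_sq hR hG hγ hγL).integral_le hN (orbit_isDriven hG x)
    (integrable_const_orbit (fun x => ‖x‖ ^ 2) x) (by positivity) k
  rw [integral_orbit_zero (V := fun x => ‖x‖ ^ 2)] at h
  refine h.trans (le_of_eq ?_)
  congr 1
  field_simp
  ring

lemma orbit_memLp (hR : RegularField D H T μ L) (hG : Oracle D G Pξ L τ₂ τ₄ τ₆)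
    (hN : IsNoiseSequence P Pξ ξ θ₀) (hγ : 0 < γ) (hγL : γ * L ≤ 1) (x : Vec d) (k : ℕ) :
    MemLp (orbit G ξ γ x k) 2 P :=
  (memLp_two_iff_integrable_sq_norm (orbit_measurable hG hN x k).aestronglyMeasurable).2
    ((drift_sq hR hG hγ hγL).integrable_process hN (orbit_isDriven hG x)
      (integrable_const_orbit (fun x => ‖x‖ ^ 2) x) k)

lemma orbit_zero_sq_le (hR : RegularField D H T μ L) (hG : Oracle D G Pξ L τ₂ τ₄ τ₆)
    (hN : IsNoiseSequence P Pξ ξ θ₀) (hγ : 0 < γ) (hγL : γ * L ≤ 1) (k : ℕ) :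
    ∫ ω, ‖orbit G ξ γ 0 k ω‖ ^ 2 ∂P ≤ 12 * (γ * τ₂ ^ 2 / μ) := by
  simpa using orbit_sq_le hR hG hN hγ hγL 0 k

/-- Summed dissipation from `drift_sq`. The average of `⟪D x, x⟫` is of order `γ τ₂² = μ (γ τ₂² /
μ)`, better by a factor `L/μ` than the pointwise bound `L‖x‖²` would give. -/
lemma orbit_zero_sum_field_le (hR : RegularField D H T μ L) (hG : Oracle D G Pξ L τ₂ τ₄ τ₆)
    (hN : IsNoiseSequence P Pξ ξ θ₀) (hγ : 0 < γ) (hγL : γ * L ≤ 1) (N : ℕ) :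
    ∑ k ∈ Finset.range N, ∫ ω, inner ℝ (D (orbit G ξ γ 0 k ω)) (orbit G ξ γ 0 k ω) ∂P ≤
      N * (12 * (γ * τ₂ ^ 2)) := by
  have h := (drift_sq hR hG hγ hγL).sum_le hN (orbit_isDriven hG 0)
    (integrable_const_orbit (fun x => ‖x‖ ^ 2) 0) 0 N
  rw [integral_orbit_zero (V := fun x => ‖x‖ ^ 2)] at h
  simp only [zero_add, norm_zero, integral_const_mul, ← Finset.mul_sum] at h
  have : γ / 4 * ∑ k ∈ Finset.range N,
      ∫ ω, inner ℝ (D (orbit G ξ γ 0 k ω)) (orbit G ξ γ 0 k ω) ∂P ≤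
      γ / 4 * (N * (12 * (γ * τ₂ ^ 2))) := by
    refine h.trans (le_of_eq ?_); ring
  exact le_of_mul_le_mul_left this (by positivity)

lemma orbit_integrable_field (hR : RegularField D H T μ L) (hG : Oracle D G Pξ L τ₂ τ₄ τ₆)
    (hN : IsNoiseSequence P Pξ ξ θ₀) (hγ : 0 < γ) (hγL : γ * L ≤ 1) (x : Vec d) (k : ℕ) :
    Integrable (fun ω => inner ℝ (D (orbit G ξ γ x k ω)) (orbit G ξ γ x k ω)) P := by
  have := ((drift_sq hR hG hγ hγL).integrable_rate hN (orbit_isDriven hG x)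
    (integrable_const_orbit (fun x => ‖x‖ ^ 2) x) k).const_mul (4 / γ)
  refine this.congr (Filter.Eventually.of_forall fun ω => ?_)
  field_simp

lemma orbit_zero_four_le (hR : RegularField D H T μ L) (hG : Oracle D G Pξ L τ₂ τ₄ τ₆)
    (hN : IsNoiseSequence P Pξ ξ θ₀) (hγ : 0 < γ) (hγL : γ * L ≤ 1 / 30) (k : ℕ) :
    Integrable (fun ω => ‖orbit G ξ γ 0 k ω‖ ^ 4) P ∧
      ∫ ω, ‖orbit G ξ γ 0 k ω‖ ^ 4 ∂P ≤ 88 * (γ * τ₄ ^ 2 / μ) ^ 2 := by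
  have hμ := hR.pos
  have hd := drift_four hR hG hγ hγL
  have h := hd.integral_le hN (orbit_isDriven hG 0)
    (integrable_const_orbit (fun x => ‖x‖ ^ 4) 0) (by positivity) k
  rw [integral_orbit_zero (V := fun x => ‖x‖ ^ 4)] at h
  refine ⟨hd.integrable_process hN (orbit_isDriven hG 0) (integrable_const_orbit (fun x => ‖x‖ ^ 4) 0) k,
    h.trans (le_of_eq ?_)⟩
  rw [norm_zero]
  field_simp
  ring

/-- The same gain of a factor `L/μ` at order four, from the rate kept in `drift_four`. -/
lemma orbit_zero_sum_four_le (hR : RegularField D H T μ L) (hG : Oracle D G Pξ L τ₂ τ₄ τ₆)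
    (hN : IsNoiseSequence P Pξ ξ θ₀) (hγ : 0 < γ) (hγL : γ * L ≤ 1 / 30) (N : ℕ) :
    (∀ k, Integrable (fun ω => ‖orbit G ξ γ 0 k ω‖ ^ 2 *
      inner ℝ (D (orbit G ξ γ 0 k ω)) (orbit G ξ γ 0 k ω)) P) ∧
    ∑ k ∈ Finset.range N, ∫ ω, ‖orbit G ξ γ 0 k ω‖ ^ 2 *
      inner ℝ (D (orbit G ξ γ 0 k ω)) (orbit G ξ γ 0 k ω) ∂P ≤
      N * (88 * (μ * (γ * τ₄ ^ 2 / μ) ^ 2)) := by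
  have hμ := hR.pos
  have hd := drift_four hR hG hγ hγL
  constructor
  · intro k
    have := (hd.integrable_rate hN (orbit_isDriven hG 0)
      (integrable_const_orbit (fun x => ‖x‖ ^ 4) 0) k).const_mul (1 / γ)
    refine this.congr (Filter.Eventually.of_forall fun ω => ?_)
    field_simp
  have h := hd.sum_le hN (orbit_isDriven hG 0) (integrable_const_orbit (fun x => ‖x‖ ^ 4) 0) 0 N
  rw [integral_orbit_zero (V := fun x => ‖x‖ ^ 4)] at h
  simp only [zero_add, norm_zero, integral_const_mul, ← Finset.mul_sum] at h
  refine le_of_mul_le_mul_left (h.trans (le_of_eq ?_)) hγ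
  field_simp
  ring

lemma orbit_zero_six_le (hR : RegularField D H T μ L) (hG : Oracle D G Pξ L τ₂ τ₄ τ₆)
    (hN : IsNoiseSequence P Pξ ξ θ₀) (hγ : 0 < γ) (hγL : γ * L ≤ 1 / 30) (k : ℕ) :
    Integrable (fun ω => ‖orbit G ξ γ 0 k ω‖ ^ 6) P ∧
      ∫ ω, ‖orbit G ξ γ 0 k ω‖ ^ 6 ∂P ≤ 1260288 * (γ * τ₆ ^ 2 / μ) ^ 3 := by
  have hμ := hR.pos
  have hd := drift_six hR hG hγ hγL
  have h := hd.integral_le hN (orbit_isDriven hG 0)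
    (integrable_const_orbit (fun x => ‖x‖ ^ 6) 0) (by positivity) k
  rw [integral_orbit_zero (V := fun x => ‖x‖ ^ 6)] at h
  refine ⟨hd.integrable_process hN (orbit_isDriven hG 0) (integrable_const_orbit (fun x => ‖x‖ ^ 6) 0) k,
    h.trans (le_of_eq ?_)⟩
  rw [norm_zero]
  field_simp
  ring

/-- Contraction of two orbits driven by the same noise, from arbitrary initial points. -/
lemma sgd_coupling_le (hR : RegularField D H T μ L) (hG : Oracle D G Pξ L τ₂ τ₄ τ₆)
    (hN : IsNoiseSequence P Pξ ξ θ₀) (hγ : 0 < γ) (hγL : γ * L ≤ 1) {x₀ y₀ : Ω → Vec d}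
    (hx : Measurable[past ξ θ₀ 0] x₀) (hy : Measurable[past ξ θ₀ 0] y₀)
    (hi : Integrable (fun ω => ‖x₀ ω - y₀ ω‖ ^ 2) P) (k : ℕ) :
    Integrable (fun ω => ‖sgd G ξ x₀ γ k ω - sgd G ξ y₀ γ k ω‖ ^ 2) P ∧
    ∫ ω, ‖sgd G ξ x₀ γ k ω - sgd G ξ y₀ γ k ω‖ ^ 2 ∂P ≤
      (1 - γ * μ) ^ k * ∫ ω, ‖x₀ ω - y₀ ω‖ ^ 2 ∂P := by
  have hμ := hR.pos
  have hd := drift_coupling hR hG hγ hγL zero_le_one le_rfl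
  have hdr := (isDriven_sgd (ξ := ξ) (θ₀ := θ₀) (γ := γ) hG.meas hx).pair
    (isDriven_sgd (ξ := ξ) (θ₀ := θ₀) (γ := γ) hG.meas hy)
  have h := hd.integral_le hN hdr hi (by positivity) k
  rw [zero_div, add_zero, one_mul] at h
  exact ⟨hd.integrable_process hN hdr hi k, h⟩

lemma orbit_coupling_le (hR : RegularField D H T μ L) (hG : Oracle D G Pξ L τ₂ τ₄ τ₆)
    (hN : IsNoiseSequence P Pξ ξ θ₀) (hγ : 0 < γ) (hγL : γ * L ≤ 1) (x y : Vec d) (k : ℕ) :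
    ∫ ω, ‖orbit G ξ γ x k ω - orbit G ξ γ y k ω‖ ^ 2 ∂P ≤ (1 - γ * μ) ^ k * ‖x - y‖ ^ 2 := by
  have h := (sgd_coupling_le hR hG hN hγ hγL (measurable_const (a := x))
    (measurable_const (a := y)) (integrable_const _) k).2
  simpa using h

/-- Iterates of the transition operator are expectations along orbits. -/
lemma transition_iterate_eq (hR : RegularField D H T μ L) (hG : Oracle D G Pξ L τ₂ τ₄ τ₆)
    (hN : IsNoiseSequence P Pξ ξ θ₀) (hγ : 0 < γ) (hγL : γ * L ≤ 1) {h : Vec d → Vec d}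
    (hh : LinearGrowth h) (x : Vec d) (l : ℕ) :
    (transition G Pξ γ)^[l] h x = ∫ ω, h (orbit G ξ γ x l ω) ∂P := by
  have := integral_iterate (x₀ := fun _ => x) hR.posL.le hR.norm_le hR.zero hN hG
    measurable_const (orbit_memLp hR hG hN hγ hγL x) 0 l hh
  rw [zero_add] at this
  rw [this]
  change _ = ∫ _, (transition G Pξ γ)^[l] h x ∂P
  simp

/-- Both iterates are expectations along orbits driven by the same noise, so that coupling estimates
bound the oscillation of conditional expectations. -/
lemma norm_transition_iterate_sub_le (hR : RegularField D H T μ L)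
    (hG : Oracle D G Pξ L τ₂ τ₄ τ₆)
    (hN : IsNoiseSequence P Pξ ξ θ₀) (hγ : 0 < γ) (hγL : γ * L ≤ 1) {h : Vec d → Vec d}
    (hh : LinearGrowth h) (x : Vec d) (l : ℕ) :
    ‖(transition G Pξ γ)^[l] h x - (transition G Pξ γ)^[l] h 0‖ ≤
      ∫ ω, ‖h (orbit G ξ γ x l ω) - h (orbit G ξ γ 0 l ω)‖ ∂P := by
  rw [transition_iterate_eq hR hG hN hγ hγL hh, transition_iterate_eq hR hG hN hγ hγL hh]
  have i := fun y => (hh.memLp (orbit_memLp hR hG hN hγ hγL y l)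
    (orbit_measurable hG hN y l)).integrable (by norm_num)
  rw [← integral_sub (i x) (i 0)]
  exact norm_integral_le_integral_norm _

/-- The noise of the stochastic gradient along an orbit. -/
noncomputable def gradNoise (D : Vec d → Vec d) (G : Vec d → Z → Vec d) (ξ : ℕ → Ω → Z) (γ : ℝ)
    (k : ℕ) (ω : Ω) : Vec d :=
  G (orbit G ξ γ 0 k ω) (ξ (k + 1) ω) - D (orbit G ξ γ 0 k ω)

lemma measurable_gradNoise (hR : RegularField D H T μ L) (hG : Oracle D G Pξ L τ₂ τ₄ τ₆)
    (k : ℕ) : Measurable[past ξ θ₀ (k + 1)] (gradNoise D G ξ γ k) := by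
  have h1 : Measurable[past ξ θ₀ (k + 1)] (orbit G ξ γ 0 k) :=
    ((orbit_isDriven hG 0).adapted k).mono (past_mono k.le_succ) le_rfl
  exact (hG.meas.comp (h1.prodMk (measurable_past_noise le_rfl))).sub
    (hR.continuous.measurable.comp h1)

lemma gradNoise_sq (hR : RegularField D H T μ L) (hG : Oracle D G Pξ L τ₂ τ₄ τ₆)
    (hN : IsNoiseSequence P Pξ ξ θ₀) (hγ : 0 < γ) (hγL : γ * L ≤ 1) (k : ℕ) :
    MemLp (gradNoise D G ξ γ k) 2 P ∧
      ∫ ω, ‖gradNoise D G ξ γ k ω‖ ^ 2 ∂P ≤ 2 * τ₂ ^ 2 + 24 * L ^ 2 * (γ * τ₂ ^ 2 / μ) := by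
  have hm : Measurable (gradNoise D G ξ γ k) :=
    (measurable_gradNoise hR hG k).mono (past_le hN (k + 1)) le_rfl
  set F : Vec d × Z → ℝ := fun p => ‖G p.1 p.2 - D p.1‖ ^ 2
  have hF : Measurable F :=
    ((hG.meas.sub (hR.continuous.measurable.comp measurable_fst)).norm.pow_const 2)
  have h2 : ∀ x, MemLp (fun z => G x z - D x) 2 Pξ := fun x =>
    (hG.memLp_of_le x (by norm_num)).sub (memLp_const _)
  have hb : ∀ x, ∫ z, F (x, z) ∂Pξ ≤ 2 * (L * ‖x‖) ^ 2 + 2 * τ₂ ^ 2 := fun x => by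
    have := integral_inner_centered (hG.memLp_of_le x (p := 2) (by norm_num))
      (hG.memLp_of_le x (p := 2) (by norm_num))
    simp only [hG.mean, real_inner_self_eq_norm_sq] at this
    refine this.le.trans ?_
    linarith [hG.integral_norm_le hR.posL.le hR.norm_le hR.zero x, sq_nonneg ‖D x‖]
  have hX := orbit_memLp hR hG hN hγ hγL 0 k
  have hdom : Integrable (fun ω => 2 * (L * ‖orbit G ξ γ 0 k ω‖) ^ 2 + 2 * τ₂ ^ 2) P := by
    simp_rw [mul_pow]
    exact (((integrable_norm_sq hX).const_mul _).const_mul _).add (integrable_const _)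
  have had := (orbit_isDriven (ξ := ξ) (θ₀ := θ₀) (γ := γ) hG 0).adapted k
  have hmF : Measurable fun x => ∫ z, F (x, z) ∂Pξ :=
    (hF.stronglyMeasurable.integral_prod_right').measurable
  have hi0 : Integrable (fun ω => ∫ z, F (orbit G ξ γ 0 k ω, z) ∂Pξ) P := by
    refine hdom.mono' (hmF.comp (orbit_measurable hG hN 0 k)).aestronglyMeasurable
      (Filter.Eventually.of_forall fun ω => ?_)
    rw [Real.norm_of_nonneg (integral_nonneg fun z => sq_nonneg _)]
    exact hb _
  have hi : Integrable (fun ω => F (orbit G ξ γ 0 k ω, ξ (k + 1) ω)) P := by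
    refine integrable_noise hN had hF (fun x => integrable_norm_sq (h2 x)) ?_
    have : ∀ p, ‖F p‖ = F p := fun p => Real.norm_of_nonneg (sq_nonneg _)
    simp_rw [this]
    exact hi0
  refine ⟨(memLp_two_iff_integrable_sq_norm hm.aestronglyMeasurable).2 hi, ?_⟩
  refine (integral_noise hN had hF hi).2.le.trans ?_
  refine (integral_mono hi0 hdom fun ω => hb _).trans ?_
  have e : ∫ ω, (2 * (L * ‖orbit G ξ γ 0 k ω‖) ^ 2 + 2 * τ₂ ^ 2) ∂P =
      2 * (L ^ 2 * ∫ ω, ‖orbit G ξ γ 0 k ω‖ ^ 2 ∂P) + 2 * τ₂ ^ 2 := by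
    simp_rw [mul_pow]
    rw [integral_add (((integrable_norm_sq hX).const_mul _).const_mul _) (integrable_const _),
      integral_const_mul, integral_const_mul]
    simp
  rw [e]
  have := mul_le_mul_of_nonneg_left (orbit_zero_sq_le hR hG hN hγ hγL k) (sq_nonneg L)
  linarith

/-- The sum of the noises is a martingale. -/
lemma gradNoise_sum_sq_le (hR : RegularField D H T μ L) (hG : Oracle D G Pξ L τ₂ τ₄ τ₆)
    (hN : IsNoiseSequence P Pξ ξ θ₀) (hγ : 0 < γ) (hγL : γ * L ≤ 1) (m n : ℕ) :
    ∫ ω, ‖∑ k ∈ Finset.range n, gradNoise D G ξ γ (m + k) ω‖ ^ 2 ∂P ≤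
      n * (2 * τ₂ ^ 2 + 24 * L ^ 2 * (γ * τ₂ ^ 2 / μ)) := by
  have h2 := fun k => (gradNoise_sq hR hG hN hγ hγL k).1
  have hS : ∀ n, MemLp (fun ω => ∑ k ∈ Finset.range n, gradNoise D G ξ γ (m + k) ω) 2 P :=
    fun n => memLp_finsetSum _ fun k _ => h2 (m + k)
  induction n with
  | zero => simp
  | succ n ih =>
    have had := (orbit_isDriven (ξ := ξ) (θ₀ := θ₀) (γ := γ) hG 0).adapted (m + n)
    have hA : Measurable[past ξ θ₀ (m + n)]
        fun ω => ∑ k ∈ Finset.range n, gradNoise D G ξ γ (m + k) ω := by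
      refine Finset.measurable_fun_sum _ fun k hk => ?_
      refine (measurable_gradNoise hR hG (m + k)).mono (past_mono ?_) le_rfl
      have := Finset.mem_range.1 hk
      omega
    set F : (Vec d × Vec d) × Z → ℝ := fun p => inner ℝ p.1.1 (G p.1.2 p.2 - D p.1.2)
    have hF : Measurable F := by
      have h1 : Measurable fun p : (Vec d × Vec d) × Z => G p.1.2 p.2 :=
        hG.meas.comp (f := fun p : (Vec d × Vec d) × Z => (p.1.2, p.2)) (by fun_prop)
      exact (measurable_fst.comp measurable_fst).inner
        (h1.sub (hR.continuous.measurable.comp (measurable_snd.comp measurable_fst)))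
    -- The sum up to time `m + n` depends only on the past and the next noise has zero conditional
    -- mean, so the cross term vanishes.
    have hcross := (integral_noise hN (hA.prodMk had) hF
      (integrable_inner (hS n) (h2 (m + n)))).2
    have hz : ∀ ω, ∫ z, F ((∑ k ∈ Finset.range n, gradNoise D G ξ γ (m + k) ω,
        orbit G ξ γ 0 (m + n) ω), z) ∂Pξ = 0 := fun ω => by
      simp only [F]
      have i : Integrable (fun z => G (orbit G ξ γ 0 (m + n) ω) z -
        D (orbit G ξ γ 0 (m + n) ω)) Pξ := (hG.integrable _).sub (integrable_const _)
      rw [_root_.integral_inner i, integral_sub (hG.integrable _) (integrable_const _), hG.mean]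
      simp
    simp_rw [hz] at hcross
    simp_rw [Finset.sum_range_succ, norm_add_sq_real]
    have i1 := integrable_norm_sq (hS n)
    have i2 : Integrable (fun ω => 2 * inner ℝ (∑ k ∈ Finset.range n, gradNoise D G ξ γ (m + k) ω)
      (gradNoise D G ξ γ (m + n) ω)) P := (integrable_inner (hS n) (h2 (m + n))).const_mul 2
    rw [integral_add (by exact i1.add i2) (integrable_norm_sq (h2 (m + n))), integral_add i1 i2,
      integral_const_mul]
    have e : ∫ ω, inner ℝ (∑ k ∈ Finset.range n, gradNoise D G ξ γ (m + k) ω)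
      (gradNoise D G ξ γ (m + n) ω) ∂P = 0 := hcross.trans (by simp)
    rw [e]
    have := (gradNoise_sq hR hG hN hγ hγL (m + n)).2
    push_cast
    linarith

/-- Summation of the recursion along an orbit. -/
lemma orbit_sum_eq (m n : ℕ) (ω : Ω) :
    γ • ∑ k ∈ Finset.range n, H (orbit G ξ γ 0 (m + k) ω) =
      orbit G ξ γ 0 m ω - orbit G ξ γ 0 (m + n) ω -
      γ • ∑ k ∈ Finset.range n, (D (orbit G ξ γ 0 (m + k) ω) - H (orbit G ξ γ 0 (m + k) ω)) -
      γ • ∑ k ∈ Finset.range n, gradNoise D G ξ γ (m + k) ω := by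
  induction n with
  | zero => simp
  | succ n ih =>
    have e : orbit G ξ γ 0 (m + (n + 1)) ω = orbit G ξ γ 0 (m + n) ω -
        γ • G (orbit G ξ γ 0 (m + n) ω) (ξ (m + n + 1) ω) := rfl
    rw [Finset.sum_range_succ, smul_add, ih, Finset.sum_range_succ, Finset.sum_range_succ, e,
      gradNoise]
    simp only [smul_add, smul_sub]
    abel

end Orbit

end RRSGD

/-! ### Fluctuations of the averages for small steps -/

namespace RRSGD

lemma sum_sqrt_geom_le {x : ℝ} (hx : 0 < x) (hx1 : x ≤ 1) (m : ℕ) :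
    ∑ l ∈ Finset.range m, √((1 - x) ^ l) ≤ 2 / x := by
  have h0 : 0 ≤ 1 - x := by linarith
  set q := √(1 - x) with hq
  have hq0 : 0 ≤ q := Real.sqrt_nonneg _
  have hq1 : q ≤ 1 - x / 2 := by
    refine Real.sqrt_le_iff.2 ⟨by linarith, by nlinarith [sq_nonneg x]⟩
  have e : ∀ l : ℕ, √((1 - x) ^ l) = q ^ l := fun l => by
    have : (1 - x) ^ l = (q ^ l) ^ 2 := by rw [← pow_mul, mul_comm, pow_mul, Real.sq_sqrt h0]
    rw [this, Real.sqrt_sq (pow_nonneg hq0 l)]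
  simp_rw [e]
  have hlt : q < 1 := by linarith
  rw [geom_sum_eq hlt.ne, ← neg_div_neg_eq, neg_sub, neg_sub]
  rw [div_le_div_iff₀ (by linarith) hx]
  have : 0 ≤ q ^ m := by positivity
  nlinarith

section L2

variable {Ω : Type*} [MeasurableSpace Ω] {P : Measure Ω} {d : ℕ}

lemma integral_norm_add_sq_le {f g : Ω → Vec d} (hf : MemLp f 2 P) (hg : MemLp g 2 P) :
    ∫ ω, ‖f ω + g ω‖ ^ 2 ∂P ≤ 2 * ∫ ω, ‖f ω‖ ^ 2 ∂P + 2 * ∫ ω, ‖g ω‖ ^ 2 ∂P := by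
  have i1 := (integrable_norm_sq hf).const_mul 2
  have i2 := (integrable_norm_sq hg).const_mul 2
  have := integral_mono (integrable_norm_sq (hf.add hg)) (i1.add i2) fun ω => (by
    change ‖f ω + g ω‖ ^ 2 ≤ 2 * ‖f ω‖ ^ 2 + 2 * ‖g ω‖ ^ 2
    nlinarith [norm_add_le (f ω) (g ω), norm_nonneg (f ω + g ω), sq_nonneg (‖f ω‖ - ‖g ω‖)])
  rw [integral_add' i1 i2, integral_const_mul, integral_const_mul] at this
  exact this

lemma integral_norm_sub_sq_le {f g : Ω → Vec d} (hf : MemLp f 2 P) (hg : MemLp g 2 P) :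
    ∫ ω, ‖f ω - g ω‖ ^ 2 ∂P ≤ 2 * ∫ ω, ‖f ω‖ ^ 2 ∂P + 2 * ∫ ω, ‖g ω‖ ^ 2 ∂P := by
  simpa [sub_eq_add_neg] using integral_norm_add_sq_le hf hg.neg

end L2

section SmallStep

variable {d : ℕ} {Z Ω : Type*} [MeasurableSpace Z] [mΩ : MeasurableSpace Ω]
  {P : Measure Ω} [IsProbabilityMeasure P] {Pξ : Measure Z} [IsProbabilityMeasure Pξ]
  {ξ : ℕ → Ω → Z} {θ₀ : Ω → Vec d}
  {D : Vec d → Vec d} {H : Vec d →L[ℝ] Vec d} {T : Vec d →L[ℝ] Vec d →L[ℝ] Vec d}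
  {G : Vec d → Z → Vec d} {μ L τ₂ τ₄ τ₆ γ : ℝ}

lemma RegularField.linearGrowth_rem (hR : RegularField D H T μ L) :
    LinearGrowth fun x => D x - H x := by
  have hL := hR.posL
  refine ⟨(hR.continuous.sub H.continuous).measurable, 2 * L, by positivity, fun x => ?_⟩
  have := (norm_sub_le (D x) (H x)).trans (add_le_add (hR.norm_le x) (hR.hnorm x))
  linarith

lemma RegularField.linearGrowth_hessian (hR : RegularField D H T μ L) :
    LinearGrowth fun x => H x := by
  have hL := hR.posL
  refine ⟨H.continuous.measurable, L, hL.le, fun x => (hR.hnorm x).trans ?_⟩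
  linarith

/-- The variance of the sum of the nonlinear remainders along the chain. -/
lemma rem_variance_le (hR : RegularField D H T μ L) (hG : Oracle D G Pξ L τ₂ τ₄ τ₆)
    (hN : IsNoiseSequence P Pξ ξ θ₀) (hγ : 0 < γ) (hγL : γ * L ≤ 1 / 30) (m n : ℕ) :
    ∫ ω, ‖∑ k ∈ Finset.range n, ((D (orbit G ξ γ 0 (m + k) ω) - H (orbit G ξ γ 0 (m + k) ω)) -
        ∫ ω, (D (orbit G ξ γ 0 (m + k) ω) - H (orbit G ξ γ 0 (m + k) ω)) ∂P)‖ ^ 2 ∂P ≤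
      n * (6192 * (L ^ 2 * (γ * τ₄ ^ 2 / μ) ^ 2 / (γ * μ))) := by
  have hμ := hR.pos
  have hL := hR.posL
  have hγL1 : γ * L ≤ 1 := hγL.trans (by norm_num)
  have hγμ := hR.mul_le_one hγ hγL1
  have hγμ0 : 0 < γ * μ := by positivity
  set v := γ * τ₂ ^ 2 / μ with hv
  set v₄ := γ * τ₄ ^ 2 / μ with hv₄
  have hv0 : 0 ≤ v := by positivity
  have hvv : v ≤ v₄ := by
    have := pow_le_pow_left₀ hG.nonneg hG.le24 2
    rw [hv, hv₄]; gcongr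
  -- Cauchy–Schwarz for the local Lipschitz bound `rem_lip`: `2‖x‖² + 48 v` bounds the second moment
  -- of the sum of the norms, the coupled distance is at most `√((1 - γμ)^l) ‖x‖`, and the square
  -- roots sum to at most `2 / (γμ)`.
  set U : Vec d → ℝ := fun x => 2 / (γ * μ) * (L * (√(2 * ‖x‖ ^ 2 + 48 * v) * ‖x‖)) with hU
  have hosc : ∀ m x, ∑ l ∈ Finset.range m, ‖(transition G Pξ γ)^[l] (fun x => D x - H x) x -
      (transition G Pξ γ)^[l] (fun x => D x - H x) 0‖ ≤ U x := fun m x => by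
    have hterm : ∀ l, ‖(transition G Pξ γ)^[l] (fun x => D x - H x) x -
        (transition G Pξ γ)^[l] (fun x => D x - H x) 0‖ ≤
        √((1 - γ * μ) ^ l) * (L * (√(2 * ‖x‖ ^ 2 + 48 * v) * ‖x‖)) := fun l => by
      refine (norm_transition_iterate_sub_le hR hG hN hγ hγL1 hR.linearGrowth_rem x l).trans ?_
      have hX := orbit_memLp hR hG hN hγ hγL1 x l
      have hX' := orbit_memLp hR hG hN hγ hγL1 0 l
      have hs : MemLp (fun ω => ‖orbit G ξ γ x l ω‖ + ‖orbit G ξ γ 0 l ω‖) 2 P :=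
        hX.norm.add hX'.norm
      have hy : MemLp (fun ω => ‖orbit G ξ γ x l ω - orbit G ξ γ 0 l ω‖) 2 P :=
        (hX.sub hX').norm
      have hrem := hR.linearGrowth_rem
      have i1 := ((hrem.memLp hX (orbit_measurable hG hN x l)).sub
        (hrem.memLp hX' (orbit_measurable hG hN 0 l))).norm.integrable (by norm_num)
      have i2 := (MemLp.integrable_mul (p := 2) (q := 2) hs hy).const_mul L
      have b1 : ∫ ω, ‖(D (orbit G ξ γ x l ω) - H (orbit G ξ γ x l ω)) -
          (D (orbit G ξ γ 0 l ω) - H (orbit G ξ γ 0 l ω))‖ ∂P ≤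
          L * ∫ ω, (‖orbit G ξ γ x l ω‖ + ‖orbit G ξ γ 0 l ω‖) *
            ‖orbit G ξ γ x l ω - orbit G ξ γ 0 l ω‖ ∂P := by
        rw [← integral_const_mul]
        refine integral_mono i1 i2 fun ω => (hR.rem_lip _ _).trans (le_of_eq ?_)
        change _ = L * ((‖orbit G ξ γ x l ω‖ + ‖orbit G ξ γ 0 l ω‖) *
            ‖orbit G ξ γ x l ω - orbit G ξ γ 0 l ω‖)
        ring
      refine b1.trans ?_
      have b2 := integral_mul_le_sqrt hs hy
      have b3 : ∫ ω, (‖orbit G ξ γ x l ω‖ + ‖orbit G ξ γ 0 l ω‖) ^ 2 ∂P ≤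
          2 * ‖x‖ ^ 2 + 48 * v := by
        have j1 := (integrable_norm_sq hX).const_mul 2
        have j2 := (integrable_norm_sq hX').const_mul 2
        have := integral_mono hs.integrable_sq (j1.add j2) fun ω => (by
          change (‖orbit G ξ γ x l ω‖ + ‖orbit G ξ γ 0 l ω‖) ^ 2 ≤
            2 * ‖orbit G ξ γ x l ω‖ ^ 2 + 2 * ‖orbit G ξ γ 0 l ω‖ ^ 2
          nlinarith [sq_nonneg (‖orbit G ξ γ x l ω‖ - ‖orbit G ξ γ 0 l ω‖)])
        rw [integral_add' j1 j2, integral_const_mul, integral_const_mul] at this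
        have h1 := orbit_sq_le hR hG hN hγ hγL1 x l
        have h2 := orbit_zero_sq_le hR hG hN hγ hγL1 l
        have h3 : (1 - γ * μ / 4) ^ l * ‖x‖ ^ 2 ≤ 1 * ‖x‖ ^ 2 := by
          gcongr
          exact pow_le_one₀ (by linarith) (by linarith)
        rw [← hv] at h1 h2
        linarith
      have b4 := orbit_coupling_le hR hG hN hγ hγL1 x 0 l
      rw [sub_zero] at b4
      have b5 : √(∫ ω, ‖orbit G ξ γ x l ω - orbit G ξ γ 0 l ω‖ ^ 2 ∂P) ≤
          √((1 - γ * μ) ^ l) * ‖x‖ := by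
        refine (Real.sqrt_le_sqrt b4).trans (le_of_eq ?_)
        rw [Real.sqrt_mul (pow_nonneg (by linarith) l), Real.sqrt_sq (norm_nonneg x)]
      have b6 := mul_le_mul (Real.sqrt_le_sqrt b3) b5 (Real.sqrt_nonneg _) (Real.sqrt_nonneg _)
      have b7 := mul_le_mul_of_nonneg_left (b2.trans b6) hL.le
      refine b7.trans (le_of_eq ?_)
      ring
    refine (Finset.sum_le_sum fun l _ => hterm l).trans ?_
    rw [← Finset.sum_mul]
    exact mul_le_mul_of_nonneg_right (sum_sqrt_geom_le hγμ0 hγμ m) (by positivity)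
  have hUm : Measurable U := by
    refine Measurable.const_mul (Measurable.const_mul ?_ _) _
    exact ((((measurable_norm.pow_const 2).const_mul _).add_const _).sqrt).mul measurable_norm
  have hU2 : ∀ x, U x ^ 2 = (2 / (γ * μ)) ^ 2 * L ^ 2 * (2 * ‖x‖ ^ 4 + 48 * v * ‖x‖ ^ 2) :=
    fun x => by
      simp only [hU]
      rw [mul_pow, mul_pow, mul_pow, Real.sq_sqrt (by positivity)]
      ring
  have i4 := fun k => (orbit_zero_four_le hR hG hN hγ hγL k).1
  have i2 := fun k => integrable_norm_sq (orbit_memLp hR hG hN hγ hγL1 0 k)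
  have iU : ∀ k, Integrable (fun ω => U (orbit G ξ γ 0 k ω) ^ 2) P := fun k => by
    simp_rw [hU2]
    exact (((i4 k).const_mul _).add ((i2 k).const_mul _)).const_mul _
  have hEU : ∀ k, ∫ ω, U (orbit G ξ γ 0 k ω) ^ 2 ∂P ≤
      3008 * ((1 / (γ * μ)) ^ 2 * (L ^ 2 * v₄ ^ 2)) := fun k => by
    simp_rw [hU2]
    rw [integral_const_mul, integral_add ((i4 k).const_mul _) ((i2 k).const_mul _),
      integral_const_mul, integral_const_mul]
    have h1 := (orbit_zero_four_le hR hG hN hγ hγL k).2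
    have h2 := orbit_zero_sq_le hR hG hN hγ hγL1 k
    rw [← hv] at h2
    rw [← hv₄] at h1
    have h3 : 2 * ∫ ω, ‖orbit G ξ γ 0 k ω‖ ^ 4 ∂P +
        48 * v * ∫ ω, ‖orbit G ξ γ 0 k ω‖ ^ 2 ∂P ≤ 752 * v₄ ^ 2 := by
      have : 48 * v * ∫ ω, ‖orbit G ξ γ 0 k ω‖ ^ 2 ∂P ≤ 48 * v * (12 * v) := by gcongr
      nlinarith
    have h4 := mul_le_mul_of_nonneg_left h3
      (by positivity : 0 ≤ (2 / (γ * μ)) ^ 2 * L ^ 2)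
    refine h4.trans (le_of_eq ?_)
    ring
  have hEh : ∀ k, ∫ ω, ‖D (orbit G ξ γ 0 k ω) - H (orbit G ξ γ 0 k ω)‖ ^ 2 ∂P ≤
      88 * (L ^ 2 * v₄ ^ 2) := fun k => by
    have h1 := (orbit_zero_four_le hR hG hN hγ hγL k).2
    have hm := hR.linearGrowth_rem.memLp (orbit_memLp hR hG hN hγ hγL1 0 k)
      (orbit_measurable hG hN 0 k)
    have h2 := integral_mono (integrable_norm_sq hm) ((i4 k).const_mul (L ^ 2)) fun ω => (by
      change ‖D (orbit G ξ γ 0 k ω) - H (orbit G ξ γ 0 k ω)‖ ^ 2 ≤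
        L ^ 2 * ‖orbit G ξ γ 0 k ω‖ ^ 4
      have := pow_le_pow_left₀ (norm_nonneg _) (hR.norm_rem_le (orbit G ξ γ 0 k ω)) 2
      refine this.trans (le_of_eq ?_)
      ring)
    rw [integral_const_mul] at h2
    have := mul_le_mul_of_nonneg_left h1 (sq_nonneg L)
    linarith
  -- The weight `c` is the relaxation time `1 / (γμ)`, which balances the two terms of the variance
  -- bound.
  have := variance_sum_le (x₀ := fun _ => 0) hL.le hR.norm_le hR.zero hN hG measurable_const
    (orbit_memLp hR hG hN hγ hγL1 0) hR.linearGrowth_rem hUm hosc iU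
    (c := 1 / (γ * μ)) (by positivity) m n
  refine this.trans ?_
  have hk : ∀ k ∈ Finset.range n,
      2 * (1 / (γ * μ)) * ∫ ω, ‖D (orbit G ξ γ 0 (m + k) ω) - H (orbit G ξ γ 0 (m + k) ω)‖ ^ 2 ∂P +
        2 / (1 / (γ * μ)) * ∫ ω, U (orbit G ξ γ 0 (m + k) ω) ^ 2 ∂P ≤
      6192 * (L ^ 2 * v₄ ^ 2 / (γ * μ)) := fun k _ => by
    have h1 := mul_le_mul_of_nonneg_left (hEh (m + k)) (by positivity : 0 ≤ 2 * (1 / (γ * μ)))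
    have h2 := mul_le_mul_of_nonneg_left (hEU (m + k)) (by positivity : 0 ≤ 2 / (1 / (γ * μ)))
    refine (add_le_add h1 h2).trans (le_of_eq ?_)
    field_simp
    ring
  refine (Finset.sum_le_sum hk).trans (le_of_eq ?_)
  simp

/-- The fluctuations of the averaged chain for small step sizes. -/
lemma small_step_fluctuation (hR : RegularField D H T μ L) (hG : Oracle D G Pξ L τ₂ τ₄ τ₆)
    (hN : IsNoiseSequence P Pξ ξ θ₀) (hγ : 0 < γ) (hγL : γ * L ≤ 1 / 30) (m n : ℕ) :
    ∫ ω, ‖∑ k ∈ Finset.range n, H (orbit G ξ γ 0 (m + k) ω) + ∑ k ∈ Finset.range n,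
        ∫ ω, (D (orbit G ξ γ 0 (m + k) ω) - H (orbit G ξ γ 0 (m + k) ω)) ∂P‖ ^ 2 ∂P ≤
      40000 * (γ * τ₂ ^ 2 / μ / γ ^ 2 + n * (τ₂ ^ 2 + L ^ 2 * (γ * τ₂ ^ 2 / μ) +
        L ^ 2 * (γ * τ₄ ^ 2 / μ) ^ 2 / (γ * μ))) := by
  have hμ := hR.pos
  have hL := hR.posL
  have hγL1 : γ * L ≤ 1 := hγL.trans (by norm_num)
  set R : ℕ → Ω → Vec d := fun k ω => D (orbit G ξ γ 0 k ω) - H (orbit G ξ γ 0 k ω) with hRdef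
  have hX := orbit_memLp hR hG hN hγ hγL1 0
  have hRm : ∀ k, MemLp (R k) 2 P := fun k =>
    hR.linearGrowth_rem.memLp (hX k) (orbit_measurable hG hN 0 k)
  set A : Ω → Vec d := fun ω => (1 / γ) • (orbit G ξ γ 0 m ω - orbit G ξ γ 0 (m + n) ω)
  set B : Ω → Vec d := fun ω => ∑ k ∈ Finset.range n, (R (m + k) ω - ∫ ω, R (m + k) ω ∂P)
  set E : Ω → Vec d := fun ω => ∑ k ∈ Finset.range n, gradNoise D G ξ γ (m + k) ω
  have hA : MemLp A 2 P := ((hX m).sub (hX (m + n))).const_smul (1 / γ)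
  have hB : MemLp B 2 P := memLp_finsetSum _ fun k _ => (hRm (m + k)).sub (memLp_const _)
  have hE : MemLp E 2 P := memLp_finsetSum _ fun k _ => (gradNoise_sq hR hG hN hγ hγL1 (m + k)).1
  -- Adding the mean remainders back leaves the boundary term `A`, the centred remainders `B` and
  -- the martingale `E`.
  have e : ∀ ω, ∑ k ∈ Finset.range n, H (orbit G ξ γ 0 (m + k) ω) + ∑ k ∈ Finset.range n,
      ∫ ω, (D (orbit G ξ γ 0 (m + k) ω) - H (orbit G ξ γ 0 (m + k) ω)) ∂P =
      A ω - (B ω + E ω) := fun ω => by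
    have h := congrArg (fun x => (1 / γ) • x) (orbit_sum_eq (D := D) (H := H) (G := G) (ξ := ξ)
      (γ := γ) m n ω)
    simp only [smul_sub, smul_smul, one_div_mul_cancel hγ.ne', one_smul] at h
    have e2 : B ω = ∑ k ∈ Finset.range n, R (m + k) ω -
      ∑ k ∈ Finset.range n, ∫ ω, R (m + k) ω ∂P := Finset.sum_sub_distrib _ _
    rw [h, e2]
    simp only [A, E, hRdef, smul_sub]
    abel
  simp_rw [e]
  have hbA : ∫ ω, ‖A ω‖ ^ 2 ∂P ≤ 48 * (γ * τ₂ ^ 2 / μ / γ ^ 2) := by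
    have h1 := integral_norm_sub_sq_le (hX m) (hX (m + n))
    have h2 := orbit_zero_sq_le hR hG hN hγ hγL1 m
    have h3 := orbit_zero_sq_le hR hG hN hγ hγL1 (m + n)
    have e1 : ∫ ω, ‖A ω‖ ^ 2 ∂P =
        (1 / γ) ^ 2 * ∫ ω, ‖orbit G ξ γ 0 m ω - orbit G ξ γ 0 (m + n) ω‖ ^ 2 ∂P := by
      rw [← integral_const_mul]
      congr 1; funext ω
      simp only [A, norm_smul, mul_pow, Real.norm_eq_abs, sq_abs]
    rw [e1]
    have h4 : ∫ ω, ‖orbit G ξ γ 0 m ω - orbit G ξ γ 0 (m + n) ω‖ ^ 2 ∂P ≤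
        48 * (γ * τ₂ ^ 2 / μ) := by linarith
    refine (mul_le_mul_of_nonneg_left h4 (sq_nonneg _)).trans (le_of_eq ?_)
    field_simp
  have hbB := rem_variance_le hR hG hN hγ hγL m n
  change ∫ ω, ‖B ω‖ ^ 2 ∂P ≤ _ at hbB
  have hbE := gradNoise_sum_sq_le hR hG hN hγ hγL1 m n
  change ∫ ω, ‖E ω‖ ^ 2 ∂P ≤ _ at hbE
  have h1 := integral_norm_sub_sq_le hA (hB.add hE)
  have h2 := integral_norm_add_sq_le hB hE
  have p1 : 0 ≤ γ * τ₂ ^ 2 / μ / γ ^ 2 := by positivity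
  have p2 : 0 ≤ (n : ℝ) * (L ^ 2 * (γ * τ₄ ^ 2 / μ) ^ 2 / (γ * μ)) := by positivity
  have p3 : 0 ≤ (n : ℝ) * τ₂ ^ 2 := by positivity
  have p4 : 0 ≤ (n : ℝ) * (L ^ 2 * (γ * τ₂ ^ 2 / μ)) := by positivity
  simp only [Pi.add_apply] at h1
  linarith

end SmallStep

end RRSGD

/-! ### The linearized chain -/

namespace RRSGD

section Linear

variable {d : ℕ} {Z : Type*} [MeasurableSpace Z] {Pξ : Measure Z} [IsProbabilityMeasure Pξ]
  {D : Vec d → Vec d} {H : Vec d →L[ℝ] Vec d} {T : Vec d →L[ℝ] Vec d →L[ℝ] Vec d}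
  {G : Vec d → Z → Vec d} {μ L τ₂ τ₄ τ₆ γ : ℝ}

/-- The linearized stochastic gradient. -/
def linearize (H : Vec d →L[ℝ] Vec d) (G : Vec d → Z → Vec d) (x : Vec d) (z : Z) : Vec d :=
  H x + G 0 z

/-- The linear field is again regular, with zero second differential, so every moment estimate
applies to the linearized chain. -/
lemma RegularField.linear (hR : RegularField D H T μ L) :
    RegularField (fun x => H x) H 0 μ L where
  pos := hR.pos
  le := hR.le
  zero := map_zero H
  lip x y := by rw [← map_sub]; exact hR.hnorm _
  mono x y := by rw [← map_sub]; exact hR.hlower _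
  hsymm := hR.hsymm
  hlower := hR.hlower
  hnorm := hR.hnorm
  rem_lip x y := by
    have := hR.posL
    simp only [sub_self, norm_zero]; positivity
  taylor x := by
    have := hR.posL
    simp only [sub_self, zero_apply, smul_zero, norm_zero]
    positivity
  tcomm u v := by simp
  tsymm e u v := by simp
  tnorm u v := by
    have := hR.posL
    simp only [zero_apply, norm_zero]
    positivity
  psd e v := by
    have := hR.posL
    have := hR.hessian_nonneg v
    simp only [zero_apply, inner_zero_left]
    positivity

/-- Increments of the linearized oracle are deterministic, and co-coercivity of order `q` follows
from `H² ≤ L H` and `‖H‖ ≤ L`. -/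
lemma Oracle.linear (hR : RegularField D H T μ L) (hG : Oracle D G Pξ L τ₂ τ₄ τ₆) :
    Oracle (fun x => H x) (linearize H G) Pξ L τ₂ τ₄ τ₆ where
  meas := (H.continuous.measurable.comp measurable_fst).add
    ((hG.meas_right 0).comp measurable_snd)
  memLp x := (memLp_const (H x)).add (hG.memLp 0)
  mean x := by
    simp only [linearize]
    rw [integral_add (integrable_const _) (hG.integrable 0), hG.mean, hR.zero]
    simp
  nonneg := hG.nonneg
  le24 := hG.le24
  le46 := hG.le46
  m2 := by simpa [linearize] using hG.m2
  m4 := by simpa [linearize] using hG.m4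
  m6 := by simpa [linearize] using hG.m6
  coco q h2 _ x y := by
    have hL := hR.posL
    simp only [linearize, add_sub_add_right_eq_sub, ← map_sub]
    obtain ⟨j, rfl⟩ := Nat.exists_eq_add_of_le h2
    have h1 := hR.norm_hessian_sq_le (x - y)
    have h3 : ‖H (x - y)‖ ^ j ≤ (L * ‖x - y‖) ^ j := by
      gcongr; exact hR.hnorm _
    have h4 := hR.hessian_nonneg (x - y)
    have h5 := mul_le_mul h1 h3 (by positivity) (by positivity)
    simp only [integral_const, probReal_univ, one_smul]
    rw [pow_add, show 2 + j - 1 = j + 1 by omega, show 2 + j - 2 = j by omega]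
    refine h5.trans (le_of_eq ?_)
    rw [mul_pow]; ring

/-- The remainder, tested against a direction, with the Hessian form of the direction absorbed. -/
lemma RegularField.abs_inner_rem_le (hR : RegularField D H T μ L) (x v : Vec d) :
    |inner ℝ (D x - H x) v| ≤ 3 / 8 * inner ℝ (H v) v +
      4 * (L / μ) * (‖x‖ ^ 2 * inner ℝ (D x) x) + 7 * (L / μ) * L * ‖x‖ ^ 6 := by
  have hL := hR.posL
  have hμ := hR.pos
  set q := inner ℝ (H v) v
  set κ := L / μ with hκ
  have hκ0 : 0 < κ := by positivity
  have hμv : L * ‖v‖ ^ 2 ≤ κ * q := by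
    have := mul_le_mul_of_nonneg_left (hR.hlower v) hκ0.le
    refine le_trans (le_of_eq ?_) this
    rw [hκ]; field_simp
  have hq0 : 0 ≤ q := hR.hessian_nonneg v
  have hd0 := hR.inner_nonneg x
  rcases eq_or_ne x 0 with rfl | hx
  · simp only [hR.zero, map_zero, sub_self, inner_zero_left, abs_zero, norm_zero]
    positivity
  have hr : 0 < ‖x‖ := norm_pos_iff.2 hx
  set r := ‖x‖
  set ρ := √κ * r with hρ
  have hρ0 : 0 < ρ := by positivity
  have hρ2 : ρ ^ 2 = κ * r ^ 2 := by rw [hρ, mul_pow, Real.sq_sqrt hκ0.le]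
  have hN : ∀ w, L * ‖w‖ ^ 2 ≤ κ * inner ℝ (H w) w → inner ℝ (H w) w / (1 / ρ) +
      L * (1 / ρ) * r ^ 2 * ‖w‖ ^ 2 ≤ 2 * ρ * inner ℝ (H w) w := fun w hw => by
    have : L * (1 / ρ) * r ^ 2 * ‖w‖ ^ 2 ≤ ρ * inner ℝ (H w) w := by
      have e : L * (1 / ρ) * r ^ 2 * ‖w‖ ^ 2 = r ^ 2 / ρ * (L * ‖w‖ ^ 2) := by ring
      have h2 := mul_le_mul_of_nonneg_left hw (by positivity : 0 ≤ r ^ 2 / ρ)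
      rw [e]
      refine h2.trans (le_of_eq ?_)
      have : r ^ 2 / ρ * (κ * inner ℝ (H w) w) = (κ * r ^ 2) / ρ * inner ℝ (H w) w := by ring
      rw [this, ← hρ2]
      field_simp
    rw [div_div_eq_mul_div, div_one]
    linarith
  have hμx : L * r ^ 2 ≤ κ * inner ℝ (H x) x := by
    have := mul_le_mul_of_nonneg_left (hR.hlower x) hκ0.le
    refine le_trans (le_of_eq ?_) this
    rw [hκ]; field_simp
    rfl
  -- The choice `t = 1 / ρ` makes both parts of the bound at most `ρ` times the Hessian form, and `l
  -- = 4 ρ` leaves only `q / 4` in the direction `v`.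
  have h1 := hR.abs_third_inner_le x x v (t := 1 / ρ) (l := 4 * ρ) (by positivity) (by positivity)
  have h2 := hN x hμx
  have h3 := hN v hμv
  have h4 : |inner ℝ (T x x) v| ≤ 4 * (κ * r ^ 2) * inner ℝ (H x) x + q / 4 := by
    have a1 := mul_le_mul_of_nonneg_left h2 (by positivity : 0 ≤ 4 * ρ)
    have a2 := div_le_div_of_nonneg_right h3 (by positivity : 0 ≤ 4 * ρ)
    have e1 : 2 * ρ * q / (4 * ρ) = q / 2 := by field_simp; ring
    change _ ≤ 2 * ρ * q / (4 * ρ) at a2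
    rw [e1] at a2
    have e2 : 4 * ρ * (2 * ρ * inner ℝ (H x) x) = 8 * (κ * r ^ 2) * inner ℝ (H x) x := by
      rw [← hρ2]; ring
    rw [e2] at a1
    linarith
  -- Young's inequality, the term `μ‖v‖² / 4` being absorbed by the Hessian form of `v`.
  have h5 : |inner ℝ (D x - H x - (1 / 2 : ℝ) • T x x) v| ≤ q / 4 + κ * L * r ^ 6 := by
    refine (abs_real_inner_le_norm _ _).trans ?_
    refine (mul_le_mul_of_nonneg_right (hR.taylor x) (norm_nonneg v)).trans ?_
    have h6 : μ * ‖v‖ ^ 2 ≤ q := hR.hlower v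
    have e : μ / 4 * ‖v‖ ^ 2 + κ * L * r ^ 6 - L * r ^ 3 * ‖v‖ =
      1 / μ * (μ / 2 * ‖v‖ - L * r ^ 3) ^ 2 := by rw [hκ]; field_simp; ring
    have : 0 ≤ 1 / μ * (μ / 2 * ‖v‖ - L * r ^ 3) ^ 2 := by positivity
    linarith
  have h7 : |inner ℝ (D x - H x) v| ≤ 1 / 2 * |inner ℝ (T x x) v| +
      |inner ℝ (D x - H x - (1 / 2 : ℝ) • T x x) v| := by
    have e : inner ℝ (D x - H x) v = 1 / 2 * inner ℝ (T x x) v +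
        inner ℝ (D x - H x - (1 / 2 : ℝ) • T x x) v := by
      rw [inner_sub_left (D x - H x), inner_smul_left, conj_trivial]; ring
    rw [e]
    refine (abs_add_le _ _).trans (le_of_eq ?_)
    rw [abs_mul, abs_of_pos (by norm_num : (0 : ℝ) < 1 / 2)]
  have h8 := mul_le_mul_of_nonneg_left (hR.hessian_le_quartic x)
    (by positivity : 0 ≤ 4 * (κ * r ^ 2))
  have e8 : 4 * (κ * r ^ 2) * (2 * inner ℝ (D x) x + 3 * L * r ^ 4) =
    8 * κ * (r ^ 2 * inner ℝ (D x) x) + 12 * κ * L * r ^ 6 := by ring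
  change _ ≤ 4 * (κ * r ^ 2) * (2 * inner ℝ (D x) x + 3 * L * r ^ 4) at h8
  rw [e8] at h8
  linarith

lemma RegularField.third_eq (hR : RegularField D H T μ L) (e x : Vec d) :
    inner ℝ (T x x) e = inner ℝ (T e x) x := by
  rw [hR.tsymm, hR.tcomm x e, real_inner_comm]

/-- Comparison of the quadratic form `⟪T e x, x⟫` at two points. -/
lemma RegularField.abs_third_sub_le (hR : RegularField D H T μ L) {e : Vec d} (he : ‖e‖ ≤ 1)
    (x y : Vec d) {l : ℝ} (hl : 0 < l) :
    |inner ℝ (T e x) x - inner ℝ (T e y) y| ≤ 2 * √(L / μ) * (l * inner ℝ (H y) y +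
      (1 / l + 1) * inner ℝ (H (x - y)) (x - y)) := by
  have hL := hR.posL
  have hμ := hR.pos
  set k := √(L / μ) with hk
  have hk0 : 0 < k := Real.sqrt_pos.2 (by positivity)
  have hk2 : k ^ 2 = L / μ := Real.sq_sqrt (by positivity)
  -- For `‖e‖ ≤ 1` the value `t = 1 / k` balances `abs_third_le`, and the third derivative costs
  -- only `√(L/μ)` times the Hessian form.
  have hN : ∀ w, inner ℝ (H w) w / (1 / k) + L * (1 / k) * ‖e‖ ^ 2 * ‖w‖ ^ 2 ≤
      2 * k * inner ℝ (H w) w := fun w => by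
    have h1 : L * (1 / k) * ‖e‖ ^ 2 * ‖w‖ ^ 2 ≤ L * (1 / k) * 1 ^ 2 * ‖w‖ ^ 2 := by gcongr
    have h2 := mul_le_mul_of_nonneg_left (hR.hlower w) hk0.le
    have h3 : L * (1 / k) * 1 ^ 2 * ‖w‖ ^ 2 = k * (μ * ‖w‖ ^ 2) := by
      have : L = k ^ 2 * μ := by rw [hk2]; field_simp
      rw [this]; field_simp
    rw [div_div_eq_mul_div, div_one]
    linarith
  set w := x - y with hw
  have hx : x = y + w := by rw [hw]; abel
  have hs : inner ℝ (T e w) y = inner ℝ (T e y) w := by rw [hR.tsymm, real_inner_comm]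
  have e1 : inner ℝ (T e x) x - inner ℝ (T e y) y =
      2 * inner ℝ (T e y) w + inner ℝ (T e w) w := by
    rw [hx, map_add, inner_add_left, inner_add_right, inner_add_right, hs]; ring
  have h1 := hR.abs_third_inner_le e y w (t := 1 / k) (by positivity) hl
  have h2 := hR.abs_third_le e w (t := 1 / k) (by positivity)
  have h3 := mul_le_mul_of_nonneg_left (hN y) hl.le
  have h4 := div_le_div_of_nonneg_right (hN w) hl.le
  have h5 := hN w
  rw [e1]
  refine (abs_add_le _ _).trans ?_
  rw [abs_mul, abs_of_pos (by norm_num : (0 : ℝ) < 2)]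
  have e2 : 2 * k * (l * inner ℝ (H y) y + (1 / l + 1) * inner ℝ (H w) w) =
    l * (2 * k * inner ℝ (H y) y) + 2 * k * inner ℝ (H w) w / l + 2 * k * inner ℝ (H w) w := by
    field_simp
    ring
  rw [e2]
  linarith

end Linear

/-! ### Distance between the chain and its linearization -/

section Mean

variable {d : ℕ} {Z Ω : Type*} [MeasurableSpace Z] [mΩ : MeasurableSpace Ω]
  {P : Measure Ω} [IsProbabilityMeasure P] {Pξ : Measure Z} [IsProbabilityMeasure Pξ]
  {ξ : ℕ → Ω → Z} {θ₀ : Ω → Vec d}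
  {D : Vec d → Vec d} {H : Vec d →L[ℝ] Vec d} {T : Vec d →L[ℝ] Vec d →L[ℝ] Vec d}
  {G : Vec d → Z → Vec d} {μ L τ₂ τ₄ τ₆ γ : ℝ}

lemma IsDriven.integral_succ_le {S : Type*} [MeasurableSpace S] {u : S × Z → S} {X : ℕ → Ω → S}
    (hX : IsDriven ξ θ₀ u X) (hN : IsNoiseSequence P Pξ ξ θ₀) {F g : S → ℝ} (hF : Measurable F)
    {k : ℕ} (hi : Integrable (fun ω => F (X (k + 1) ω)) P)
    (hg : Integrable (fun ω => g (X k ω)) P) (h : ∀ s, ∫ z, F (u (s, z)) ∂Pξ ≤ g s) :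
    ∫ ω, F (X (k + 1) ω) ∂P ≤ ∫ ω, g (X k ω) ∂P := by
  simp only [hX.succ] at hi ⊢
  have := integral_noise hN (hX.adapted k) (F := fun p => F (u p)) (hF.comp hX.measurable) hi
  rw [this.2]
  exact integral_mono this.1 hg fun ω => h _

/-- Under common noise the additive part `G 0` cancels, so the conditional drift of the difference
`v` is `-γ (H v + (D x - H x))`. By `abs_inner_rem_le`, testing the remainder against `v` consumes
at most `3/4` of the dissipation `2γ ⟪H v, v⟫`. -/
lemma linear_difference_step (hR : RegularField D H T μ L) (hG : Oracle D G Pξ L τ₂ τ₄ τ₆)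
    (hγ : 0 < γ) (x y : Vec d) :
    ∫ z, ‖sgdStep G γ (x, z) - sgdStep (linearize H G) γ (y, z)‖ ^ 2 ∂Pξ ≤
      ‖x - y‖ ^ 2 - γ * inner ℝ (H (x - y)) (x - y) +
      γ * (8 * (L / μ) * (‖x‖ ^ 2 * inner ℝ (D x) x) + 14 * (L / μ) * L * ‖x‖ ^ 6 +
        2 * γ * L ^ 2 * (‖x‖ ^ 2 + ‖y‖ ^ 2)) := by
  have hL := hR.posL
  set v := x - y
  have e : ∀ z, ‖sgdStep G γ (x, z) - sgdStep (linearize H G) γ (y, z)‖ ^ 2 =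
      ‖v‖ ^ 2 - 2 * γ * inner ℝ (G x z - G 0 z - H y) v + γ ^ 2 * ‖G x z - G 0 z - H y‖ ^ 2 :=
    fun z => by
      have : sgdStep G γ (x, z) - sgdStep (linearize H G) γ (y, z) =
          v - γ • (G x z - G 0 z - H y) := by
        simp only [sgdStep, linearize, v, smul_sub, smul_add]; abel
      rw [this, norm_sub_sq_real, inner_smul_right, real_inner_comm, norm_smul, mul_pow,
        Real.norm_eq_abs, sq_abs]
      ring
  have hp : MemLp (fun z => G x z - G 0 z) 2 Pξ :=
    (hG.memLp_of_le x (by norm_num)).sub (hG.memLp_of_le 0 (by norm_num))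
  have hw : MemLp (fun z => G x z - G 0 z - H y) 2 Pξ := hp.sub (memLp_const _)
  have i1 : Integrable (fun z => G x z - G 0 z - H y) Pξ := hw.integrable (by norm_num)
  have i2 : Integrable (fun z => ‖v‖ ^ 2 - 2 * γ * inner ℝ (G x z - G 0 z - H y) v) Pξ :=
    (integrable_const _).sub ((i1.inner_const _).const_mul _)
  simp_rw [e]
  rw [integral_add i2 ((integrable_norm_sq hw).const_mul _), integral_sub (integrable_const _)
      ((i1.inner_const _).const_mul _), integral_const_mul, integral_const_mul]
  have e1 : ∫ z, inner ℝ (G x z - G 0 z - H y) v ∂Pξ = inner ℝ (H v) v + inner ℝ (D x - H x) v := by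
    simp_rw [real_inner_comm v]
    rw [_root_.integral_inner i1, integral_sub (hp.integrable (by norm_num)) (integrable_const _),
      integral_sub (hG.integrable _) (hG.integrable _), hG.mean, hG.mean, hR.zero]
    simp only [integral_const, probReal_univ, one_smul, sub_zero]
    rw [← inner_add_right]
    congr 1
    simp only [v, map_sub]; abel
  have h2 := integral_norm_sub_sq_le hp (memLp_const (H y))
  have h3 := hG.coco 2 le_rfl (by norm_num) x 0
  simp only [hR.zero, sub_zero, Nat.sub_self, Nat.add_one_sub_one, pow_one, pow_zero, mul_one] at h3
  simp only [integral_const, probReal_univ, one_smul] at h2 ⊢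
  rw [e1]
  have h4 : L * inner ℝ (D x) x ≤ L * (L * ‖x‖ ^ 2) :=
    mul_le_mul_of_nonneg_left (hR.inner_le x) hL.le
  have h5 : ‖H y‖ ^ 2 ≤ (L * ‖y‖) ^ 2 := by gcongr; exact hR.hnorm y
  have h6 : ∫ z, ‖G x z - G 0 z - H y‖ ^ 2 ∂Pξ ≤ 2 * L ^ 2 * (‖x‖ ^ 2 + ‖y‖ ^ 2) := by
    linarith
  have h7 := mul_le_mul_of_nonneg_left h6 (sq_nonneg γ)
  have h8 := (abs_le.1 (hR.abs_inner_rem_le x v)).1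
  have h9 := mul_le_mul_of_nonneg_left h8 (by positivity : 0 ≤ 2 * γ)
  have h10 := mul_nonneg hγ.le (hR.hessian_nonneg v)
  linarith

/-- The Hessian form of the difference between the chain and its linearization. -/
lemma sum_hessian_difference_le (hR : RegularField D H T μ L) (hG : Oracle D G Pξ L τ₂ τ₄ τ₆)
    (hN : IsNoiseSequence P Pξ ξ θ₀) (hγ : 0 < γ) (hγL : γ * L ≤ 1 / 30) (N : ℕ) :
    ∑ k ∈ Finset.range N, ∫ ω, inner ℝ (H (orbit G ξ γ 0 k ω - orbit (linearize H G) ξ γ 0 k ω))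
      (orbit G ξ γ 0 k ω - orbit (linearize H G) ξ γ 0 k ω) ∂P ≤
      N * (20000000 * (L * (γ * τ₄ ^ 2 / μ) ^ 2 + L / μ * L * (γ * τ₆ ^ 2 / μ) ^ 3 +
        γ * L * L * (γ * τ₂ ^ 2 / μ))) := by
  have hμ := hR.pos
  have hL := hR.posL
  have hγL1 : γ * L ≤ 1 := hγL.trans (by norm_num)
  have hR' := hR.linear
  have hG' := hG.linear hR
  set X := orbit G ξ γ 0
  set Y := orbit (linearize H G) ξ γ 0
  have hX := orbit_memLp hR hG hN hγ hγL1 0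
  have hY := orbit_memLp hR' hG' hN hγ hγL1 0
  have hV : ∀ k, MemLp (fun ω => X k ω - Y k ω) 2 P := fun k => (hX k).sub (hY k)
  have iq : ∀ k, Integrable (fun ω => inner ℝ (H (X k ω - Y k ω)) (X k ω - Y k ω)) P := fun k =>
    integrable_inner (hR.linearGrowth_hessian.memLp (hV k)
      ((orbit_measurable hG hN 0 k).sub (orbit_measurable hG' hN 0 k))) (hV k)
  have i2 := fun k => integrable_norm_sq (hX k)
  have i2' := fun k => integrable_norm_sq (hY k)
  have iV := fun k => integrable_norm_sq (hV k)
  have i4 := (orbit_zero_sum_four_le hR hG hN hγ hγL N).1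
  have i6 := fun k => (orbit_zero_six_le hR hG hN hγ hγL k).1
  have hdr := (orbit_isDriven (ξ := ξ) (θ₀ := θ₀) (γ := γ) hG 0).pair
    (orbit_isDriven (ξ := ξ) (θ₀ := θ₀) (γ := γ) hG' 0)
  have j1 := fun k => (iV k).sub ((iq k).const_mul γ)
  have j2 := fun k => ((i4 k).const_mul (8 * (L / μ))).add ((i6 k).const_mul (14 * (L / μ) * L))
  have j3 := fun k => ((i2 k).add (i2' k)).const_mul (2 * γ * L ^ 2)
  have j4 := fun k => ((j2 k).add (j3 k)).const_mul γ
  have step : ∀ k, ∫ ω, ‖X (k + 1) ω - Y (k + 1) ω‖ ^ 2 ∂P ≤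
      ∫ ω, ‖X k ω - Y k ω‖ ^ 2 ∂P - γ * ∫ ω, inner ℝ (H (X k ω - Y k ω)) (X k ω - Y k ω) ∂P +
      γ * (8 * (L / μ) * ∫ ω, ‖X k ω‖ ^ 2 * inner ℝ (D (X k ω)) (X k ω) ∂P +
        14 * (L / μ) * L * ∫ ω, ‖X k ω‖ ^ 6 ∂P +
        2 * γ * L ^ 2 * (∫ ω, ‖X k ω‖ ^ 2 ∂P + ∫ ω, ‖Y k ω‖ ^ 2 ∂P)) := fun k => by
    have := hdr.integral_succ_le hN (F := fun p : Vec d × Vec d => ‖p.1 - p.2‖ ^ 2)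
      ((measurable_fst.sub measurable_snd).norm.pow_const 2) (iV (k + 1))
      ((j1 k).add (j4 k)) (fun s => linear_difference_step hR hG hγ s.1 s.2)
    refine this.trans (le_of_eq ((integral_add' (j1 k) (j4 k)).trans ?_))
    have e1 := integral_add' (j2 k) (j3 k)
    have e2 := integral_add' ((i4 k).const_mul (8 * (L / μ)))
      ((i6 k).const_mul (14 * (L / μ) * L))
    have e3 := integral_add' (i2 k) (i2' k)
    have e4 := integral_sub' (iV k) ((iq k).const_mul γ)
    rw [integral_const_mul, integral_const_mul] at e2
    rw [integral_const_mul, e3, e2] at e1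
    rw [integral_const_mul] at e4
    rw [e4, integral_const_mul, e1]
  have b4 := (orbit_zero_sum_four_le hR hG hN hγ hγL N).2
  have b6 : ∀ k, ∫ ω, ‖X k ω‖ ^ 6 ∂P ≤ _ := fun k => (orbit_zero_six_le hR hG hN hγ hγL k).2
  have b2 : ∀ k, ∫ ω, ‖X k ω‖ ^ 2 ∂P ≤ _ := fun k => orbit_zero_sq_le hR hG hN hγ hγL1 k
  have b2' : ∀ k, ∫ ω, ‖Y k ω‖ ^ 2 ∂P ≤ _ := fun k => orbit_zero_sq_le hR' hG' hN hγ hγL1 k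
  set v := γ * τ₂ ^ 2 / μ
  set v₄ := γ * τ₄ ^ 2 / μ
  set v₆ := γ * τ₆ ^ 2 / μ
  have hsum : ∀ N : ℕ, ∫ ω, ‖X N ω - Y N ω‖ ^ 2 ∂P +
      γ * ∑ k ∈ Finset.range N, ∫ ω, inner ℝ (H (X k ω - Y k ω)) (X k ω - Y k ω) ∂P ≤
      γ * (8 * (L / μ) * ∑ k ∈ Finset.range N,
          ∫ ω, ‖X k ω‖ ^ 2 * inner ℝ (D (X k ω)) (X k ω) ∂P +
        N * (14 * (L / μ) * L * (1260288 * v₆ ^ 3) + 2 * γ * L ^ 2 * (24 * v))) := fun N => by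
    induction N with
    | zero =>
      have : ∫ ω, ‖X 0 ω - Y 0 ω‖ ^ 2 ∂P = 0 := by
        change ∫ _, ‖(0 : Vec d) - 0‖ ^ 2 ∂P = 0
        simp
      simp [this]
    | succ N ih =>
      rw [Finset.sum_range_succ, Finset.sum_range_succ]
      have s := step N
      have c6 : γ * (14 * (L / μ) * L * ∫ ω, ‖X N ω‖ ^ 6 ∂P) ≤
          γ * (14 * (L / μ) * L * (1260288 * v₆ ^ 3)) := by
        gcongr; exact b6 N
      have c2 : γ * (2 * γ * L ^ 2 * (∫ ω, ‖X N ω‖ ^ 2 ∂P + ∫ ω, ‖Y N ω‖ ^ 2 ∂P)) ≤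
          γ * (2 * γ * L ^ 2 * (12 * v + 12 * v)) := by
        gcongr
        · exact b2 N
        · exact b2' N
      push_cast
      linarith
  have h1 := hsum N
  have h0 : 0 ≤ ∫ ω, ‖X N ω - Y N ω‖ ^ 2 ∂P := integral_nonneg fun ω => sq_nonneg _
  -- The summed bound on `‖x‖² ⟪D x, x⟫` carries a factor `μ`, which cancels the denominator of `L /
  -- μ`.
  have h2 := mul_le_mul_of_nonneg_left b4 (by positivity : 0 ≤ γ * (8 * (L / μ)))
  have e2 : γ * (8 * (L / μ)) * (N * (88 * (μ * v₄ ^ 2))) = γ * (N * (704 * (L * v₄ ^ 2))) := by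
    field_simp; ring
  rw [e2] at h2
  refine le_of_mul_le_mul_left (?_ : γ * _ ≤ γ * _) hγ
  have p1 : 0 ≤ γ * (N * (L * v₄ ^ 2)) := by positivity
  have p2 : 0 ≤ γ * (N * (L / μ * L * v₆ ^ 3)) := by positivity
  have p3 : 0 ≤ γ * (N * (γ * L * L * v)) := by positivity
  change _ ≤ γ * (N * (20000000 * (L * v₄ ^ 2 + L / μ * L * v₆ ^ 3 + γ * L * L * v)))
  linarith

end Mean

end RRSGD

/-! ### Mean of the nonlinear remainder -/

namespace RRSGD

section Mean

variable {d : ℕ} {Z Ω : Type*} [MeasurableSpace Z] [mΩ : MeasurableSpace Ω]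
  {P : Measure Ω} [IsProbabilityMeasure P] {Pξ : Measure Z} [IsProbabilityMeasure Pξ]
  {ξ : ℕ → Ω → Z} {θ₀ : Ω → Vec d}
  {D : Vec d → Vec d} {H : Vec d →L[ℝ] Vec d} {T : Vec d →L[ℝ] Vec d →L[ℝ] Vec d}
  {G : Vec d → Z → Vec d} {μ L τ₂ τ₄ τ₆ γ : ℝ}

lemma linearGrowth_clm (M : Vec d →L[ℝ] Vec d) : LinearGrowth fun x => M x := by
  refine ⟨M.continuous.measurable, ‖M‖, norm_nonneg _, fun x => (M.le_opNorm x).trans ?_⟩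
  nlinarith [norm_nonneg M]

lemma integrable_inner_clm {X : Ω → Vec d} (hX : MemLp X 2 P) (hm : Measurable X)
    (M : Vec d →L[ℝ] Vec d) : Integrable (fun ω => inner ℝ (M (X ω)) (X ω)) P :=
  integrable_inner ((linearGrowth_clm M).memLp hX hm) hX

lemma orbit_zero_cube_le (hR : RegularField D H T μ L) (hG : Oracle D G Pξ L τ₂ τ₄ τ₆)
    (hN : IsNoiseSequence P Pξ ξ θ₀) (hγ : 0 < γ) (hγL : γ * L ≤ 1 / 30) {s₆ : ℝ} (hs₆ : 0 ≤ s₆)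
    (hs : γ * τ₆ ^ 2 / μ = s₆ ^ 2) (k : ℕ) :
    Integrable (fun ω => ‖orbit G ξ γ 0 k ω‖ ^ 3) P ∧
      ∫ ω, ‖orbit G ξ γ 0 k ω‖ ^ 3 ∂P ≤ 1123 * s₆ ^ 3 := by
  obtain ⟨h1, h2⟩ := orbit_zero_six_le hR hG hN hγ hγL k
  have hm := orbit_measurable (γ := γ) hG hN 0 k
  have e : ∀ ω, ‖orbit G ξ γ 0 k ω‖ ^ 6 = (‖orbit G ξ γ 0 k ω‖ ^ 3) ^ 2 := fun ω => by ring
  simp_rw [e] at h1 h2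
  have h3 : MemLp (fun ω => ‖orbit G ξ γ 0 k ω‖ ^ 3) 2 P :=
    (memLp_two_iff_integrable_sq (hm.norm.pow_const 3).aestronglyMeasurable).2 h1
  refine ⟨h3.integrable (by norm_num), ?_⟩
  have h4 := sq_integral_le h3
  rw [hs] at h2
  -- The constant satisfies `1123 ^ 2 ≥ 1260288`, the constant of the sixth moment.
  refine abs_le_of_sq_le_sq' (h4.trans (h2.trans ?_)) (by positivity) |>.2
  have : 0 ≤ s₆ ^ 6 := by positivity
  nlinarith

/-- The mean remainder is that of the quadratic form along the linearized chain. -/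
lemma sum_mean_rem_sub_le (hR : RegularField D H T μ L) (hG : Oracle D G Pξ L τ₂ τ₄ τ₆)
    (hN : IsNoiseSequence P Pξ ξ θ₀) (hγ : 0 < γ) (hγL : γ * L ≤ 1 / 30) {s₆ : ℝ} (hs₆ : 0 ≤ s₆)
    (hs : γ * τ₆ ^ 2 / μ = s₆ ^ 2) (hκ : √(L / μ) * s₆ ≤ 2) {e : Vec d} (he : ‖e‖ ≤ 1) (N : ℕ) :
    ∑ k ∈ Finset.range N, |∫ ω, inner ℝ (D (orbit G ξ γ 0 k ω) - H (orbit G ξ γ 0 k ω)) e ∂P -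
      1 / 2 * ∫ ω, inner ℝ (T e (orbit (linearize H G) ξ γ 0 k ω))
        (orbit (linearize H G) ξ γ 0 k ω) ∂P| ≤
      N * (400000000 * (L * s₆ ^ 3 + L * (γ * τ₂ ^ 2 / μ) * (√(γ * L) * √(L / μ)))) := by
  have hμ := hR.pos
  have hL := hR.posL
  have hγL1 : γ * L ≤ 1 := hγL.trans (by norm_num)
  have hR' := hR.linear
  have hG' := hG.linear hR
  set X := orbit G ξ γ 0 with hXdef
  set Y := orbit (linearize H G) ξ γ 0 with hYdef
  have hX : ∀ k, MemLp (X k) 2 P := orbit_memLp hR hG hN hγ hγL1 0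
  have hY : ∀ k, MemLp (Y k) 2 P := orbit_memLp hR' hG' hN hγ hγL1 0
  have hXm : ∀ k, Measurable (X k) := orbit_measurable hG hN 0
  have hYm : ∀ k, Measurable (Y k) := orbit_measurable hG' hN 0
  set k₀ := √(L / μ) with hk
  have hk0 : 0 < k₀ := Real.sqrt_pos.2 (by positivity)
  have hk2 : k₀ ^ 2 = L / μ := Real.sq_sqrt (by positivity)
  have hk1 : 1 ≤ k₀ := Real.one_le_sqrt.2 ((one_le_div hμ).2 hR.le)
  set b := √(γ * L) with hb
  have hb0 : 0 < b := Real.sqrt_pos.2 (by positivity)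
  have hb2 : b ^ 2 = γ * L := Real.sq_sqrt (by positivity)
  have hb1 : b ≤ 1 := Real.sqrt_le_one.2 hγL1
  -- This `l` balances the two terms of `abs_third_sub_le`: the average Hessian form of `Y` is of
  -- order `μ v`, that of `X - Y` of order `L s₆ ^ 4 + b ^ 2 L v`.
  set l := k₀ * (s₆ + b) with hl
  have hl0 : 0 < l := by positivity
  set v := γ * τ₂ ^ 2 / μ with hv
  set v₄ := γ * τ₄ ^ 2 / μ with hv₄
  have hv0 : 0 ≤ v := by positivity
  have hvv : v ≤ v₄ := by
    have := pow_le_pow_left₀ hG.nonneg hG.le24 2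
    rw [hv, hv₄]; gcongr
  have hvv₆ : v₄ ≤ s₆ ^ 2 := by
    have := pow_le_pow_left₀ (hG.nonneg.trans hG.le24) hG.le46 2
    rw [hv₄, ← hs]; gcongr
  have iη : ∀ k, Integrable (fun ω => inner ℝ (D (X k ω) - H (X k ω)) e) P := fun k =>
    ((hR.linearGrowth_rem.memLp (hX k) (hXm k)).integrable (by norm_num)).inner_const e
  have iT : ∀ k, Integrable (fun ω => inner ℝ (T e (Y k ω)) (Y k ω)) P := fun k =>
    integrable_inner_clm (hY k) (hYm k) (T e)
  have i3 := fun k => (orbit_zero_cube_le hR hG hN hγ hγL hs₆ hs k).1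
  have iq : ∀ k, Integrable (fun ω => inner ℝ (H (Y k ω)) (Y k ω)) P := fun k =>
    integrable_inner_clm (hY k) (hYm k) H
  have iq' : ∀ k, Integrable (fun ω => inner ℝ (H (X k ω - Y k ω)) (X k ω - Y k ω)) P := fun k =>
    integrable_inner_clm ((hX k).sub (hY k)) ((hXm k).sub (hYm k)) H
  have hterm : ∀ k, |∫ ω, inner ℝ (D (X k ω) - H (X k ω)) e ∂P -
      1 / 2 * ∫ ω, inner ℝ (T e (Y k ω)) (Y k ω) ∂P| ≤
      1123 * (L * s₆ ^ 3) + k₀ * (l * ∫ ω, inner ℝ (H (Y k ω)) (Y k ω) ∂P +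
        (1 / l + 1) * ∫ ω, inner ℝ (H (X k ω - Y k ω)) (X k ω - Y k ω) ∂P) := fun k => by
    rw [← integral_const_mul, ← integral_sub (iη k) ((iT k).const_mul _)]
    have hpt : ∀ ω, |inner ℝ (D (X k ω) - H (X k ω)) e - 1 / 2 * inner ℝ (T e (Y k ω)) (Y k ω)| ≤
        L * ‖X k ω‖ ^ 3 + (k₀ * l * inner ℝ (H (Y k ω)) (Y k ω) +
        k₀ * (1 / l + 1) * inner ℝ (H (X k ω - Y k ω)) (X k ω - Y k ω)) := fun ω => by
      set x := X k ω
      set y := Y k ω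
      have h1 := hR.abs_third_sub_le he x y hl0
      have h2 : |inner ℝ (D x - H x - (1 / 2 : ℝ) • T x x) e| ≤ L * ‖x‖ ^ 3 := by
        refine (abs_real_inner_le_norm _ _).trans ?_
        have := hR.taylor x
        have h3 := mul_le_mul this he (norm_nonneg e) (by positivity)
        linarith
      have e1 : inner ℝ (D x - H x) e - 1 / 2 * inner ℝ (T e y) y =
          inner ℝ (D x - H x - (1 / 2 : ℝ) • T x x) e +
            1 / 2 * (inner ℝ (T e x) x - inner ℝ (T e y) y) := by
        rw [inner_sub_left (D x - H x), inner_smul_left, conj_trivial, hR.third_eq]; ring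
      rw [e1]
      refine (abs_add_le _ _).trans ?_
      rw [abs_mul, abs_of_pos (by norm_num : (0 : ℝ) < 1 / 2)]
      rw [← hk] at h1
      linarith
    have j1 := ((iq k).const_mul (k₀ * l)).add ((iq' k).const_mul (k₀ * (1 / l + 1)))
    have j2 := ((i3 k).const_mul L).add j1
    have h3 := integral_mono ((iη k).sub ((iT k).const_mul _)).abs j2 hpt
    have e2 := integral_add' ((i3 k).const_mul L) j1
    have e3 := integral_add' ((iq k).const_mul (k₀ * l)) ((iq' k).const_mul (k₀ * (1 / l + 1)))
    rw [integral_const_mul, integral_const_mul] at e3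
    rw [integral_const_mul, e3] at e2
    refine (abs_integral_le_integral_abs).trans (h3.trans ?_)
    rw [e2]
    have h4 := mul_le_mul_of_nonneg_left (orbit_zero_cube_le hR hG hN hγ hγL hs₆ hs k).2 hL.le
    linarith
  refine (Finset.sum_le_sum fun k _ => hterm k).trans ?_
  rw [Finset.sum_add_distrib, Finset.sum_const, Finset.card_range, nsmul_eq_mul,
    ← Finset.mul_sum, Finset.sum_add_distrib, ← Finset.mul_sum, ← Finset.mul_sum]
  have hA := orbit_zero_sum_field_le hR' hG' hN hγ hγL1 N
  have hB := sum_hessian_difference_le hR hG hN hγ hγL N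
  rw [hs, ← hv, ← hv₄] at hB
  set A := ∑ k ∈ Finset.range N, ∫ ω, inner ℝ (H (Y k ω)) (Y k ω) ∂P
  set B := ∑ k ∈ Finset.range N, ∫ ω, inner ℝ (H (X k ω - Y k ω)) (X k ω - Y k ω) ∂P
  set Q := L * v₄ ^ 2 + L / μ * L * (s₆ ^ 2) ^ 3 + γ * L * L * v with hQ
  -- The assumption `k₀ s₆ ≤ 2` reduces the sixth moment contribution to the size of the fourth
  -- moment one.
  have hQ5 : Q ≤ 5 * L * s₆ ^ 4 + b ^ 2 * (L * v) := by
    have h1 : v₄ ^ 2 ≤ (s₆ ^ 2) ^ 2 := by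
      have : 0 ≤ v₄ := hv0.trans hvv
      gcongr
    have h2 : (k₀ * s₆) ^ 2 ≤ 2 ^ 2 := by gcongr
    have h3 : L * s₆ ^ 4 * (k₀ * s₆) ^ 2 ≤ L * s₆ ^ 4 * 2 ^ 2 := by gcongr
    have h4 := mul_le_mul_of_nonneg_left h1 hL.le
    rw [hQ, ← hk2, hb2]
    linarith
  have hA' : A ≤ N * (12 * (μ * v)) := by
    have : γ * τ₂ ^ 2 = μ * v := by rw [hv]; field_simp
    rw [this] at hA
    exact hA
  have hLμ : L = k₀ ^ 2 * μ := by rw [hk2]; field_simp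
  have c1 : k₀ * (l * (12 * (μ * v))) ≤ 12 * (L * s₆ ^ 3 + L * v * (b * k₀)) := by
    have e1 : k₀ * (l * (12 * (μ * v))) = 12 * (L * (s₆ * v) + L * v * (b * 1)) := by
      rw [hl, hLμ]; ring
    rw [e1]
    have h1 : s₆ * v ≤ s₆ * s₆ ^ 2 := by
      have := hvv.trans hvv₆
      gcongr
    have h2 : L * v * (b * 1) ≤ L * v * (b * k₀) := by gcongr
    have h3 := mul_le_mul_of_nonneg_left h1 hL.le
    linarith
  have c2 : k₀ * ((1 / l + 1) * Q) ≤ 15 * (L * s₆ ^ 3 + L * v * (b * k₀)) := by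
    have h1 : k₀ * (1 / l * Q) ≤ 5 * (L * s₆ ^ 3) + L * v * (b * k₀) := by
      have e1 : k₀ * (1 / l * Q) = Q / (s₆ + b) := by rw [hl]; field_simp
      rw [e1, div_le_iff₀ (by positivity)]
      have h2 : b * (L * v) * b * 1 ≤ b * (L * v) * b * k₀ := by gcongr
      have h3 : 0 ≤ L * s₆ ^ 3 * b := by positivity
      have h4 : 0 ≤ L * v * (b * k₀) * s₆ := by positivity
      linarith
    have h2 : k₀ * Q ≤ 10 * (L * s₆ ^ 3) + L * v * (b * k₀) := by
      have h3 := mul_le_mul_of_nonneg_left hQ5 hk0.le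
      have h4 : 5 * L * s₆ ^ 3 * (k₀ * s₆) ≤ 5 * L * s₆ ^ 3 * 2 := by gcongr
      have h5 : k₀ * (L * v) * b * b ≤ k₀ * (L * v) * b * 1 := by gcongr
      linarith
    have h3 : 0 ≤ L * v * (b * k₀) := by positivity
    linarith
  have c3 : k₀ * (l * A + (1 / l + 1) * B) ≤ k₀ * (l * (N * (12 * (μ * v))) + (1 / l + 1) *
      (N * (20000000 * Q))) := by gcongr
  have c4 := mul_le_mul_of_nonneg_left c1 (Nat.cast_nonneg (α := ℝ) N)
  have c5 := mul_le_mul_of_nonneg_left c2 (Nat.cast_nonneg (α := ℝ) N)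
  have p1 : 0 ≤ (N : ℝ) * (L * s₆ ^ 3) := by positivity
  have p2 : 0 ≤ (N : ℝ) * (L * v * (b * k₀)) := by positivity
  linarith

/-- The crude bound of the mean remainder, for large noise. -/
lemma sum_mean_rem_le (hR : RegularField D H T μ L) (hG : Oracle D G Pξ L τ₂ τ₄ τ₆)
    (hN : IsNoiseSequence P Pξ ξ θ₀) (hγ : 0 < γ) (hγL : γ * L ≤ 1 / 30) {s₆ : ℝ} (hs₆ : 0 ≤ s₆)
    (hs : γ * τ₆ ^ 2 / μ = s₆ ^ 2) (hκ : 1 ≤ √(L / μ) * s₆) {e : Vec d} (he : ‖e‖ ≤ 1) (N : ℕ) :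
    ∑ k ∈ Finset.range N, |∫ ω, inner ℝ (D (orbit G ξ γ 0 k ω) - H (orbit G ξ γ 0 k ω)) e ∂P| ≤
      N * (2000 * (L * s₆ ^ 3)) := by
  have hμ := hR.pos
  have hL := hR.posL
  have hγL1 : γ * L ≤ 1 := hγL.trans (by norm_num)
  set X := orbit G ξ γ 0 with hXdef
  have hX : ∀ k, MemLp (X k) 2 P := orbit_memLp hR hG hN hγ hγL1 0
  have hXm : ∀ k, Measurable (X k) := orbit_measurable hG hN 0
  have hs0 : 0 < s₆ := by
    rcases hs₆.eq_or_lt with h | h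
    · rw [← h] at hκ; norm_num at hκ
    · exact h
  -- Large noise means `μ ≤ L s₆²`; this is what lets the crude bound reach the order `L s₆³`.
  have hμs : μ ≤ L * s₆ ^ 2 := by
    have h1 : (1 : ℝ) ^ 2 ≤ (√(L / μ) * s₆) ^ 2 := by gcongr
    rw [mul_pow, Real.sq_sqrt (by positivity), one_pow, div_mul_eq_mul_div, le_div_iff₀ hμ] at h1
    linarith
  set v := γ * τ₂ ^ 2 / μ with hv
  set v₄ := γ * τ₄ ^ 2 / μ with hv₄
  have hv0 : 0 ≤ v := by positivity
  have hvv : v ≤ v₄ := by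
    have := pow_le_pow_left₀ hG.nonneg hG.le24 2
    rw [hv, hv₄]; gcongr
  have hvv₆ : v₄ ≤ s₆ ^ 2 := by
    have := pow_le_pow_left₀ (hG.nonneg.trans hG.le24) hG.le46 2
    rw [hv₄, ← hs]; gcongr
  have iη : ∀ k, Integrable (fun ω => inner ℝ (D (X k ω) - H (X k ω)) e) P := fun k =>
    ((hR.linearGrowth_rem.memLp (hX k) (hXm k)).integrable (by norm_num)).inner_const e
  have i2 := fun k => integrable_norm_sq (hX k)
  have i3 := fun k => (orbit_zero_cube_le hR hG hN hγ hγL hs₆ hs k).1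
  have i4 := fun k => (orbit_zero_four_le hR hG hN hγ hγL k).1
  have iF : ∀ k, Integrable (fun ω => inner ℝ (D (X k ω)) (X k ω)) P :=
    orbit_integrable_field hR hG hN hγ hγL1 0
  have hterm : ∀ k, |∫ ω, inner ℝ (D (X k ω) - H (X k ω)) e ∂P| ≤
      1 / s₆ * ∫ ω, inner ℝ (D (X k ω)) (X k ω) ∂P + 1261 * (L * s₆ ^ 3) := fun k => by
    have hpt : ∀ ω, |inner ℝ (D (X k ω) - H (X k ω)) e| ≤
        1 / s₆ * inner ℝ (D (X k ω)) (X k ω) + (3 / 2 * L / s₆ * ‖X k ω‖ ^ 4 +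
          (L * s₆ / 2 * ‖X k ω‖ ^ 2 + L * ‖X k ω‖ ^ 3)) := fun ω => by
      set x := X k ω
      -- With `t = s₆`, the Hessian form is divided by the typical size of the chain and then
      -- replaced by the field, whose time average is small.
      have h1 := hR.abs_third_le e x hs0
      have h2 : |inner ℝ (D x - H x - (1 / 2 : ℝ) • T x x) e| ≤ L * ‖x‖ ^ 3 := by
        refine (abs_real_inner_le_norm _ _).trans ?_
        have := hR.taylor x
        have h3 := mul_le_mul this he (norm_nonneg e) (by positivity)
        linarith
      have e1 : inner ℝ (D x - H x) e =
          inner ℝ (D x - H x - (1 / 2 : ℝ) • T x x) e + 1 / 2 * inner ℝ (T e x) x := by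
        rw [inner_sub_left (D x - H x), inner_smul_left, conj_trivial, hR.third_eq]; ring
      rw [e1]
      refine (abs_add_le _ _).trans ?_
      rw [abs_mul, abs_of_pos (by norm_num : (0 : ℝ) < 1 / 2)]
      have h3 := div_le_div_of_nonneg_right (hR.hessian_le_quartic x) hs0.le
      have h4 : L * s₆ * ‖e‖ ^ 2 * ‖x‖ ^ 2 ≤ L * s₆ * 1 ^ 2 * ‖x‖ ^ 2 := by gcongr
      have e3 : (2 * inner ℝ (D x) x + 3 * L * ‖x‖ ^ 4) / s₆ =
        2 * (1 / s₆ * inner ℝ (D x) x) + 2 * (3 / 2 * L / s₆ * ‖x‖ ^ 4) := by ring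
      rw [e3] at h3
      linarith
    have j1 := ((i2 k).const_mul (L * s₆ / 2)).add ((i3 k).const_mul L)
    have j2 := ((i4 k).const_mul (3 / 2 * L / s₆)).add j1
    have j3 := ((iF k).const_mul (1 / s₆)).add j2
    have h3 := integral_mono (iη k).abs j3 hpt
    have e1 := integral_add' ((i2 k).const_mul (L * s₆ / 2)) ((i3 k).const_mul L)
    have e2 := integral_add' ((i4 k).const_mul (3 / 2 * L / s₆)) j1
    have e3 := integral_add' ((iF k).const_mul (1 / s₆)) j2
    rw [integral_const_mul, integral_const_mul] at e1
    rw [integral_const_mul, e1] at e2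
    rw [integral_const_mul, e2] at e3
    refine (abs_integral_le_integral_abs).trans (h3.trans ?_)
    rw [e3]
    have b2 := mul_le_mul_of_nonneg_left (orbit_zero_sq_le hR hG hN hγ hγL1 k)
      (by positivity : 0 ≤ L * s₆ / 2)
    have b3 := mul_le_mul_of_nonneg_left (orbit_zero_cube_le hR hG hN hγ hγL hs₆ hs k).2 hL.le
    have b4 := mul_le_mul_of_nonneg_left (orbit_zero_four_le hR hG hN hγ hγL k).2
      (by positivity : 0 ≤ 3 / 2 * L / s₆)
    rw [← hv] at b2
    rw [← hv₄] at b4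
    have c2 : L * s₆ / 2 * (12 * v) ≤ 6 * (L * s₆ ^ 3) := by
      have : L * s₆ * v ≤ L * s₆ * s₆ ^ 2 := by
        have := hvv.trans hvv₆
        gcongr
      linarith
    have c4 : 3 / 2 * L / s₆ * (88 * v₄ ^ 2) ≤ 132 * (L * s₆ ^ 3) := by
      have h1 : 3 / 2 * L / s₆ * (88 * v₄ ^ 2) ≤ 3 / 2 * L / s₆ * (88 * (s₆ ^ 2) ^ 2) := by
        have : 0 ≤ v₄ := hv0.trans hvv
        gcongr
      refine h1.trans (le_of_eq ?_)
      field_simp; ring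
    linarith
  refine (Finset.sum_le_sum fun k _ => hterm k).trans ?_
  rw [Finset.sum_add_distrib, ← Finset.mul_sum]
  have hA := orbit_zero_sum_field_le hR hG hN hγ hγL1 N
  have h1 : 1 / s₆ * (N * (12 * (γ * τ₂ ^ 2))) ≤ N * (12 * (L * s₆ ^ 3)) := by
    have e1 : γ * τ₂ ^ 2 = μ * v := by rw [hv]; field_simp
    have h2 : μ * v ≤ (L * s₆ ^ 2) * s₆ ^ 2 := by
      have := hvv.trans hvv₆
      gcongr
    rw [e1]
    calc 1 / s₆ * (N * (12 * (μ * v))) ≤ 1 / s₆ * (N * (12 * ((L * s₆ ^ 2) * s₆ ^ 2))) := by gcongr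
      _ = _ := by field_simp
  have h2 := mul_le_mul_of_nonneg_left hA (by positivity : 0 ≤ 1 / s₆)
  have p1 : 0 ≤ (N : ℝ) * (L * s₆ ^ 3) := by positivity
  simp only [Finset.sum_const, Finset.card_range, nsmul_eq_mul]
  linarith

end Mean

end RRSGD

/-! ### Richardson–Romberg cancellation of the quadratic moments -/

namespace RRSGD

section QuadraticComparison

variable {d : ℕ} {Z Ω : Type*} [MeasurableSpace Z] [mΩ : MeasurableSpace Ω]
  {P : Measure Ω} [IsProbabilityMeasure P] {Pξ : Measure Z} [IsProbabilityMeasure Pξ]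
  {ξ : ℕ → Ω → Z} {θ₀ : Ω → Vec d}
  {D : Vec d → Vec d} {H : Vec d →L[ℝ] Vec d} {T : Vec d →L[ℝ] Vec d →L[ℝ] Vec d}
  {G : Vec d → Z → Vec d} {μ L τ₂ τ₄ τ₆ γ : ℝ}

/-- The transition matrix of the linearized chain. -/
noncomputable def decay (H : Vec d →L[ℝ] Vec d) (γ : ℝ) : Vec d →L[ℝ] Vec d := 1 - γ • H

lemma decay_apply (H : Vec d →L[ℝ] Vec d) (γ : ℝ) (v : Vec d) : decay H γ v = v - γ • H v := rfl

lemma norm_decay_sq_le (hR : RegularField D H T μ L) (hγ : 0 < γ) (hγL : γ * L ≤ 1) (v : Vec d) :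
    ‖decay H γ v‖ ^ 2 ≤ (1 - γ * μ) * ‖v‖ ^ 2 := by
  rw [decay_apply, norm_sub_sq_real, inner_smul_right, norm_smul, mul_pow, Real.norm_of_nonneg hγ.le,
    real_inner_comm]
  have h1 := mul_le_mul_of_nonneg_left (hR.norm_hessian_sq_le v) (sq_nonneg γ)
  have h2 := mul_le_mul_of_nonneg_left (hR.hlower v) hγ.le
  have h3 := mul_le_mul_of_nonneg_right hγL (mul_nonneg hγ.le (hR.hessian_nonneg v))
  linarith

/-- From `1 - 2γμ ≤ (1 - γμ)²`: one step of size `2γ` contracts by `1 - γμ`, as do two steps of size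
`γ` in `norm_decay_decay_le`. -/
lemma norm_decay_two_le (hR : RegularField D H T μ L) (hγ : 0 < γ) (hγL : 2 * γ * L ≤ 1)
    (v : Vec d) : ‖decay H (2 * γ) v‖ ≤ (1 - γ * μ) * ‖v‖ := by
  have h := norm_decay_sq_le hR (by positivity : 0 < 2 * γ) hγL v
  have h1 := hR.mul_le_one (by positivity : 0 < 2 * γ) hγL
  refine abs_le_of_sq_le_sq' (h.trans ?_) (mul_nonneg (by linarith) (norm_nonneg _)) |>.2
  rw [mul_pow]
  gcongr
  nlinarith [sq_nonneg (γ * μ)]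

lemma norm_decay_decay_le (hR : RegularField D H T μ L) (hγ : 0 < γ) (hγL : γ * L ≤ 1)
    (v : Vec d) : ‖decay H γ (decay H γ v)‖ ≤ (1 - γ * μ) * ‖v‖ := by
  have h := norm_decay_sq_le hR hγ hγL v
  have h' := norm_decay_sq_le hR hγ hγL (decay H γ v)
  have h1 := hR.mul_le_one hγ hγL
  have h2 : 0 ≤ 1 - γ * μ := by linarith
  refine abs_le_of_sq_le_sq' (h'.trans ?_) (mul_nonneg h2 (norm_nonneg _)) |>.2
  rw [mul_pow, sq (1 - γ * μ), mul_assoc]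
  gcongr

lemma norm_decay_pow_sq_le (hR : RegularField D H T μ L) (hγ : 0 < γ) (hγL : γ * L ≤ 1) (v : Vec d)
    (j : ℕ) : ‖(decay H γ ^ j) v‖ ^ 2 ≤ (1 - γ * μ) ^ j * ‖v‖ ^ 2 := by
  have h2 : 0 ≤ 1 - γ * μ := by linarith [hR.mul_le_one hγ hγL]
  induction j with
  | zero => simp
  | succ j ih =>
    rw [pow_succ' (decay H γ), pow_succ' (1 - γ * μ), mul_apply_eq_comp, mul_assoc]
    exact (norm_decay_sq_le hR hγ hγL _).trans (by gcongr)

lemma norm_decay_pow_even_le (hR : RegularField D H T μ L) (hγ : 0 < γ) (hγL : γ * L ≤ 1)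
    (v : Vec d) (j : ℕ) : ‖(decay H γ ^ (2 * j)) v‖ ≤ (1 - γ * μ) ^ j * ‖v‖ := by
  have h2 : 0 ≤ 1 - γ * μ := by linarith [hR.mul_le_one hγ hγL]
  induction j with
  | zero => simp
  | succ j ih =>
    rw [show 2 * (j + 1) = 2 * j + 1 + 1 by ring, pow_succ', pow_succ', pow_succ',
      mul_apply_eq_comp, mul_apply_eq_comp, mul_assoc]
    exact (norm_decay_decay_le hR hγ hγL _).trans (by gcongr)

lemma norm_decay_two_pow_le (hR : RegularField D H T μ L) (hγ : 0 < γ) (hγL : 2 * γ * L ≤ 1)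
    (v : Vec d) (j : ℕ) : ‖(decay H (2 * γ) ^ j) v‖ ≤ (1 - γ * μ) ^ j * ‖v‖ := by
  have h1 := hR.mul_le_one (by positivity : 0 < 2 * γ) hγL
  have h2 : 0 ≤ 1 - γ * μ := by linarith [mul_pos hγ hR.pos]
  induction j with
  | zero => simp
  | succ j ih =>
    rw [pow_succ', pow_succ', mul_apply_eq_comp, mul_assoc]
    exact (norm_decay_two_le hR hγ hγL _).trans (by gcongr)

/-- The basic identity is `(1 - γH)² = (1 - 2γH) + γ² H²`; the defect is propagated by contractions.
The factor `2` compensates one missing power of `1 - γμ ≥ 1/2`. -/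
lemma norm_decay_pow_sub_le (hR : RegularField D H T μ L) (hγ : 0 < γ) (hγL : 2 * γ * L ≤ 1)
    (v : Vec d) (j : ℕ) : ‖(decay H γ ^ (2 * j)) v - (decay H (2 * γ) ^ j) v‖ ≤
      2 * j * (γ * L) ^ 2 * (1 - γ * μ) ^ j * ‖v‖ := by
  have hL := hR.posL
  have hμ := hR.pos
  have hγL1 : γ * L ≤ 1 := by nlinarith [mul_pos hγ hL]
  have h2 : 1 ≤ 2 * (1 - γ * μ) := by
    linarith [hR.mul_le_one (by positivity : 0 < 2 * γ) hγL]
  set ρ := 1 - γ * μ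
  induction j with
  | zero => simp
  | succ j ih =>
    rw [show 2 * (j + 1) = 2 * j + 1 + 1 by ring, pow_succ' _ (2 * j + 1), pow_succ' _ (2 * j),
      pow_succ' _ j, mul_apply_eq_comp, mul_apply_eq_comp,
      mul_apply_eq_comp]
    set u := (decay H γ ^ (2 * j)) v
    set w := (decay H (2 * γ) ^ j) v
    have e : decay H γ (decay H γ u) - decay H (2 * γ) w =
        decay H (2 * γ) (u - w) + γ ^ 2 • H (H u) := by
      simp only [decay_apply, map_sub, map_smul]
      module
    have h3 := norm_decay_two_le hR hγ hγL (u - w)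
    have h4 : ‖γ ^ 2 • H (H u)‖ ≤ (γ * L) ^ 2 * (ρ ^ j * ‖v‖) := by
      rw [norm_smul, Real.norm_of_nonneg (sq_nonneg _), mul_pow, mul_assoc]
      have := (hR.hnorm (H u)).trans (mul_le_mul_of_nonneg_left (hR.hnorm u) hL.le)
      have h5 := norm_decay_pow_even_le hR hγ hγL1 v j
      have h6 : L * (L * ‖u‖) ≤ L * (L * (ρ ^ j * ‖v‖)) := by gcongr
      have := mul_le_mul_of_nonneg_left (this.trans h6) (sq_nonneg γ)
      linarith
    rw [e]
    refine (norm_add_le _ _).trans ?_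
    have h5 : ρ * ‖u - w‖ ≤ ρ * (2 * j * (γ * L) ^ 2 * ρ ^ j * ‖v‖) :=
      mul_le_mul_of_nonneg_left ih (by linarith)
    have h6 : (γ * L) ^ 2 * (ρ ^ j * ‖v‖) * 1 ≤ (γ * L) ^ 2 * (ρ ^ j * ‖v‖) * (2 * ρ) := by
      have : 0 ≤ ρ := by linarith
      gcongr
    push_cast
    rw [pow_succ ρ]
    linarith

lemma sum_nat_mul_pow_le {x : ℝ} (hx0 : 0 ≤ x) (hx1 : x < 1) (n : ℕ) :
    ∑ j ∈ Finset.range n, (j : ℝ) * x ^ j ≤ 1 / (1 - x) ^ 2 := by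
  have h := hasSum_coe_mul_geometric_of_norm_lt_one (r := x) (by
    rw [Real.norm_of_nonneg hx0]; exact hx1)
  refine (h.summable.sum_le_tsum _ fun j _ => by positivity).trans ?_
  rw [h.tsum_eq]
  gcongr

lemma sum_pow_le {x : ℝ} (hx0 : 0 ≤ x) (hx1 : x < 1) (n : ℕ) :
    ∑ j ∈ Finset.range n, x ^ j ≤ 1 / (1 - x) := by
  have h := hasSum_geometric_of_lt_one hx0 hx1
  refine (h.summable.sum_le_tsum _ fun j _ => by positivity).trans ?_
  rw [h.tsum_eq, one_div]

lemma abs_quadratic_sub_le {M : Vec d →L[ℝ] Vec d}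
    (hM : ∀ u v, |inner ℝ (M u) v| ≤ L * ‖u‖ * ‖v‖) (u v : Vec d) :
    |inner ℝ (M u) u - inner ℝ (M v) v| ≤ L * ‖u - v‖ * (‖u‖ + ‖v‖) := by
  have e : inner ℝ (M u) u - inner ℝ (M v) v =
      inner ℝ (M (u - v)) u + inner ℝ (M v) (u - v) := by
    rw [map_sub, inner_sub_left, inner_sub_right]; ring
  rw [e]
  refine (abs_add_le _ _).trans ((add_le_add (hM _ _) (hM _ _)).trans (le_of_eq ?_))
  ring

/-- The Richardson-Romberg combination of the quadratic moments of the linearized chains with step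
sizes `γ` and `2γ`, for a single noise vector. -/
lemma abs_quadratic_combination_le (hR : RegularField D H T μ L) (hγ : 0 < γ)
    (hγL : 2 * γ * L ≤ 1) {M : Vec d →L[ℝ] Vec d}
    (hM : ∀ u v, |inner ℝ (M u) v| ≤ L * ‖u‖ * ‖v‖) (w : Vec d) (n : ℕ) :
    |∑ j ∈ Finset.range n, inner ℝ (M ((decay H γ ^ j) w)) ((decay H γ ^ j) w) -
      2 * ∑ j ∈ Finset.range n, inner ℝ (M ((decay H (2 * γ) ^ j) w)) ((decay H (2 * γ) ^ j) w)| ≤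
      L / (γ * μ) * (10 * (γ * L * (L / μ)) + (1 - γ * μ) ^ n) * ‖w‖ ^ 2 := by
  have hL := hR.posL
  have hμ := hR.pos
  have hγL1 : γ * L ≤ 1 := by nlinarith [mul_pos hγ hL]
  have hx0 : 0 < γ * μ := mul_pos hγ hμ
  have h2 : 1 ≤ 2 * (1 - γ * μ) := by
    linarith [hR.mul_le_one (by positivity : 0 < 2 * γ) hγL]
  have hκ : 1 ≤ L / μ := (one_le_div hμ).2 hR.le
  set ρ := 1 - γ * μ with hρ
  have hρ0 : 0 ≤ ρ := by linarith
  have hρ1 : ρ < 1 := by linarith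
  have e1ρ : 1 - ρ = γ * μ := by rw [hρ]; ring
  set a := fun j => inner ℝ (M ((decay H γ ^ j) w)) ((decay H γ ^ j) w) with ha
  set b := fun j => inner ℝ (M ((decay H (2 * γ) ^ j) w)) ((decay H (2 * γ) ^ j) w) with hb
  -- Pairing consecutive steps of size `γ` produces two terms per step of size `2γ`, which matches
  -- the factor `2` in front of the second sum.
  have hsplit : ∀ n, ∑ j ∈ Finset.range (2 * n), a j =
      ∑ j ∈ Finset.range n, (a (2 * j) + a (2 * j + 1)) := fun n => by
    induction n with
    | zero => simp
    | succ n ih => rw [mul_add, mul_one, Finset.sum_range_succ, Finset.sum_range_succ, ih,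
        Finset.sum_range_succ, add_assoc]
  -- The pairing needs `2n` terms of `a` while only `n` are present; the missing ones are
  -- exponentially small.
  have htail : |∑ j ∈ Finset.range n, a (n + j)| ≤ L / (γ * μ) * ρ ^ n * ‖w‖ ^ 2 := by
    have h1 : ∀ j, |a (n + j)| ≤ L * ρ ^ n * ‖w‖ ^ 2 * ρ ^ j := fun j => by
      have h3 := norm_decay_pow_sq_le hR hγ hγL1 w (n + j)
      refine (hM _ _).trans ?_
      rw [mul_assoc, ← sq]
      refine (mul_le_mul_of_nonneg_left h3 hL.le).trans (le_of_eq ?_)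
      rw [pow_add]; ring
    refine (Finset.abs_sum_le_sum_abs _ _).trans ((Finset.sum_le_sum fun j _ => h1 j).trans ?_)
    rw [← Finset.mul_sum]
    have h4 := mul_le_mul_of_nonneg_left (sum_pow_le hρ0 hρ1 n)
      (by positivity : 0 ≤ L * ρ ^ n * ‖w‖ ^ 2)
    refine h4.trans (le_of_eq ?_)
    rw [e1ρ]; field_simp
  have hodd : ∀ j, |a (2 * j + 1) - a (2 * j)| ≤ 2 * L * (γ * L) * ‖w‖ ^ 2 * ρ ^ j := fun j => by
    have h1 : a (2 * j + 1) = inner ℝ (M (decay H γ ((decay H γ ^ (2 * j)) w)))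
        (decay H γ ((decay H γ ^ (2 * j)) w)) := by
      simp only [ha]; rw [pow_succ', mul_apply_eq_comp]
    rw [h1]
    have h5 := norm_decay_pow_sq_le hR hγ hγL1 w (2 * j)
    simp only [ha]
    set u := (decay H γ ^ (2 * j)) w
    refine (abs_quadratic_sub_le hM _ _).trans ?_
    have h3 : ‖decay H γ u - u‖ ≤ γ * L * ‖u‖ := by
      rw [decay_apply, sub_sub_cancel_left, norm_neg, norm_smul, Real.norm_of_nonneg hγ.le, mul_assoc]
      gcongr
      exact hR.hnorm u
    have h4 : ‖decay H γ u‖ ≤ ‖u‖ := by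
      refine abs_le_of_sq_le_sq' ((norm_decay_sq_le hR hγ hγL1 u).trans ?_) (norm_nonneg _) |>.2
      have : (1 - γ * μ) * ‖u‖ ^ 2 ≤ 1 * ‖u‖ ^ 2 := by gcongr
      linarith
    have h6 : ρ ^ (2 * j) ≤ ρ ^ j := pow_le_pow_of_le_one hρ0 hρ1.le (by omega)
    calc L * ‖decay H γ u - u‖ * (‖decay H γ u‖ + ‖u‖) ≤ L * (γ * L * ‖u‖) * (‖u‖ + ‖u‖) := by
          gcongr
      _ = 2 * L * (γ * L) * ‖u‖ ^ 2 := by ring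
      _ ≤ 2 * L * (γ * L) * (ρ ^ j * ‖w‖ ^ 2) := by
          gcongr
          exact h5.trans (by gcongr)
      _ = _ := by ring
  have heven : ∀ j : ℕ, |a (2 * j) - b j| ≤ 4 * L * (γ * L) ^ 2 * ‖w‖ ^ 2 * (j * ρ ^ j) := fun j => by
    refine (abs_quadratic_sub_le hM _ _).trans ?_
    have h3 := norm_decay_pow_sub_le hR hγ hγL w j
    have h4 := norm_decay_pow_even_le hR hγ hγL1 w j
    have h5 := norm_decay_two_pow_le hR hγ hγL w j
    have h6 : ρ ^ j ≤ 1 := pow_le_one₀ hρ0 hρ1.le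
    have h7 : ρ ^ j * ‖w‖ ≤ 1 * ‖w‖ := by gcongr
    rw [one_mul] at h7
    calc _ ≤ L * (2 * j * (γ * L) ^ 2 * ρ ^ j * ‖w‖) * (‖w‖ + ‖w‖) := by
          gcongr
          · exact h4.trans h7
          · exact h5.trans h7
      _ = _ := by ring
  have hS : ∑ j ∈ Finset.range n, a j - 2 * ∑ j ∈ Finset.range n, b j =
      ∑ j ∈ Finset.range n, (2 * (a (2 * j) - b j) + (a (2 * j + 1) - a (2 * j))) -
        ∑ j ∈ Finset.range n, a (n + j) := by
    have h1 : ∑ j ∈ Finset.range (2 * n), a j =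
        ∑ j ∈ Finset.range n, a j + ∑ j ∈ Finset.range n, a (n + j) := by
      rw [two_mul, Finset.sum_range_add]
    rw [hsplit] at h1
    rw [Finset.mul_sum, ← sub_eq_of_eq_add h1, sub_right_comm, ← Finset.sum_sub_distrib]
    congr 1
    exact Finset.sum_congr rfl fun j _ => by ring
  rw [hS]
  refine (abs_sub _ _).trans ?_
  have hmain : |∑ j ∈ Finset.range n, (2 * (a (2 * j) - b j) + (a (2 * j + 1) - a (2 * j)))| ≤
      8 * L * (γ * L) ^ 2 * ‖w‖ ^ 2 * (1 / (γ * μ) ^ 2) +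
        2 * L * (γ * L) * ‖w‖ ^ 2 * (1 / (γ * μ)) := by
    refine (Finset.abs_sum_le_sum_abs _ _).trans ?_
    refine (Finset.sum_le_sum (g := fun j : ℕ => 8 * L * (γ * L) ^ 2 * ‖w‖ ^ 2 * (j * ρ ^ j) +
      2 * L * (γ * L) * ‖w‖ ^ 2 * ρ ^ j) (fun j _ => ?_)).trans ?_
    · refine (abs_add_le _ _).trans ?_
      rw [abs_mul, abs_two]
      linarith [hodd j, heven j]
    rw [Finset.sum_add_distrib, ← Finset.mul_sum, ← Finset.mul_sum, ← e1ρ]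
    gcongr
    · exact sum_nat_mul_pow_le hρ0 hρ1 n
    · exact sum_pow_le hρ0 hρ1 n
  have e1 : 8 * L * (γ * L) ^ 2 * ‖w‖ ^ 2 * (1 / (γ * μ) ^ 2) =
      L / (γ * μ) * (8 * (γ * L * (L / μ))) * ‖w‖ ^ 2 := by field_simp
  have e2 : 2 * L * (γ * L) * ‖w‖ ^ 2 * (1 / (γ * μ)) =
      L / (γ * μ) * (2 * (γ * L * 1)) * ‖w‖ ^ 2 := by ring
  have e3 : L / (γ * μ) * (2 * (γ * L * 1)) * ‖w‖ ^ 2 ≤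
      L / (γ * μ) * (2 * (γ * L * (L / μ))) * ‖w‖ ^ 2 := by gcongr
  linarith

lemma linear_orbit_succ (k : ℕ) (ω : Ω) : orbit (linearize H G) ξ γ 0 (k + 1) ω =
    decay H γ (orbit (linearize H G) ξ γ 0 k ω) - γ • G 0 (ξ (k + 1) ω) := by
  change orbit (linearize H G) ξ γ 0 k ω - γ • linearize H G (orbit (linearize H G) ξ γ 0 k ω)
    (ξ (k + 1) ω) = _
  rw [linearize, decay_apply, smul_add]; abel

/-- The quadratic moments of the linearized chain started at its minimizer. -/
lemma linear_orbit_quadratic (hR : RegularField D H T μ L) (hG : Oracle D G Pξ L τ₂ τ₄ τ₆)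
    (hN : IsNoiseSequence P Pξ ξ θ₀) (hγ : 0 < γ) (hγL : γ * L ≤ 1) (M : Vec d →L[ℝ] Vec d)
    (k i : ℕ) :
    ∫ ω, inner ℝ (M ((decay H γ ^ i) (orbit (linearize H G) ξ γ 0 k ω)))
      ((decay H γ ^ i) (orbit (linearize H G) ξ γ 0 k ω)) ∂P =
    γ ^ 2 * ∑ j ∈ Finset.range k, ∫ z, inner ℝ (M ((decay H γ ^ (i + j)) (G 0 z)))
      ((decay H γ ^ (i + j)) (G 0 z)) ∂Pξ := by
  have hR' := hR.linear
  have hG' := hG.linear hR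
  have hζ : MemLp (G 0) 2 Pξ := hG.memLp_of_le 0 (by norm_num)
  have hζm := hG.meas_right 0
  induction k generalizing i with
  | zero => simp [orbit, sgd]
  | succ k ih =>
    set Y := orbit (linearize H G) ξ γ 0 with hYdef
    have hY : MemLp (Y k) 2 P := orbit_memLp hR' hG' hN hγ hγL 0 k
    have hYm : Measurable (Y k) := orbit_measurable hG' hN 0 k
    set A := decay H γ ^ i
    set B := decay H γ ^ (i + 1)
    set ζ := fun ω => G 0 (ξ (k + 1) ω)
    have hζ' : MemLp ζ 2 P := by
      have : MemLp (G 0) 2 (P.map (ξ (k + 1))) := by rw [hN.law]; exact hζ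
      exact this.comp_of_map (hN.measurable (k + 1)).aemeasurable
    have hBY : MemLp (fun ω => B (Y k ω)) 2 P := B.comp_memLp' hY
    have hMBY : MemLp (fun ω => M (B (Y k ω))) 2 P := M.comp_memLp' hBY
    have hAζ : MemLp (fun ω => A (ζ ω)) 2 P := A.comp_memLp' hζ'
    have hMAζ : MemLp (fun ω => M (A (ζ ω))) 2 P := M.comp_memLp' hAζ
    have had := (orbit_isDriven (ξ := ξ) (θ₀ := θ₀) (γ := γ) hG' 0).adapted k
    have hAζ₀ : Integrable (fun z => A (G 0 z)) Pξ := A.integrable_comp (hG.integrable 0)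
    have hz1 : ∫ z, A (G 0 z) ∂Pξ = 0 := by
      rw [A.integral_comp_comm (hG.integrable 0), hG.mean, hR.zero, map_zero]
    have hz2 : ∫ z, M (A (G 0 z)) ∂Pξ = 0 := by
      rw [M.integral_comp_comm hAζ₀, hz1, map_zero]
    have e : ∀ ω, inner ℝ (M (A (Y (k + 1) ω))) (A (Y (k + 1) ω)) =
        inner ℝ (M (B (Y k ω))) (B (Y k ω)) - γ * inner ℝ (M (B (Y k ω))) (A (ζ ω)) -
          γ * inner ℝ (M (A (ζ ω))) (B (Y k ω)) + γ ^ 2 * inner ℝ (M (A (ζ ω))) (A (ζ ω)) :=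
      fun ω => by
        have h1 : A (Y (k + 1) ω) = B (Y k ω) - γ • A (ζ ω) := by
          rw [hYdef, linear_orbit_succ, map_sub, map_smul]
          simp only [A, B]
          rw [pow_succ, mul_apply_eq_comp]
        rw [h1, map_sub, map_smul, inner_sub_left, inner_sub_right, inner_sub_right,
          inner_smul_left, inner_smul_left, inner_smul_right, inner_smul_right, conj_trivial]
        ring
    have i1 := integrable_inner hMBY hBY
    have i2 := (integrable_inner hMBY hAζ).const_mul γ
    have i3 := (integrable_inner hMAζ hBY).const_mul γ
    have i4 := (integrable_inner hMAζ hAζ).const_mul (γ ^ 2)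
    have c2 : ∫ ω, inner ℝ (M (B (Y k ω))) (A (ζ ω)) ∂P = 0 := by
      have hF : Measurable fun p : Vec d × Z => inner ℝ (M (B p.1)) (A (G 0 p.2)) :=
        ((M.continuous.measurable.comp B.continuous.measurable).comp measurable_fst).inner
          ((A.continuous.measurable.comp hζm).comp measurable_snd)
      rw [(integral_noise hN had hF (integrable_inner hMBY hAζ)).2]
      simp_rw [_root_.integral_inner hAζ₀, hz1]
      simp
    have c3 : ∫ ω, inner ℝ (M (A (ζ ω))) (B (Y k ω)) ∂P = 0 := by
      have hF : Measurable fun p : Vec d × Z => inner ℝ (M (A (G 0 p.2))) (B p.1) :=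
        ((M.continuous.measurable.comp (A.continuous.measurable.comp hζm)).comp
          measurable_snd).inner (B.continuous.measurable.comp measurable_fst)
      rw [(integral_noise hN had hF (integrable_inner hMAζ hBY)).2]
      simp_rw [real_inner_comm (B _), _root_.integral_inner (M.integrable_comp hAζ₀), hz2]
      simp
    have c4 : ∫ ω, inner ℝ (M (A (ζ ω))) (A (ζ ω)) ∂P =
        ∫ z, inner ℝ (M (A (G 0 z))) (A (G 0 z)) ∂Pξ := by
      rw [← hN.law (k + 1), integral_map (hN.measurable _).aemeasurable]
      exact (((M.continuous.measurable.comp (A.continuous.measurable.comp hζm))).inner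
        (A.continuous.measurable.comp hζm)).aestronglyMeasurable
    simp_rw [e]
    have h1 := integral_sub' i1 i2
    have h2 := integral_sub' (i1.sub i2) i3
    have h3 := integral_add' ((i1.sub i2).sub i3) i4
    rw [integral_const_mul] at h1 h2 h3
    rw [c2] at h1
    rw [c3, h1] at h2
    rw [c4, h2] at h3
    refine h3.trans ?_
    rw [ih (i + 1), Finset.sum_range_succ']
    simp only [add_zero, mul_zero, sub_zero, mul_add]
    congr 2
    refine Finset.sum_congr rfl fun j _ => ?_
    rw [show i + 1 + j = i + (j + 1) by ring]

/-- The covariances carry the factors `γ²` and `(2γ)²`, so the extrapolation weights `2` and `-1`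
give `2γ² (a - 2b)`, the combination that nearly cancels. -/
lemma abs_quadratic_moment_combination_le (hR : RegularField D H T μ L)
    (hG : Oracle D G Pξ L τ₂ τ₄ τ₆) (hN : IsNoiseSequence P Pξ ξ θ₀) (hγ : 0 < γ)
    (hγL : 2 * γ * L ≤ 1) {e : Vec d} (he : ‖e‖ ≤ 1) (k : ℕ) :
    |2 * ∫ ω, inner ℝ (T e (orbit (linearize H G) ξ γ 0 k ω)) (orbit (linearize H G) ξ γ 0 k ω) ∂P -
      ∫ ω, inner ℝ (T e (orbit (linearize H G) ξ (2 * γ) 0 k ω))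
        (orbit (linearize H G) ξ (2 * γ) 0 k ω) ∂P| ≤
      2 * (L * (γ * τ₂ ^ 2 / μ)) * (10 * (γ * L * (L / μ)) + (1 - γ * μ) ^ k) := by
  have hL := hR.posL
  have hμ := hR.pos
  have hγL1 : γ * L ≤ 1 := by nlinarith [mul_pos hγ hL]
  have hρ0 : 0 ≤ 1 - γ * μ := by linarith [hR.mul_le_one hγ hγL1]
  have hM : ∀ u v, |inner ℝ (T e u) v| ≤ L * ‖u‖ * ‖v‖ := fun u v => by
    refine (abs_real_inner_le_norm _ _).trans ?_
    have h1 : ‖T e u‖ ≤ L * ‖u‖ := by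
      refine (hR.tnorm e u).trans ?_
      have : L * ‖e‖ * ‖u‖ ≤ L * 1 * ‖u‖ := by gcongr
      linarith
    gcongr
  have h1 := linear_orbit_quadratic hR hG hN hγ hγL1 (T e) k 0
  have h2 := linear_orbit_quadratic hR hG hN (by positivity : 0 < 2 * γ) hγL (T e) k 0
  simp only [pow_zero, one_apply_eq_self, zero_add] at h1 h2
  have hζ : MemLp (G 0) 2 Pξ := hG.memLp_of_le 0 (by norm_num)
  have ii : ∀ (B : Vec d →L[ℝ] Vec d), Integrable (fun z => inner ℝ (T e (B (G 0 z))) (B (G 0 z))) Pξ :=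
    fun B => integrable_inner ((T e).comp_memLp' (B.comp_memLp' hζ)) (B.comp_memLp' hζ)
  rw [h1, h2, ← integral_finsetSum _ fun j _ => ii _, ← integral_finsetSum _ fun j _ => ii _]
  have iA := integrable_finsetSum (Finset.range k) fun j _ => ii (decay H γ ^ j)
  have iB := integrable_finsetSum (Finset.range k) fun j _ => ii (decay H (2 * γ) ^ j)
  have e1 := integral_sub' iA (iB.const_mul 2)
  rw [integral_const_mul] at e1
  have h3 := (abs_integral_le_integral_abs (μ := Pξ)).trans (integral_mono (iA.sub (iB.const_mul 2)).abs
    ((integrable_norm_sq hζ).const_mul _) fun z => abs_quadratic_combination_le hR hγ hγL hM (G 0 z) k)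
  rw [e1, integral_const_mul] at h3
  set a := ∫ z, ∑ j ∈ Finset.range k, inner ℝ (T e ((decay H γ ^ j) (G 0 z)))
      ((decay H γ ^ j) (G 0 z)) ∂Pξ
  set b := ∫ z, ∑ j ∈ Finset.range k, inner ℝ (T e ((decay H (2 * γ) ^ j) (G 0 z)))
      ((decay H (2 * γ) ^ j) (G 0 z)) ∂Pξ
  have e2 : 2 * (γ ^ 2 * a) - (2 * γ) ^ 2 * b = 2 * γ ^ 2 * (a - 2 * b) := by ring
  rw [e2, abs_mul, abs_of_nonneg (by positivity)]
  refine (mul_le_mul_of_nonneg_left (h3.trans (mul_le_mul_of_nonneg_left hG.m2 ?_))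
    (by positivity)).trans (le_of_eq ?_)
  · positivity
  · field_simp

end QuadraticComparison

end RRSGD

/-! ### The combined error for small steps -/

namespace RRSGD

section SmallSteps

variable {d : ℕ} {Z Ω : Type*} [MeasurableSpace Z] [mΩ : MeasurableSpace Ω]
  {P : Measure Ω} [IsProbabilityMeasure P] {Pξ : Measure Z} [IsProbabilityMeasure Pξ]
  {ξ : ℕ → Ω → Z} {θ₀ : Ω → Vec d}
  {D : Vec d → Vec d} {H : Vec d →L[ℝ] Vec d} {T : Vec d →L[ℝ] Vec d →L[ℝ] Vec d}
  {G : Vec d → Z → Vec d} {μ L τ₂ τ₄ τ₆ γ : ℝ}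

lemma norm_mean_rem_le (hR : RegularField D H T μ L) (hG : Oracle D G Pξ L τ₂ τ₄ τ₆)
    (hN : IsNoiseSequence P Pξ ξ θ₀) (hγ : 0 < γ) (hγL : γ * L ≤ 1) (k : ℕ) :
    ‖∫ ω, (D (orbit G ξ γ 0 k ω) - H (orbit G ξ γ 0 k ω)) ∂P‖ ≤ 12 * (L * (γ * τ₂ ^ 2 / μ)) := by
  have hL := hR.posL
  have hX := orbit_memLp hR hG hN hγ hγL 0 k
  have hXm := orbit_measurable (γ := γ) hG hN 0 k
  have i := (hR.linearGrowth_rem.memLp hX hXm).integrable (by norm_num)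
  refine (norm_integral_le_integral_norm _).trans ((integral_mono i.norm
    ((integrable_norm_sq hX).const_mul L) fun ω => hR.norm_rem_le _).trans ?_)
  rw [integral_const_mul]
  have := mul_le_mul_of_nonneg_left (orbit_zero_sq_le hR hG hN hγ hγL k) hL.le
  linarith

/-- The averaging window lies in the first `2n + 1` times, so estimates summed from time `0` apply
to it. -/
lemma sum_shift_le {f : ℕ → ℝ} (hf : ∀ k, 0 ≤ f k) (n : ℕ) :
    ∑ k ∈ Finset.range n, f (n + 1 + k) ≤ ∑ k ∈ Finset.range (2 * n + 1), f k := by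
  rw [show 2 * n + 1 = n + 1 + n by ring, Finset.sum_range_add]
  exact le_add_of_nonneg_left (Finset.sum_nonneg fun k _ => hf k)

/-- Bernoulli's inequality gives `√(n x) ≤ 1 + n x ≤ (1 + x)^n`, and `(1 - x)^n (1 + x)^n ≤ 1`. It
turns the transient of the bias into a term of statistical order. -/
lemma pow_le_inv_sqrt {x : ℝ} (hx : 0 < x) (hx1 : x ≤ 1) {n : ℕ} (hn : 0 < n) :
    (1 - x) ^ n ≤ 1 / √(n * x) := by
  have h0 : 0 ≤ 1 - x := by linarith
  have hnx : 0 < (n : ℝ) * x := by positivity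
  rw [le_div_iff₀ (Real.sqrt_pos.2 hnx)]
  have h1 : √(n * x) ≤ 1 + n * x := by
    nlinarith [Real.sq_sqrt hnx.le, sq_nonneg (√(n * x) - 1), Real.sqrt_nonneg (n * x)]
  have h2 : 1 + n * x ≤ (1 + x) ^ n := one_add_mul_le_pow (by linarith) n
  calc (1 - x) ^ n * √(n * x) ≤ (1 - x) ^ n * (1 + x) ^ n :=
        mul_le_mul_of_nonneg_left (h1.trans h2) (pow_nonneg h0 n)
    _ = ((1 - x) * (1 + x)) ^ n := (mul_pow _ _ _).symm
    _ ≤ 1 := pow_le_one₀ (by nlinarith) (by nlinarith)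

set_option maxHeartbeats 1000000 in
/-- The bias of the Richardson-Romberg combination, for small steps. -/
lemma abs_mean_rem_combination_le (hR : RegularField D H T μ L) (hG : Oracle D G Pξ L τ₂ τ₄ τ₆)
    (hN : IsNoiseSequence P Pξ ξ θ₀) (hγ : 0 < γ) (hγL : 2 * γ * L ≤ 1 / 30)
    {e : Vec d} (he : ‖e‖ ≤ 1) {n : ℕ} (hn : 0 < n) :
    |∑ k ∈ Finset.range n,
      (2 * ∫ ω, inner ℝ (D (orbit G ξ γ 0 (n + 1 + k) ω) - H (orbit G ξ γ 0 (n + 1 + k) ω)) e ∂P -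
        ∫ ω, inner ℝ (D (orbit G ξ (2 * γ) 0 (n + 1 + k) ω) -
          H (orbit G ξ (2 * γ) 0 (n + 1 + k) ω)) e ∂P)| ≤
      n * (10000000000 * (L * √(γ * τ₆ ^ 2 / μ) ^ 3 +
        L * (γ * τ₂ ^ 2 / μ) * (√(γ * L) * √(L / μ)) +
        L * (γ * τ₂ ^ 2 / μ) * (1 / √(n * (γ * μ))))) := by
  have hμ := hR.pos
  have hL := hR.posL
  have hγ2 : 0 < 2 * γ := by positivity
  have hγL1 : γ * L ≤ 1 / 30 := by nlinarith [mul_pos hγ hL]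
  have hx1 := hR.mul_le_one hγ (by linarith)
  set a := fun k => ∫ ω, inner ℝ (D (orbit G ξ γ 0 k ω) - H (orbit G ξ γ 0 k ω)) e ∂P with ha
  set b := fun k => ∫ ω, inner ℝ (D (orbit G ξ (2 * γ) 0 k ω) - H (orbit G ξ (2 * γ) 0 k ω)) e ∂P
    with hb
  change |∑ k ∈ Finset.range n, (2 * a (n + 1 + k) - b (n + 1 + k))| ≤ _
  set v := γ * τ₂ ^ 2 / μ with hv
  have hv0 : 0 ≤ v := by positivity
  have hv2 : 2 * γ * τ₂ ^ 2 / μ = 2 * v := by rw [hv]; ring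
  set s := √(γ * τ₆ ^ 2 / μ) with hs
  have hs0 : 0 ≤ s := Real.sqrt_nonneg _
  have hs2 : γ * τ₆ ^ 2 / μ = s ^ 2 := (Real.sq_sqrt (by positivity)).symm
  set s' := √2 * s with hs'
  have hs'0 : 0 ≤ s' := by positivity
  have h22 : √2 ^ 2 = (2 : ℝ) := Real.sq_sqrt (by norm_num)
  have h2u : √2 ≤ (3 / 2 : ℝ) := by rw [Real.sqrt_le_left (by norm_num)]; norm_num
  have h2l : 1 ≤ √(2 : ℝ) := Real.one_le_sqrt.2 (by norm_num)
  have hs'2 : 2 * γ * τ₆ ^ 2 / μ = s' ^ 2 := by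
    rw [hs', mul_pow, ← hs2, h22]; ring
  have hs'3 : s' ^ 3 ≤ 4 * s ^ 3 := by
    rw [hs', mul_pow]
    have : √2 ^ 3 ≤ (3 / 2 : ℝ) ^ 3 := by gcongr
    have h3 : 0 ≤ s ^ 3 := by positivity
    nlinarith
  set κ := √(L / μ) with hκ
  have hκ0 : 0 < κ := Real.sqrt_pos.2 (by positivity)
  have hκ2 : κ ^ 2 = L / μ := Real.sq_sqrt (by positivity)
  set c := √(γ * L) with hc
  have hc0 : 0 < c := Real.sqrt_pos.2 (by positivity)
  have hc2 : c ^ 2 = γ * L := Real.sq_sqrt (by positivity)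
  have hc' : √(2 * γ * L) ≤ 2 * c := by
    rw [mul_assoc, Real.sqrt_mul (by norm_num)]
    gcongr
    linarith
  set R := L * v * (1 / √(n * (γ * μ))) with hRdef
  have hR0 : 0 ≤ R := by positivity
  have hn1 : (1 : ℝ) ≤ n := by exact_mod_cast hn
  have p1 : 0 ≤ L * s ^ 3 := by positivity
  have p2 : 0 ≤ L * v * (c * κ) := by positivity
  -- If `γL · L/μ ≥ 1` the allowed error exceeds the whole mean remainder and no cancellation is
  -- needed.
  rcases le_total 1 (c * κ) with h1 | h1
  · have ib : ∀ {γ : ℝ} (hγ : 0 < γ) (hγL : γ * L ≤ 1) (k : ℕ),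
        |∫ ω, inner ℝ (D (orbit G ξ γ 0 k ω) - H (orbit G ξ γ 0 k ω)) e ∂P| ≤
          12 * (L * (γ * τ₂ ^ 2 / μ)) := fun hγ hγL k => by
      have i := (hR.linearGrowth_rem.memLp (orbit_memLp hR hG hN hγ hγL 0 k)
        (orbit_measurable hG hN 0 k)).integrable (by norm_num)
      simp_rw [real_inner_comm e]
      rw [_root_.integral_inner i]
      refine (abs_real_inner_le_norm _ _).trans ?_
      have h3 := norm_mean_rem_le hR hG hN hγ hγL k
      have := mul_le_mul he h3 (norm_nonneg _) zero_le_one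
      linarith
    have h2 : ∀ k, |2 * a k - b k| ≤ 48 * (L * v * (c * κ)) := fun k => by
      have h3 := ib hγ (by linarith) k
      have h4 := ib hγ2 (by linarith) k
      rw [hv2] at h4
      refine (abs_sub _ _).trans ?_
      rw [abs_mul, abs_two]
      have : L * v * 1 ≤ L * v * (c * κ) := by gcongr
      linarith
    refine (Finset.abs_sum_le_sum_abs _ _).trans ((Finset.sum_le_sum fun k _ => h2 _).trans ?_)
    rw [Finset.sum_const, Finset.card_range, nsmul_eq_mul]
    exact mul_le_mul_of_nonneg_left (by linarith) (Nat.cast_nonneg n)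
  have hN3 : ((2 * n + 1 : ℕ) : ℝ) ≤ 3 * n := by push_cast; linarith
  -- For large noise the crude bound serves both steps. Otherwise `κ s ≤ 1`, and the scale `s' = √2
  -- s` of the step `2γ` still satisfies `κ s' ≤ 2`, the threshold of the linearization estimate.
  rcases le_total 1 (κ * s) with h2 | h2
  · have h3 := sum_mean_rem_le hR hG hN hγ hγL1 hs0 hs2 h2 he (2 * n + 1)
    have h2' : 1 ≤ κ * s' := by
      rw [hs']
      have : κ * s * 1 ≤ κ * s * √2 := by gcongr
      linarith
    have h4 := sum_mean_rem_le hR hG hN hγ2 hγL hs'0 hs'2 h2' he (2 * n + 1)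
    have h5 := (sum_shift_le (fun k => abs_nonneg (a k)) n).trans h3
    have h6 := (sum_shift_le (fun k => abs_nonneg (b k)) n).trans h4
    have h7 : |∑ k ∈ Finset.range n, (2 * a (n + 1 + k) - b (n + 1 + k))| ≤
        2 * ∑ k ∈ Finset.range n, |a (n + 1 + k)| + ∑ k ∈ Finset.range n, |b (n + 1 + k)| := by
      rw [Finset.mul_sum, ← Finset.sum_add_distrib]
      refine (Finset.abs_sum_le_sum_abs _ _).trans (Finset.sum_le_sum fun k _ => ?_)
      refine (abs_sub _ _).trans (le_of_eq ?_)
      rw [abs_mul, abs_two]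
    have h8 : ((2 * n + 1 : ℕ) : ℝ) * (2000 * (L * s ^ 3)) ≤ 3 * n * (2000 * (L * s ^ 3)) := by gcongr
    have h9 : ((2 * n + 1 : ℕ) : ℝ) * (2000 * (L * s' ^ 3)) ≤
        3 * n * (2000 * (L * (4 * s ^ 3))) := by gcongr
    have h10 : (n : ℝ) * (36000 * (L * s ^ 3)) ≤ n * (10000000000 * (L * s ^ 3 + L * v * (c * κ) + R)) :=
      mul_le_mul_of_nonneg_left (by linarith) (Nat.cast_nonneg n)
    linarith
  · have h3 := sum_mean_rem_sub_le hR hG hN hγ hγL1 hs0 hs2 (h2.trans (by norm_num)) he (2 * n + 1)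
    have h2' : κ * s' ≤ 2 := by
      rw [hs']
      have : κ * s * √2 ≤ 1 * (3 / 2) := by gcongr
      linarith
    have h4 := sum_mean_rem_sub_le hR hG hN hγ2 hγL hs'0 hs'2 h2' he (2 * n + 1)
    rw [hv2] at h4
    set a' := fun k => ∫ ω, inner ℝ (T e (orbit (linearize H G) ξ γ 0 k ω))
        (orbit (linearize H G) ξ γ 0 k ω) ∂P with ha'
    set b' := fun k => ∫ ω, inner ℝ (T e (orbit (linearize H G) ξ (2 * γ) 0 k ω))
        (orbit (linearize H G) ξ (2 * γ) 0 k ω) ∂P with hb'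
    have h5 := (sum_shift_le (fun k => abs_nonneg (a k - 1 / 2 * a' k)) n).trans h3
    have h6 := (sum_shift_le (fun k => abs_nonneg (b k - 1 / 2 * b' k)) n).trans h4
    have hq : ∀ k, |2 * a' (n + 1 + k) - b' (n + 1 + k)| ≤ 20 * (L * v * (c * κ)) + 2 * R :=
      fun k => by
      refine (abs_quadratic_moment_combination_le hR hG hN hγ (by linarith) he _).trans ?_
      -- The left side is `(c κ)²`, and `c κ ≤ 1` in this case.
      have e1 : γ * L * (L / μ) ≤ c * κ := by
        rw [← hc2, ← hκ2, ← mul_pow]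
        exact pow_le_of_le_one (by positivity) h1 (by norm_num)
      have e2 : (1 - γ * μ) ^ (n + 1 + k) ≤ 1 / √(n * (γ * μ)) :=
        (pow_le_pow_of_le_one (by linarith) (by linarith [mul_pos hγ hμ]) (by omega)).trans
          (pow_le_inv_sqrt (mul_pos hγ hμ) hx1 hn)
      calc _ ≤ 2 * (L * v) * (10 * (c * κ) + 1 / √(n * (γ * μ))) := by gcongr
        _ = _ := by rw [hRdef]; ring
    have h7 : |∑ k ∈ Finset.range n, (2 * a (n + 1 + k) - b (n + 1 + k))| ≤
        2 * ∑ k ∈ Finset.range n, |a (n + 1 + k) - 1 / 2 * a' (n + 1 + k)| +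
          ∑ k ∈ Finset.range n, |b (n + 1 + k) - 1 / 2 * b' (n + 1 + k)| +
          n * (20 * (L * v * (c * κ)) + 2 * R) := by
      have e1 : (n : ℝ) * (20 * (L * v * (c * κ)) + 2 * R) =
          ∑ k ∈ Finset.range n, (20 * (L * v * (c * κ)) + 2 * R) := by
        rw [Finset.sum_const, Finset.card_range, nsmul_eq_mul]
      rw [e1, Finset.mul_sum, ← Finset.sum_add_distrib, ← Finset.sum_add_distrib]
      refine (Finset.abs_sum_le_sum_abs _ _).trans (Finset.sum_le_sum fun k _ => ?_)
      have h8 := hq k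
      set j := n + 1 + k
      have e2 : 2 * a j - b j = 2 * (a j - 1 / 2 * a' j) - (b j - 1 / 2 * b' j) +
        1 / 2 * (2 * a' j - b' j) := by ring
      rw [e2]
      refine (abs_add_le _ _).trans (add_le_add ((abs_sub _ _).trans (le_of_eq ?_)) ?_)
      · rw [abs_mul, abs_two]
      · rw [abs_mul, abs_of_pos (by norm_num : (0 : ℝ) < 1 / 2)]
        linarith [abs_nonneg (2 * a' j - b' j)]
    have h8 : ((2 * n + 1 : ℕ) : ℝ) * (400000000 * (L * s ^ 3 + L * v * (c * κ))) ≤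
        3 * n * (400000000 * (L * s ^ 3 + L * v * (c * κ))) := by gcongr
    have h9 : ((2 * n + 1 : ℕ) : ℝ) * (400000000 * (L * s' ^ 3 + L * (2 * v) * (√(2 * γ * L) * κ))) ≤
        3 * n * (400000000 * (L * (4 * s ^ 3) + L * (2 * v) * (2 * c * κ))) := by gcongr
    have h10 : (n : ℝ) * (7200000000 * (L * s ^ 3) + 7200000020 * (L * v * (c * κ)) + 2 * R) ≤
        n * (10000000000 * (L * s ^ 3 + L * v * (c * κ) + R)) :=
      mul_le_mul_of_nonneg_left (by linarith) (Nat.cast_nonneg n)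
    linarith

/-- The squared error of the sums, up to a universal factor. -/
noncomputable def errorBudget (μ L τ₂ τ₄ τ₆ γ : ℝ) (n : ℕ) : ℝ :=
  γ * τ₂ ^ 2 / μ / γ ^ 2 +
    n * (τ₂ ^ 2 + L ^ 2 * (γ * τ₂ ^ 2 / μ) + L ^ 2 * (γ * τ₄ ^ 2 / μ) ^ 2 / (γ * μ)) +
    n ^ 2 * (L ^ 2 * (γ * τ₆ ^ 2 / μ) ^ 3 + L ^ 2 * (γ * τ₂ ^ 2 / μ) ^ 2 * (γ * L * (L / μ)))

/-- Add and subtract the mean remainders: the fluctuations of the two chains are bounded separately,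
and the deterministic combination `2A - B` by the cancellation estimate. -/
lemma richardsonRomberg_small_step (hR : RegularField D H T μ L) (hG : Oracle D G Pξ L τ₂ τ₄ τ₆)
    (hN : IsNoiseSequence P Pξ ξ θ₀) (hγ : 0 < γ) (hγL : 2 * γ * L ≤ 1 / 30)
    {n : ℕ} (hn : 0 < n) :
    ∫ ω, ‖(2 : ℝ) • ∑ k ∈ Finset.range n, H (orbit G ξ γ 0 (n + 1 + k) ω) -
      ∑ k ∈ Finset.range n, H (orbit G ξ (2 * γ) 0 (n + 1 + k) ω)‖ ^ 2 ∂P ≤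
      (10 : ℝ) ^ 22 * errorBudget μ L τ₂ τ₄ τ₆ γ n := by
  have hμ := hR.pos
  have hL := hR.posL
  have hγ2 : 0 < 2 * γ := by positivity
  have hγL1 : γ * L ≤ 1 / 30 := by nlinarith [mul_pos hγ hL]
  have f1 := small_step_fluctuation hR hG hN hγ hγL1 (n + 1) n
  have f2 := small_step_fluctuation hR hG hN hγ2 hγL (n + 1) n
  have iη : ∀ {γ : ℝ} (hγ : 0 < γ) (hγL : γ * L ≤ 1) (k : ℕ),
      Integrable (fun ω => D (orbit G ξ γ 0 k ω) - H (orbit G ξ γ 0 k ω)) P := fun hγ hγL k =>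
    (hR.linearGrowth_rem.memLp (orbit_memLp hR hG hN hγ hγL 0 k)
        (orbit_measurable hG hN 0 k)).integrable (by norm_num)
  set A := ∑ k ∈ Finset.range n, ∫ ω, (D (orbit G ξ γ 0 (n + 1 + k) ω) -
    H (orbit G ξ γ 0 (n + 1 + k) ω)) ∂P with hA
  set B := ∑ k ∈ Finset.range n, ∫ ω, (D (orbit G ξ (2 * γ) 0 (n + 1 + k) ω) -
    H (orbit G ξ (2 * γ) 0 (n + 1 + k) ω)) ∂P with hB
  set v := γ * τ₂ ^ 2 / μ with hv
  set v₄ := γ * τ₄ ^ 2 / μ with hv₄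
  set v₆ := γ * τ₆ ^ 2 / μ with hv₆
  have hv0 : 0 ≤ v := by positivity
  have hvv : v ≤ v₄ := by
    have := pow_le_pow_left₀ hG.nonneg hG.le24 2
    rw [hv, hv₄]; gcongr
  have hm : ‖(2 : ℝ) • A - B‖ ≤ n * (10000000000 * (L * √v₆ ^ 3 + L * v * (√(γ * L) * √(L / μ)) +
      L * v * (1 / √(n * (γ * μ))))) := by
    rcases eq_or_ne ((2 : ℝ) • A - B) 0 with h0 | h0
    · rw [h0, norm_zero]; positivity
    set M := (2 : ℝ) • A - B with hM
    have hMn : 0 < ‖M‖ := norm_pos_iff.2 h0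
    -- Testing against the unit vector along `M` recovers the full norm from the scalar bias
    -- estimate.
    have he : ‖‖M‖⁻¹ • M‖ ≤ 1 := by
      rw [norm_smul, norm_inv, norm_norm, inv_mul_cancel₀ hMn.ne']
    have h := abs_mean_rem_combination_le hR hG hN hγ hγL he hn
    refine le_trans (le_of_eq ?_) h
    have e1 : ∀ {γ : ℝ} (hγ : 0 < γ) (hγL : γ * L ≤ 1) (k : ℕ),
        ∫ ω, inner ℝ (D (orbit G ξ γ 0 k ω) - H (orbit G ξ γ 0 k ω)) (‖M‖⁻¹ • M) ∂P =
        inner ℝ (‖M‖⁻¹ • M) (∫ ω, (D (orbit G ξ γ 0 k ω) - H (orbit G ξ γ 0 k ω)) ∂P) :=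
      fun hγ hγL k => by
        simp_rw [real_inner_comm (‖M‖⁻¹ • M)]
        exact _root_.integral_inner (iη hγ hγL k) _
    simp_rw [e1 hγ (hγL1.trans (by norm_num)), e1 hγ2 (hγL.trans (by norm_num))]
    rw [Finset.sum_sub_distrib, ← Finset.mul_sum, ← inner_sum, ← inner_sum, ← hA, ← hB,
      ← inner_smul_right, ← inner_sub_right, ← hM, inner_smul_left, conj_trivial,
      real_inner_self_eq_norm_sq, sq, inv_mul_cancel_left₀ hMn.ne', abs_of_pos hMn]
  have hm2 : ‖(2 : ℝ) • A - B‖ ^ 2 ≤ 3 * (10000000000 : ℝ) ^ 2 * (n ^ 2 * (L ^ 2 * v₆ ^ 3 +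
      L ^ 2 * v ^ 2 * (γ * L * (L / μ))) + n * (L ^ 2 * v₄ ^ 2 / (γ * μ))) := by
    refine (pow_le_pow_left₀ (norm_nonneg _) hm 2).trans ?_
    set p := L * √v₆ ^ 3 with hp
    set q := L * v * (√(γ * L) * √(L / μ)) with hq
    set r := L * v * (1 / √(n * (γ * μ))) with hr
    have hp2 : p ^ 2 = L ^ 2 * v₆ ^ 3 := by
      have : √v₆ ^ 2 = v₆ := Real.sq_sqrt (by positivity)
      rw [hp, mul_pow, ← pow_mul, mul_comm 3 2, pow_mul, this]
    have hq2 : q ^ 2 = L ^ 2 * v ^ 2 * (γ * L * (L / μ)) := by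
      rw [hq, mul_pow, mul_pow, mul_pow, Real.sq_sqrt (by positivity), Real.sq_sqrt (by positivity)]
    -- The transient of the bias scales like a variance in `n`, and joins the fourth moment
    -- fluctuation term.
    have hr2 : n ^ 2 * r ^ 2 = n * (L ^ 2 * v ^ 2 / (γ * μ)) := by
      have e1 : (1 / √(n * (γ * μ))) ^ 2 = 1 / (n * (γ * μ)) := by
        rw [div_pow, Real.sq_sqrt (by positivity), one_pow]
      rw [hr, mul_pow, e1]
      field_simp
    have hvv2 : n * (L ^ 2 * v ^ 2 / (γ * μ)) ≤ n * (L ^ 2 * v₄ ^ 2 / (γ * μ)) := by gcongr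
    have h3 : (p + q + r) ^ 2 ≤ 3 * (p ^ 2 + q ^ 2 + r ^ 2) := by
      linarith [sq_nonneg (p - q), sq_nonneg (q - r), sq_nonneg (p - r)]
    have h4 : (n * (10000000000 * (p + q + r))) ^ 2 ≤
        (10000000000 : ℝ) ^ 2 * (n ^ 2 * (3 * (p ^ 2 + q ^ 2 + r ^ 2))) := by
      rw [mul_pow, mul_pow, mul_left_comm]
      gcongr
    refine h4.trans ?_
    rw [← hp2, ← hq2]
    linarith
  have hSm : ∀ {γ : ℝ} (hγ : 0 < γ) (hγL : γ * L ≤ 1), MemLp (fun ω => ∑ k ∈ Finset.range n,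
      H (orbit G ξ γ 0 (n + 1 + k) ω)) 2 P := fun hγ hγL =>
    memLp_finsetSum _ fun k _ => H.comp_memLp' (orbit_memLp hR hG hN hγ hγL 0 _)
  have m1 : MemLp (fun ω => ∑ k ∈ Finset.range n, H (orbit G ξ γ 0 (n + 1 + k) ω) + A) 2 P :=
    (hSm hγ (hγL1.trans (by norm_num))).add (memLp_const A)
  have m2 : MemLp (fun ω => ∑ k ∈ Finset.range n, H (orbit G ξ (2 * γ) 0 (n + 1 + k) ω) + B) 2 P :=
    (hSm hγ2 (hγL.trans (by norm_num))).add (memLp_const B)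
  have m3 : MemLp (fun ω => (2 : ℝ) • (∑ k ∈ Finset.range n, H (orbit G ξ γ 0 (n + 1 + k) ω) + A))
    2 P := m1.const_smul (2 : ℝ)
  have e0 : ∀ ω, (2 : ℝ) • ∑ k ∈ Finset.range n, H (orbit G ξ γ 0 (n + 1 + k) ω) -
      ∑ k ∈ Finset.range n, H (orbit G ξ (2 * γ) 0 (n + 1 + k) ω) =
      (2 : ℝ) • (∑ k ∈ Finset.range n, H (orbit G ξ γ 0 (n + 1 + k) ω) + A) -
      (∑ k ∈ Finset.range n, H (orbit G ξ (2 * γ) 0 (n + 1 + k) ω) + B) - ((2 : ℝ) • A - B) :=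
    fun ω => by module
  simp_rw [e0]
  have s1 := integral_norm_sub_sq_le (m3.sub m2) (memLp_const ((2 : ℝ) • A - B))
  have s2 := integral_norm_sub_sq_le m3 m2
  simp only [Pi.sub_apply] at s1
  have e3 : ∫ ω, ‖(2 : ℝ) • (∑ k ∈ Finset.range n, H (orbit G ξ γ 0 (n + 1 + k) ω) + A)‖ ^ 2 ∂P
      = 4 * ∫ ω, ‖∑ k ∈ Finset.range n, H (orbit G ξ γ 0 (n + 1 + k) ω) + A‖ ^ 2 ∂P := by
    rw [← integral_const_mul]
    congr 1 with ω
    rw [norm_smul, mul_pow, Real.norm_ofNat]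
    norm_num
  simp only [integral_const, probReal_univ, one_smul] at s1
  refine s1.trans ?_
  have s3 := s2.trans (add_le_add (mul_le_mul_of_nonneg_left (e3.le.trans
    (mul_le_mul_of_nonneg_left f1 (by norm_num))) (by norm_num))
      (mul_le_mul_of_nonneg_left f2 (by norm_num)))
  have e4 : 2 * γ * τ₂ ^ 2 / μ / (2 * γ) ^ 2 = 1 / 2 * (v / γ ^ 2) := by rw [hv]; ring
  have e5 : 2 * γ * τ₂ ^ 2 / μ = 2 * v := by rw [hv]; ring
  have e6 : (2 * γ * τ₄ ^ 2 / μ) ^ 2 / (2 * γ * μ) = 2 * (v₄ ^ 2 / (γ * μ)) := by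
    rw [hv₄]; field_simp
  rw [e4, e5, mul_div_assoc _ _ (2 * γ * μ), e6, mul_div_assoc _ _ (γ * μ)] at s3
  rw [mul_div_assoc _ _ (γ * μ)] at hm2
  rw [errorBudget, ← hv, ← hv₄, ← hv₆, mul_div_assoc _ _ (γ * μ)]
  have p1 : 0 ≤ v / γ ^ 2 := by positivity
  have p2 : 0 ≤ (n : ℝ) * τ₂ ^ 2 := by positivity
  have p3 : 0 ≤ (n : ℝ) * (L ^ 2 * v) := by positivity
  have p4 : 0 ≤ (n : ℝ) * (L ^ 2 * (v₄ ^ 2 / (γ * μ))) := by positivity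
  have p5 : 0 ≤ (n : ℝ) ^ 2 * (L ^ 2 * v₆ ^ 3 + L ^ 2 * v ^ 2 * (γ * L * (L / μ))) := by positivity
  linarith

end SmallSteps

end RRSGD

/-! ### Weighted dissipation sums -/

namespace RRSGD

section Weights

/-- Weights growing no faster than the inverse contraction keep the telescoping valid. They need not
be monotone, so they may drop to zero, which is used to restrict the sum to the times when the chain
is far out. -/
lemma HasDrift.weighted_sum_le {d : ℕ} {Z Ω : Type*} [MeasurableSpace Z] [mΩ : MeasurableSpace Ω]
    {P : Measure Ω} [IsProbabilityMeasure P] {Pξ : Measure Z} [IsProbabilityMeasure Pξ]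
    {ξ : ℕ → Ω → Z} {θ₀ : Ω → Vec d} {S : Type*} [MeasurableSpace S]
    {u : S × Z → S} {X : ℕ → Ω → S} {V Q : S → ℝ} {β B : ℝ}
    (hD : HasDrift Pξ u V Q β B) (hN : IsNoiseSequence P Pξ ξ θ₀)
    (hX : IsDriven ξ θ₀ u X) (h0 : Integrable (fun ω => V (X 0 ω)) P) {W : ℕ → ℝ}
    (hW0 : ∀ l, 0 ≤ W l) (hW : ∀ l, (1 - β) * W (l + 1) ≤ W l) (hW1 : (1 - β) * W 0 ≤ 1) (m : ℕ) :
    ∑ l ∈ Finset.range m, W l * ∫ ω, Q (X l ω) ∂P ≤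
      ∫ ω, V (X 0 ω) ∂P + B * ∑ l ∈ Finset.range m, W l := by
  have hV : ∀ l, 0 ≤ ∫ ω, V (X l ω) ∂P := fun l => integral_nonneg fun ω => hD.nonnegV _
  have h1 : 0 ≤ 1 - β := by linarith [hD.leβ]
  suffices h : ∑ l ∈ Finset.range m, W l * ∫ ω, Q (X l ω) ∂P + (1 - β) * W m * ∫ ω, V (X m ω) ∂P ≤
      ∫ ω, V (X 0 ω) ∂P + B * ∑ l ∈ Finset.range m, W l by
    linarith [mul_nonneg (mul_nonneg h1 (hW0 m)) (hV m)]
  induction m with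
  | zero =>
    have := mul_le_mul_of_nonneg_right hW1 (hV 0)
    simp only [Finset.range_zero, Finset.sum_empty]
    linarith
  | succ m ih =>
    have h2 := mul_le_mul_of_nonneg_left
      (hD.step hN hX (hD.integrable_process hN hX h0 m)).2.2 (hW0 m)
    have h3 := mul_le_mul_of_nonneg_right (hW m) (hV (m + 1))
    rw [Finset.sum_range_succ, Finset.sum_range_succ]
    linarith

/-- Cauchy–Schwarz with geometric weights: a plain sum costs one relaxation time instead of the
number of terms. -/
lemma sq_sum_le_weighted {q : ℝ} (hq : 0 < q) (f : ℕ → ℝ) (m : ℕ) :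
    (∑ l ∈ Finset.range m, f l) ^ 2 ≤
      (∑ l ∈ Finset.range m, (1 / q) ^ l) * ∑ l ∈ Finset.range m, q ^ l * f l ^ 2 := by
  refine Finset.sum_sq_le_sum_mul_sum_of_sq_le_mul _ (fun l _ => by positivity)
    (fun l _ => by positivity) fun l _ => le_of_eq ?_
  rw [← mul_assoc, ← mul_pow, one_div_mul_cancel hq.ne', one_pow, one_mul]

lemma sum_inv_pow_le {x : ℝ} (hx : 0 < x) (hx1 : x ≤ 1) (m : ℕ) :
    ∑ l ∈ Finset.range m, (1 / (1 + x / 50)) ^ l ≤ 51 / x := by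
  have h1 : 1 / (1 + x / 50) < 1 := by rw [div_lt_one (by positivity)]; linarith
  refine (sum_pow_le (by positivity) h1 m).trans ?_
  have e : 1 - 1 / (1 + x / 50) = x / (50 + x) := by field_simp; ring
  rw [e, one_div_div]
  gcongr
  linarith

/-- The part of a geometric sequence below a threshold has a sum controlled by the threshold. -/
lemma sum_ite_le {t : ℕ → ℝ} {s q : ℝ} (ht0 : ∀ l, 0 ≤ t l) (hs : 0 ≤ s) (hq : 0 < q)
    (ht : ∀ l, t (l + 1) ≤ (1 - q) * t l) (m : ℕ) :
    ∑ l ∈ Finset.range m, (if t l ≤ s then t l else 0) ≤ s / q := by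
  -- The potential `min (t m) s / q` pays for every term below the threshold, and does not increase
  -- above it.
  suffices h : ∑ l ∈ Finset.range m, (if t l ≤ s then t l else 0) + min (t m) s / q ≤ s / q by
    have : 0 ≤ min (t m) s / q := div_nonneg (le_min (ht0 m) hs) hq.le
    linarith
  induction m with
  | zero =>
    simp only [Finset.range_zero, Finset.sum_empty, zero_add]
    gcongr
    exact min_le_right _ _
  | succ m ih =>
    rw [Finset.sum_range_succ]
    refine le_trans ?_ ih
    rw [add_assoc]
    gcongr
    split_ifs with h
    · rw [min_eq_left h]
      have h1 : min (t (m + 1)) s ≤ (1 - q) * t m := (min_le_left _ _).trans (ht m)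
      rw [← sub_nonneg]
      have : t m / q - (t m + min (t (m + 1)) s / q) = ((1 - q) * t m - min (t (m + 1)) s) / q := by
        field_simp; ring
      rw [this]
      exact div_nonneg (by linarith) hq.le
    · rw [zero_add]
      gcongr
      refine (ht m).trans ?_
      have := mul_nonneg hq.le (ht0 m)
      linarith

end Weights

/-! ### Oscillation of the Hessian images for steps of order `1/L` -/

section LargeSteps

variable {d : ℕ} {Z Ω : Type*} [MeasurableSpace Z] [mΩ : MeasurableSpace Ω]
  {P : Measure Ω} [IsProbabilityMeasure P] {Pξ : Measure Z} [IsProbabilityMeasure Pξ]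
  {ξ : ℕ → Ω → Z} {θ₀ : Ω → Vec d}
  {D : Vec d → Vec d} {H : Vec d →L[ℝ] Vec d} {T : Vec d →L[ℝ] Vec d →L[ℝ] Vec d}
  {G : Vec d → Z → Vec d} {μ L τ₂ τ₄ τ₆ γ : ℝ}

/-- Apply `H² ≤ L H` to `x - y`, then replace the Hessian form by `⟪D x - D y, x - y⟫`, the
dissipation of the coupling, at the cost of the remainder. -/
lemma RegularField.norm_hessian_sub_le (hR : RegularField D H T μ L) (x y : Vec d) :
    ‖H x - H y‖ ≤ √(L * inner ℝ (D x - D y) (x - y)) + L * (√(‖x‖ + ‖y‖) * ‖x - y‖) := by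
  have hL := hR.posL
  have h0 : 0 ≤ inner ℝ (D x - D y) (x - y) :=
    (mul_nonneg hR.pos.le (sq_nonneg _)).trans (hR.mono x y)
  have h1 := hR.norm_hessian_sq_le (x - y)
  have h2 : inner ℝ (H (x - y)) (x - y) ≤ inner ℝ (D x - D y) (x - y) +
      L * (‖x‖ + ‖y‖) * ‖x - y‖ * ‖x - y‖ := by
    have h3 := (abs_le.1 (abs_real_inner_le_norm ((D x - H x) - (D y - H y)) (x - y))).1
    have h4 := mul_le_mul_of_nonneg_right (hR.rem_lip x y) (norm_nonneg (x - y))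
    have e : inner ℝ ((D x - H x) - (D y - H y)) (x - y) =
        inner ℝ (D x - D y) (x - y) - inner ℝ (H (x - y)) (x - y) := by
      rw [← inner_sub_left, map_sub]; congr 1; abel
    linarith
  rw [← map_sub]
  refine abs_le_of_sq_le_sq' ?_ (by positivity) |>.2
  have e1 : √(L * inner ℝ (D x - D y) (x - y)) ^ 2 = L * inner ℝ (D x - D y) (x - y) :=
    Real.sq_sqrt (by positivity)
  have e2 : √(‖x‖ + ‖y‖) ^ 2 = ‖x‖ + ‖y‖ := Real.sq_sqrt (by positivity)
  have h5 : 0 ≤ √(L * inner ℝ (D x - D y) (x - y)) * (L * (√(‖x‖ + ‖y‖) * ‖x - y‖)) := by positivity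
  have h6 := mul_le_mul_of_nonneg_left h2 hL.le
  rw [add_sq, e1, mul_pow L, mul_pow _ ‖x - y‖, e2]
  linarith

lemma integral_norm_hessian_sub_le (hR : RegularField D H T μ L) {X Y : Ω → Vec d}
    (hX : MemLp X 2 P) (hY : MemLp Y 2 P) (hXm : Measurable X) (hYm : Measurable Y) :
    ∫ ω, ‖H (X ω) - H (Y ω)‖ ∂P ≤
      √(L * ∫ ω, inner ℝ (D (X ω) - D (Y ω)) (X ω - Y ω) ∂P) +
      L * (√(∫ ω, (‖X ω‖ + ‖Y ω‖) ∂P) * √(∫ ω, ‖X ω - Y ω‖ ^ 2 ∂P)) := by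
  have hL := hR.posL
  have h0 : ∀ ω, 0 ≤ inner ℝ (D (X ω) - D (Y ω)) (X ω - Y ω) := fun ω =>
    (mul_nonneg hR.pos.le (sq_nonneg _)).trans (hR.mono _ _)
  have hDg : LinearGrowth D := ⟨hR.continuous.measurable, L, hL.le, fun x =>
    (hR.norm_le x).trans (by linarith)⟩
  have iD := integrable_inner ((hDg.memLp hX hXm).sub (hDg.memLp hY hYm)) (hX.sub hY)
  simp only [Pi.sub_apply] at iD
  have hDm : Measurable fun ω => √(L * inner ℝ (D (X ω) - D (Y ω)) (X ω - Y ω)) :=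
    ((((hDg.1.comp hXm).sub (hDg.1.comp hYm)).inner (hXm.sub hYm)).const_mul L).sqrt
  have m1 : MemLp (fun ω => √(L * inner ℝ (D (X ω) - D (Y ω)) (X ω - Y ω))) 2 P := by
    refine (memLp_two_iff_integrable_sq hDm.aestronglyMeasurable).2
      ((iD.const_mul L).congr (Filter.Eventually.of_forall fun ω => ?_))
    exact (Real.sq_sqrt (mul_nonneg hL.le (h0 ω))).symm
  have iN : Integrable (fun ω => ‖X ω‖ + ‖Y ω‖) P :=
    (hX.integrable (by norm_num)).norm.add (hY.integrable (by norm_num)).norm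
  have m2 : MemLp (fun ω => √(‖X ω‖ + ‖Y ω‖)) 2 P := by
    refine (memLp_two_iff_integrable_sq (hXm.norm.add hYm.norm).sqrt.aestronglyMeasurable).2
      (iN.congr (Filter.Eventually.of_forall fun ω => ?_))
    exact (Real.sq_sqrt (by positivity)).symm
  have m3 : MemLp (fun ω => ‖X ω - Y ω‖) 2 P := (hX.sub hY).norm
  have j1 := m1.integrable (by norm_num : (1 : ℝ≥0∞) ≤ 2)
  have j2 : Integrable (fun ω => L * (√(‖X ω‖ + ‖Y ω‖) * ‖X ω - Y ω‖)) P :=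
    (MemLp.integrable_mul (p := 2) (q := 2) m2 m3).const_mul L
  have iH : Integrable (fun ω => ‖H (X ω) - H (Y ω)‖) P :=
    (((H.comp_memLp' hX).sub (H.comp_memLp' hY)).integrable (by norm_num)).norm
  refine (integral_mono iH (j1.add j2) fun ω => hR.norm_hessian_sub_le _ _).trans ?_
  rw [integral_add' j1 j2, integral_const_mul]
  gcongr
  · refine Real.le_sqrt_of_sq_le ((sq_integral_le m1).trans (le_of_eq ?_))
    rw [← integral_const_mul]
    exact integral_congr_ae (Filter.Eventually.of_forall fun ω =>
      Real.sq_sqrt (mul_nonneg hL.le (h0 ω)))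
  · refine (integral_mul_le_sqrt m2 m3).trans (le_of_eq ?_)
    congr 2
    exact integral_congr_ae (Filter.Eventually.of_forall fun ω => Real.sq_sqrt (by positivity))

lemma integral_norm_orbit_le (hR : RegularField D H T μ L) (hG : Oracle D G Pξ L τ₂ τ₄ τ₆)
    (hN : IsNoiseSequence P Pξ ξ θ₀) (hγ : 0 < γ) (hγL : γ * L ≤ 1) {s : ℝ} (hs0 : 0 ≤ s)
    (hs : γ * τ₂ ^ 2 = μ * s ^ 2) (x : Vec d) (l : ℕ)
    (hx : (1 - γ * μ / 4) ^ l * ‖x‖ ^ 2 ≤ s ^ 2) :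
    ∫ ω, ‖orbit G ξ γ x l ω‖ ∂P ≤ 4 * s := by
  have h1 := sq_integral_le (orbit_memLp hR hG hN hγ hγL x l).norm
  have h2 := orbit_sq_le hR hG hN hγ hγL x l
  have h3 : γ * τ₂ ^ 2 / μ = s ^ 2 := by rw [hs]; field_simp [hR.pos.ne']
  rw [h3] at h2
  exact abs_le_of_sq_le_sq' (by nlinarith [sq_nonneg s]) (by positivity) |>.2

set_option maxHeartbeats 1000000 in
/-- The summed oscillation of the conditional expectations of `H x` along the chain. -/
lemma hessian_oscillation_le (hR : RegularField D H T μ L) (hG : Oracle D G Pξ L τ₂ τ₄ τ₆)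
    (hN : IsNoiseSequence P Pξ ξ θ₀) (hγ : 0 < γ) (hγL : γ * L ≤ 1) {s s₄ : ℝ} (hs0 : 0 < s)
    (hs : γ * τ₂ ^ 2 = μ * s ^ 2) (hs₄ : γ * τ₄ ^ 2 = μ * s₄ ^ 2) (m : ℕ) (x : Vec d) :
    ∑ l ∈ Finset.range m, ‖(transition G Pξ γ)^[l] (fun x => H x) x -
        (transition G Pξ γ)^[l] (fun x => H x) 0‖ ≤
      √(3 * (202 * (L / γ) * (51 / (γ * μ)) * lyapunov μ L x +
        400 * (L / γ) * lyapunovNoise μ L γ s s₄ * (51 / (γ * μ)) ^ 2 * (‖x‖ ^ 2 / s ^ 2) +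
        512 * (L ^ 2 * s ^ 3) / (γ * μ) ^ 2)) := by
  have hμ := hR.pos
  have hL := hR.posL
  have hx1 := hR.mul_le_one hγ hγL
  have hx0 : 0 < γ * μ := mul_pos hγ hμ
  have hd := drift_lyapunov hR hG hγ hγL hs0.le hs hs₄
  have hc := drift_coupling hR hG hγ hγL (t := 1 / 2) (by norm_num) (by norm_num)
  set B := lyapunovNoise μ L γ s s₄ with hB
  have hB0 : 0 ≤ B := hd.nonnegB
  set y := γ * μ with hy
  set q := 1 + y / 50 with hq
  have hq0 : 0 < q := by positivity
  set ϑ := 1 - y / 4 with hϑ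
  have hϑ0 : 0 < ϑ := by rw [hϑ]; linarith
  -- `t l` bounds the transient of the orbit from `x`. While it exceeds `s` the orbit is far out and
  -- norms are bounded separately; afterwards the coupled difference is used.
  set t : ℕ → ℝ := fun l => √ϑ ^ l * ‖x‖ with ht
  have ht0 : ∀ l, 0 ≤ t l := fun l => by positivity
  have ht2 : ∀ l, t l ^ 2 = ϑ ^ l * ‖x‖ ^ 2 := fun l => by
    simp only [ht]
    rw [mul_pow, ← pow_mul, mul_comm l 2, pow_mul, Real.sq_sqrt hϑ0.le]
  have hsϑ : √ϑ ≤ 1 - y / 8 := by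
    rw [Real.sqrt_le_left (by linarith)]
    nlinarith [sq_nonneg y]
  have ht1 : ∀ l, t (l + 1) ≤ (1 - y / 8) * t l := fun l => by
    simp only [ht]
    rw [pow_succ']
    have : √ϑ * (√ϑ ^ l * ‖x‖) ≤ (1 - y / 8) * (√ϑ ^ l * ‖x‖) := by gcongr
    linarith
  have htmono : ∀ l, t (l + 1) ≤ t l := fun l => (ht1 l).trans (by
    have := mul_nonneg hx0.le (ht0 l)
    linarith)
  have hX := orbit_memLp hR hG hN hγ hγL x
  have hX' := orbit_memLp hR hG hN hγ hγL 0
  have hXm := orbit_measurable (γ := γ) hG hN x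
  have hX'm := orbit_measurable (γ := γ) hG hN 0
  set X := orbit G ξ γ x with hXdef
  set X' := orbit G ξ γ 0 with hX'def
  set f : ℕ → ℝ := fun l => ∫ ω, ‖H (X l ω)‖ ∂P with hf
  set f' : ℕ → ℝ := fun l => ∫ ω, ‖H (X' l ω)‖ ∂P with hf'
  set F : ℕ → ℝ := fun l => ∫ ω, ‖H (X l ω)‖ ^ 2 ∂P with hF
  set F' : ℕ → ℝ := fun l => ∫ ω, ‖H (X' l ω)‖ ^ 2 ∂P with hF'
  set Δ : ℕ → ℝ := fun l => ∫ ω, inner ℝ (D (X l ω) - D (X' l ω)) (X l ω - X' l ω) ∂P with hΔ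
  have hΔ0 : ∀ l, 0 ≤ Δ l := fun l => integral_nonneg fun ω =>
    (mul_nonneg hμ.le (sq_nonneg _)).trans (hR.mono _ _)
  have hfF : ∀ l, f l ^ 2 ≤ F l := fun l => sq_integral_le (H.comp_memLp' (hX l)).norm
  have hfF' : ∀ l, f' l ^ 2 ≤ F' l := fun l => sq_integral_le (H.comp_memLp' (hX' l)).norm
  have hF0 : ∀ l, 0 ≤ F l := fun l => (sq_nonneg _).trans (hfF l)
  have hF'0 : ∀ l, 0 ≤ F' l := fun l => (sq_nonneg _).trans (hfF' l)
  have hterm : ∀ l, ‖(transition G Pξ γ)^[l] (fun x => H x) x -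
      (transition G Pξ γ)^[l] (fun x => H x) 0‖ ≤
      (if t l ≤ s then 0 else f l + f' l) + √(L * Δ l) +
        L * √(8 * s) * (if t l ≤ s then t l else 0) := fun l => by
    refine (norm_transition_iterate_sub_le hR hG hN hγ hγL hR.linearGrowth_hessian x l).trans ?_
    split_ifs with hl
    · have h1 := integral_norm_hessian_sub_le hR (hX l) (hX' l) (hXm l) (hX'm l)
      refine h1.trans ?_
      have i1 := ((hX l).integrable (by norm_num : (1 : ℝ≥0∞) ≤ 2)).norm
      have i2 := ((hX' l).integrable (by norm_num : (1 : ℝ≥0∞) ≤ 2)).norm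
      have h2 : ∫ ω, (‖X l ω‖ + ‖X' l ω‖) ∂P ≤ 8 * s := by
        rw [integral_add i1 i2]
        have h3 := integral_norm_orbit_le hR hG hN hγ hγL hs0.le hs x l (by
          rw [← hy, ← hϑ, ← ht2]
          exact pow_le_pow_left₀ (ht0 l) hl 2)
        have h4 := integral_norm_orbit_le hR hG hN hγ hγL hs0.le hs 0 l (by
          rw [norm_zero]; nlinarith)
        linarith
      have h5 : √(∫ ω, ‖X l ω - X' l ω‖ ^ 2 ∂P) ≤ t l := by
        rw [Real.sqrt_le_left (ht0 l), ht2]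
        have h6 := orbit_coupling_le hR hG hN hγ hγL x 0 l
        rw [sub_zero] at h6
        refine h6.trans ?_
        rw [← hy]
        gcongr
        linarith
      rw [zero_add, mul_assoc]
      gcongr
    · have i1 := ((H.comp_memLp' (hX l)).integrable (by norm_num : (1 : ℝ≥0∞) ≤ 2))
      have i2 := ((H.comp_memLp' (hX' l)).integrable (by norm_num : (1 : ℝ≥0∞) ≤ 2))
      have h1 := integral_mono (i1.sub i2).norm (i1.norm.add i2.norm) fun ω => norm_sub_le _ _
      rw [integral_add' i1.norm i2.norm] at h1
      have : 0 ≤ √(L * Δ l) := Real.sqrt_nonneg _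
      refine h1.trans ?_
      rw [mul_zero, add_zero]
      exact le_add_of_nonneg_right this
  refine (Finset.sum_le_sum fun l _ => hterm l).trans ?_
  rw [Finset.sum_add_distrib, Finset.sum_add_distrib, ← Finset.mul_sum]
  set A₁ := ∑ l ∈ Finset.range m, (if t l ≤ s then 0 else f l + f' l) with hA₁
  set A₂ := ∑ l ∈ Finset.range m, √(L * Δ l) with hA₂
  set A₃ := L * √(8 * s) * ∑ l ∈ Finset.range m, (if t l ≤ s then t l else 0) with hA₃
  -- Growing weights cut off when the transient falls below `s`; the cutoff is compatible with
  -- `weighted_sum_le` because `t` is nonincreasing.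
  set W : ℕ → ℝ := fun l => if t l ≤ s then 0 else q ^ l with hW
  have hW0 : ∀ l, 0 ≤ W l := fun l => by
    simp only [hW]; split_ifs
    · exact le_rfl
    · positivity
  have hS := sum_inv_pow_le hx0 hx1 m
  have hW1 : ∀ l, (1 - γ * μ / 50) * W (l + 1) ≤ W l := fun l => by
    simp only [hW]
    split_ifs with h1 h2 h2
    · simp
    · rw [mul_zero]; positivity
    · exact absurd ((htmono l).trans h2) h1
    · rw [pow_succ', ← mul_assoc, ← hy]
      have : (1 - y / 50) * q ≤ 1 := by rw [hq]; nlinarith [sq_nonneg y]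
      have := mul_le_mul_of_nonneg_right this (pow_nonneg hq0.le l)
      linarith
  have hW2 : (1 - γ * μ / 50) * W 0 ≤ 1 := by
    simp only [hW]
    split_ifs
    · simp
    · rw [pow_zero, ← hy]; linarith
  -- At the times kept, `s² ≤ ϑ^l ‖x‖²`; since `q² ϑ ≤ 1`, the weight `q^l` is at most `q^(-l) ‖x‖²
  -- / s²`.
  have hWs : ∑ l ∈ Finset.range m, W l ≤ 51 / y * (‖x‖ ^ 2 / s ^ 2) := by
    refine (Finset.sum_le_sum (g := fun l => (1 / q) ^ l * (‖x‖ ^ 2 / s ^ 2)) fun l _ => ?_).trans ?_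
    · simp only [hW]
      split_ifs with h1
      · positivity
      · have h2 : s ^ 2 ≤ ϑ ^ l * ‖x‖ ^ 2 := by
          rw [← ht2]
          exact pow_le_pow_left₀ hs0.le (not_le.1 h1).le 2
        have h3 : (q ^ 2 * ϑ) ^ l ≤ 1 := by
          refine pow_le_one₀ (by positivity) ?_
          rw [hq, hϑ]
          nlinarith [sq_nonneg y, mul_pos hx0 hx0, mul_pos hx0 (mul_pos hx0 hx0)]
        rw [mul_pow, ← pow_mul, mul_comm 2 l, pow_mul] at h3
        rw [one_div, inv_pow, ← div_eq_inv_mul, le_div_iff₀ (by positivity), le_div_iff₀ (by positivity)]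
        calc q ^ l * q ^ l * s ^ 2 ≤ q ^ l * q ^ l * (ϑ ^ l * ‖x‖ ^ 2) := by gcongr
          _ = (q ^ l) ^ 2 * ϑ ^ l * ‖x‖ ^ 2 := by ring
          _ ≤ 1 * ‖x‖ ^ 2 := by gcongr
          _ = _ := one_mul _
    · rw [← Finset.sum_mul]
      gcongr
  have hwx := hd.weighted_sum_le hN (orbit_isDriven hG x)
    (integrable_const_orbit (lyapunov μ L) x) hW0 hW1 hW2 m
  have hw0 := hd.weighted_sum_le hN (orbit_isDriven hG 0)
    (integrable_const_orbit (lyapunov μ L) 0) hW0 hW1 hW2 m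
  rw [integral_orbit_zero (V := lyapunov μ L)] at hwx hw0
  have hl0 : lyapunov μ L (0 : Vec d) = 0 := by simp [lyapunov]
  rw [hl0] at hw0
  simp only [integral_const_mul] at hwx hw0
  have hdr := (orbit_isDriven (ξ := ξ) (θ₀ := θ₀) (γ := γ) hG x).pair
    (orbit_isDriven (ξ := ξ) (θ₀ := θ₀) (γ := γ) hG 0)
  have h00 : Integrable (fun ω => ‖X 0 ω - X' 0 ω‖ ^ 2) P := integrable_const (‖x - 0‖ ^ 2)
  have hwc := hc.weighted_sum_le hN hdr h00 (W := fun l => q ^ l)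
    (fun l => by positivity) (fun l => by
      rw [pow_succ', ← mul_assoc]
      have : (1 - 1 / 2 * y) * q ≤ 1 := by rw [hq]; nlinarith [sq_nonneg y]
      have := mul_le_mul_of_nonneg_right this (pow_nonneg hq0.le l)
      linarith) (by rw [pow_zero]; linarith) m
  simp only [integral_const_mul, zero_mul, add_zero] at hwc
  have hwc0 : ∫ ω, ‖X 0 ω - X' 0 ω‖ ^ 2 ∂P = ‖x‖ ^ 2 := by simp [hXdef, hX'def, orbit, sgd]
  rw [hwc0] at hwc
  have hV := sq_le_lyapunov (μ := μ) (L := L) x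
  -- Far part: Cauchy–Schwarz and the Lyapunov dissipation of both orbits, the one from `0` starting
  -- with zero Lyapunov value.
  have b1 : A₁ ^ 2 ≤ 51 / y * (200 * (L / γ) * (lyapunov μ L x +
      2 * (B * (51 / y * (‖x‖ ^ 2 / s ^ 2))))) := by
    refine (sq_sum_le_weighted hq0 _ m).trans (mul_le_mul hS ?_
      (Finset.sum_nonneg fun l _ => by positivity) (by positivity))
    have h1 : ∀ l, q ^ l * (if t l ≤ s then 0 else f l + f' l) ^ 2 ≤
        200 * (L / γ) * (W l * (γ / (100 * L) * F l) + W l * (γ / (100 * L) * F' l)) := fun l => by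
      have e : 200 * (L / γ) * (W l * (γ / (100 * L) * F l) + W l * (γ / (100 * L) * F' l)) =
          W l * (2 * (F l + F' l)) := by field_simp; ring
      rw [e]
      simp only [hW]
      split_ifs
      · simp
      · gcongr
        have := hfF l
        have := hfF' l
        linarith [sq_nonneg (f l - f' l)]
    refine (Finset.sum_le_sum fun l _ => h1 l).trans ?_
    rw [← Finset.mul_sum, Finset.sum_add_distrib]
    have h2 := mul_le_mul_of_nonneg_left hWs hB0
    exact mul_le_mul_of_nonneg_left (by linarith) (by positivity)
  have b2 : A₂ ^ 2 ≤ 51 / y * (2 * (L / γ) * lyapunov μ L x) := by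
    refine (sq_sum_le_weighted hq0 _ m).trans (mul_le_mul hS ?_
      (Finset.sum_nonneg fun l _ => by positivity) (by positivity))
    have h1 : ∀ l, q ^ l * √(L * Δ l) ^ 2 =
        2 * (L / γ) * (q ^ l * ((1 - 1 / 2) * γ * Δ l)) := fun l => by
      rw [Real.sq_sqrt (mul_nonneg hL.le (hΔ0 l))]; field_simp; ring
    simp_rw [h1]
    rw [← Finset.mul_sum]
    gcongr
    exact hwc.trans hV
  have b3 : A₃ ^ 2 ≤ 512 * (L ^ 2 * s ^ 3) / y ^ 2 := by
    have h1 := sum_ite_le ht0 hs0.le (by positivity : 0 < y / 8) ht1 m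
    have h0 : 0 ≤ ∑ l ∈ Finset.range m, (if t l ≤ s then t l else 0) :=
      Finset.sum_nonneg fun l _ => by split_ifs <;> simp [ht0]
    have h2 : A₃ ≤ L * √(8 * s) * (s / (y / 8)) := by
      rw [hA₃]; gcongr
    have h3 := pow_le_pow_left₀ (by positivity : 0 ≤ A₃) h2 2
    refine h3.trans (le_of_eq ?_)
    rw [mul_pow, mul_pow, Real.sq_sqrt (by positivity)]
    field_simp
    norm_num
  refine Real.le_sqrt_of_sq_le ?_
  have h3 : (A₁ + A₂ + A₃) ^ 2 ≤ 3 * (A₁ ^ 2 + A₂ ^ 2 + A₃ ^ 2) := by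
    linarith [sq_nonneg (A₁ - A₂), sq_nonneg (A₂ - A₃), sq_nonneg (A₁ - A₃)]
  linarith

end LargeSteps

end RRSGD

/-! ### Error bound for large steps -/

namespace RRSGD

section LargeStepBound

variable {d : ℕ} {Z Ω : Type*} [MeasurableSpace Z] [mΩ : MeasurableSpace Ω]
  {P : Measure Ω} [IsProbabilityMeasure P] {Pξ : Measure Z} [IsProbabilityMeasure Pξ]
  {ξ : ℕ → Ω → Z} {θ₀ : Ω → Vec d}
  {D : Vec d → Vec d} {H : Vec d →L[ℝ] Vec d} {T : Vec d →L[ℝ] Vec d →L[ℝ] Vec d}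
  {G : Vec d → Z → Vec d} {μ L τ₂ τ₄ τ₆ γ : ℝ}

/-- Summed dissipation of `drift_lyapunov` over at most `3n` times, hence `300 = 3 · 100`. -/
lemma sum_norm_hessian_sq_le (hR : RegularField D H T μ L) (hG : Oracle D G Pξ L τ₂ τ₄ τ₆)
    (hN : IsNoiseSequence P Pξ ξ θ₀) (hγ : 0 < γ) (hγL : γ * L ≤ 1) {s s₄ : ℝ} (hs0 : 0 ≤ s)
    (hs : γ * τ₂ ^ 2 = μ * s ^ 2) (hs₄ : γ * τ₄ ^ 2 = μ * s₄ ^ 2) {n : ℕ} (hn : 0 < n) :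
    ∑ k ∈ Finset.range n, ∫ ω, ‖H (orbit G ξ γ 0 (n + 1 + k) ω)‖ ^ 2 ∂P ≤
      300 * n * (L / γ * lyapunovNoise μ L γ s s₄) := by
  have hL := hR.posL
  have hd := drift_lyapunov hR hG hγ hγL hs0 hs hs₄
  have h := hd.sum_le hN (orbit_isDriven hG 0) (integrable_const_orbit (lyapunov μ L) 0) 0 (2 * n + 1)
  rw [integral_orbit_zero (V := lyapunov μ L)] at h
  have hl0 : lyapunov μ L (0 : Vec d) = 0 := by simp [lyapunov]
  simp only [hl0, zero_add, integral_const_mul, ← Finset.mul_sum] at h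
  refine (sum_shift_le (f := fun k => ∫ ω, ‖H (orbit G ξ γ 0 k ω)‖ ^ 2 ∂P)
    (fun k => integral_nonneg fun ω => sq_nonneg _) n).trans ?_
  have hB := hd.nonnegB
  have hn1 : ((2 * n + 1 : ℕ) : ℝ) ≤ 3 * n := by
    have : (1 : ℝ) ≤ n := by exact_mod_cast hn
    push_cast; linarith
  have h2 := h.trans (mul_le_mul_of_nonneg_right hn1 hB)
  have h3 := mul_le_mul_of_nonneg_left h2 (by positivity : 0 ≤ 100 * L / γ)
  refine le_trans (le_of_eq ?_) (h3.trans (le_of_eq ?_))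
  · field_simp
  · ring

lemma integral_norm_sum_hessian_sq_le (hR : RegularField D H T μ L)
    (hG : Oracle D G Pξ L τ₂ τ₄ τ₆) (hN : IsNoiseSequence P Pξ ξ θ₀) (hγ : 0 < γ)
    (hγL : γ * L ≤ 1) (m n : ℕ) :
    ∫ ω, ‖∑ k ∈ Finset.range n, H (orbit G ξ γ 0 (m + k) ω)‖ ^ 2 ∂P ≤
      n * ∑ k ∈ Finset.range n, ∫ ω, ‖H (orbit G ξ γ 0 (m + k) ω)‖ ^ 2 ∂P := by
  have hH : ∀ k, MemLp (fun ω => H (orbit G ξ γ 0 (m + k) ω)) 2 P := fun k =>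
    H.comp_memLp' (orbit_memLp hR hG hN hγ hγL 0 _)
  rw [← integral_finsetSum _ fun k _ => integrable_norm_sq (hH k), ← integral_const_mul]
  refine integral_mono (integrable_norm_sq (memLp_finsetSum _ fun k _ => hH k))
    ((integrable_finsetSum _ fun k _ => integrable_norm_sq (hH k)).const_mul _) fun ω => ?_
  have h1 := pow_le_pow_left₀ (norm_nonneg _)
    (norm_sum_le (Finset.range n) fun k => H (orbit G ξ γ 0 (m + k) ω)) 2
  have h2 := sq_sum_le_card_mul_sum_sq (s := Finset.range n)
    (f := fun k => ‖H (orbit G ξ γ 0 (m + k) ω)‖)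
  rw [Finset.card_range] at h2
  exact h1.trans h2

/-- The summed recursion in mean, with each mean remainder bounded crudely by `12 L γ τ₂² / μ`; at
large steps this is already within the budget. -/
lemma norm_integral_sum_hessian_sq_le (hR : RegularField D H T μ L)
    (hG : Oracle D G Pξ L τ₂ τ₄ τ₆) (hN : IsNoiseSequence P Pξ ξ θ₀) (hγ : 0 < γ)
    (hγL : γ * L ≤ 1) (m n : ℕ) :
    ‖∫ ω, ∑ k ∈ Finset.range n, H (orbit G ξ γ 0 (m + k) ω) ∂P‖ ^ 2 ≤
      192 * (γ * τ₂ ^ 2 / μ / γ ^ 2 + n * (τ₂ ^ 2 + L ^ 2 * (γ * τ₂ ^ 2 / μ))) +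
        288 * (n ^ 2 * (L ^ 2 * (γ * τ₂ ^ 2 / μ) ^ 2)) := by
  have hL := hR.posL
  have hμ := hR.pos
  have hX := orbit_memLp hR hG hN hγ hγL 0
  have hH : MemLp (fun ω => ∑ k ∈ Finset.range n, H (orbit G ξ γ 0 (m + k) ω)) 2 P :=
    memLp_finsetSum _ fun k _ => H.comp_memLp' (hX _)
  have hη : ∀ k, MemLp (fun ω => D (orbit G ξ γ 0 k ω) - H (orbit G ξ γ 0 k ω)) 2 P := fun k =>
    hR.linearGrowth_rem.memLp (hX k) (orbit_measurable hG hN 0 k)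
  have hη' : MemLp (fun ω => ∑ k ∈ Finset.range n, (D (orbit G ξ γ 0 (m + k) ω) -
      H (orbit G ξ γ 0 (m + k) ω))) 2 P := memLp_finsetSum _ fun k _ => hη _
  set A : Ω → Vec d := fun ω => (1 / γ) • (orbit G ξ γ 0 m ω - orbit G ξ γ 0 (m + n) ω)
  set E : Ω → Vec d := fun ω => ∑ k ∈ Finset.range n, gradNoise D G ξ γ (m + k) ω
  have hA : MemLp A 2 P := ((hX m).sub (hX (m + n))).const_smul (1 / γ)
  have hE : MemLp E 2 P := memLp_finsetSum _ fun k _ => (gradNoise_sq hR hG hN hγ hγL (m + k)).1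
  have e : ∀ ω, ∑ k ∈ Finset.range n, H (orbit G ξ γ 0 (m + k) ω) +
      ∑ k ∈ Finset.range n, (D (orbit G ξ γ 0 (m + k) ω) - H (orbit G ξ γ 0 (m + k) ω)) =
      A ω - E ω := fun ω => by
    have h := congrArg (fun x => (1 / γ) • x) (orbit_sum_eq (D := D) (H := H) (G := G) (ξ := ξ)
      (γ := γ) m n ω)
    simp only [smul_sub, smul_smul, one_div_mul_cancel hγ.ne', one_smul] at h
    rw [h]
    simp only [A, E, smul_sub]
    abel
  have hbA : ∫ ω, ‖A ω‖ ^ 2 ∂P ≤ 48 * (γ * τ₂ ^ 2 / μ / γ ^ 2) := by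
    have h1 := integral_norm_sub_sq_le (hX m) (hX (m + n))
    have h2 := orbit_zero_sq_le hR hG hN hγ hγL m
    have h3 := orbit_zero_sq_le hR hG hN hγ hγL (m + n)
    have e1 : ∫ ω, ‖A ω‖ ^ 2 ∂P =
        (1 / γ) ^ 2 * ∫ ω, ‖orbit G ξ γ 0 m ω - orbit G ξ γ 0 (m + n) ω‖ ^ 2 ∂P := by
      rw [← integral_const_mul]
      congr 1; funext ω
      simp only [A, norm_smul, mul_pow, Real.norm_eq_abs, sq_abs]
    rw [e1]
    have h4 : ∫ ω, ‖orbit G ξ γ 0 m ω - orbit G ξ γ 0 (m + n) ω‖ ^ 2 ∂P ≤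
        48 * (γ * τ₂ ^ 2 / μ) := by linarith
    refine (mul_le_mul_of_nonneg_left h4 (sq_nonneg _)).trans (le_of_eq ?_)
    field_simp
  have hbE := gradNoise_sum_sq_le hR hG hN hγ hγL m n
  change ∫ ω, ‖E ω‖ ^ 2 ∂P ≤ _ at hbE
  have h1 := (norm_integral_sq_le (hA.sub hE)).trans (integral_norm_sub_sq_le hA hE)
  have i1 := hH.integrable (by norm_num : (1 : ℝ≥0∞) ≤ 2)
  have i2 := hη'.integrable (by norm_num : (1 : ℝ≥0∞) ≤ 2)
  have e2 : ∫ ω, (A - E) ω ∂P = ∫ ω, ∑ k ∈ Finset.range n, H (orbit G ξ γ 0 (m + k) ω) ∂P +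
      ∑ k ∈ Finset.range n, ∫ ω, (D (orbit G ξ γ 0 (m + k) ω) - H (orbit G ξ γ 0 (m + k) ω)) ∂P := by
    rw [← integral_finsetSum _ fun k _ => (hη _).integrable (by norm_num), ← integral_add i1 i2]
    exact integral_congr_ae (Filter.Eventually.of_forall fun ω => (e ω).symm)
  rw [e2] at h1
  set x := ∫ ω, ∑ k ∈ Finset.range n, H (orbit G ξ γ 0 (m + k) ω) ∂P
  set y := ∑ k ∈ Finset.range n, ∫ ω, (D (orbit G ξ γ 0 (m + k) ω) -
    H (orbit G ξ γ 0 (m + k) ω)) ∂P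
  have hy : ‖y‖ ≤ n * (12 * (L * (γ * τ₂ ^ 2 / μ))) := by
    refine (norm_sum_le _ _).trans ((Finset.sum_le_sum fun k _ =>
      norm_mean_rem_le hR hG hN hγ hγL (m + k)).trans (le_of_eq ?_))
    simp
  have hy2 := pow_le_pow_left₀ (norm_nonneg _) hy 2
  have hx : ‖x‖ ^ 2 ≤ 2 * ‖x + y‖ ^ 2 + 2 * ‖y‖ ^ 2 := by
    have h2 : ‖x‖ ≤ ‖x + y‖ + ‖y‖ := by
      have := norm_sub_le (x + y) y
      rwa [add_sub_cancel_right] at this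
    have := pow_le_pow_left₀ (norm_nonneg _) h2 2
    linarith [sq_nonneg (‖x + y‖ - ‖y‖)]
  have p1 : 0 ≤ (n : ℝ) * τ₂ ^ 2 := by positivity
  have p2 : 0 ≤ (n : ℝ) * (L ^ 2 * (γ * τ₂ ^ 2 / μ)) := by positivity
  linarith

-- `variance_sum_le` is applied to `H` itself, not to the nonlinear remainder, so that only the
-- Lyapunov function of order `5/2` and second moments of the chain are needed.
set_option maxHeartbeats 1000000 in
lemma hessian_variance_le (hR : RegularField D H T μ L) (hG : Oracle D G Pξ L τ₂ τ₄ τ₆)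
    (hN : IsNoiseSequence P Pξ ξ θ₀) (hγ : 0 < γ) (hγL : γ * L ≤ 1) {s s₄ : ℝ} (hs0 : 0 < s)
    (hs : γ * τ₂ ^ 2 = μ * s ^ 2) (hs₄ : γ * τ₄ ^ 2 = μ * s₄ ^ 2) {n : ℕ} (hn : 0 < n) :
    ∫ ω, ‖∑ k ∈ Finset.range n, (H (orbit G ξ γ 0 (n + 1 + k) ω) -
        ∫ ω, H (orbit G ξ γ 0 (n + 1 + k) ω) ∂P)‖ ^ 2 ∂P ≤
      n / (γ * μ) * (100000000 * (L / γ * lyapunovNoise μ L γ s s₄) + 4000 * (L ^ 2 * s ^ 3)) := by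
  have hL := hR.posL
  have hμ := hR.pos
  have hd := drift_lyapunov hR hG hγ hγL hs0.le hs hs₄
  set B := lyapunovNoise μ L γ s s₄ with hB
  have hB0 : 0 ≤ B := hd.nonnegB
  set U : Vec d → ℝ := fun x => √(3 * (202 * (L / γ) * (51 / (γ * μ)) * lyapunov μ L x +
        400 * (L / γ) * B * (51 / (γ * μ)) ^ 2 * (‖x‖ ^ 2 / s ^ 2) +
        512 * (L ^ 2 * s ^ 3) / (γ * μ) ^ 2)) with hU
  have hUm : Measurable U :=
    ((((measurable_lyapunov.const_mul _).add (((measurable_norm.pow_const 2).div_const _).const_mul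
      _)).add_const _).const_mul _).sqrt
  have hX := orbit_memLp hR hG hN hγ hγL 0
  have iV := fun k => hd.integrable_process hN (orbit_isDriven hG 0)
    (integrable_const_orbit (lyapunov μ L) 0) k
  have hVb := fun k => hd.integral_le hN (orbit_isDriven hG 0)
    (integrable_const_orbit (lyapunov μ L) 0) (by positivity) k
  have hl0 : lyapunov μ L (0 : Vec d) = 0 := by simp [lyapunov]
  simp only [integral_orbit_zero (V := lyapunov μ L), hl0, mul_zero, zero_add] at hVb
  have hU2 : ∀ x, U x ^ 2 = 3 * (202 * (L / γ) * (51 / (γ * μ)) * lyapunov μ L x +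
        400 * (L / γ) * B * (51 / (γ * μ)) ^ 2 * (‖x‖ ^ 2 / s ^ 2) +
        512 * (L ^ 2 * s ^ 3) / (γ * μ) ^ 2) := fun x => by
    have := lyapunov_nonneg (μ := μ) (L := L) x
    exact Real.sq_sqrt (by positivity)
  have i2 := fun k => ((integrable_norm_sq (hX k)).div_const (s ^ 2)).const_mul
    (400 * (L / γ) * B * (51 / (γ * μ)) ^ 2)
  have i1 := fun k => (iV k).const_mul (202 * (L / γ) * (51 / (γ * μ)))
  have iU : ∀ k, Integrable (fun ω => U (orbit G ξ γ 0 k ω) ^ 2) P := fun k => by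
    simp_rw [hU2]
    exact (((i1 k).add (i2 k)).add (integrable_const _)).const_mul 3
  have hEU : ∀ k, ∫ ω, U (orbit G ξ γ 0 k ω) ^ 2 ∂P ≤
      1 / (γ * μ) ^ 2 * (40000000 * (L / γ * B) + 1536 * (L ^ 2 * s ^ 3)) := fun k => by
    simp_rw [hU2]
    have h1 := integral_add' (i1 k) (i2 k)
    have h2 := integral_add' ((i1 k).add (i2 k))
      (integrable_const (512 * (L ^ 2 * s ^ 3) / (γ * μ) ^ 2))
    rw [integral_const_mul, integral_const_mul, integral_div] at h1
    rw [h1] at h2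
    simp only [integral_const, probReal_univ, one_smul] at h2
    rw [integral_const_mul]
    refine (mul_le_mul_of_nonneg_left h2.le (by norm_num)).trans ?_
    have h3 := orbit_zero_sq_le hR hG hN hγ hγL k
    have h4 : γ * τ₂ ^ 2 / μ = s ^ 2 := by rw [hs]; field_simp
    rw [h4] at h3
    have h5 : (∫ ω, ‖orbit G ξ γ 0 k ω‖ ^ 2 ∂P) / s ^ 2 ≤ 12 := by
      rw [div_le_iff₀ (by positivity)]; exact h3
    have h6 := mul_le_mul_of_nonneg_left (hVb k)
      (by positivity : 0 ≤ 202 * (L / γ) * (51 / (γ * μ)))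
    have h7 := mul_le_mul_of_nonneg_left h5
      (by positivity : 0 ≤ 400 * (L / γ) * B * (51 / (γ * μ)) ^ 2)
    have e1 : 202 * (L / γ) * (51 / (γ * μ)) * (B / (γ * μ / 50)) =
        515100 * (1 / (γ * μ) ^ 2 * (L / γ * B)) := by field_simp; ring
    have e2 : 400 * (L / γ) * B * (51 / (γ * μ)) ^ 2 * 12 =
        12484800 * (1 / (γ * μ) ^ 2 * (L / γ * B)) := by field_simp; ring
    have e3 : 512 * (L ^ 2 * s ^ 3) / (γ * μ) ^ 2 =
        512 * (1 / (γ * μ) ^ 2 * (L ^ 2 * s ^ 3)) := by ring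
    have p : 0 ≤ 1 / (γ * μ) ^ 2 * (L / γ * B) := by positivity
    rw [e1] at h6
    rw [e2] at h7
    rw [e3]
    linarith
  have h := variance_sum_le (x₀ := fun _ => 0) hL.le hR.norm_le hR.zero hN hG measurable_const
    hX hR.linearGrowth_hessian hUm (hessian_oscillation_le hR hG hN hγ hγL hs0 hs hs₄) iU
    (c := 1 / (γ * μ)) (by positivity) (n + 1) n
  refine h.trans ?_
  rw [Finset.sum_add_distrib, ← Finset.mul_sum, ← Finset.mul_sum]
  have h1 := mul_le_mul_of_nonneg_left (sum_norm_hessian_sq_le hR hG hN hγ hγL hs0.le hs hs₄ hn)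
    (by positivity : 0 ≤ 2 * (1 / (γ * μ)))
  have h2 := mul_le_mul_of_nonneg_left (Finset.sum_le_sum (s := Finset.range n)
    fun k _ => hEU (n + 1 + k)) (by positivity : 0 ≤ 2 / (1 / (γ * μ)))
  rw [Finset.sum_const, Finset.card_range, nsmul_eq_mul] at h2
  have e2 : 2 / (1 / (γ * μ)) * (n * (1 / (γ * μ) ^ 2 *
      (40000000 * (L / γ * B) + 1536 * (L ^ 2 * s ^ 3)))) =
      n / (γ * μ) * (80000000 * (L / γ * B) + 3072 * (L ^ 2 * s ^ 3)) := by field_simp; ring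
  have e1 : 2 * (1 / (γ * μ)) * (300 * n * (L / γ * B)) = n / (γ * μ) * (600 * (L / γ * B)) := by
    ring
  rw [e2] at h2
  rw [← hB, e1] at h1
  have p1 : 0 ≤ n / (γ * μ) * (L / γ * B) := by positivity
  have p2 : 0 ≤ n / (γ * μ) * (L ^ 2 * s ^ 3) := by positivity
  refine (add_le_add h1 h2).trans ?_
  linarith

set_option maxHeartbeats 1000000 in
/-- The squared sum of the Hessian images for step sizes of the order of `1 / L`. -/
lemma large_step_sum_le (hR : RegularField D H T μ L) (hG : Oracle D G Pξ L τ₂ τ₄ τ₆)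
    (hN : IsNoiseSequence P Pξ ξ θ₀) (hγ : 0 < γ) (hγL : γ * L ≤ 1) (hγL' : 1 / 60 ≤ γ * L)
    {n : ℕ} (hn : 0 < n) :
    ∫ ω, ‖∑ k ∈ Finset.range n, H (orbit G ξ γ 0 (n + 1 + k) ω)‖ ^ 2 ∂P ≤
      (10 : ℝ) ^ 19 * errorBudget μ L τ₂ τ₄ τ₆ γ n := by
  have hL := hR.posL
  have hμ := hR.pos
  set v := γ * τ₂ ^ 2 / μ with hv
  set v₄ := γ * τ₄ ^ 2 / μ with hv₄
  set v₆ := γ * τ₆ ^ 2 / μ with hv₆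
  set s := √v with hsdef
  set s₄ := √v₄ with hs₄def
  have hv0 : 0 ≤ v := by positivity
  have hv40 : 0 ≤ v₄ := by positivity
  have hs2 : s ^ 2 = v := Real.sq_sqrt hv0
  have hs42 : s₄ ^ 2 = v₄ := Real.sq_sqrt hv40
  have hs0 : 0 ≤ s := Real.sqrt_nonneg _
  have hs : γ * τ₂ ^ 2 = μ * s ^ 2 := by rw [hs2, hv]; field_simp
  have hs₄ : γ * τ₄ ^ 2 = μ * s₄ ^ 2 := by rw [hs42, hv₄]; field_simp
  have hn1 : (1 : ℝ) ≤ n := by exact_mod_cast hn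
  set κ := L / μ with hκ
  have hκ1 : 1 ≤ κ := (one_le_div hμ).2 hR.le
  have hκ0 : 0 < κ := by linarith
  set K := 1 / (γ * μ) with hK
  have hK0 : 0 < K := by positivity
  have hκK : κ ≤ K := by
    rw [hκ, hK, div_le_div_iff₀ hμ (by positivity)]
    nlinarith only [mul_le_mul_of_nonneg_right hγL hμ.le]
  have hKκ : K ≤ 60 * κ := by
    have : K = κ / (γ * L) := by rw [hK, hκ]; field_simp
    rw [this, div_le_iff₀ (by positivity)]
    nlinarith only [mul_le_mul_of_nonneg_left hγL' hκ0.le]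
  set b := √κ with hb
  have hb0 : 0 < b := Real.sqrt_pos.2 hκ0
  have hb2 : b ^ 2 = κ := Real.sq_sqrt hκ0.le
  set r := √s with hr
  have hr0 : 0 ≤ r := Real.sqrt_nonneg _
  have hr2 : r ^ 2 = s := Real.sq_sqrt hs0
  have hA : L / γ * lyapunovNoise μ L γ s s₄ =
      1800000 * (L ^ 2 * s ^ 2 / κ + L ^ 2 * (b * (s ^ 2 * r)) / κ + L ^ 2 * s₄ ^ 4) := by
    rw [lyapunovNoise, ← hκ, ← hb, ← hr, hκ]
    field_simp
  have hW : errorBudget μ L τ₂ τ₄ τ₆ γ n = s ^ 2 / γ ^ 2 + (n * τ₂ ^ 2 + n * (L ^ 2 * s ^ 2) +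
      n * (L ^ 2 * s₄ ^ 4 * K)) + (n ^ 2 * (L ^ 2 * v₆ ^ 3) + n ^ 2 * (L ^ 2 * s ^ 4 * (γ * L * κ))) := by
    rw [errorBudget, ← hv, ← hv₄, ← hv₆, ← hs2, ← hs42, hK]
    ring
  rw [hW]
  have p1 : 0 ≤ s ^ 2 / γ ^ 2 := by positivity
  have p2 : 0 ≤ (n : ℝ) * τ₂ ^ 2 := by positivity
  have p3 : 0 ≤ (n : ℝ) * (L ^ 2 * s ^ 2) := by positivity
  have p4 : 0 ≤ (n : ℝ) * (L ^ 2 * s₄ ^ 4 * K) := by positivity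
  have p5 : 0 ≤ (n : ℝ) ^ 2 * (L ^ 2 * v₆ ^ 3) := by positivity
  have p6 : 0 ≤ (n : ℝ) ^ 2 * (L ^ 2 * s ^ 4 * (γ * L * κ)) := by positivity
  -- The variance contains `n L² s³ κ`, within the budget when `n s ≥ 1` or `κ s ≤ 1`. Otherwise `n
  -- < 1/s < κ`: the window is shorter than the relaxation time and plain Cauchy–Schwarz suffices.
  by_cases hcase : 1 ≤ n * s ∨ κ * s ≤ 1
  -- For `s = 0` there is no noise at the minimizer and the second moments of the orbit vanish; the
  -- variance bound needs `s > 0`.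
  · rcases hs0.eq_or_lt with hs00 | hspos
    · have h1 := integral_norm_sum_hessian_sq_le hR hG hN hγ hγL (n + 1) n
      have h2 : ∀ k ∈ Finset.range n, ∫ ω, ‖H (orbit G ξ γ 0 (n + 1 + k) ω)‖ ^ 2 ∂P ≤ 0 :=
        fun k _ => by
          have hX := orbit_memLp hR hG hN hγ hγL 0 (n + 1 + k)
          have h3 := integral_mono (integrable_norm_sq (H.comp_memLp' hX))
            ((integrable_norm_sq hX).const_mul (L ^ 2)) fun ω => (by
              change ‖H (orbit G ξ γ 0 (n + 1 + k) ω)‖ ^ 2 ≤ L ^ 2 * ‖orbit G ξ γ 0 (n + 1 + k) ω‖ ^ 2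
              rw [← mul_pow]
              exact pow_le_pow_left₀ (norm_nonneg _) (hR.hnorm _) 2)
          rw [integral_const_mul] at h3
          change ∫ ω, ‖H (orbit G ξ γ 0 (n + 1 + k) ω)‖ ^ 2 ∂P ≤ _ at h3
          have h4 := orbit_zero_sq_le hR hG hN hγ hγL (n + 1 + k)
          rw [← hv, ← hs2, ← hs00] at h4
          have := mul_le_mul_of_nonneg_left h4 (sq_nonneg L)
          linarith
      have h5 := mul_le_mul_of_nonneg_left (Finset.sum_nonpos h2) (Nat.cast_nonneg (α := ℝ) n)
      linarith
    have hX := orbit_memLp hR hG hN hγ hγL 0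
    have hH : ∀ k, MemLp (fun ω => H (orbit G ξ γ 0 k ω)) 2 P := fun k => H.comp_memLp' (hX k)
    have hvar := hessian_variance_le hR hG hN hγ hγL hspos hs hs₄ hn
    have hmean := norm_integral_sum_hessian_sq_le hR hG hN hγ hγL (n + 1) n
    rw [← hv, ← hs2] at hmean
    set M := ∫ ω, ∑ k ∈ Finset.range n, H (orbit G ξ γ 0 (n + 1 + k) ω) ∂P with hM
    have hM' : M = ∑ k ∈ Finset.range n, ∫ ω, H (orbit G ξ γ 0 (n + 1 + k) ω) ∂P :=
      integral_finsetSum _ fun k _ => (hH _).integrable (by norm_num)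
    have hC : MemLp (fun ω => ∑ k ∈ Finset.range n, (H (orbit G ξ γ 0 (n + 1 + k) ω) -
        ∫ ω, H (orbit G ξ γ 0 (n + 1 + k) ω) ∂P)) 2 P :=
      memLp_finsetSum _ fun k _ => (hH _).sub (memLp_const _)
    have h1 := integral_norm_add_sq_le hC (memLp_const M)
    have e1 : ∀ ω, ∑ k ∈ Finset.range n, (H (orbit G ξ γ 0 (n + 1 + k) ω) -
        ∫ ω, H (orbit G ξ γ 0 (n + 1 + k) ω) ∂P) + M =
        ∑ k ∈ Finset.range n, H (orbit G ξ γ 0 (n + 1 + k) ω) := fun ω => by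
      rw [Finset.sum_sub_distrib, ← hM', sub_add_cancel]
    simp_rw [e1] at h1
    simp only [integral_const, probReal_univ, one_smul] at h1
    have hnl : n ^ 2 * (L ^ 2 * (s ^ 2) ^ 2) ≤ 60 * (n ^ 2 * (L ^ 2 * s ^ 4 * (γ * L * κ))) := by
      have : 1 ≤ 60 * (γ * L) * κ := by
        linarith [mul_le_mul hγL' hκ1 zero_le_one (by positivity)]
      have := mul_le_mul_of_nonneg_left this (by positivity : 0 ≤ n ^ 2 * (L ^ 2 * s ^ 4))
      linarith
    have hs3 : n * (L ^ 2 * s ^ 3 * κ) ≤ n * (L ^ 2 * s ^ 2) +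
        60 * (n ^ 2 * (L ^ 2 * s ^ 4 * (γ * L * κ))) := by
      rcases hcase with h | h
      · have h2 : 1 ≤ n * s * (60 * (γ * L)) := by
          linarith [mul_le_mul h hγL' (by norm_num) (by positivity)]
        have := mul_le_mul_of_nonneg_left h2 (by positivity : 0 ≤ n * (L ^ 2 * s ^ 3 * κ))
        linarith
      · have := mul_le_mul_of_nonneg_left h (by positivity : 0 ≤ n * (L ^ 2 * s ^ 2))
        linarith
    -- The left side is the geometric mean of `s²` and `κ s³`.
    have hbr : b * (s ^ 2 * r) ≤ s ^ 2 + κ * s ^ 3 := by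
      have : (s - b * (s * r)) ^ 2 = s ^ 2 - 2 * (b * (s ^ 2 * r)) + κ * s ^ 3 := by
        rw [← hb2, sub_sq, mul_pow, mul_pow, hr2]; ring
      have h2 := sq_nonneg (s - b * (s * r))
      have h3 : 0 ≤ b * (s ^ 2 * r) := by positivity
      linarith
    have hKκ' : K / κ ≤ 60 := by rwa [div_le_iff₀ hκ0]
    have t1 : n * K * (L ^ 2 * s ^ 2 / κ) ≤ 60 * (n * (L ^ 2 * s ^ 2)) := by
      have := mul_le_mul_of_nonneg_left hKκ' p3
      calc _ = n * (L ^ 2 * s ^ 2) * (K / κ) := by ring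
        _ ≤ _ := by linarith
    have t2 : n * K * (L ^ 2 * (b * (s ^ 2 * r)) / κ) ≤
        60 * (n * (L ^ 2 * s ^ 2) + n * (L ^ 2 * s ^ 3 * κ)) := by
      have h2 := mul_le_mul_of_nonneg_left hKκ' (by positivity : 0 ≤ n * (L ^ 2 * (b * (s ^ 2 * r))))
      have h3 := mul_le_mul_of_nonneg_left hbr (by positivity : 0 ≤ n * L ^ 2)
      calc _ = n * (L ^ 2 * (b * (s ^ 2 * r))) * (K / κ) := by ring
        _ ≤ _ := by linarith
    have t3 : n * K * (L ^ 2 * s ^ 3) ≤ 60 * (n * (L ^ 2 * s ^ 3 * κ)) := by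
      have := mul_le_mul_of_nonneg_left hKκ (by positivity : 0 ≤ n * (L ^ 2 * s ^ 3))
      linarith
    have e2 : (n : ℝ) / (γ * μ) = n * K := by rw [hK]; ring
    rw [hA, e2] at hvar
    linarith
  · rw [not_or, not_le, not_le] at hcase
    obtain ⟨hns, hκs⟩ := hcase
    have h1 := (integral_norm_sum_hessian_sq_le hR hG hN hγ hγL (n + 1) n).trans
      (mul_le_mul_of_nonneg_left (sum_norm_hessian_sq_le hR hG hN hγ hγL hs0 hs hs₄ hn)
        (Nat.cast_nonneg n))
    rw [hA] at h1
    have hspos : 0 < s := by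
      rcases hs0.eq_or_lt with h | h
      · rw [← h] at hκs; norm_num at hκs
      · exact h
    have hnκ : n ≤ κ := by
      have : n * s < κ * s := hns.trans hκs
      exact (lt_of_mul_lt_mul_right this hs0).le
    have t1 : (n : ℝ) ^ 2 * (L ^ 2 * s ^ 2 / κ) ≤ n * (L ^ 2 * s ^ 2) := by
      have h2 : (n : ℝ) / κ ≤ 1 := (div_le_one hκ0).2 hnκ
      have := mul_le_mul_of_nonneg_left h2 p3
      calc _ = n * (L ^ 2 * s ^ 2) * (n / κ) := by ring
        _ ≤ _ := by linarith
    have t2 : (n : ℝ) ^ 2 * (L ^ 2 * (b * (s ^ 2 * r)) / κ) ≤ n * (L ^ 2 * s ^ 2) := by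
      have h2 : b * r ≤ κ * s := by
        have e : (b * r) ^ 2 = κ * s := by rw [mul_pow, hb2, hr2]
        nlinarith only [mul_nonneg hb0.le hr0, e, hκs]
      have h3 := mul_le_mul_of_nonneg_left h2 (by positivity : 0 ≤ n ^ 2 * (L ^ 2 * s ^ 2) / κ)
      have h4 := mul_le_mul_of_nonneg_left hns.le p3
      calc _ = n ^ 2 * (L ^ 2 * s ^ 2) / κ * (b * r) := by ring
        _ ≤ n ^ 2 * (L ^ 2 * s ^ 2) / κ * (κ * s) := h3
        _ = n * (L ^ 2 * s ^ 2) * (n * s) := by field_simp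
        _ ≤ _ := by linarith
    have t3 : (n : ℝ) ^ 2 * (L ^ 2 * s₄ ^ 4) ≤ n * (L ^ 2 * s₄ ^ 4 * K) := by
      have := mul_le_mul_of_nonneg_left (hnκ.trans hκK) (by positivity : 0 ≤ n * (L ^ 2 * s₄ ^ 4))
      linarith
    linarith

end LargeStepBound

end RRSGD

/-! ### All admissible steps -/

namespace RRSGD

section AllSteps

variable {d : ℕ} {Z Ω : Type*} [MeasurableSpace Z] [mΩ : MeasurableSpace Ω]
  {P : Measure Ω} [IsProbabilityMeasure P] {Pξ : Measure Z} [IsProbabilityMeasure Pξ]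
  {ξ : ℕ → Ω → Z} {θ₀ : Ω → Vec d}
  {D : Vec d → Vec d} {H : Vec d →L[ℝ] Vec d} {T : Vec d →L[ℝ] Vec d →L[ℝ] Vec d}
  {G : Vec d → Z → Vec d} {μ L τ₂ τ₄ τ₆ γ : ℝ}

lemma errorBudget_two_mul_le (hμ : 0 < μ) (hL : 0 < L) (hγ : 0 < γ) (n : ℕ) :
    errorBudget μ L τ₂ τ₄ τ₆ (2 * γ) n ≤ 8 * errorBudget μ L τ₂ τ₄ τ₆ γ n := by
  set a := γ * τ₂ ^ 2 / μ / γ ^ 2 with ha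
  set b := (n : ℝ) * τ₂ ^ 2 with hb
  set c := (n : ℝ) * (L ^ 2 * (γ * τ₂ ^ 2 / μ)) with hc
  set e := (n : ℝ) * (L ^ 2 * (γ * τ₄ ^ 2 / μ) ^ 2 / (γ * μ)) with he
  set f := (n : ℝ) ^ 2 * (L ^ 2 * (γ * τ₆ ^ 2 / μ) ^ 3) with hf
  set g := (n : ℝ) ^ 2 * (L ^ 2 * (γ * τ₂ ^ 2 / μ) ^ 2 * (γ * L * (L / μ))) with hg
  have h1 : errorBudget μ L τ₂ τ₄ τ₆ γ n = a + (b + c + e) + (f + g) := by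
    rw [errorBudget]; ring
  have h2 : errorBudget μ L τ₂ τ₄ τ₆ (2 * γ) n =
      1 / 2 * a + (b + 2 * c + 2 * e) + (8 * f + 8 * g) := by
    rw [errorBudget, ha, hb, hc, he, hf, hg]; field_simp; ring
  have p1 : 0 ≤ a := by positivity
  have p2 : 0 ≤ b := by positivity
  have p3 : 0 ≤ c := by positivity
  have p4 : 0 ≤ e := by positivity
  rw [h1, h2]
  linarith

/-- The mean squared error of the Richardson-Romberg combination of the two chains started at the
minimizer. -/
lemma richardsonRomberg_orbit_le (hR : RegularField D H T μ L) (hG : Oracle D G Pξ L τ₂ τ₄ τ₆)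
    (hN : IsNoiseSequence P Pξ ξ θ₀) (hγ : 0 < γ) (hγL : 2 * γ * L ≤ 1) {n : ℕ} (hn : 0 < n) :
    ∫ ω, ‖(2 : ℝ) • ∑ k ∈ Finset.range n, H (orbit G ξ γ 0 (n + 1 + k) ω) -
      ∑ k ∈ Finset.range n, H (orbit G ξ (2 * γ) 0 (n + 1 + k) ω)‖ ^ 2 ∂P ≤
      (10 : ℝ) ^ 22 * errorBudget μ L τ₂ τ₄ τ₆ γ n := by
  have hμ := hR.pos
  have hL := hR.posL
  have hγ2 : 0 < 2 * γ := by positivity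
  rcases le_total (2 * γ * L) (1 / 30) with h | h
  · exact richardsonRomberg_small_step hR hG hN hγ h hn
  have hγL1 : γ * L ≤ 1 := by nlinarith [mul_pos hγ hL]
  have h1 := large_step_sum_le hR hG hN hγ hγL1 (by linarith) hn
  have h2 := large_step_sum_le hR hG hN hγ2 hγL (by linarith) hn
  have h3 := errorBudget_two_mul_le (τ₂ := τ₂) (τ₄ := τ₄) (τ₆ := τ₆) hμ hL hγ n
  have hSm : ∀ {γ : ℝ} (hγ : 0 < γ) (hγL : γ * L ≤ 1), MemLp (fun ω => ∑ k ∈ Finset.range n,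
      H (orbit G ξ γ 0 (n + 1 + k) ω)) 2 P := fun hγ hγL =>
    memLp_finsetSum _ fun k _ => H.comp_memLp' (orbit_memLp hR hG hN hγ hγL 0 _)
  have m1 : MemLp (fun ω => (2 : ℝ) • ∑ k ∈ Finset.range n,
      H (orbit G ξ γ 0 (n + 1 + k) ω)) 2 P := (hSm hγ hγL1).const_smul (2 : ℝ)
  have h4 := integral_norm_sub_sq_le m1 (hSm hγ2 hγL)
  have e3 : ∫ ω, ‖(2 : ℝ) • ∑ k ∈ Finset.range n, H (orbit G ξ γ 0 (n + 1 + k) ω)‖ ^ 2 ∂P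
      = 4 * ∫ ω, ‖∑ k ∈ Finset.range n, H (orbit G ξ γ 0 (n + 1 + k) ω)‖ ^ 2 ∂P := by
    rw [← integral_const_mul]
    congr 1 with ω
    rw [norm_smul, mul_pow, Real.norm_ofNat]
    norm_num
  rw [e3] at h4
  have h5 : 0 ≤ errorBudget μ L τ₂ τ₄ τ₆ γ n := by
    rw [errorBudget]; positivity
  linarith

end AllSteps

/-! ### From the noise conditions to an oracle -/

section Moments

lemma integral_norm_pow_eq {α E : Type*} [MeasurableSpace α] {ν : Measure α}
    [NormedAddCommGroup E] {f : α → E} {p : ℕ} (hp : p ≠ 0) (hf : MemLp f p ν) :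
    ∫ x, ‖f x‖ ^ p ∂ν = (eLpNorm f p ν).toReal ^ p := by
  rw [hf.eLpNorm_eq_integral_rpow_norm (by exact_mod_cast hp) (ENNReal.natCast_ne_top p)]
  simp only [ENNReal.toReal_natCast, Real.rpow_natCast]
  have h0 : 0 ≤ ∫ x, ‖f x‖ ^ p ∂ν := integral_nonneg fun x => by positivity
  rw [ENNReal.toReal_ofReal (by positivity), Real.rpow_inv_natCast_pow h0 hp]

lemma eLpNorm_natCast_eq_lintegral {α E : Type*} [MeasurableSpace α] {ν : Measure α}
    [NormedAddCommGroup E] {f : α → E} {p : ℕ} (hp : p ≠ 0) :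
    eLpNorm f p ν = (∫⁻ x, ‖f x‖ₑ ^ p ∂ν) ^ (1 / (p : ℝ)) := by
  rw [eLpNorm_eq_lintegral_rpow_enorm_toReal (by exact_mod_cast hp) (ENNReal.natCast_ne_top p)]
  simp

lemma eLpNorm_two_le {α E : Type*} [MeasurableSpace α] {ν : Measure α}
    [NormedAddCommGroup E] {f : α → E} (hf : MemLp f 2 ν) {c : ℝ} (hc : 0 ≤ c)
    (h : ∫ x, ‖f x‖ ^ 2 ∂ν ≤ c ^ 2) : eLpNorm f 2 ν ≤ ENNReal.ofReal c := by
  have h1 := integral_norm_pow_eq (p := 2) (by norm_num) (by exact_mod_cast hf)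
  rw [h1] at h
  have h2 := abs_le_of_sq_le_sq' h hc |>.2
  refine ENNReal.le_ofReal_iff_toReal_le ?_ hc |>.2 (by exact_mod_cast h2)
  exact hf.2.ne

lemma rootMoment_two {d : ℕ} {Ω : Type*} [MeasurableSpace Ω] (P : Measure Ω) (X : Ω → Vec d) :
    rootMoment P 2 X = eLpNorm X 2 P := by
  have := eLpNorm_natCast_eq_lintegral (f := X) (ν := P) (p := 2) (by norm_num)
  rw [Nat.cast_ofNat] at this
  rw [this, rootMoment]
  norm_num

variable {d : ℕ} {Z : Type*} [MeasurableSpace Z] {f : Vec d → ℝ} {g : Vec d → Z → Vec d}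
  {Pξ : Measure Z} {θs : Vec d} {L₁ τ L : ℝ} {p : ℕ}

lemma GradientNoise.eLpNorm_le (h : GradientNoise p f g Pξ θs L₁ τ) (hp : p ≠ 0) :
    eLpNorm (g θs) p Pξ ≤ ENNReal.ofReal τ := by
  rw [eLpNorm_natCast_eq_lintegral hp]; exact h.moment

lemma GradientNoise.memLp (h : GradientNoise p f g Pξ θs L₁ τ)
    (hg : Measurable (Function.uncurry g)) (hp : 2 ≤ p) (θ : Vec d) : MemLp (g θ) p Pξ := by
  have hm : ∀ θ, Measurable (g θ) := fun θ => hg.of_uncurry_left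
  have h1 : MemLp (g θs) p Pξ :=
    ⟨(hm θs).aestronglyMeasurable, (h.eLpNorm_le (by omega)).trans_lt ENNReal.ofReal_lt_top⟩
  have h2 : MemLp (fun z => g θ z - g θs z) p Pξ := by
    refine ⟨((hm θ).sub (hm θs)).aestronglyMeasurable, ?_⟩
    rw [eLpNorm_natCast_eq_lintegral (by omega)]
    exact ENNReal.rpow_lt_top_of_nonneg (by positivity)
      ((h.cocoercive p hp le_rfl θ θs).trans_lt ENNReal.ofReal_lt_top).ne
  have h3 := h1.add h2
  refine h3.ae_eq (Filter.Eventually.of_forall fun z => ?_)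
  simp

/-- The exact `p`-th moment of the stochastic gradient at the minimizer. -/
noncomputable def gradMoment (p : ℕ) (g : Vec d → Z → Vec d) (Pξ : Measure Z) (θs : Vec d) : ℝ :=
  (eLpNorm (g θs) p Pξ).toReal

lemma GradientNoise.gradMoment_le (h : GradientNoise p f g Pξ θs L₁ τ) (hp : p ≠ 0) :
    gradMoment p g Pξ θs ≤ τ :=
  ENNReal.toReal_le_of_le_ofReal h.nonneg (h.eLpNorm_le hp)

lemma gradMoment_mono [IsProbabilityMeasure Pξ] {p q : ℕ} (hpq : p ≤ q)
    (hq : MemLp (g θs) q Pξ) : gradMoment p g Pξ θs ≤ gradMoment q g Pξ θs :=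
  ENNReal.toReal_mono hq.2.ne
    (eLpNorm_le_eLpNorm_of_exponent_le (by exact_mod_cast hpq) hq.1)

/-- The oracle carries the exact moments rather than the bounds `τ`: they increase with the order,
and the second one is the root of the trace of the noise covariance. Monotonicity of the gradient
allows `L₁` to be enlarged to `L`. -/
lemma GradientNoise.oracle [IsProbabilityMeasure Pξ] (h : GradientNoise 6 f g Pξ θs L₁ τ)
    (hg : Measurable (Function.uncurry g)) (hL : L₁ ≤ L)
    (hmono : ∀ θ θ', 0 ≤ inner ℝ (gradient f θ - gradient f θ') (θ - θ')) :
    Oracle (fun x => gradient f (θs + x)) (fun x z => g (θs + x) z) Pξ L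
      (gradMoment 2 g Pξ θs) (gradMoment 4 g Pξ θs) (gradMoment 6 g Pξ θs) where
  meas := hg.comp ((measurable_fst.const_add θs).prodMk measurable_snd)
  memLp x := h.memLp hg (by norm_num) _
  mean x := h.unbiased _
  nonneg := ENNReal.toReal_nonneg
  le24 := gradMoment_mono (by norm_num) ((h.memLp hg (by norm_num) θs).mono_exponent (by norm_num))
  le46 := gradMoment_mono (by norm_num) (h.memLp hg (by norm_num) θs)
  m2 := by
    rw [add_zero]
    exact (integral_norm_pow_eq (by norm_num)
      ((h.memLp hg (by norm_num) θs).mono_exponent (by norm_num))).le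
  m4 := by
    rw [add_zero]
    exact (integral_norm_pow_eq (by norm_num)
      ((h.memLp hg (by norm_num) θs).mono_exponent (by norm_num))).le
  m6 := by
    rw [add_zero]
    exact (integral_norm_pow_eq (by norm_num) (h.memLp hg (by norm_num) θs)).le
  coco q h2 h6 x y := by
    have h1 := h.cocoercive q h2 h6 (θs + x) (θs + y)
    have h3 := hmono (θs + x) (θs + y)
    have hpos := h.pos
    rw [add_sub_add_left_eq_sub] at h1 h3
    have hm : Measurable fun z => g (θs + x) z - g (θs + y) z :=
      (hg.of_uncurry_left).sub hg.of_uncurry_left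
    rw [integral_eq_lintegral_of_nonneg_ae (Filter.Eventually.of_forall fun z => by positivity)
      (hm.norm.pow_const q).aestronglyMeasurable]
    simp_rw [ENNReal.ofReal_pow (norm_nonneg _), ofReal_norm]
    refine (ENNReal.toReal_le_of_le_ofReal (by positivity) h1).trans ?_
    gcongr

lemma trace_noiseCov [IsProbabilityMeasure Pξ] (hg : MemLp (g θs) 2 Pξ) :
    (noiseCov g Pξ θs).trace = gradMoment 2 g Pξ θs ^ 2 := by
  have h1 := integral_norm_pow_eq (p := 2) (by norm_num) (by exact_mod_cast hg)
  rw [gradMoment, ← h1]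
  have hi : ∀ i, MemLp (fun z => g θs z i) 2 Pξ := fun i =>
    (EuclideanSpace.proj (𝕜 := ℝ) i).comp_memLp' hg
  simp_rw [EuclideanSpace.real_norm_sq_eq]
  rw [integral_finsetSum _ fun i _ => (hi i).integrable_sq]
  simp [Matrix.trace, noiseCov, sq]

end Moments

end RRSGD

namespace RRSGD

/-! ### Forgetting the initial condition -/

section Transient

variable {d : ℕ} {Z Ω : Type*} [MeasurableSpace Z] [mΩ : MeasurableSpace Ω]
  {P : Measure Ω} [IsProbabilityMeasure P] {Pξ : Measure Z} [IsProbabilityMeasure Pξ]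
  {ξ : ℕ → Ω → Z} {θ₀ : Ω → Vec d}
  {D : Vec d → Vec d} {H : Vec d →L[ℝ] Vec d} {T : Vec d →L[ℝ] Vec d →L[ℝ] Vec d}
  {G : Vec d → Z → Vec d} {μ L τ₂ τ₄ τ₆ γ : ℝ}

/-- The exponent `(n + 1) / 2` comes from the square root of the mean square contraction at `n + 1`,
the first time of the averaging window. -/
lemma sum_sqrt_geom_tail_le {x : ℝ} (hx : 0 < x) (hx1 : x ≤ 1) (n : ℕ) :
    ∑ k ∈ Finset.range n, √((1 - x) ^ (n + 1 + k)) ≤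
      (1 - x) ^ (((n : ℝ) + 1) / 2) * (2 / x) := by
  have h0 : 0 ≤ 1 - x := by linarith
  have h1 : (1 - x) ^ (((n : ℝ) + 1) / 2) = √((1 - x) ^ (n + 1)) := by
    rw [Real.sqrt_eq_rpow, ← Real.rpow_natCast, ← Real.rpow_mul h0]
    push_cast
    ring_nf
  simp_rw [h1, pow_add _ (n + 1), Real.sqrt_mul (pow_nonneg h0 (n + 1)), ← Finset.mul_sum]
  exact mul_le_mul_of_nonneg_left (sum_sqrt_geom_le hx hx1 n) (Real.sqrt_nonneg _)

lemma memLp_sgd_sub_orbit (hR : RegularField D H T μ L) (hG : Oracle D G Pξ L τ₂ τ₄ τ₆)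
    (hN : IsNoiseSequence P Pξ ξ θ₀) (hγ : 0 < γ) (hγL : γ * L ≤ 1) {x₀ : Ω → Vec d}
    (hx : Measurable[past ξ θ₀ 0] x₀) (hx2 : MemLp x₀ 2 P) (k : ℕ) :
    MemLp (fun ω => sgd G ξ x₀ γ k ω - orbit G ξ γ 0 k ω) 2 P := by
  have hi : Integrable (fun ω => ‖x₀ ω - (fun _ => (0 : Vec d)) ω‖ ^ 2) P := by
    simpa using hx2.integrable_norm_pow (p := 2) (by norm_num)
  have h := (sgd_coupling_le hR hG hN hγ hγL hx measurable_const hi k).1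
  have hm : Measurable fun ω => sgd G ξ x₀ γ k ω - orbit G ξ γ 0 k ω :=
    ((isDriven_sgd (ξ := ξ) (θ₀ := θ₀) (γ := γ) hG.meas hx).meas hN k).sub
      (orbit_measurable hG hN 0 k)
  exact (memLp_two_iff_integrable_sq_norm hm.aestronglyMeasurable).2 h

/-- The initial condition is forgotten geometrically fast in mean square. -/
lemma eLpNorm_sgd_sub_orbit_le (hR : RegularField D H T μ L) (hG : Oracle D G Pξ L τ₂ τ₄ τ₆)
    (hN : IsNoiseSequence P Pξ ξ θ₀) (hγ : 0 < γ) (hγL : γ * L ≤ 1) {x₀ : Ω → Vec d}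
    (hx : Measurable[past ξ θ₀ 0] x₀) (hx2 : MemLp x₀ 2 P) (k : ℕ) :
    eLpNorm (fun ω => sgd G ξ x₀ γ k ω - orbit G ξ γ 0 k ω) 2 P ≤
      ENNReal.ofReal (√((1 - γ * μ) ^ k)) * eLpNorm x₀ 2 P := by
  have hi : Integrable (fun ω => ‖x₀ ω - (fun _ => (0 : Vec d)) ω‖ ^ 2) P := by
    simpa using hx2.integrable_norm_pow (p := 2) (by norm_num)
  have h := (sgd_coupling_le hR hG hN hγ hγL hx measurable_const hi k).2
  have h0 : 0 ≤ 1 - γ * μ := by linarith [hR.mul_le_one hγ hγL]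
  simp only [sub_zero] at h
  rw [integral_norm_pow_eq (f := x₀) (p := 2) (by norm_num) (by exact_mod_cast hx2)] at h
  rw [← ENNReal.ofReal_toReal hx2.2.ne, ← ENNReal.ofReal_mul (Real.sqrt_nonneg _)]
  refine eLpNorm_two_le (memLp_sgd_sub_orbit hR hG hN hγ hγL hx hx2 k) (by positivity) ?_
  rw [mul_pow, Real.sq_sqrt (pow_nonneg h0 k)]
  exact_mod_cast h

lemma eLpNorm_sum_sgd_sub_orbit_le (hR : RegularField D H T μ L)
    (hG : Oracle D G Pξ L τ₂ τ₄ τ₆)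
    (hN : IsNoiseSequence P Pξ ξ θ₀) (hγ : 0 < γ) (hγL : γ * L ≤ 1) {x₀ : Ω → Vec d}
    (hx : Measurable[past ξ θ₀ 0] x₀) (hx2 : MemLp x₀ 2 P) (n : ℕ) :
    eLpNorm (fun ω => ∑ k ∈ Finset.range n,
      H (sgd G ξ x₀ γ (n + 1 + k) ω - orbit G ξ γ 0 (n + 1 + k) ω)) 2 P ≤
      ENNReal.ofReal (L * ((1 - γ * μ) ^ (((n : ℝ) + 1) / 2) * (2 / (γ * μ)))) *
        eLpNorm x₀ 2 P := by
  have hL := hR.posL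
  have hm := memLp_sgd_sub_orbit hR hG hN hγ hγL hx hx2
  have e : (fun ω => ∑ k ∈ Finset.range n,
      H (sgd G ξ x₀ γ (n + 1 + k) ω - orbit G ξ γ 0 (n + 1 + k) ω)) =
      ∑ k ∈ Finset.range n, fun ω =>
        H (sgd G ξ x₀ γ (n + 1 + k) ω - orbit G ξ γ 0 (n + 1 + k) ω) := by
    ext1 ω; simp
  rw [e]
  refine (eLpNorm_sum_le (fun k _ => (H.comp_memLp' (hm (n + 1 + k))).1) (by norm_num)).trans ?_
  have hk : ∀ k, eLpNorm (fun ω => H (sgd G ξ x₀ γ k ω - orbit G ξ γ 0 k ω)) 2 P ≤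
      ENNReal.ofReal (L * √((1 - γ * μ) ^ k)) * eLpNorm x₀ 2 P := fun k => by
    refine (eLpNorm_le_mul_eLpNorm_of_ae_le_mul (c := L)
      (Filter.Eventually.of_forall fun ω => hR.hnorm _) 2).trans ?_
    rw [ENNReal.ofReal_mul hL.le, mul_assoc]
    exact mul_le_mul_right (eLpNorm_sgd_sub_orbit_le hR hG hN hγ hγL hx hx2 k) _
  refine (Finset.sum_le_sum fun k _ => hk (n + 1 + k)).trans ?_
  rw [← Finset.sum_mul, ← ENNReal.ofReal_sum_of_nonneg fun k _ => by positivity,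
    ← Finset.mul_sum]
  refine mul_le_mul_left (ENNReal.ofReal_le_ofReal (mul_le_mul_of_nonneg_left ?_ hL.le)) _
  exact sum_sqrt_geom_tail_le (mul_pos hγ hR.pos) (hR.mul_le_one hγ hγL) n

end Transient

lemma rpow_three_halves {x : ℝ} (hx : 0 ≤ x) : x ^ (3 / 2 : ℝ) = √x ^ 3 := by
  rw [Real.sqrt_eq_rpow, ← Real.rpow_natCast, ← Real.rpow_mul hx]
  norm_num

/-- The leading part of the error bound. -/
noncomputable def errorRate (L μ D₂ D₄ D₆ t₂ τ₂ τ₄ τ₆ γ : ℝ) (n : ℕ) : ℝ :=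
  t₂ / √n + rrConst₁ L μ D₂ D₄ τ₂ τ₄ * √γ / √n + rrConst₂ μ D₂ τ₂ / (√γ * n)
    + rrConst₃ L μ D₂ D₆ τ₂ τ₆ * γ ^ (3 / 2 : ℝ) + rrConst₄ L μ D₄ τ₄ * γ / √n

/-- In terms of `√μ`, `√γ` and `√n` the budget is a sum of six squares, which is at most the square
of the sum of the nonnegative roots. -/
lemma errorBudget_le_sq {μ L γ t₂ t₄ t₆ : ℝ} (hμ : 0 < μ) (hL : 0 < L) (hγ : 0 < γ)
    (h2 : 0 ≤ t₂) (h6 : 0 ≤ t₆) (n : ℕ) :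
    errorBudget μ L t₂ t₄ t₆ γ n ≤
      (t₂ / (√μ * √γ) + √n * t₂ + √n * (L * t₂ * √γ / √μ) + √n * (L * t₄ ^ 2 * √γ / √μ ^ 3) +
        n * (L * t₆ ^ 3 * √γ ^ 3 / √μ ^ 3) + n * (L ^ 2 * t₂ ^ 2 * √γ ^ 3 / √μ ^ 3)) ^ 2 := by
  set x := √γ with hx
  set m := √μ with hm
  set r := √(n : ℝ) with hr
  have hx0 : 0 < x := Real.sqrt_pos.2 hγ
  have hm0 : 0 < m := Real.sqrt_pos.2 hμ
  have hr0 : 0 ≤ r := Real.sqrt_nonneg _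
  have ex : γ = x ^ 2 := (Real.sq_sqrt hγ.le).symm
  have em : μ = m ^ 2 := (Real.sq_sqrt hμ.le).symm
  have er : (n : ℝ) = r ^ 2 := (Real.sq_sqrt (Nat.cast_nonneg n)).symm
  have key : ∀ a b c d e f : ℝ, 0 ≤ a → 0 ≤ b → 0 ≤ c → 0 ≤ d → 0 ≤ e → 0 ≤ f →
      a ^ 2 + b ^ 2 + c ^ 2 + d ^ 2 + e ^ 2 + f ^ 2 ≤ (a + b + c + d + e + f) ^ 2 := by
    have two : ∀ a b : ℝ, 0 ≤ a → 0 ≤ b → a ^ 2 + b ^ 2 ≤ (a + b) ^ 2 := fun a b ha hb => by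
      nlinarith [mul_nonneg ha hb]
    intro a b c d e f ha hb hc hd he hf
    have h1 := two a b ha hb
    have h2 := two (a + b) c (by positivity) hc
    have h3 := two (a + b + c) d (by positivity) hd
    have h4 := two (a + b + c + d) e (by positivity) he
    have h5 := two (a + b + c + d + e) f (by positivity) hf
    linarith
  refine le_trans (le_of_eq ?_) (key _ _ _ _ _ _ (by positivity) (by positivity) (by positivity)
    (by positivity) (by positivity) (by positivity))
  rw [errorBudget, ex, em, er]
  field_simp
  ring

/-- The six roots match `rrConst₂`, the leading term, the two halves of `rrConst₁`, and the sixth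
moment and `L² D₂` terms of `rrConst₃`. The constants `D` being at least `2`, they only enlarge the
right side. -/
lemma errorBudget_le_errorRate_sq {μ L γ D₂ D₄ D₆ t₂ t₄ t₆ τ₂ τ₄ τ₆ : ℝ} (hμ : 0 < μ)
    (hL : 0 < L) (hγ : 0 < γ) (hD₂ : 2 ≤ D₂) (hD₄ : 2 ≤ D₄) (hD₆ : 2 ≤ D₆)
    (h2 : 0 ≤ t₂) (h4 : 0 ≤ t₄) (h6 : 0 ≤ t₆) (h2' : t₂ ≤ τ₂) (h4' : t₄ ≤ τ₄) (h6' : t₆ ≤ τ₆)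
    {n : ℕ} (hn : 0 < n) :
    errorBudget μ L t₂ t₄ t₆ γ n ≤ (n * errorRate L μ D₂ D₄ D₆ t₂ τ₂ τ₄ τ₆ γ n) ^ 2 := by
  refine (errorBudget_le_sq hμ hL hγ h2 h6 n).trans ?_
  refine pow_le_pow_left₀ (by positivity) ?_ 2
  have hs : 1 ≤ √D₂ := Real.one_le_sqrt.2 (by linarith)
  have hs6 : 1 ≤ D₆ ^ (3 / 2 : ℝ) := Real.one_le_rpow (by linarith) (by norm_num)
  have hn' : (0 : ℝ) < n := by exact_mod_cast hn
  rw [errorRate, rrConst₁, rrConst₂, rrConst₃, rrConst₄, biasConst, rpow_three_halves hμ.le,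
    rpow_three_halves hγ.le]
  generalize D₆ ^ (3 / 2 : ℝ) = q at *
  generalize √D₂ = s at *
  set x := √γ with hx
  set m := √μ with hm
  set r := √(n : ℝ) with hr
  have hx0 : 0 < x := Real.sqrt_pos.2 hγ
  have hm0 : 0 < m := Real.sqrt_pos.2 hμ
  have hr0 : 0 < r := Real.sqrt_pos.2 hn'
  have ex : γ = x ^ 2 := (Real.sq_sqrt hγ.le).symm
  have em : μ = m ^ 2 := (Real.sq_sqrt hμ.le).symm
  have er : (n : ℝ) = r ^ 2 := (Real.sq_sqrt (Nat.cast_nonneg n)).symm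
  -- The last bracket collects what is not needed: the rest of `rrConst₃`, and `rrConst₄`.
  have e : (n : ℝ) * (t₂ / r + (D₄ * L * τ₄ ^ 2 / m ^ 3 + L * s * τ₂ / m) * x / r +
      s * τ₂ / m / (x * n) + (L * q * τ₆ ^ 3 / m ^ 3 +
        ((L ^ 2 * D₂ / m + L * s / m) * (τ₂ ^ 2 / μ) + L / μ)) * x ^ 3 +
      D₄ * L * τ₄ ^ 2 / μ * γ / r) =
      s * τ₂ / (m * x) + r * t₂ + r * (L * (s * τ₂) * x / m) +
        r * (L * (D₄ * τ₄ ^ 2) * x / m ^ 3) + n * (L * (q * τ₆ ^ 3) * x ^ 3 / m ^ 3) +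
        n * (L ^ 2 * (D₂ * τ₂ ^ 2) * x ^ 3 / m ^ 3) +
      (n * ((L * s / m * (τ₂ ^ 2 / μ) + L / μ) * x ^ 3) + n * (D₄ * L * τ₄ ^ 2 / μ * γ / r)) := by
    rw [ex, em, er]
    field_simp
    ring
  rw [e]
  have hb2 : t₂ ≤ s * τ₂ := h2'.trans (le_mul_of_one_le_left (h2.trans h2') hs)
  have hb4 : t₄ ^ 2 ≤ D₄ * τ₄ ^ 2 := (pow_le_pow_left₀ h4 h4' 2).trans
    (le_mul_of_one_le_left (by positivity) (by linarith))
  have hb22 : t₂ ^ 2 ≤ D₂ * τ₂ ^ 2 := (pow_le_pow_left₀ h2 h2' 2).trans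
    (le_mul_of_one_le_left (by positivity) (by linarith))
  have hb6 : t₆ ^ 3 ≤ q * τ₆ ^ 3 := (pow_le_pow_left₀ h6 h6' 3).trans
    (le_mul_of_one_le_left (pow_nonneg (h6.trans h6') 3) hs6)
  refine le_add_of_le_of_nonneg ?_ (by positivity)
  gcongr

/-! ### Translation of the minimizer to the origin -/

section Centring

variable {d : ℕ} {Z Ω : Type*}

lemma sgd_sub_eq (g : Vec d → Z → Vec d) (ξ : ℕ → Ω → Z) (θ₀ : Ω → Vec d) (θs : Vec d) (γ : ℝ)
    (k : ℕ) (ω : Ω) :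
    sgd g ξ θ₀ γ k ω - θs =
      sgd (fun x z => g (θs + x) z) ξ (fun ω => θ₀ ω - θs) γ k ω := by
  induction k with
  | zero => rfl
  | succ k ih =>
    simp only [sgd]
    rw [← ih, add_sub_cancel]
    abel

lemma polyakRuppert_sub_eq (g : Vec d → Z → Vec d) (ξ : ℕ → Ω → Z) (θ₀ : Ω → Vec d)
    (θs : Vec d) (γ : ℝ) {n : ℕ} (hn : 0 < n) (ω : Ω) :
    polyakRuppert g ξ θ₀ γ n ω - θs = (1 / (n : ℝ)) • ∑ k ∈ Finset.range n,
      sgd (fun x z => g (θs + x) z) ξ (fun ω => θ₀ ω - θs) γ (n + 1 + k) ω := by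
  have hn' : (n : ℝ) ≠ 0 := by exact_mod_cast hn.ne'
  have e : Finset.Icc (n + 1) (2 * n) = Finset.Ico (n + 1) (2 * n + 1) := by
    ext; simp
  simp_rw [← sgd_sub_eq, Finset.sum_sub_distrib, Finset.sum_const, Finset.card_range, smul_sub]
  rw [polyakRuppert, e, Finset.sum_Ico_eq_sum_range, ← Nat.cast_smul_eq_nsmul ℝ, smul_smul,
    one_div_mul_cancel hn', one_smul]
  congr 4
  omega

end Centring

end RRSGD

/-! ### Assembly -/

namespace RRSGD

section Assembly

variable {d : ℕ} {Z Ω : Type*} [MeasurableSpace Z] [mΩ : MeasurableSpace Ω]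
  {P : Measure Ω} [IsProbabilityMeasure P] {Pξ : Measure Z} [IsProbabilityMeasure Pξ]
  {ξ : ℕ → Ω → Z} {θ₀ : Ω → Vec d}
  {D : Vec d → Vec d} {H : Vec d →L[ℝ] Vec d} {T : Vec d →L[ℝ] Vec d →L[ℝ] Vec d}
  {G : Vec d → Z → Vec d} {μ L τ₂ τ₄ τ₆ γ : ℝ}

/-- The error of the Richardson-Romberg combination of two chains started at `x₀`, when the chains
started at the minimizer have error at most `(n A) ^ 2`. -/
lemma eLpNorm_richardsonRomberg_le (hR : RegularField D H T μ L)
    (hG : Oracle D G Pξ L τ₂ τ₄ τ₆)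
    (hN : IsNoiseSequence P Pξ ξ θ₀) (hγ : 0 < γ) (hγL : 2 * γ * L ≤ 1) {x₀ : Ω → Vec d}
    (hx : Measurable[past ξ θ₀ 0] x₀) (hx2 : MemLp x₀ 2 P) {n : ℕ} (hn : 0 < n) {A : ℝ}
    (hA : 0 ≤ A) (hW : errorBudget μ L τ₂ τ₄ τ₆ γ n ≤ (n * A) ^ 2) :
    eLpNorm (fun ω => H ((2 : ℝ) • ((1 / (n : ℝ)) • ∑ k ∈ Finset.range n,
        sgd G ξ x₀ γ (n + 1 + k) ω) -
      (1 / (n : ℝ)) • ∑ k ∈ Finset.range n, sgd G ξ x₀ (2 * γ) (n + 1 + k) ω)) 2 P ≤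
      ENNReal.ofReal (10 ^ 11) * (ENNReal.ofReal A +
        ENNReal.ofReal (L * (1 - γ * μ) ^ (((n : ℝ) + 1) / 2) / (n * γ * μ)) *
          eLpNorm x₀ 2 P) := by
  have hμ := hR.pos
  have hL := hR.posL
  have hn' : (0 : ℝ) < n := by exact_mod_cast hn
  have hγ2 : 0 < 2 * γ := by positivity
  have hγL1 : γ * L ≤ 1 := by nlinarith [mul_pos hγ hL]
  have hγμ := hR.mul_le_one hγ2 hγL
  have hm1 := memLp_sgd_sub_orbit hR hG hN hγ hγL1 hx hx2
  have hm2 := memLp_sgd_sub_orbit hR hG hN hγ2 hγL hx hx2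
  set M : Ω → Vec d := fun ω =>
    (2 : ℝ) • ∑ k ∈ Finset.range n, H (orbit G ξ γ 0 (n + 1 + k) ω) -
      ∑ k ∈ Finset.range n, H (orbit G ξ (2 * γ) 0 (n + 1 + k) ω) with hM
  set U : Ω → Vec d := fun ω => ∑ k ∈ Finset.range n,
      H (sgd G ξ x₀ γ (n + 1 + k) ω - orbit G ξ γ 0 (n + 1 + k) ω) with hU
  set V : Ω → Vec d := fun ω => ∑ k ∈ Finset.range n,
      H (sgd G ξ x₀ (2 * γ) (n + 1 + k) ω - orbit G ξ (2 * γ) 0 (n + 1 + k) ω) with hV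
  -- `M` is the combination for the chains started at the minimizer; `U` and `V` are the transients
  -- for steps `γ` and `2γ`.
  have e : (fun ω => H ((2 : ℝ) • ((1 / (n : ℝ)) • ∑ k ∈ Finset.range n,
        sgd G ξ x₀ γ (n + 1 + k) ω) -
      (1 / (n : ℝ)) • ∑ k ∈ Finset.range n, sgd G ξ x₀ (2 * γ) (n + 1 + k) ω)) =
      (1 / (n : ℝ)) • (M + ((2 : ℝ) • U - V)) := by
    funext ω
    simp only [hM, hU, hV, Pi.smul_apply, Pi.add_apply, Pi.sub_apply, map_sub, map_smul, map_sum,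
      Finset.sum_sub_distrib]
    module
  have lM : MemLp M 2 P := by
    have h1 : MemLp (fun ω => ∑ k ∈ Finset.range n, H (orbit G ξ γ 0 (n + 1 + k) ω)) 2 P :=
      memLp_finsetSum _ fun k _ => H.comp_memLp' (orbit_memLp hR hG hN hγ hγL1 0 _)
    have h2 : MemLp (fun ω => ∑ k ∈ Finset.range n, H (orbit G ξ (2 * γ) 0 (n + 1 + k) ω)) 2 P :=
      memLp_finsetSum _ fun k _ => H.comp_memLp' (orbit_memLp hR hG hN hγ2 hγL 0 _)
    exact (h1.const_smul (2 : ℝ)).sub h2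
  have lU : MemLp U 2 P := memLp_finsetSum _ fun k _ => H.comp_memLp' (hm1 _)
  have lV : MemLp V 2 P := memLp_finsetSum _ fun k _ => H.comp_memLp' (hm2 _)
  set c := L * (1 - γ * μ) ^ (((n : ℝ) + 1) / 2) / (n * γ * μ) with hc
  have h0 : 0 ≤ 1 - γ * μ := by nlinarith [mul_pos hγ hμ]
  have hc0 : 0 ≤ c := by positivity
  have bM : eLpNorm M 2 P ≤ ENNReal.ofReal (10 ^ 11 * (n * A)) := by
    refine eLpNorm_two_le lM (by positivity) ?_
    refine (richardsonRomberg_orbit_le hR hG hN hγ hγL hn).trans ?_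
    rw [mul_pow, ← pow_mul]
    exact mul_le_mul_of_nonneg_left hW (by positivity)
  have bU : eLpNorm U 2 P ≤ ENNReal.ofReal (2 * n * c) * eLpNorm x₀ 2 P := by
    refine (eLpNorm_sum_sgd_sub_orbit_le hR hG hN hγ hγL1 hx hx2 n).trans
      (mul_le_mul_left (ENNReal.ofReal_le_ofReal (le_of_eq ?_)) _)
    rw [hc]
    field_simp
  -- The step `2γ` contracts faster and has half the relaxation time, so its transient is dominated
  -- by that of `γ`.
  have bV : eLpNorm V 2 P ≤ ENNReal.ofReal (n * c) * eLpNorm x₀ 2 P := by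
    refine (eLpNorm_sum_sgd_sub_orbit_le hR hG hN hγ2 hγL hx hx2 n).trans
      (mul_le_mul_left (ENNReal.ofReal_le_ofReal ?_) _)
    have h1 : (1 - 2 * γ * μ) ^ (((n : ℝ) + 1) / 2) ≤ (1 - γ * μ) ^ (((n : ℝ) + 1) / 2) :=
      Real.rpow_le_rpow (by linarith) (by nlinarith [mul_pos hγ hμ]) (by positivity)
    have h2 : n * c = L * ((1 - γ * μ) ^ (((n : ℝ) + 1) / 2) * (2 / (2 * γ * μ))) := by
      rw [hc]; field_simp
    rw [h2]
    gcongr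
  have b2U : eLpNorm ((2 : ℝ) • U) 2 P ≤ ENNReal.ofReal (4 * n * c) * eLpNorm x₀ 2 P := by
    rw [eLpNorm_const_smul, Real.enorm_eq_ofReal zero_le_two,
      show 4 * n * c = 2 * (2 * n * c) by ring, ENNReal.ofReal_mul zero_le_two, mul_assoc]
    exact mul_le_mul_right bU _
  have bD : eLpNorm ((2 : ℝ) • U - V) 2 P ≤ ENNReal.ofReal (5 * n * c) * eLpNorm x₀ 2 P := by
    refine (eLpNorm_sub_le (lU.const_smul (2 : ℝ)).1 lV.1 (by norm_num)).trans
      ((add_le_add b2U bV).trans (le_of_eq ?_))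
    rw [← add_mul, ← ENNReal.ofReal_add (by positivity) (by positivity)]
    ring_nf
  rw [e, eLpNorm_const_smul, Real.enorm_eq_ofReal (by positivity)]
  have bT := (eLpNorm_add_le lM.1 ((lU.const_smul (2 : ℝ)).sub lV).1 (by norm_num)).trans
    (add_le_add bM bD)
  refine (mul_le_mul_right bT _).trans ?_
  rw [mul_add, mul_add, ← mul_assoc (ENNReal.ofReal (1 / (n : ℝ))),
    ← mul_assoc (ENNReal.ofReal (10 ^ 11)), ← ENNReal.ofReal_mul (by positivity),
    ← ENNReal.ofReal_mul (by positivity), ← ENNReal.ofReal_mul (by positivity),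
    ← ENNReal.ofReal_mul (by positivity)]
  refine add_le_add (ENNReal.ofReal_le_ofReal (le_of_eq ?_))
    (mul_le_mul_left (ENNReal.ofReal_le_ofReal ?_) _)
  · field_simp
  · have : 1 / (n : ℝ) * (5 * n * c) = 5 * c := by field_simp
    rw [this]
    nlinarith

end Assembly

end RRSGD

theorem mainTheorem3 :
    ∃ c₀ : ℝ, 0 < c₀ ∧
      ∀ (d : ℕ), 0 < d →
      ∀ (Z : Type*) [MeasurableSpace Z] (Ω : Type*) [MeasurableSpace Ω]
        (P : Measure Ω) [IsProbabilityMeasure P] (Pξ : Measure Z) [IsProbabilityMeasure Pξ]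
        (f : RRSGD.Vec d → ℝ) (g : RRSGD.Vec d → Z → RRSGD.Vec d) (θs : RRSGD.Vec d)
        (ξ : ℕ → Ω → Z) (θ₀ : Ω → RRSGD.Vec d)
        (μ L₁ L₂ L₃ L₄ L τ₂ τ₄ τ₆ D₂ D₄ D₆ S₂ S₄ S₆ : ℝ),
      L = max (max L₁ L₂) (max L₃ L₄) →
      Measurable (Function.uncurry g) →
      RRSGD.IsMinimizer f θs →
      RRSGD.StronglyConvex f μ →
      RRSGD.SmoothUpToFour f L₂ L₃ L₄ →
      RRSGD.GradientNoise 2 f g Pξ θs L₁ τ₂ →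
      RRSGD.GradientNoise 4 f g Pξ θs L₁ τ₄ →
      RRSGD.GradientNoise 6 f g Pξ θs L₁ τ₆ →
      RRSGD.MomentBounds 2 g Pξ θs μ L τ₂ D₂ S₂ →
      RRSGD.MomentBounds 4 g Pξ θs μ L τ₄ D₄ S₄ →
      RRSGD.MomentBounds 6 g Pξ θs μ L τ₆ D₆ S₆ →
      RRSGD.IsNoiseSequence P Pξ ξ θ₀ →
      ∀ γ : ℝ, 0 < γ → γ ≤ 1 / (L * S₆) → ∀ n : ℕ, 1 ≤ n →
        RRSGD.rootMoment P 2
            (fun ω => RRSGD.hessian f θs (RRSGD.richardsonRomberg g ξ θ₀ γ n ω - θs)) ≤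
          ENNReal.ofReal c₀ *
            (ENNReal.ofReal
              (√(RRSGD.noiseCov g Pξ θs).trace / √n
                + RRSGD.rrConst₁ L μ D₂ D₄ τ₂ τ₄ * √γ / √n
                + RRSGD.rrConst₂ μ D₂ τ₂ / (√γ * n)
                + RRSGD.rrConst₃ L μ D₂ D₆ τ₂ τ₆ * γ ^ (3 / 2 : ℝ)
                + RRSGD.rrConst₄ L μ D₄ τ₄ * γ / √n)
              + RRSGD.remainder₄ P (fun ω => θ₀ ω - θs) L μ D₄ τ₄ γ n) := by
  -- The square root of the factor `10 ^ 22` in front of `errorBudget`.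
  refine ⟨10 ^ 11, by positivity, ?_⟩
  intro d hd Z _ Ω _ P _ Pξ _ f g θs ξ θ₀ μ L₁ L₂ L₃ L₄ L τ₂ τ₄ τ₆ D₂ D₄ D₆ S₂ S₄ S₆ hLdef hg hmin
    hc hs hA2 hA4 hA6 hC2 hC4 hC6 hN γ hγ hγS n hn
  have h₁ : L₁ ≤ L := hLdef ▸ (le_max_left _ _).trans (le_max_left _ _)
  have h₂ : L₂ ≤ L := hLdef ▸ (le_max_right _ _).trans (le_max_left _ _)
  have h₃ : L₃ ≤ L := hLdef ▸ (le_max_left _ _).trans (le_max_right _ _)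
  have h₄ : L₄ ≤ L := hLdef ▸ (le_max_right _ _).trans (le_max_right _ _)
  have hR := RRSGD.regularField_gradient hd h₂ h₃ h₄ hmin hc hs
  have hμ := hR.pos
  have hL := hR.posL
  have hmono : ∀ θ θ', 0 ≤ inner ℝ (gradient f θ - gradient f θ') (θ - θ') := fun θ θ' => by
    have h := hR.mono (θ - θs) (θ' - θs)
    simp only [add_sub_cancel, sub_sub_sub_cancel_right] at h
    exact (by positivity : (0 : ℝ) ≤ _).trans h
  have hG := hA6.oracle hg h₁ hmono
  have hS := hC6.two_le_step
  -- `S₆ ≥ 2` makes the doubled step admissible for the contraction estimates.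
  have hγL : 2 * γ * L ≤ 1 := by
    rw [le_div_iff₀ (by positivity)] at hγS
    nlinarith [mul_pos hγ hL]
  have hn' : (0 : ℝ) < n := by exact_mod_cast hn
  have hγμ := hR.mul_le_one (by positivity : 0 < 2 * γ) hγL
  have hγμ0 : 0 < 1 - γ * μ := by nlinarith [mul_pos hγ hμ]
  have m6 := hA6.memLp hg (by norm_num) θs
  have m2 : MemLp (g θs) (2 : ℕ) Pξ := m6.mono_exponent (by norm_num)
  have ht : √(RRSGD.noiseCov g Pξ θs).trace = RRSGD.gradMoment 2 g Pξ θs := by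
    rw [RRSGD.trace_noiseCov (by exact_mod_cast m2)]
    exact Real.sqrt_sq ENNReal.toReal_nonneg
  have hτ₂ := hA2.nonneg
  have hτ₄ := hA4.nonneg
  have hτ₆ := hA6.nonneg
  have hD₂ := hC2.two_le_last
  have hD₄ := hC4.two_le_last
  have hD₆ := hC6.two_le_last
  have hW := RRSGD.errorBudget_le_errorRate_sq hμ hL hγ hD₂ hD₄ hD₆
    (t₂ := RRSGD.gradMoment 2 g Pξ θs) (t₄ := RRSGD.gradMoment 4 g Pξ θs)
    (t₆ := RRSGD.gradMoment 6 g Pξ θs) ENNReal.toReal_nonneg ENNReal.toReal_nonneg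
    ENNReal.toReal_nonneg (hA2.gradMoment_le (by norm_num)) (hA4.gradMoment_le (by norm_num))
    (hA6.gradMoment_le (by norm_num)) hn
  have hA : 0 ≤ RRSGD.errorRate L μ D₂ D₄ D₆ (RRSGD.gradMoment 2 g Pξ θs) τ₂ τ₄ τ₆ γ n := by
    have : 0 ≤ RRSGD.gradMoment 2 g Pξ θs := ENNReal.toReal_nonneg
    rw [RRSGD.errorRate, RRSGD.rrConst₁, RRSGD.rrConst₂, RRSGD.rrConst₃, RRSGD.rrConst₄,
      RRSGD.biasConst]
    positivity
  have hx : Measurable[RRSGD.past ξ θ₀ 0] fun ω => θ₀ ω - θs :=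
    (RRSGD.measurable_past_init 0).sub_const θs
  rw [ht, RRSGD.remainder₄, RRSGD.rootMoment_two, RRSGD.rootMoment_two]
  have hcpos : 0 < L * (1 - γ * μ) ^ (((n : ℝ) + 1) / 2) / (n * γ * μ) := by positivity
  -- An infinite initial second moment makes the right side infinite, as its coefficient is
  -- positive.
  by_cases hfin : eLpNorm (fun ω => θ₀ ω - θs) 2 P = ⊤
  · rw [hfin, add_top, top_add, ENNReal.mul_top (ENNReal.ofReal_pos.2 hcpos).ne', add_top,
      ENNReal.mul_top (ENNReal.ofReal_pos.2 (by positivity)).ne']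
    exact le_top
  have hx2 : MemLp (fun ω => θ₀ ω - θs) 2 P :=
    ⟨(hN.measurable_init.sub_const θs).aestronglyMeasurable, Ne.lt_top hfin⟩
  have e : ∀ ω, RRSGD.richardsonRomberg g ξ θ₀ γ n ω - θs =
      (2 : ℝ) • (RRSGD.polyakRuppert g ξ θ₀ γ n ω - θs) -
        (RRSGD.polyakRuppert g ξ θ₀ (2 * γ) n ω - θs) := fun ω => by
    rw [RRSGD.richardsonRomberg]
    module
  simp_rw [e, RRSGD.polyakRuppert_sub_eq g ξ θ₀ θs _ hn]
  refine (RRSGD.eLpNorm_richardsonRomberg_le hR hG hN hγ hγL hx hx2 hn hA hW).trans ?_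
  refine mul_le_mul_right (add_le_add le_rfl (mul_le_mul_right ?_ _)) _
  -- Of the initial moments in `remainder₄`, the second one suffices for the coupling argument.
  exact le_add_right (le_add_left le_rfl)
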